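/- Let $\gamma=\frac15\min_{z\in\mathbb R}\int_1^2|\sin(z+t)-\sin z|\,t^{-2}\,dt>0$ and let $q\ge 7$ be an integer with $\frac1{q-1}\le\gamma$ (so all sufficiently large $q$ are allowed). Put $$f(x)=\sum_{k=1}^\infty q^{-k}\sin\bigl(2^{q^k}x\bigr),\qquad F(x)=1+\int_0^x f(t)\,dt ,$$ and, in polar coordinates, $\omega=\{(r,\theta)\mid 0\le r<F(\theta)\}\subset\mathbb R^2$. Then $\omega$ is a bounded $C^1$ domain with the following properties. Here $W^{s,p}(\omega)$ are the Sobolev–Slobodeckij spaces, and functions are real- or complex-valued. (i) The Dirichlet problem with right-hand side $g=1\in C^\infty(\overline\omega)$, $$\Delta v_D=g\ \text{ in }\omega,\qquad v_D=0\ \text{ on }\partial\omega ,$$ has exactly one solution $v_D\in H^1_0(\omega)$, and $v_D\notin W^{1+\frac1p+\varepsilon,p}(\omega)$ for all $1\le p<\infty$ and all $\varepsilon>0$. (ii) There are real numbers $\alpha,\beta$, not both zero, such that for the harmonic quadratic polynomial $g(x_1,x_2)=\alpha x_1x_2+\beta(x_1^2-x_2^2)\in C^\infty(\overline\omega)$ the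 Neumann problem $$\Delta v_N=g\ \text{ in }\omega,\qquad \partial_n v_N=0\ \text{ on }\partial\omega ,$$ has a solution $v_N\in H^1(\omega)$ (in the weak sense: $\int_\omega\nabla v_N\cdot\nabla\varphi\,dx=-\int_\omega g\varphi\,dx$ for all $\varphi\in H^1(\omega)$), and no solution $v_N\in H^1(\omega)$ belongs to $W^{1+\frac1p+\varepsilon,p}(\omega)$ for any $1\le p<\infty$ and any $\varepsilon>0$. -/

import Mathlib

open MeasureTheory Set Real
open scoped ENNReal ContDiff

namespace LimitReg

/-! ### Sobolev spaces on subsets of Euclidean space -/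

section Sobolev

variable {d : ℕ} {𝕜 : Type*} [RCLike 𝕜]

/-- The classical partial derivative `∂ᵢ u`. -/
noncomputable def partialDeriv (i : Fin d) (u : EuclideanSpace ℝ (Fin d) → 𝕜) :
    EuclideanSpace ℝ (Fin d) → 𝕜 :=
  fun x => fderiv ℝ u x (EuclideanSpace.single i (1 : ℝ))

/-- `φ ∈ C_c^∞(Ω)`. -/
structure IsTest (Ω : Set (EuclideanSpace ℝ (Fin d))) (φ : EuclideanSpace ℝ (Fin d) → 𝕜) :
    Prop where
  smooth : ContDiff ℝ ∞ φ
  compact : HasCompactSupport φ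
  supp : tsupport φ ⊆ Ω

/-- `w` is the `i`-th weak partial derivative of `u` in `Ω`: both are locally integrable and
`∫_Ω u ∂ᵢφ = - ∫_Ω w φ` for all `φ ∈ C_c^∞(Ω)`. -/
structure IsWeakPartial (Ω : Set (EuclideanSpace ℝ (Fin d))) (i : Fin d)
    (u w : EuclideanSpace ℝ (Fin d) → 𝕜) : Prop where
  locInt_fun : LocallyIntegrableOn u Ω
  locInt_deriv : LocallyIntegrableOn w Ω
  integral_eq : ∀ φ : EuclideanSpace ℝ (Fin d) → ℝ, IsTest Ω φ →
    ∫ x in Ω, partialDeriv i φ x • u x = - ∫ x in Ω, φ x • w x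

/-- The `p`-th power of the Sobolev-Slobodeckij seminorm of order `σ`,
`∫_Ω ∫_Ω |u(y) - u(x)|^p / |y - x|^(d + σ p) dx dy`, with values in `[0, ∞]`. -/
noncomputable def slobodeckij (Ω : Set (EuclideanSpace ℝ (Fin d))) (σ p : ℝ)
    (u : EuclideanSpace ℝ (Fin d) → 𝕜) : ℝ≥0∞ :=
  ∫⁻ y in Ω, ∫⁻ x in Ω, ‖u y - u x‖ₑ ^ p / ‖y - x‖ₑ ^ ((d : ℝ) + σ * p)

/-- `u ∈ W^{m + σ, p}(Ω)` for `m ∈ ℕ` and `0 ≤ σ < 1`. For `m = 0` this means `u ∈ L^p(Ω)` with,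
if `σ > 0`, finite Slobodeckij seminorm of order `σ`; and `u ∈ W^{s + 1, p}(Ω)` if and only if `u`
and all its weak first order partial derivatives belong to `W^{s, p}(Ω)`. -/
def MemWAux (Ω : Set (EuclideanSpace ℝ (Fin d))) (σ p : ℝ) :
    ℕ → (EuclideanSpace ℝ (Fin d) → 𝕜) → Prop
  | 0, u => MemLp u (ENNReal.ofReal p) (volume.restrict Ω) ∧ (0 < σ → slobodeckij Ω σ p u < ⊤)
  | m + 1, u => MemWAux Ω σ p m u ∧
      ∀ i : Fin d, ∃ w : EuclideanSpace ℝ (Fin d) → 𝕜,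
        IsWeakPartial Ω i u w ∧ MemWAux Ω σ p m w

/-- `u ∈ W^{s, p}(Ω)`, for real `s ≥ 0` and `1 ≤ p < ∞`. -/
def MemW (Ω : Set (EuclideanSpace ℝ (Fin d))) (s p : ℝ) (u : EuclideanSpace ℝ (Fin d) → 𝕜) :
    Prop :=
  MemWAux Ω (Int.fract s) p ⌊s⌋₊ u

/-- `v ∈ H¹(Ω)`, with weak gradient `G = (G₁, …, G_d)`. -/
structure HasH1Grad (Ω : Set (EuclideanSpace ℝ (Fin d))) (v : EuclideanSpace ℝ (Fin d) → 𝕜)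
    (G : Fin d → EuclideanSpace ℝ (Fin d) → 𝕜) : Prop where
  memLp_fun : MemLp v 2 (volume.restrict Ω)
  memLp_grad : ∀ i, MemLp (G i) 2 (volume.restrict Ω)
  weak : ∀ i, IsWeakPartial Ω i v (G i)

/-- `v ∈ H¹₀(Ω)`, with weak gradient `G`: `v` lies in the closure of `C_c^∞(Ω)` in `H¹(Ω)`. -/
structure HasH10Grad (Ω : Set (EuclideanSpace ℝ (Fin d))) (v : EuclideanSpace ℝ (Fin d) → 𝕜)
    (G : Fin d → EuclideanSpace ℝ (Fin d) → 𝕜) : Prop extends HasH1Grad Ω v G where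
  approx : ∀ δ : ℝ≥0∞, 0 < δ → ∃ φ : EuclideanSpace ℝ (Fin d) → 𝕜, IsTest Ω φ ∧
    eLpNorm (v - φ) 2 (volume.restrict Ω) < δ ∧
    ∀ i, eLpNorm (G i - partialDeriv i φ) 2 (volume.restrict Ω) < δ

/-- `v ∈ H¹₀(Ω)` is a solution of the Dirichlet problem `Δ v = g` in `Ω`, `v = 0` on `∂Ω`.
The equation holds in the sense of distributions. -/
def IsDirichletSol (Ω : Set (EuclideanSpace ℝ (Fin d))) (g v : EuclideanSpace ℝ (Fin d) → 𝕜) :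
    Prop :=
  ∃ G : Fin d → EuclideanSpace ℝ (Fin d) → 𝕜, HasH10Grad Ω v G ∧
    ∀ φ : EuclideanSpace ℝ (Fin d) → 𝕜, IsTest Ω φ →
      ∫ x in Ω, ∑ i, G i x * partialDeriv i φ x = - ∫ x in Ω, g x * φ x

/-- `v ∈ H¹(Ω)` is a (weak) solution of the Neumann problem `Δ v = g` in `Ω`, `∂ₙ v = 0` on `∂Ω`:
`∫_Ω ∇v · ∇φ = - ∫_Ω g φ` for all `φ ∈ H¹(Ω)`. -/
def IsNeumannSol (Ω : Set (EuclideanSpace ℝ (Fin d))) (g v : EuclideanSpace ℝ (Fin d) → 𝕜) :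
    Prop :=
  ∃ G : Fin d → EuclideanSpace ℝ (Fin d) → 𝕜, HasH1Grad Ω v G ∧
    ∀ (φ : EuclideanSpace ℝ (Fin d) → 𝕜) (Φ : Fin d → EuclideanSpace ℝ (Fin d) → 𝕜),
      HasH1Grad Ω φ Φ → ∫ x in Ω, ∑ i, G i x * Φ i x = - ∫ x in Ω, g x * φ x

/-- `Ω` is a bounded `C¹` domain: open, connected, bounded, and near each boundary point it is
the sublevel set `{ρ < 0}` of a `C¹` function `ρ` with non-vanishing gradient. -/
structure IsBoundedC1Domain (Ω : Set (EuclideanSpace ℝ (Fin d))) : Prop where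
  isOpen : IsOpen Ω
  isConnected : IsConnected Ω
  isBounded : Bornology.IsBounded Ω
  boundary : ∀ x₀ ∈ frontier Ω, ∃ (U : Set (EuclideanSpace ℝ (Fin d)))
    (ρ : EuclideanSpace ℝ (Fin d) → ℝ), IsOpen U ∧ x₀ ∈ U ∧ ContDiffOn ℝ 1 ρ U ∧
      (∀ x ∈ U, fderiv ℝ ρ x ≠ 0) ∧ Ω ∩ U = {x ∈ U | ρ x < 0}

end Sobolev

/-! ### The domain -/

/-- `γ = (1/5) min_z ∫_1^2 |sin (z + t) - sin z| t⁻² dt`. -/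
noncomputable def gamma : ℝ :=
  (1 / 5) * ⨅ z : ℝ, ∫ t in (1 : ℝ)..2, |sin (z + t) - sin z| / t ^ 2

/-- The natural number `q` is large enough for the construction. -/
def LargeBase (q : ℕ) : Prop := 7 ≤ q ∧ 1 / ((q : ℝ) - 1) ≤ gamma

/-- `f(x) = ∑_{k ≥ 1} q^{-k} sin (2^{q^k} x)`. -/
noncomputable def sepFun (q : ℕ) (x : ℝ) : ℝ :=
  ∑' k : ℕ, ((q : ℝ) ^ (k + 1))⁻¹ * sin ((2 : ℝ) ^ (q ^ (k + 1)) * x)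

/-- `F(x) = 1 + ∫_0^x f(t) dt`. -/
noncomputable def radius (q : ℕ) (x : ℝ) : ℝ := 1 + ∫ t in (0 : ℝ)..x, sepFun q t

/-- `ω = {(r, θ) | r < F(θ)}` in polar coordinates. -/
def omega (q : ℕ) : Set (EuclideanSpace ℝ (Fin 2)) :=
  {x | ∃ r θ : ℝ, 0 ≤ r ∧ r < radius q θ ∧ x = !₂[r * cos θ, r * sin θ]}

/-- The quadratic polynomial `α x₁ x₂ + β (x₁² - x₂²)`. -/
def quadPoly (α β : ℝ) (x : EuclideanSpace ℝ (Fin 2)) : ℝ :=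
  α * (x 0 * x 1) + β * (x 0 ^ 2 - x 1 ^ 2)

theorem gamma_pos : 0 < gamma := by
  set J : ℝ → ℝ := fun z => ∫ t in (1 : ℝ)..2, |sin (z + t) - sin z| / t ^ 2 with hJ
  have hper : Function.Periodic J (2 * π) := by
    intro z
    simp only [hJ]
    congr 1
    ext t
    rw [show z + 2 * π + t = (z + t) + 2 * π by ring, sin_add_two_pi, sin_add_two_pi]
  have hfc : ∀ z : ℝ, ContinuousOn (fun t : ℝ => |sin (z + t) - sin z| / t ^ 2) (Icc 1 2) := by
    intro z
    refine ContinuousOn.div (by fun_prop) (by fun_prop) ?_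
    intro t ht
    have : 0 < t := by linarith [ht.1]
    positivity
  have hJc : Continuous J := by
    have h : J = fun z => ∫ t in (1 : ℝ)..2, |sin (z + t) - sin z| / (max t 1) ^ 2 := by
      ext z
      simp only [hJ]
      refine intervalIntegral.integral_congr ?_
      intro t ht
      rw [uIcc_of_le (by norm_num)] at ht
      simp only [max_eq_left ht.1]
    rw [h]
    refine intervalIntegral.continuous_parametric_intervalIntegral_of_continuous' ?_ _ _
    refine Continuous.div (by fun_prop) (by fun_prop) ?_
    rintro ⟨z, t⟩
    have : 0 < max t 1 := lt_max_of_lt_right one_pos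
    positivity
  have hpos : ∀ z, 0 < J z := by
    intro z
    have hnn : ∀ t ∈ Icc (1 : ℝ) 2, 0 ≤ |sin (z + t) - sin z| / t ^ 2 := fun t _ => by positivity
    have hex : ∃ t ∈ Icc (1 : ℝ) 2, 0 < |sin (z + t) - sin z| / t ^ 2 := by
      by_contra! hc
      have h0 : ∀ t ∈ Icc (1 : ℝ) 2, sin (z + t) = sin z := by
        intro t ht
        have ht0 : 0 < t := by linarith [ht.1]
        have h1 := le_antisymm (hc t ht) (hnn t ht)
        have h2 : |sin (z + t) - sin z| = 0 := by
          rcases div_eq_zero_iff.1 h1 with h | h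
          · exact h
          · exact absurd h (by positivity)
        linarith [abs_eq_zero.1 h2]
      have e1 := h0 1 (by constructor <;> norm_num)
      have e2 := h0 (3 / 2) (by constructor <;> norm_num)
      have e3 := h0 2 (by constructor <;> norm_num)
      -- with `w = z + 3 / 2`: `sin (w ± 1 / 2) = sin w` forces `sin w = 0` and `cos w = 0`
      have a1 : sin (z + 1) = sin (z + 3 / 2) * cos (1 / 2) - cos (z + 3 / 2) * sin (1 / 2) := by
        rw [← sin_sub]; congr 1; ring
      have a3 : sin (z + 2) = sin (z + 3 / 2) * cos (1 / 2) + cos (z + 3 / 2) * sin (1 / 2) := by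
        rw [← sin_add]; congr 1; ring
      have hs : 0 < sin (1 / 2 : ℝ) :=
        sin_pos_of_pos_of_lt_pi (by norm_num) (by linarith [pi_gt_three])
      have hcs := sin_sq_add_cos_sq (1 / 2 : ℝ)
      have hc1 : cos (1 / 2 : ℝ) < 1 := by nlinarith
      have b1 : cos (z + 3 / 2) * sin (1 / 2) = 0 := by linarith
      have b2 : sin (z + 3 / 2) * (1 - cos (1 / 2)) = 0 := by nlinarith
      have c1 : cos (z + 3 / 2) = 0 := by
        rcases mul_eq_zero.1 b1 with h | h
        · exact h
        · exact absurd h hs.ne'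
      have c2 : sin (z + 3 / 2) = 0 := by
        rcases mul_eq_zero.1 b2 with h | h
        · exact h
        · linarith
      have := sin_sq_add_cos_sq (z + 3 / 2)
      rw [c1, c2] at this
      norm_num at this
    exact intervalIntegral.integral_pos (by norm_num) (hfc z)
      (fun t ht => hnn t (Ioc_subset_Icc_self ht)) hex
  obtain ⟨z₀, -, hz₀⟩ := isCompact_Icc.exists_isMinOn
    (nonempty_Icc.2 two_pi_pos.le) hJc.continuousOn
  have hmin : ∀ z, J z₀ ≤ J z := by
    intro z
    obtain ⟨y, hy, hyz⟩ := hper.exists_mem_Ico₀ two_pi_pos z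
    rw [hyz]
    exact hz₀ (Ico_subset_Icc_self hy)
  have : J z₀ ≤ ⨅ z, J z := le_ciInf hmin
  have h2 := hpos z₀
  unfold gamma
  have : 0 < ⨅ z, J z := lt_of_lt_of_le h2 this
  simp only [hJ] at this
  positivity

/-- All sufficiently large `q` are admitted. -/
theorem eventually_largeBase : ∀ᶠ q : ℕ in Filter.atTop, LargeBase q := by
  have h : Filter.Tendsto (fun q : ℕ => 1 / ((q : ℝ) - 1)) Filter.atTop (nhds 0) := by
    refine Filter.Tendsto.div_atTop tendsto_const_nhds ?_
    exact Filter.tendsto_atTop_add_const_right _ _ tendsto_natCast_atTop_atTop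
  filter_upwards [Filter.eventually_ge_atTop 7, h.eventually (ge_mem_nhds gamma_pos)] with q h1 h2
  exact ⟨h1, h2⟩

end LimitReg

namespace LimitReg

/-! ### The lacunary series and the radius function -/

section Series

variable {q : ℕ}

/-! The boundary r = F(θ) is C¹, but its normal oscillates everywhere. On the scale h_k =
2^(-q^(k+1)) (`scale q k`) the mean increment of f = F' is at least of order q^(-(k+1)), uniformly
in θ (`integral_abs_sepFun_sub_ge`), whereas q^(k+1) h_k^η → 0 for every η > 0. Hence a field X
whose boundary values have some positive order of smoothness in L¹, and whose normal component
vanishes, must vanish completely on the boundary. Indeed, the normal is n = F e_r - f e_θ up to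
length. If n·X vanishes at θ and at θ + s, then (f(θ+s) - f(θ)) e_θ·X(θ) is controlled by |X(θ+s) -
X(θ)| and s|X(θ)|. Averaging over s between h_k and 2h_k and dividing by q^(-(k+1)) leaves positive
powers of h_k times q^(k+1), which tend to 0.

No trace theory is used. Boundary values are replaced by radial averages `bAvg` over strips of width
h, and regularity enters through two estimates only: the L¹ oscillation between points at distance
comparable with h, integrated over a parameter set of volume of order h³, is O(h^(3+η)), and the L¹
norm over the strip is O(h^(1/2)). The first holds for the gradient of every function in
W^{1+1/p+ε,p} (`oscBound_of_memW`), the second for every square integrable gradient. `FluxField`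
collects what is needed. `FluxField.lintegral_flux_le` gives a rate for the normal component,
`FluxField.lintegral_tang_le` transfers it to the component along e_θ, and `FluxField.tendsto_rot`
concludes that the rotated field has vanishing flux too, with any C¹ weight.

Dirichlet problem: the rotated gradient is divergence free with zero flux. Rotating once more, ∇v
has zero flux, although its total flux is ∫Δv = |ω| > 0. Neumann problem: ∇v has zero flux, hence so
has its rotation, weighted with the harmonic conjugate k of g. As the rotated gradient is divergence
free, this gives 0 = ∫ rot ∇v·∇k = ∫ ∇v·∇g = -∫ g², which is absurd for g ≠ 0.

Existence is Lax-Milgram. Coercivity comes from the Sobolev inequality for test functions in the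
Dirichlet case, and from a Poincaré inequality on the star-shaped domain in the Neumann case, where
(α, β) is chosen so that g has mean zero. Real and imaginary parts reduce general scalars to real
ones. -/

theorem hasSum_inv_pow_succ (hq : 7 ≤ q) :
    HasSum (fun k : ℕ => ((q : ℝ) ^ (k + 1))⁻¹) (1 / ((q : ℝ) - 1)) := by
  have hq' : (7 : ℝ) ≤ q := by exact_mod_cast hq
  have h := (hasSum_geometric_of_lt_one (r := (q : ℝ)⁻¹) (by positivity)
    (inv_lt_one_of_one_lt₀ (by linarith))).mul_left (q : ℝ)⁻¹
  have h2 : (q : ℝ)⁻¹ * (1 - (q : ℝ)⁻¹)⁻¹ = 1 / ((q : ℝ) - 1) := by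
    have : (q : ℝ) ≠ 0 := by positivity
    have : (q : ℝ) - 1 ≠ 0 := by linarith
    field_simp
  rw [h2] at h
  refine h.congr_fun ?_
  intro k
  rw [pow_succ, mul_inv, inv_pow, mul_comm]

theorem abs_sepTerm_le (k : ℕ) (x : ℝ) :
    ‖((q : ℝ) ^ (k + 1))⁻¹ * sin ((2 : ℝ) ^ (q ^ (k + 1)) * x)‖ ≤ ((q : ℝ) ^ (k + 1))⁻¹ := by
  rw [norm_mul, Real.norm_eq_abs, Real.norm_eq_abs, abs_of_nonneg (by positivity)]
  exact mul_le_of_le_one_right (by positivity) (abs_sin_le_one _)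

theorem summable_sepTerm (hq : 7 ≤ q) (x : ℝ) :
    Summable (fun k : ℕ => ((q : ℝ) ^ (k + 1))⁻¹ * sin ((2 : ℝ) ^ (q ^ (k + 1)) * x)) :=
  .of_norm_bounded (hasSum_inv_pow_succ hq).summable fun k => abs_sepTerm_le k x

theorem continuous_sepFun (hq : 7 ≤ q) : Continuous (sepFun q) :=
  continuous_tsum (fun k => by fun_prop) (hasSum_inv_pow_succ hq).summable
    fun k x => abs_sepTerm_le k x

theorem abs_sepFun_le (hq : 7 ≤ q) (x : ℝ) : |sepFun q x| ≤ 1 / 6 := by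
  have hq' : (7 : ℝ) ≤ q := by exact_mod_cast hq
  have h : ‖sepFun q x‖ ≤ 1 / ((q : ℝ) - 1) :=
    tsum_of_norm_bounded (hasSum_inv_pow_succ hq) fun k => abs_sepTerm_le k x
  refine (Real.norm_eq_abs _ ▸ h).trans ?_
  exact one_div_le_one_div_of_le (by norm_num) (by linarith)

theorem sepFun_neg (x : ℝ) : sepFun q (-x) = - sepFun q x := by
  simp only [sepFun, mul_neg, sin_neg, tsum_neg]

theorem sepFun_periodic : Function.Periodic (sepFun q) (2 * π) := by
  intro x
  simp only [sepFun]
  congr 1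
  ext k
  have : (2 : ℝ) ^ (q ^ (k + 1)) * (x + 2 * π) =
      2 ^ (q ^ (k + 1)) * x + ((2 ^ (q ^ (k + 1)) : ℕ) : ℝ) * (2 * π) := by
    push_cast; ring
  rw [this, sin_add_nat_mul_two_pi]

/-- The series is odd. The vanishing mean is what makes `radius` periodic, so that the boundary
curve closes up. -/
theorem integral_sepFun_period : ∫ t in (-π)..π, sepFun q t = 0 := by
  have h : ∫ t in (-π)..π, sepFun q (-t) = ∫ t in (-π)..π, sepFun q t := by
    rw [intervalIntegral.integral_comp_neg, neg_neg]
  simp only [sepFun_neg, intervalIntegral.integral_neg] at h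
  linarith

theorem hasDerivAt_radius (hq : 7 ≤ q) (x : ℝ) : HasDerivAt (radius q) (sepFun q x) x := by
  have hc := continuous_sepFun hq
  exact (intervalIntegral.integral_hasDerivAt_right (hc.intervalIntegrable _ _)
    hc.stronglyMeasurable.stronglyMeasurableAtFilter hc.continuousAt).const_add 1

theorem contDiff_radius (hq : 7 ≤ q) : ContDiff ℝ 1 (radius q) := by
  rw [contDiff_one_iff_deriv]
  refine ⟨fun x => (hasDerivAt_radius hq x).differentiableAt, ?_⟩
  rw [funext fun x => (hasDerivAt_radius hq x).deriv]
  exact continuous_sepFun hq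

theorem continuous_radius (hq : 7 ≤ q) : Continuous (radius q) := (contDiff_radius hq).continuous

theorem radius_zero : radius q 0 = 1 := by simp [radius]

theorem radius_periodic (hq : 7 ≤ q) : Function.Periodic (radius q) (2 * π) := by
  intro x
  have hc := continuous_sepFun hq
  have h := intervalIntegral.integral_add_adjacent_intervals
    (hc.intervalIntegrable 0 x (μ := volume)) (hc.intervalIntegrable x (x + 2 * π))
  have h2 := sepFun_periodic.intervalIntegral_add_eq (f := sepFun q) x (-π)
  rw [show -π + 2 * π = π by ring, integral_sepFun_period] at h2
  simp only [radius]
  linarith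

theorem lipschitz_radius (hq : 7 ≤ q) (x y : ℝ) : |radius q x - radius q y| ≤ 1 / 6 * |x - y| := by
  have := Convex.norm_image_sub_le_of_norm_hasDerivWithin_le (f := radius q) (f' := sepFun q)
    (s := univ) (C := 1 / 6) (fun z _ => (hasDerivAt_radius hq z).hasDerivWithinAt)
    (fun z _ => abs_sepFun_le hq z) convex_univ (mem_univ y) (mem_univ x)
  simpa using this

/-- By periodicity |x| ≤ π may be assumed, and π/6 < 3/5. -/
theorem radius_bounds (hq : 7 ≤ q) (x : ℝ) : 2 / 5 ≤ radius q x ∧ radius q x ≤ 8 / 5 := by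
  obtain ⟨y, hy, hxy⟩ := (radius_periodic hq).exists_mem_Ico two_pi_pos x (-π)
  rw [hxy]
  have h := lipschitz_radius hq y 0
  rw [radius_zero, sub_zero] at h
  have hy' : |y| ≤ π := abs_le.2 ⟨hy.1, by linarith [hy.2]⟩
  have := abs_le.1 (h.trans (by gcongr))
  have hpi := pi_lt_d2
  constructor <;> linarith [this.1, this.2]

/-- This quantifies the lacunarity: consecutive frequencies differ by a factor of at least q^(k+1),
so the slower terms of the series hardly move over the length `scale q k`. -/
theorem pow_mul_two_pow_le (hq : 7 ≤ q) (k : ℕ) :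
    q ^ (k + 1) * 2 ^ (q ^ k) ≤ 2 ^ (q ^ (k + 1)) := by
  have hm : 1 ≤ q ^ k := Nat.one_le_pow _ _ (by omega)
  set m := q ^ k
  have h1 : q ≤ 2 ^ (q - 2) := by
    obtain ⟨n, hn⟩ := Nat.exists_eq_add_of_le hq
    have key : ∀ n, 7 + n ≤ 2 ^ (5 + n) := fun n => by
      induction n with
      | zero => norm_num
      | succ n ih => rw [← add_assoc, ← add_assoc, pow_succ]; omega
    rw [show q - 2 = 5 + n by omega]
    exact hn.trans_le (key n)
  have h2 : m ≤ 2 ^ m := Nat.lt_two_pow_self.le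
  have h3 : 2 ^ (q - 2) ≤ 2 ^ ((q - 2) * m) := Nat.pow_le_pow_right (by norm_num)
    (Nat.le_mul_of_pos_right _ hm)
  calc q ^ (k + 1) * 2 ^ m = m * q * 2 ^ m := by rw [pow_succ]
    _ ≤ 2 ^ m * 2 ^ ((q - 2) * m) * 2 ^ m := by gcongr; exact h1.trans h3
    _ = 2 ^ (q * m) := by
      rw [← pow_add, ← pow_add]
      congr 1
      obtain ⟨n, rfl⟩ := Nat.exists_eq_add_of_le hq
      rw [show 7 + n - 2 = 5 + n by omega]
      ring
    _ = 2 ^ (q ^ (k + 1)) := by rw [pow_succ, mul_comm]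

/-- The length scale on which the `k`-th term of the series oscillates. -/
noncomputable def scale (q k : ℕ) : ℝ := ((2 : ℝ) ^ (q ^ (k + 1)))⁻¹

theorem scale_pos (q k : ℕ) : 0 < scale q k := by unfold scale; positivity

theorem abs_sin_sub_sin_le (x y : ℝ) : |sin x - sin y| ≤ |x - y| := by
  have := Convex.norm_image_sub_le_of_norm_hasDerivWithin_le (f := sin) (f' := cos)
    (s := univ) (C := 1) (fun z _ => (hasDerivAt_sin z).hasDerivWithinAt)
    (fun z _ => abs_cos_le_one z) convex_univ (mem_univ y) (mem_univ x)
  simpa using this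

/-- Put Q = q^(-(k+1)) and split the series at the k-th term. The slower terms change by at most
Qtγ, by the Lipschitz bound for the sine, and the faster ones by at most 2Qγ, by their size. Since t
+ 2 ≤ 3t² for t ≥ 1, dividing by t² absorbs both errors into 3γ. -/
theorem abs_sepFun_sub_ge (hq : LargeBase q) (k : ℕ) (θ : ℝ) {t : ℝ} (ht : t ∈ Icc (1 : ℝ) 2) :
    ((q : ℝ) ^ (k + 1))⁻¹ * (|sin (2 ^ (q ^ (k + 1)) * θ + t) - sin (2 ^ (q ^ (k + 1)) * θ)|
      / t ^ 2 - 3 * gamma) ≤ |sepFun q (θ + scale q k * t) - sepFun q θ| := by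
  obtain ⟨hq7, hqγ⟩ := hq
  have hq' : (7 : ℝ) ≤ q := by exact_mod_cast hq7
  set Q : ℝ := ((q : ℝ) ^ (k + 1))⁻¹ with hQ
  have hQpos : 0 < Q := by positivity
  set a : ℕ → ℝ := fun j => ((q : ℝ) ^ (j + 1))⁻¹ * sin (2 ^ (q ^ (j + 1)) * (θ + scale q k * t)) -
    ((q : ℝ) ^ (j + 1))⁻¹ * sin (2 ^ (q ^ (j + 1)) * θ) with ha
  have hsum : Summable a := (summable_sepTerm hq7 _).sub (summable_sepTerm hq7 _)
  have hdiff : sepFun q (θ + scale q k * t) - sepFun q θ = ∑' j, a j :=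
    ((summable_sepTerm hq7 _).tsum_sub (summable_sepTerm hq7 _)).symm
  have hsplit : sepFun q (θ + scale q k * t) - sepFun q θ =
      ∑ j ∈ Finset.range k, a j + a k + ∑' j, a (j + (k + 1)) := by
    rw [hdiff, ← hsum.sum_add_tsum_nat_add (k + 1), Finset.sum_range_succ]
  have hab : ∀ j, |a j| ≤ 2 * ((q : ℝ) ^ (j + 1))⁻¹ := by
    intro j
    have h1 := abs_sepTerm_le (q := q) j (θ + scale q k * t)
    have h2 := abs_sepTerm_le (q := q) j θ
    rw [Real.norm_eq_abs] at h1 h2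
    exact (abs_sub _ _).trans (by linarith)
  have htail : |∑' j, a (j + (k + 1))| ≤ 2 * Q * gamma := by
    have h := ((hasSum_inv_pow_succ hq7).mul_left (2 * Q))
    have h2 : ‖∑' j, a (j + (k + 1))‖ ≤ 2 * Q * (1 / ((q : ℝ) - 1)) := by
      refine tsum_of_norm_bounded h fun j => (hab _).trans_eq ?_
      rw [hQ, mul_assoc, ← mul_inv, ← pow_add]
      congr 3; ring
    exact h2.trans (by gcongr)
  have hhead : |∑ j ∈ Finset.range k, a j| ≤ Q * t * gamma := by
    have hterm : ∀ j ∈ Finset.range k, |a j| ≤ ((q : ℝ) ^ (j + 1))⁻¹ * (Q * t) := by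
      intro j hj
      have hjk : j + 1 ≤ k := Finset.mem_range.1 hj
      simp only [ha]
      rw [← mul_sub, abs_mul, abs_of_nonneg (by positivity)]
      gcongr
      refine (abs_sin_sub_sin_le _ _).trans ?_
      rw [show (2 : ℝ) ^ (q ^ (j + 1)) * (θ + scale q k * t) - 2 ^ (q ^ (j + 1)) * θ =
        2 ^ (q ^ (j + 1)) * scale q k * t by ring, abs_of_nonneg (by
          have := scale_pos q k; have := ht.1; positivity)]
      have h1 : (2 : ℝ) ^ (q ^ (j + 1)) ≤ 2 ^ (q ^ k) := by
        gcongr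
        · norm_num
        · omega
      have h2 : ((q : ℝ) ^ (k + 1)) * 2 ^ (q ^ k) ≤ 2 ^ (q ^ (k + 1)) := by
        exact_mod_cast pow_mul_two_pow_le hq7 k
      have h3 : (2 : ℝ) ^ (q ^ k) * scale q k ≤ Q := by
        rw [scale, hQ, ← div_eq_mul_inv, div_le_iff₀ (by positivity), ← div_eq_inv_mul,
          le_div_iff₀ (by positivity)]
        linarith
      have := ht.1
      have := scale_pos q k
      calc (2 : ℝ) ^ (q ^ (j + 1)) * scale q k * t ≤ 2 ^ (q ^ k) * scale q k * t := by gcongr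
        _ ≤ Q * t := by gcongr
    calc |∑ j ∈ Finset.range k, a j| ≤ ∑ j ∈ Finset.range k, ((q : ℝ) ^ (j + 1))⁻¹ * (Q * t) :=
          (Finset.abs_sum_le_sum_abs _ _).trans (Finset.sum_le_sum hterm)
      _ = (∑ j ∈ Finset.range k, ((q : ℝ) ^ (j + 1))⁻¹) * (Q * t) := by rw [Finset.sum_mul]
      _ ≤ gamma * (Q * t) := by
        have := ht.1
        gcongr
        exact ((hasSum_inv_pow_succ hq7).summable.sum_le_tsum _ fun _ _ => by positivity).trans
          ((hasSum_inv_pow_succ hq7).tsum_eq.trans_le hqγ)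
      _ = Q * t * gamma := by ring
  have hk : a k = Q * (sin (2 ^ (q ^ (k + 1)) * θ + t) - sin (2 ^ (q ^ (k + 1)) * θ)) := by
    simp only [ha]
    rw [← mul_sub, show (2 : ℝ) ^ (q ^ (k + 1)) * (θ + scale q k * t) =
      2 ^ (q ^ (k + 1)) * θ + t by rw [scale]; field_simp]
  have hmain : |a k| - Q * t * gamma - 2 * Q * gamma ≤
      |sepFun q (θ + scale q k * t) - sepFun q θ| := by
    rw [hsplit]
    have e : a k = (∑ j ∈ Finset.range k, a j + a k + ∑' j, a (j + (k + 1))) -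
      (∑ j ∈ Finset.range k, a j) - ∑' j, a (j + (k + 1)) := by ring
    have h1 := abs_sub ((∑ j ∈ Finset.range k, a j + a k + ∑' j, a (j + (k + 1))) -
      (∑ j ∈ Finset.range k, a j)) (∑' j, a (j + (k + 1)))
    have h2 := abs_sub (∑ j ∈ Finset.range k, a j + a k + ∑' j, a (j + (k + 1)))
      (∑ j ∈ Finset.range k, a j)
    rw [← e] at h1
    linarith
  rw [hk, abs_mul, abs_of_pos hQpos] at hmain
  set A := |sin (2 ^ (q ^ (k + 1)) * θ + t) - sin (2 ^ (q ^ (k + 1)) * θ)|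
  set D := |sepFun q (θ + scale q k * t) - sepFun q θ|
  have ht1 := ht.1
  have hD : 0 ≤ D := abs_nonneg _
  have hg := gamma_pos
  have h5 : Q * (A / t ^ 2 - 3 * gamma) * t ^ 2 = Q * A - 3 * Q * gamma * t ^ 2 := by
    field_simp
  have h6 : Q * (A / t ^ 2 - 3 * gamma) * t ^ 2 ≤ D * t ^ 2 := by
    rw [h5]
    have h7 : D ≤ D * t ^ 2 := le_mul_of_one_le_right hD (by nlinarith)
    have h8 : 0 < Q * gamma := by positivity
    have h9 : Q * t * gamma + 2 * Q * gamma ≤ 3 * Q * gamma * t ^ 2 := by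
      have : t + 2 ≤ 3 * t ^ 2 := by nlinarith
      calc Q * t * gamma + 2 * Q * gamma = (Q * gamma) * (t + 2) := by ring
        _ ≤ (Q * gamma) * (3 * t ^ 2) := by gcongr
        _ = _ := by ring
    linarith
  exact le_of_mul_le_mul_right h6 (by positivity)

theorem continuousOn_sin_sub_div (z : ℝ) :
    ContinuousOn (fun t : ℝ => |sin (z + t) - sin z| / t ^ 2) (Icc 1 2) := by
  refine ContinuousOn.div (by fun_prop) (by fun_prop) ?_
  intro t ht
  have : 0 < t := by linarith [ht.1]
  positivity

theorem five_gamma_le (z : ℝ) :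
    5 * gamma ≤ ∫ t in (1 : ℝ)..2, |sin (z + t) - sin z| / t ^ 2 := by
  have h : (⨅ z : ℝ, ∫ t in (1 : ℝ)..2, |sin (z + t) - sin z| / t ^ 2) ≤
      ∫ t in (1 : ℝ)..2, |sin (z + t) - sin z| / t ^ 2 := by
    refine ciInf_le ⟨0, ?_⟩ z
    rintro _ ⟨y, rfl⟩
    exact intervalIntegral.integral_nonneg (by norm_num) fun t _ => by positivity
  rw [gamma]
  linarith

/-- Uniformly in `θ`, the increments of `f` at distance comparable with `scale q k` are at least
of the order `q^{-k}` on average. -/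
theorem integral_abs_sepFun_sub_ge (hq : LargeBase q) (k : ℕ) (θ : ℝ) :
    2 * gamma * ((q : ℝ) ^ (k + 1))⁻¹ * scale q k ≤
      ∫ s in (scale q k)..(2 * scale q k), |sepFun q (θ + s) - sepFun q θ| := by
  have hc := continuous_sepFun hq.1
  have hs := scale_pos q k
  have hsub : ∫ t in (1 : ℝ)..2, |sepFun q (θ + scale q k * t) - sepFun q θ| =
      (scale q k)⁻¹ * ∫ s in (scale q k)..(2 * scale q k), |sepFun q (θ + s) - sepFun q θ| := by
    have := intervalIntegral.integral_comp_mul_left (a := 1) (b := 2)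
      (fun s => |sepFun q (θ + s) - sepFun q θ|) hs.ne'
    rw [this, mul_one, mul_comm (scale q k) 2, smul_eq_mul]
  have hmain : 2 * gamma * ((q : ℝ) ^ (k + 1))⁻¹ ≤
      ∫ t in (1 : ℝ)..2, |sepFun q (θ + scale q k * t) - sepFun q θ| := by
    set z : ℝ := 2 ^ (q ^ (k + 1)) * θ
    have hi : IntervalIntegrable (fun t : ℝ => |sin (z + t) - sin z| / t ^ 2) volume 1 2 := by
      apply ContinuousOn.intervalIntegrable
      rw [uIcc_of_le (by norm_num)]
      exact continuousOn_sin_sub_div z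
    -- After integration 5γ - 3γ = 2γ remains, by the normalisation of `gamma`.
    have h1 : ∫ t in (1 : ℝ)..2, ((q : ℝ) ^ (k + 1))⁻¹ *
        (|sin (z + t) - sin z| / t ^ 2 - 3 * gamma) ≤
        ∫ t in (1 : ℝ)..2, |sepFun q (θ + scale q k * t) - sepFun q θ| := by
      refine intervalIntegral.integral_mono_on (by norm_num) ?_ ?_ ?_
      · exact (hi.sub intervalIntegrable_const).const_mul _
      · exact Continuous.intervalIntegrable (by fun_prop) _ _
      · intro t ht
        exact abs_sepFun_sub_ge hq k θ ht
    refine le_trans ?_ h1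
    rw [intervalIntegral.integral_const_mul, intervalIntegral.integral_sub hi
      intervalIntegrable_const, intervalIntegral.integral_const]
    have h5 := five_gamma_le z
    have : (0 : ℝ) < ((q : ℝ) ^ (k + 1))⁻¹ := by
      have : (7 : ℝ) ≤ q := by exact_mod_cast hq.1
      positivity
    rw [mul_comm (2 * gamma)]
    gcongr
    simp only [smul_eq_mul]
    linarith
  rw [hsub, ← div_eq_inv_mul, le_div_iff₀ hs] at hmain
  exact hmain

/-- With n = q^(k+1) the expression is n·2^(-ηn). The amplitudes of the series thus decay more
slowly than any power of the scale, which defeats every gain η > 0. -/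
theorem tendsto_pow_mul_scale_rpow (hq : 7 ≤ q) {η : ℝ} (hη : 0 < η) :
    Filter.Tendsto (fun k : ℕ => (q : ℝ) ^ (k + 1) * scale q k ^ η) Filter.atTop (nhds 0) := by
  have h1 : Filter.Tendsto (fun n : ℕ => (n : ℝ) * ((2 : ℝ) ^ (-η)) ^ n) Filter.atTop (nhds 0) :=
    tendsto_self_mul_const_pow_of_lt_one (by positivity)
      (rpow_lt_one_of_one_lt_of_neg (by norm_num) (by linarith))
  have h2 : Filter.Tendsto (fun k : ℕ => q ^ (k + 1)) Filter.atTop Filter.atTop :=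
    (tendsto_pow_atTop_atTop_of_one_lt (by omega)).comp (Filter.tendsto_add_atTop_nat 1)
  refine (h1.comp h2).congr fun k => ?_
  simp only [Function.comp_apply, Nat.cast_pow]
  congr 1
  rw [scale, ← rpow_natCast (2 : ℝ), ← rpow_neg (by norm_num), ← rpow_natCast, ← rpow_mul (by norm_num),
    ← rpow_mul (by norm_num)]
  congr 1
  ring

theorem tendsto_scale (hq : 7 ≤ q) : Filter.Tendsto (scale q) Filter.atTop (nhds 0) := by
  refine squeeze_zero (fun k => (scale_pos q k).le) (fun k => ?_)
    (tendsto_pow_mul_scale_rpow hq one_pos)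
  rw [rpow_one]
  have : (1 : ℝ) ≤ q := by exact_mod_cast (by omega : 1 ≤ q)
  exact le_mul_of_one_le_left (scale_pos q k).le (one_le_pow₀ this)

end Series

/-! ### Polar coordinates in the plane -/

/-- The Euclidean plane. -/
abbrev Plane : Type := EuclideanSpace ℝ (Fin 2)

/-- The identification of the Euclidean plane with `ℂ`. -/
noncomputable def toComplex : Plane ≃ₗᵢ[ℝ] ℂ := Complex.orthonormalBasisOneI.repr.symm

theorem toComplex_apply (x : Plane) : toComplex x = ⟨x 0, x 1⟩ := by
  rw [toComplex, LinearIsometryEquiv.symm_apply_eq]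
  ext i
  rw [Complex.orthonormalBasisOneI_repr_apply]
  fin_cases i <;> simp

theorem toComplex_ne_zero {x : Plane} (hx : x ≠ 0) : toComplex x ≠ 0 := by
  simpa using hx

/-- The polar angle, in `(-π, π]`. -/
noncomputable def angle (x : Plane) : ℝ := (toComplex x).arg

/-- The radial unit vector. -/
noncomputable def er (θ : ℝ) : Plane := !₂[cos θ, sin θ]

theorem er_zero (θ : ℝ) : er θ 0 = cos θ := rfl

theorem er_one (θ : ℝ) : er θ 1 = sin θ := rfl

theorem toComplex_er (θ : ℝ) : toComplex (er θ) = Complex.cos θ + Complex.sin θ * Complex.I := by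
  rw [toComplex_apply]
  apply Complex.ext <;> simp [er, ← Complex.ofReal_cos, ← Complex.ofReal_sin]

theorem norm_er (θ : ℝ) : ‖er θ‖ = 1 := by
  rw [EuclideanSpace.norm_eq, Fin.sum_univ_two, er_zero, er_one]
  simp

theorem norm_smul_er_angle (x : Plane) : ‖x‖ • er (angle x) = x := by
  ext i
  have h : ‖x‖ = ‖toComplex x‖ := (toComplex.norm_map x).symm
  fin_cases i
  · simp only [angle, h, er]
    simp [toComplex_apply, Complex.norm_mul_cos_arg]
  · simp only [angle, h, er]
    simp [toComplex_apply, Complex.norm_mul_sin_arg]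

theorem angle_smul_er {r θ : ℝ} (hr : 0 < r) (hθ : θ ∈ Ioc (-π) π) : angle (r • er θ) = θ := by
  rw [angle, map_smul, toComplex_er, Complex.real_smul]
  exact Complex.arg_mul_cos_add_sin_mul_I hr hθ

theorem angle_mem (x : Plane) : angle x ∈ Ioc (-π) π := Complex.arg_mem_Ioc _

theorem er_periodic : Function.Periodic er (2 * π) := by
  intro θ
  ext i
  fin_cases i <;> simp [er]

theorem contDiff_er : ContDiff ℝ ∞ er := by
  rw [contDiff_euclidean]
  intro i
  fin_cases i
  · exact contDiff_cos
  · exact contDiff_sin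

theorem comp_angle_smul_er {g : ℝ → ℝ} (hg : Function.Periodic g (2 * π)) {r : ℝ} (hr : 0 < r)
    (θ : ℝ) : g (angle (r • er θ)) = g θ := by
  have hp : Function.Periodic (fun θ => (g θ, er θ)) (2 * π) := fun θ => by
    simp only [hg θ, er_periodic θ]
  obtain ⟨y, hy, hxy⟩ := hp.exists_mem_Ioc two_pi_pos θ (-π)
  simp only [Prod.mk.injEq] at hxy
  rw [hxy.1, hxy.2, angle_smul_er hr ⟨hy.1, by linarith [hy.2]⟩]

theorem measurable_angle : Measurable angle :=
  Complex.measurable_arg.comp toComplex.continuous.measurable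

/-- The differential of the polar angle. -/
noncomputable def dAngle (x : Plane) : Plane →L[ℝ] ℝ :=
  Complex.imCLM.comp ((ContinuousLinearMap.mul ℝ ℂ (toComplex x)⁻¹).comp
    (toComplex : Plane →L[ℝ] ℂ))

theorem dAngle_apply (x w : Plane) : dAngle x w = ((toComplex x)⁻¹ * toComplex w).im := rfl

theorem dAngle_smul_er {r : ℝ} (hr : 0 < r) (θ : ℝ) (w : Plane) :
    dAngle (r • er θ) w = (w 1 * cos θ - w 0 * sin θ) / r := by
  have h2 := sin_sq_add_cos_sq θ
  have h : (toComplex (r • er θ))⁻¹ = ⟨cos θ / r, - sin θ / r⟩ := by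
    refine inv_eq_of_mul_eq_one_right ?_
    rw [toComplex_apply]
    apply Complex.ext <;> simp [er_zero, er_one] <;> field_simp <;> linarith
  rw [dAngle_apply, h, toComplex_apply]
  simp
  ring

theorem norm_dAngle_le (x w : Plane) : |dAngle x w| ≤ ‖x‖⁻¹ * ‖w‖ := by
  rw [dAngle_apply]
  refine (Complex.abs_im_le_norm _).trans ?_
  rw [norm_mul, norm_inv, toComplex.norm_map, toComplex.norm_map]

theorem hasFDerivAt_arg_mul {c : ℂ} {x : Plane} (hx : c * toComplex x ∈ Complex.slitPlane) :
    ContDiffAt ℝ ∞ (fun y => (c * toComplex y).arg) x ∧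
    HasFDerivAt (fun y => (c * toComplex y).arg) (dAngle x) x := by
  have he : (fun y => (c * toComplex y).arg) = fun y => (Complex.log (c * toComplex y)).im := by
    ext y; rw [Complex.log_im]
  rw [he]
  have hc : c ≠ 0 := by
    rintro rfl
    simp at hx
  constructor
  · have h1 : ContDiffAt ℝ ∞ Complex.log (c * toComplex x) :=
      (Complex.contDiffAt_log hx).restrict_scalars ℝ
    have h2 : ContDiffAt ℝ ∞ (fun y => Complex.log (c * toComplex y)) x :=
      h1.comp x (contDiffAt_const.mul (toComplex.contDiff.contDiffAt))
    exact Complex.imCLM.contDiff.contDiffAt.comp x h2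
  · have h1 := (Complex.hasStrictDerivAt_log hx).hasDerivAt.hasFDerivAt.restrictScalars ℝ
    have h2 : HasFDerivAt (fun y => c * toComplex y)
        (c • (toComplex : Plane →L[ℝ] ℂ)) x :=
      (toComplex : Plane →L[ℝ] ℂ).hasFDerivAt.const_mul c
    have h3 := Complex.imCLM.hasFDerivAt.comp x (h1.comp x h2)
    refine h3.congr_fderiv ?_
    ext w
    have e : (toComplex x)⁻¹ * toComplex w = c * toComplex w * (c * toComplex x)⁻¹ := by
      have := right_ne_zero_of_mul (Complex.slitPlane_ne_zero hx)
      field_simp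
    rw [dAngle_apply, e]
    simp

/-- Near every point different from the origin there is a smooth branch of the polar angle. -/
theorem exists_angle_branch {x : Plane} (hx : x ≠ 0) : ∃ A : Plane → ℝ, ContDiffAt ℝ ∞ A x ∧
    HasFDerivAt A (dAngle x) x ∧ ∀ y, y ≠ 0 → (A y : Real.Angle) = angle y := by
  by_cases h : toComplex x ∈ Complex.slitPlane
  · have := hasFDerivAt_arg_mul (c := 1) (x := x) (by simpa using h)
    refine ⟨_, this.1, this.2, fun y _ => ?_⟩
    simp [angle]
  -- On the negative half axis the branch arg(-z) + π is used.
  · have hn : -1 * toComplex x ∈ Complex.slitPlane := by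
      rw [Complex.mem_slitPlane_iff] at h ⊢
      push Not at h
      rw [neg_one_mul, Complex.neg_re, Complex.neg_im, h.2]
      left
      have : (toComplex x).re ≠ 0 := fun h0 => toComplex_ne_zero hx (Complex.ext h0 h.2)
      have := lt_of_le_of_ne h.1 this
      linarith
    have := hasFDerivAt_arg_mul hn
    refine ⟨fun y => (-1 * toComplex y).arg + π, this.1.add contDiffAt_const,
      this.2.add_const π, fun y hy => ?_⟩
    beta_reduce
    rw [neg_one_mul, Real.Angle.coe_add, Complex.arg_neg_coe_angle (toComplex_ne_zero hy), angle,
      add_assoc, Real.Angle.coe_pi_add_coe_pi, add_zero]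

theorem periodic_eq_of_coe_eq {g : ℝ → ℝ} (hg : Function.Periodic g (2 * π)) {a b : ℝ}
    (h : (a : Real.Angle) = b) : g a = g b := by
  obtain ⟨k, hk⟩ := Real.Angle.angle_eq_iff_two_pi_dvd_sub.1 h
  have := hg.int_mul k b
  rw [← this]
  congr 1
  linarith

theorem contDiffAt_comp_angle {g : ℝ → ℝ} (hg : ContDiff ℝ 1 g)
    (hp : Function.Periodic g (2 * π)) {x : Plane} (hx : x ≠ 0) :
    ContDiffAt ℝ 1 (fun y => g (angle y)) x := by
  obtain ⟨A, hA, -, hA2⟩ := exists_angle_branch hx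
  refine (hg.contDiffAt.comp x (hA.of_le (by norm_cast))).congr_of_eventuallyEq ?_
  filter_upwards [isOpen_ne.mem_nhds hx] with y hy
  exact (periodic_eq_of_coe_eq hp (hA2 y hy)).symm

theorem hasFDerivAt_comp_angle {g g' : ℝ → ℝ} (hg : ∀ θ, HasDerivAt g (g' θ) θ)
    (hp : Function.Periodic g (2 * π)) (hp' : Function.Periodic g' (2 * π))
    {x : Plane} (hx : x ≠ 0) :
    HasFDerivAt (fun y => g (angle y)) (g' (angle x) • dAngle x) x := by
  obtain ⟨A, -, hA, hA2⟩ := exists_angle_branch hx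
  have h := (hg (A x)).comp_hasFDerivAt x hA
  rw [periodic_eq_of_coe_eq hp' (hA2 x hx)] at h
  refine h.congr_of_eventuallyEq ?_
  filter_upwards [isOpen_ne.mem_nhds hx] with y hy
  exact (periodic_eq_of_coe_eq hp (hA2 y hy)).symm

theorem norm_mul_cos_angle (x : Plane) : ‖x‖ * cos (angle x) = x 0 := by
  conv_rhs => rw [← norm_smul_er_angle x]
  simp [er_zero]

/-- A function on the circle supported away from the negative half axis. -/
theorem hasFDerivAt_comp_angle_of_support {ψ ψ' : ℝ → ℝ} (hψ : ∀ θ, HasDerivAt ψ (ψ' θ) θ)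
    (hψ' : Continuous ψ') {a : ℝ} (ha : a < π) (ha0 : 0 < a)
    (hs : ∀ θ, ψ θ ≠ 0 → |θ| ≤ a) {x : Plane} (hx : x ≠ 0) :
    ContDiffAt ℝ 1 (fun y => ψ (angle y)) x ∧
    HasFDerivAt (fun y => ψ (angle y)) (ψ' (angle x) • dAngle x) x := by
  have hψ1 : ContDiff ℝ 1 ψ := by
    rw [contDiff_one_iff_deriv]
    refine ⟨fun θ => (hψ θ).differentiableAt, ?_⟩
    rwa [funext fun θ => (hψ θ).deriv]
  -- Either the angle is smooth at `x`, or `x` lies on the cut, near which `ψ` composed with the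
  -- angle vanishes.
  have hfd : ContDiffAt ℝ ∞ angle x ∧ HasFDerivAt angle (dAngle x) x ∨
      (∀ᶠ y in nhds x, ψ (angle y) = 0) ∧ ψ' (angle x) = 0 := by
    by_cases h : toComplex x ∈ Complex.slitPlane
    · left
      have := hasFDerivAt_arg_mul (c := 1) (x := x) (by simpa using h)
      simp only [one_mul] at this
      exact this
    · right
      have hpos : 0 < ‖x‖ := norm_pos_iff.2 hx
      have harg : angle x = π := by
        rw [Complex.mem_slitPlane_iff_arg, not_and_or, not_not] at h
        rcases h with h | h
        · exact h
        · exact absurd (toComplex_ne_zero hx) h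
      constructor
      · have hcos : cos a > -1 := by
          rw [← cos_pi]
          exact strictAntiOn_cos ⟨ha0.le, ha.le⟩ ⟨pi_pos.le, le_rfl⟩ ha
        have hx0 : x 0 / ‖x‖ < cos a := by
          rw [← norm_mul_cos_angle, harg, cos_pi]
          field_simp
          exact hcos
        have hcont : ContinuousAt (fun y : Plane => y 0 / ‖y‖) x := by
          refine ContinuousAt.div (by fun_prop) (by fun_prop) hpos.ne'
        filter_upwards [hcont.eventually (gt_mem_nhds hx0), isOpen_ne.mem_nhds hx] with y hy hy0
        by_contra hne
        have hle := hs _ hne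
        have hy1 : 0 < ‖y‖ := norm_pos_iff.2 hy0
        rw [← norm_mul_cos_angle, mul_div_cancel_left₀ _ hy1.ne', ← cos_abs (angle y)] at hy
        exact absurd (cos_le_cos_of_nonneg_of_le_pi (abs_nonneg _) ha.le hle) (by linarith)
      · rw [harg]
        have h0 : ψ =ᶠ[nhds π] fun _ => 0 := by
          filter_upwards [lt_mem_nhds ha] with θ hθ
          by_contra hne
          have := (le_abs_self θ).trans (hs θ hne)
          linarith
        exact (hψ π).unique ((hasDerivAt_const π (0 : ℝ)).congr_of_eventuallyEq h0)
  rcases hfd with ⟨h1, h2⟩ | ⟨h1, h2⟩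
  · exact ⟨hψ1.contDiffAt.comp x (h1.of_le (by norm_cast)),
      (hψ (angle x)).comp_hasFDerivAt x h2⟩
  · rw [h2, zero_smul]
    exact ⟨contDiffAt_const.congr_of_eventuallyEq h1,
      (hasFDerivAt_const (0 : ℝ) x).congr_of_eventuallyEq h1⟩

theorem hasFDerivAt_norm {x : Plane} (hx : x ≠ 0) :
    HasFDerivAt (fun y : Plane => ‖y‖) (‖x‖⁻¹ • innerSL ℝ x) x := by
  have hpos : 0 < ‖x‖ := norm_pos_iff.2 hx
  have h := (hasStrictFDerivAt_norm_sq x).hasFDerivAt.sqrt (by positivity)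
  refine (h.congr_fderiv ?_).congr_of_eventuallyEq (.of_forall fun y => ?_)
  · ext w
    simp [Real.sqrt_sq hpos.le]
    field_simp
  · simp [Real.sqrt_sq]

theorem inner_plane (x y : Plane) : inner ℝ x y = x 0 * y 0 + x 1 * y 1 := by
  rw [EuclideanSpace.inner_eq_star_dotProduct]
  simp [dotProduct, Fin.sum_univ_two]
  ring

/-- Integration in polar coordinates. -/
theorem lintegral_polar {φ : Plane → ℝ≥0∞} (hφ : Measurable φ) :
    ∫⁻ x, φ x = ∫⁻ θ in Ioo (-π) π, ∫⁻ r in Ioi (0 : ℝ), ENNReal.ofReal r * φ (r • er θ) := by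
  have h1 := (EuclideanSpace.volume_preserving_symm_measurableEquiv_toLp (Fin 2)).symm
  have h2 := (volume_preserving_finTwoArrow ℝ).symm
  have h := (h1.comp h2).lintegral_comp hφ
  rw [← h, ← lintegral_comp_polarCoord_symm, polarCoord_target, Measure.volume_eq_prod,
    ← Measure.prod_restrict, lintegral_prod_symm']
  · refine lintegral_congr fun θ => lintegral_congr fun r => ?_
    rw [smul_eq_mul]
    congr 2
    ext i
    fin_cases i <;> simp [polarCoord, er]
  · refine (measurable_fst.ennreal_ofReal).smul ?_
    refine hφ.comp ((h1.comp h2).measurable.comp ?_)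
    exact continuous_polarCoord_symm.measurable

/-! ### The domain in polar coordinates -/

/-- Radial distance to the boundary of `omega q`. -/
noncomputable def depth (q : ℕ) (x : Plane) : ℝ := radius q (angle x) - ‖x‖

/-- The point with polar angle `θ` at radial distance `τ` from the boundary of `omega q`. -/
noncomputable def polarPt (q : ℕ) (τ θ : ℝ) : Plane := (radius q θ - τ) • er θ

/-- The boundary strip of width `h`. -/
def strip (q : ℕ) (h : ℝ) : Set Plane := {x | 0 < depth q x ∧ depth q x < h}

section

variable {q : ℕ}

theorem depth_smul_er (hq : 7 ≤ q) {r : ℝ} (hr : 0 < r) (θ : ℝ) :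
    depth q (r • er θ) = radius q θ - r := by
  rw [depth, comp_angle_smul_er (radius_periodic hq) hr, norm_smul, norm_er, mul_one,
    Real.norm_of_nonneg hr.le]

theorem depth_polarPt (hq : 7 ≤ q) {τ : ℝ} {θ : ℝ} (hτ : τ < radius q θ) :
    depth q (polarPt q τ θ) = τ := by
  rw [polarPt, depth_smul_er hq (by linarith)]
  ring

theorem mem_omega_iff (hq : 7 ≤ q) (x : Plane) : x ∈ omega q ↔ 0 < depth q x := by
  constructor
  · rintro ⟨r, θ, hr, hrF, rfl⟩
    have e : (!₂[r * cos θ, r * sin θ] : Plane) = r • er θ := by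
      ext i; fin_cases i <;> simp [er]
    rw [e]
    rcases hr.eq_or_lt with rfl | hr
    · simp only [depth, zero_smul, norm_zero, sub_zero]
      linarith [(radius_bounds hq (angle 0)).1]
    · rw [depth_smul_er hq hr]
      linarith
  · intro h
    refine ⟨‖x‖, angle x, norm_nonneg x, by rw [depth] at h; linarith, ?_⟩
    conv_lhs => rw [← norm_smul_er_angle x]
    ext i; fin_cases i <;> simp [er]

theorem contDiffAt_depth (hq : 7 ≤ q) {x : Plane} (hx : x ≠ 0) : ContDiffAt ℝ 1 (depth q) x :=
  (contDiffAt_comp_angle (contDiff_radius hq) (radius_periodic hq) hx).sub (contDiffAt_norm ℝ hx)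

/-- The differential of the depth function. -/
noncomputable def dDepth (q : ℕ) (x : Plane) : Plane →L[ℝ] ℝ :=
  sepFun q (angle x) • dAngle x - ‖x‖⁻¹ • innerSL ℝ x

theorem hasFDerivAt_depth (hq : 7 ≤ q) {x : Plane} (hx : x ≠ 0) :
    HasFDerivAt (depth q) (dDepth q x) x :=
  (hasFDerivAt_comp_angle (hasDerivAt_radius hq) (radius_periodic hq) sepFun_periodic hx).sub
    (hasFDerivAt_norm hx)

theorem dDepth_smul_er {r : ℝ} (hr : 0 < r) (θ : ℝ) (w : Plane) :
    dDepth q (r • er θ) w = sepFun q θ / r * (w 1 * cos θ - w 0 * sin θ) -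
      (w 0 * cos θ + w 1 * sin θ) := by
  have h1 : ‖r • er θ‖ = r := by
    rw [norm_smul, norm_er, mul_one, Real.norm_of_nonneg hr.le]
  simp only [dDepth, comp_angle_smul_er sepFun_periodic hr, sub_apply,
    smul_apply, dAngle_smul_er hr, h1, innerSL_apply_apply, inner_plane]
  simp only [PiLp.smul_apply, er_zero, er_one, smul_eq_mul]
  field_simp

theorem ball_subset_omega (hq : 7 ≤ q) : Metric.ball (0 : Plane) (2 / 5) ⊆ omega q := by
  intro x hx
  rw [mem_ball_zero_iff] at hx
  rw [mem_omega_iff hq, depth]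
  linarith [(radius_bounds hq (angle x)).1]

theorem omega_subset_ball (hq : 7 ≤ q) : omega q ⊆ Metric.ball (0 : Plane) (8 / 5) := by
  intro x hx
  rw [mem_omega_iff hq, depth] at hx
  rw [mem_ball_zero_iff]
  linarith [(radius_bounds hq (angle x)).2]

theorem isOpen_omega (hq : 7 ≤ q) : IsOpen (omega q) := by
  rw [isOpen_iff_mem_nhds]
  intro x hx
  rcases eq_or_ne x 0 with rfl | h0
  · exact Filter.mem_of_superset (Metric.ball_mem_nhds _ (by norm_num)) (ball_subset_omega hq)
  · rw [mem_omega_iff hq] at hx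
    filter_upwards [(contDiffAt_depth hq h0).continuousAt.eventually (lt_mem_nhds hx)] with y hy
    exact (mem_omega_iff hq y).2 hy

theorem zero_mem_omega (hq : 7 ≤ q) : (0 : Plane) ∈ omega q :=
  ball_subset_omega hq (Metric.mem_ball_self (by norm_num))

theorem smul_mem_omega (hq : 7 ≤ q) {x : Plane} (hx : x ∈ omega q) {t : ℝ} (ht0 : 0 ≤ t)
    (ht1 : t ≤ 1) : t • x ∈ omega q := by
  rcases ht0.eq_or_lt with rfl | ht0
  · rw [zero_smul]; exact zero_mem_omega hq
  rcases eq_or_ne x 0 with rfl | h0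
  · rwa [smul_zero]
  have hpos : 0 < ‖x‖ := norm_pos_iff.2 h0
  rw [mem_omega_iff hq] at hx ⊢
  have e : t • x = (t * ‖x‖) • er (angle x) := by rw [mul_smul, norm_smul_er_angle]
  rw [e, depth_smul_er hq (by positivity)]
  rw [depth] at hx
  nlinarith

theorem isBoundedC1Domain_omega (hq : 7 ≤ q) : IsBoundedC1Domain (omega q) where
  isOpen := isOpen_omega hq
  isConnected := by
    refine (StarConvex.isPathConnected (a := (0 : Plane)) ?_ (zero_mem_omega hq)).isConnected
    rw [starConvex_zero_iff]
    intro x hx t ht0 ht1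
    exact smul_mem_omega hq hx ht0 ht1
  isBounded := Metric.isBounded_ball.subset (omega_subset_ball hq)
  boundary := by
    intro x₀ hx₀
    have h0 : ∀ x ∈ ({0}ᶜ : Set Plane), HasFDerivAt (fun x => - depth q x) (- dDepth q x) x :=
      fun x hx => (hasFDerivAt_depth hq hx).neg
    -- The negative depth is a defining function away from the origin; its radial derivative equals
    -- 1.
    refine ⟨{0}ᶜ, fun x => - depth q x, isOpen_compl_singleton, ?_, ?_, ?_, ?_⟩
    · rintro rfl
      rw [(isOpen_omega hq).frontier_eq] at hx₀
      exact hx₀.2 (zero_mem_omega hq)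
    · intro x hx
      exact (contDiffAt_depth hq hx).neg.contDiffWithinAt
    · intro x hx he
      rw [(h0 x hx).fderiv] at he
      have h1 := congrArg (fun L : Plane →L[ℝ] ℝ => L (er (angle x))) he
      simp only [neg_apply, zero_apply] at h1
      rw [← norm_smul_er_angle x, dDepth_smul_er (norm_pos_iff.2 hx)] at h1
      have h2 := sin_sq_add_cos_sq (angle x)
      simp only [norm_smul_er_angle, er_zero, er_one] at h1
      rw [show sin (angle x) * cos (angle x) - cos (angle x) * sin (angle x) = 0 by ring] at h1
      nlinarith
    · ext x
      rw [mem_inter_iff, mem_omega_iff hq]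
      simp only [mem_ofPred_eq, Left.neg_neg_iff]
      tauto

theorem ne_zero_of_depth_lt (hq : 7 ≤ q) {x : Plane} (hx : depth q x < 2 / 5) : x ≠ 0 := by
  rintro rfl
  rw [depth, norm_zero] at hx
  linarith [(radius_bounds hq (angle 0)).1]

theorem isOpen_strip (hq : 7 ≤ q) {h : ℝ} (hh : h ≤ 2 / 5) : IsOpen (strip q h) := by
  rw [isOpen_iff_mem_nhds]
  rintro x ⟨hx1, hx2⟩
  have hc := (contDiffAt_depth hq (ne_zero_of_depth_lt hq (hx2.trans_le hh))).continuousAt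
  filter_upwards [hc.eventually (lt_mem_nhds hx1), hc.eventually (gt_mem_nhds hx2)] with y hy hy2
  exact ⟨hy, hy2⟩

theorem strip_subset_omega (hq : 7 ≤ q) (h : ℝ) : strip q h ⊆ omega q :=
  fun x hx => (mem_omega_iff hq x).2 hx.1

theorem polarPt_mem_strip (hq : 7 ≤ q) {h τ : ℝ} (hh : h ≤ 2 / 5) (hτ : τ ∈ Ioo 0 h) (θ : ℝ) :
    polarPt q τ θ ∈ strip q h := by
  have := (radius_bounds hq θ).1
  rw [strip, mem_ofPred_eq, depth_polarPt hq (by linarith [hτ.2])]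
  exact hτ

theorem polarPt_periodic (hq : 7 ≤ q) (τ : ℝ) : Function.Periodic (polarPt q τ) (2 * π) := by
  intro θ
  simp only [polarPt, radius_periodic hq θ, er_periodic θ]

theorem continuous_polarPt (hq : 7 ≤ q) :
    Continuous (fun p : ℝ × ℝ => polarPt q p.1 p.2) := by
  have h1 := continuous_radius hq
  have h2 := contDiff_er.continuous
  unfold polarPt
  fun_prop

theorem norm_er_sub_le (θ θ' : ℝ) : ‖er θ - er θ'‖ ≤ 2 * |θ - θ'| := by
  have hs := abs_sin_sub_sin_le θ θ'
  have hc := abs_sin_sub_sin_le (π / 2 - θ) (π / 2 - θ')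
  rw [sin_pi_div_two_sub, sin_pi_div_two_sub,
    show π / 2 - θ - (π / 2 - θ') = -(θ - θ') by ring, abs_neg] at hc
  rw [EuclideanSpace.norm_eq, Fin.sum_univ_two]
  refine Real.sqrt_le_iff.2 ⟨by positivity, ?_⟩
  simp only [PiLp.sub_apply, er_zero, er_one, Real.norm_eq_abs]
  have h1 : |cos θ - cos θ'| ^ 2 ≤ |θ - θ'| ^ 2 := by gcongr
  have h2 : |sin θ - sin θ'| ^ 2 ≤ |θ - θ'| ^ 2 := by gcongr
  nlinarith [sq_nonneg |θ - θ'|]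

/-- The angular constant is 1/6 from the Lipschitz bound for F plus (8/5)·2 from the rotation of the
unit vector, which is less than 4. -/
theorem norm_polarPt_sub_le (hq : 7 ≤ q) {τ τ' θ θ' : ℝ} (hτ : τ' ∈ Icc 0 (2 / 5)) :
    ‖polarPt q τ θ - polarPt q τ' θ'‖ ≤ |τ - τ'| + 4 * |θ - θ'| := by
  have e : polarPt q τ θ - polarPt q τ' θ' =
      ((radius q θ - radius q θ') - (τ - τ')) • er θ + (radius q θ' - τ') • (er θ - er θ') := by
    simp only [polarPt]
    module
  rw [e]
  refine (norm_add_le _ _).trans ?_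
  rw [norm_smul, norm_smul, norm_er, mul_one]
  have h1 := lipschitz_radius hq θ θ'
  have h2 := radius_bounds hq θ'
  have h3 := norm_er_sub_le θ θ'
  have h4 : ‖radius q θ' - τ'‖ ≤ 8 / 5 := by
    rw [Real.norm_eq_abs, abs_le]
    constructor <;> linarith [hτ.1, hτ.2]
  have h5 := abs_sub (radius q θ - radius q θ') (τ - τ')
  rw [Real.norm_eq_abs]
  have h6 : ‖radius q θ' - τ'‖ * ‖er θ - er θ'‖ ≤ 8 / 5 * (2 * |θ - θ'|) := by gcongr
  have := abs_nonneg (θ - θ')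
  linarith

/-- Polar coordinates with the substitution r = F(θ) - τ on each ray; the density r becomes F(θ) -
τ. -/
theorem lintegral_strip (hq : 7 ≤ q) {h : ℝ} (hh : h ≤ 2 / 5) {φ : Plane → ℝ≥0∞}
    (hφ : Measurable φ) :
    ∫⁻ x in strip q h, φ x = ∫⁻ θ in Ioo (-π) π, ∫⁻ τ in Ioo 0 h,
      ENNReal.ofReal (radius q θ - τ) * φ (polarPt q τ θ) := by
  have hm := (isOpen_strip hq hh).measurableSet
  rw [← lintegral_indicator hm, lintegral_polar (hφ.indicator hm)]
  refine lintegral_congr fun θ => ?_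
  rw [← lintegral_indicator measurableSet_Ioi, ← lintegral_indicator measurableSet_Ioo,
    ← lintegral_sub_left_eq_self _ (radius q θ)]
  refine lintegral_congr fun τ => ?_
  have hF := (radius_bounds hq θ).1
  simp only [indicator, mem_Ioi, sub_pos]
  by_cases h1 : τ < radius q θ
  · have h2 : (radius q θ - τ) • er θ ∈ strip q h ↔ τ ∈ Ioo 0 h := by
      rw [strip, mem_ofPred_eq, depth_smul_er hq (by linarith), sub_sub_cancel]
      rfl
    simp only [h1, if_true, h2]
    split_ifs <;> simp [polarPt]
  · rw [if_neg h1, if_neg]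
    rintro ⟨-, h3⟩
    linarith

/-- The density F(θ) - τ is at least 2/5 - 1/5 = 1/5 on the strip. -/
theorem lintegral_polarPt_le (hq : 7 ≤ q) {h : ℝ} (hh : h ≤ 1 / 5) {φ : Plane → ℝ≥0∞}
    (hφ : Measurable φ) :
    ∫⁻ θ in Ioo (-π) π, ∫⁻ τ in Ioo 0 h, φ (polarPt q τ θ) ≤ 5 * ∫⁻ x in strip q h, φ x := by
  rw [lintegral_strip hq (by linarith) hφ, ← lintegral_const_mul']
  swap
  · simp
  refine lintegral_mono fun θ => ?_
  rw [← lintegral_const_mul' _ _ (by simp)]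
  refine setLIntegral_mono' measurableSet_Ioo fun τ hτ => ?_
  have hF := (radius_bounds hq θ).1
  have h1 : (1 : ℝ≥0∞) ≤ 5 * ENNReal.ofReal (radius q θ - τ) := by
    have : (5 : ℝ≥0∞) = ENNReal.ofReal 5 := by simp
    rw [this, ← ENNReal.ofReal_mul (by norm_num), ← ENNReal.ofReal_one]
    exact ENNReal.ofReal_le_ofReal (by linarith [hτ.2])
  rw [← mul_assoc]
  exact le_mul_of_one_le_left' h1

theorem lintegral_strip_le (hq : 7 ≤ q) {h : ℝ} (hh : h ≤ 1 / 5) {φ : Plane → ℝ≥0∞}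
    (hφ : Measurable φ) :
    ∫⁻ x in strip q h, φ x ≤ 2 * ∫⁻ θ in Ioo (-π) π, ∫⁻ τ in Ioo 0 h, φ (polarPt q τ θ) := by
  rw [lintegral_strip hq (by linarith) hφ, ← lintegral_const_mul']
  swap
  · simp
  refine lintegral_mono fun θ => ?_
  rw [← lintegral_const_mul' _ _ (by simp)]
  refine setLIntegral_mono' measurableSet_Ioo fun τ hτ => ?_
  have hF := (radius_bounds hq θ).2
  gcongr
  have : (2 : ℝ≥0∞) = ENNReal.ofReal 2 := by simp
  rw [this]
  exact ENNReal.ofReal_le_ofReal (by linarith [hτ.1])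

/-- Integrals over a period do not change under translations. -/
theorem lintegral_period_shift {g : ℝ → ℝ≥0∞} (hg : Function.Periodic g (2 * π)) (s : ℝ) :
    ∫⁻ θ in Ioo (-π) π, g (θ + s) = ∫⁻ θ in Ioo (-π) π, g θ := by
  rw [restrict_Ioo_eq_restrict_Ioc]
  have h1 : ∫⁻ θ in Ioc (-π) π, g (θ + s) = ∫⁻ θ in Ioc (-π + s) (π + s), g θ := by
    have := (measurePreserving_add_right volume s).setLIntegral_comp_emb
      (measurableEmbedding_addRight s) g (Ioc (-π) π)
    rw [this, image_add_const_Ioc]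
  have h2 : ∀ t, IsAddFundamentalDomain (AddSubgroup.zmultiples (2 * π)) (Ioc t (t + 2 * π))
    volume := fun t => isAddFundamentalDomain_Ioc two_pi_pos t
  rw [h1]
  have h3 := (h2 (-π + s)).setLIntegral_eq (h2 (-π)) g hg.map_vadd_zmultiples
  rw [show -π + s + 2 * π = π + s by ring, show -π + 2 * π = π by ring] at h3
  exact h3

end

attribute [irreducible] polarPt

/-! ### Mollification -/

open Filter Topology in
/-- A sequence of bump functions shrinking to the origin. -/
noncomputable def bump (n : ℕ) : ContDiffBump (0 : Plane) where
  rIn := 1 / ((n : ℝ) + 1)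
  rOut := 2 / ((n : ℝ) + 1)
  rIn_pos := by positivity
  rIn_lt_rOut := by gcongr; norm_num

/-- The normalized mollifying kernels. -/
noncomputable def molKernel (n : ℕ) : Plane → ℝ := (bump n).normed volume

/-- Mollification. -/
noncomputable def mollify (n : ℕ) (g : Plane → ℝ) : Plane → ℝ :=
  convolution g (molKernel n) (ContinuousLinearMap.mul ℝ ℝ) volume

theorem tendsto_rOut : Filter.Tendsto (fun n => (bump n).rOut) Filter.atTop (nhds 0) :=
  tendsto_const_nhds.div_atTop
    (Filter.tendsto_atTop_add_const_right _ _ tendsto_natCast_atTop_atTop)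

theorem mollify_apply (n : ℕ) (g : Plane → ℝ) (x : Plane) :
    mollify n g x = ∫ t, g t * molKernel n (x - t) := rfl

theorem mollify_apply' (n : ℕ) (g : Plane → ℝ) (x : Plane) :
    mollify n g x = ∫ t, molKernel n t * g (x - t) := by
  rw [mollify, convolution_eq_swap]
  simp only [ContinuousLinearMap.mul_apply', mul_comm]

theorem mollify_eq (n : ℕ) (g : Plane → ℝ) :
    mollify n g = convolution ((bump n).normed volume) g (ContinuousLinearMap.lsmul ℝ ℝ) volume := by
  ext x
  rw [mollify_apply']
  rfl

theorem contDiff_molKernel (n : ℕ) : ContDiff ℝ ∞ (molKernel n) := (bump n).contDiff_normed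

theorem hasCompactSupport_molKernel (n : ℕ) : HasCompactSupport (molKernel n) :=
  (bump n).hasCompactSupport_normed

theorem molKernel_nonneg (n : ℕ) (x : Plane) : 0 ≤ molKernel n x := (bump n).nonneg_normed x

theorem contDiff_mollify (n : ℕ) {g : Plane → ℝ} (hg : LocallyIntegrable g) :
    ContDiff ℝ ∞ (mollify n g) :=
  (hasCompactSupport_molKernel n).contDiff_convolution_right _ hg (contDiff_molKernel n)

theorem fderiv_mollify (n : ℕ) {g : Plane → ℝ} (hg : LocallyIntegrable g) (x v : Plane) :
    fderiv ℝ (mollify n g) x v = ∫ t, g t * fderiv ℝ (molKernel n) (x - t) v := by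
  have h1 : ContDiff ℝ 1 (molKernel n) := (contDiff_molKernel n).of_le (by norm_cast)
  have h := ((hasCompactSupport_molKernel n).hasFDerivAt_convolution_right
    (ContinuousLinearMap.mul ℝ ℝ) hg h1 x).fderiv
  rw [mollify, h, convolution_precompR_apply _ hg ((hasCompactSupport_molKernel n).fderiv ℝ)
    (h1.continuous_fderiv one_ne_zero)]
  rfl

theorem ae_tendsto_mollify {g : Plane → ℝ} (hg : LocallyIntegrable g) :
    ∀ᵐ x, Filter.Tendsto (fun n => mollify n g x) Filter.atTop (nhds (g x)) := by
  simp only [mollify_eq]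
  refine ContDiffBump.ae_convolution_tendsto_right_of_locallyIntegrable (K := 2) tendsto_rOut ?_ hg
  refine .of_forall fun n => ?_
  simp only [bump]
  apply le_of_eq; ring

theorem tendsto_mollify_of_continuous {g : Plane → ℝ} (hg : Continuous g) (x : Plane) :
    Filter.Tendsto (fun n => mollify n g x) Filter.atTop (nhds (g x)) := by
  simp only [mollify_eq]
  exact ContDiffBump.convolution_tendsto_right_of_continuous tendsto_rOut hg x

/-- The derivative of the mollification is the mollification of the weak derivative. -/
theorem fderiv_mollify_of_isWeakPartial {Ω : Set Plane} (hΩ : MeasurableSet Ω) {i : Fin 2}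
    {u w : Plane → ℝ} (h : IsWeakPartial Ω i u w) (hu : IntegrableOn u Ω) (n : ℕ) {x : Plane}
    (hx : Metric.closedBall x (bump n).rOut ⊆ Ω) :
    fderiv ℝ (mollify n (Ω.indicator u)) x (EuclideanSpace.single i 1) =
      mollify n (Ω.indicator w) x := by
  have hui : LocallyIntegrable (Ω.indicator u) := (hu.integrable_indicator hΩ).locallyIntegrable
  rw [fderiv_mollify n hui, mollify_apply]
  have hts : tsupport (fun y => molKernel n (x - y)) ⊆ Metric.closedBall x (bump n).rOut := by
    refine closure_minimal (fun y hy => ?_) Metric.isClosed_closedBall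
    have hs : x - y ∈ Function.support ((bump n).normed volume) := hy
    rw [ContDiffBump.support_normed_eq, mem_ball_zero_iff, ← dist_eq_norm, dist_comm] at hs
    exact Metric.mem_closedBall.2 hs.le
  -- The translated and reflected kernel is itself admissible in the definition of the weak
  -- derivative, since its support lies in a ball contained in `Ω`.
  have htest : IsTest Ω (fun y => molKernel n (x - y)) := by
    refine ⟨(contDiff_molKernel n).comp (contDiff_const.sub contDiff_id), ?_, hts.trans hx⟩
    exact HasCompactSupport.of_support_subset_isCompact (isCompact_closedBall x (bump n).rOut)
      (subset_closure.trans hts)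
  have hpd : ∀ y, partialDeriv i (fun y => molKernel n (x - y)) y =
      - fderiv ℝ (molKernel n) (x - y) (EuclideanSpace.single i 1) := by
    intro y
    have h1 := ((contDiff_molKernel n).differentiable (by simp) (x - y)).hasFDerivAt.comp y
      ((hasFDerivAt_id y).const_sub x)
    have h2 : HasFDerivAt (fun y => molKernel n (x - y)) _ y := h1
    rw [partialDeriv, h2.fderiv]
    simp
  have he := h.integral_eq _ htest
  simp only [hpd, smul_eq_mul] at he
  rw [← integral_indicator hΩ, ← integral_indicator hΩ] at he
  have e1 : ∀ t, Ω.indicator u t * fderiv ℝ (molKernel n) (x - t) (EuclideanSpace.single i 1) =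
      - Ω.indicator (fun t => - fderiv ℝ (molKernel n) (x - t) (EuclideanSpace.single i 1) * u t) t := by
    intro t
    by_cases ht : t ∈ Ω <;> simp [ht, mul_comm]
  have e2 : ∀ t, Ω.indicator w t * molKernel n (x - t) =
      Ω.indicator (fun t => molKernel n (x - t) * w t) t := by
    intro t
    by_cases ht : t ∈ Ω <;> simp [ht, mul_comm]
  simp only [e1, e2, integral_neg]
  rw [he, neg_neg]

/-- The probability measure defined by the mollifying kernel. -/
noncomputable def molMeasure (n : ℕ) : Measure Plane :=
  volume.withDensity fun t => ENNReal.ofReal (molKernel n t)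

instance (n : ℕ) : IsProbabilityMeasure (molMeasure n) := by
  constructor
  rw [molMeasure, withDensity_apply _ MeasurableSet.univ, Measure.restrict_univ,
    ← ofReal_integral_eq_lintegral_ofReal (f := molKernel n) (bump n).integrable_normed
      (.of_forall (molKernel_nonneg n))]
  have : ∫ x, molKernel n x = 1 := (bump n).integral_normed
  rw [this, ENNReal.ofReal_one]

theorem molMeasure_ball (n : ℕ) : ∀ᵐ t ∂(molMeasure n), t ∈ Metric.ball (0 : Plane) (bump n).rOut := by
  rw [molMeasure, ae_withDensity_iff (contDiff_molKernel n).continuous.measurable.ennreal_ofReal]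
  refine .of_forall fun t ht => ?_
  rw [← (bump n).support_normed_eq (μ := volume)]
  intro h0
  exact ht (by simp [molKernel, h0])

theorem enorm_mollify_le (n : ℕ) {g : Plane → ℝ} (hg : Measurable g) (x : Plane) :
    ‖mollify n g x‖ₑ ≤ ∫⁻ t, ‖g (x - t)‖ₑ ∂(molMeasure n) := by
  have hgx : Measurable fun t => ‖g (x - t)‖ₑ :=
    (hg.comp (measurable_const.sub measurable_id)).enorm
  rw [mollify_apply', molMeasure, lintegral_withDensity_eq_lintegral_mul _
    (contDiff_molKernel n).continuous.measurable.ennreal_ofReal hgx]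
  refine (enorm_integral_le_lintegral_enorm _).trans (lintegral_mono fun t => ?_)
  simp only [enorm_mul, Pi.mul_apply]
  rw [Real.enorm_of_nonneg (molKernel_nonneg n t)]

/-- Jensen's inequality, read off from the monotonicity of L^p norms in p. -/
theorem lintegral_rpow_le_of_isProbabilityMeasure {α : Type*} [MeasurableSpace α] {μ : Measure α}
    [IsProbabilityMeasure μ] {p : ℝ} (hp : 1 ≤ p) {F : α → ℝ} (hF : Measurable F) :
    (∫⁻ a, ‖F a‖ₑ ∂μ) ^ p ≤ ∫⁻ a, ‖F a‖ₑ ^ p ∂μ := by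
  have hp0 : 0 < p := by linarith
  have h := eLpNorm_le_eLpNorm_of_exponent_le (μ := μ) (p := 1) (q := ENNReal.ofReal p)
    (by simpa using hp) hF.aestronglyMeasurable
  rw [eLpNorm_one_eq_lintegral_enorm, eLpNorm_eq_lintegral_rpow_enorm_toReal (by simpa using hp0)
    (by simp), ENNReal.toReal_ofReal hp0.le] at h
  have h2 := ENNReal.rpow_le_rpow h hp0.le
  rwa [← ENNReal.rpow_mul, one_div_mul_cancel hp0.ne', ENNReal.rpow_one] at h2

/-- Jensen's inequality for the probability measure `molMeasure n`, then Fubini: translating `A` by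
a point of the support of the kernel stays inside `U`. -/
theorem lintegral_mollify_le (n : ℕ) {g : Plane → ℝ} (hg : Measurable g) {p : ℝ} (hp : 1 ≤ p)
    {A U : Set Plane} (hA : MeasurableSet A) (hU : MeasurableSet U)
    (hAU : ∀ x ∈ A, Metric.closedBall x (bump n).rOut ⊆ U) :
    ∫⁻ x in A, ‖mollify n g x‖ₑ ^ p ≤ ∫⁻ x in U, ‖g x‖ₑ ^ p := by
  have hp0 : 0 ≤ p := by linarith
  have hm : Measurable fun z : Plane × Plane => ‖g (z.1 - z.2)‖ₑ ^ p :=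
    ((hg.comp (measurable_fst.sub measurable_snd)).enorm).pow_const p
  calc ∫⁻ x in A, ‖mollify n g x‖ₑ ^ p
      ≤ ∫⁻ x in A, ∫⁻ t, ‖g (x - t)‖ₑ ^ p ∂(molMeasure n) := by
        refine lintegral_mono fun x => ?_
        refine (ENNReal.rpow_le_rpow (enorm_mollify_le n hg x) hp0).trans ?_
        exact lintegral_rpow_le_of_isProbabilityMeasure hp
          (hg.comp (measurable_const.sub measurable_id))
    _ = ∫⁻ t, (∫⁻ x in A, ‖g (x - t)‖ₑ ^ p) ∂(molMeasure n) :=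
        lintegral_lintegral_swap hm.aemeasurable
    _ ≤ ∫⁻ _t, (∫⁻ x in U, ‖g x‖ₑ ^ p) ∂(molMeasure n) := by
        refine lintegral_mono_ae ?_
        filter_upwards [molMeasure_ball n] with t ht
        rw [← lintegral_indicator hA, ← lintegral_indicator hU,
          ← lintegral_sub_right_eq_self (U.indicator fun x => ‖g x‖ₑ ^ p) t]
        refine lintegral_mono fun x => ?_
        by_cases hx : x ∈ A
        · have : x - t ∈ U := hAU x hx (by
            rw [Metric.mem_closedBall, dist_eq_norm]
            rw [mem_ball_zero_iff] at ht
            simpa using ht.le)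
          simp [hx, this]
        · simp [hx]
    _ = ∫⁻ x in U, ‖g x‖ₑ ^ p := by simp

theorem tsupport_mollify_subset (n : ℕ) (Φ : Plane → ℝ) :
    tsupport (mollify n Φ) ⊆ Metric.cthickening (bump n).rOut (tsupport Φ) := by
  refine closure_minimal ?_ Metric.isClosed_cthickening
  refine (support_convolution_subset _).trans ?_
  rintro _ ⟨a, ha, b, hb, rfl⟩
  have hb' : b ∈ Function.support ((bump n).normed volume) := hb
  rw [ContDiffBump.support_normed_eq, mem_ball_zero_iff] at hb'
  refine Metric.mem_cthickening_of_dist_le _ a _ _ (subset_tsupport _ ha) ?_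
  simpa using hb'.le

theorem fderiv_mollify_of_contDiff (n : ℕ) {Φ : Plane → ℝ} (hΦ : ContDiff ℝ 1 Φ)
    (hc : HasCompactSupport Φ) (x v : Plane) :
    fderiv ℝ (mollify n Φ) x v = mollify n (fun y => fderiv ℝ Φ y v) x := by
  have hk : LocallyIntegrable (molKernel n) :=
    (contDiff_molKernel n).continuous.locallyIntegrable
  have h := (hc.hasFDerivAt_convolution_right (ContinuousLinearMap.lsmul ℝ ℝ) hk hΦ x).fderiv
  rw [mollify_eq]
  rw [show (bump n).normed volume = molKernel n from rfl, h, convolution_precompR_apply _ hk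
    (hc.fderiv ℝ) (hΦ.continuous_fderiv one_ne_zero), mollify_eq]
  rfl

theorem abs_mollify_le (n : ℕ) {g : Plane → ℝ} {M : ℝ} (hM : ∀ x, |g x| ≤ M) (x : Plane) :
    |mollify n g x| ≤ M := by
  rw [mollify_apply', ← Real.norm_eq_abs]
  have h1 : ∫ t, molKernel n t * M = M := by
    have : ∫ x, molKernel n x = 1 := (bump n).integral_normed
    rw [integral_mul_const, this, one_mul]
  refine (norm_integral_le_of_norm_le ((bump n).integrable_normed.mul_const M)
    (.of_forall fun t => ?_)).trans_eq h1
  rw [norm_mul, Real.norm_of_nonneg (molKernel_nonneg n t)]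
  exact mul_le_mul_of_nonneg_left (hM _) (molKernel_nonneg n t)

/-- An identity tested with smooth functions holds for all compactly supported `C¹` functions. -/
theorem integral_eq_of_contDiff_one {Ω : Set Plane} (hΩ : IsOpen Ω) {W : Fin 2 → Plane → ℝ}
    {l : Plane → ℝ} (hW : ∀ i, IntegrableOn (W i) Ω) (hl : IntegrableOn l Ω)
    (h : ∀ φ : Plane → ℝ, IsTest Ω φ →
      ∫ x in Ω, ∑ i, W i x * partialDeriv i φ x = ∫ x in Ω, l x * φ x)
    {Φ : Plane → ℝ} (hΦ : ContDiff ℝ 1 Φ) (hc : HasCompactSupport Φ) (hs : tsupport Φ ⊆ Ω) :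
    ∫ x in Ω, ∑ i, W i x * partialDeriv i Φ x = ∫ x in Ω, l x * Φ x := by
  obtain ⟨δ, hδ, hδΩ⟩ := IsCompact.exists_cthickening_subset_open hc hΩ hs
  have hev : ∀ᶠ n in Filter.atTop, IsTest Ω (mollify n Φ) := by
    filter_upwards [tendsto_rOut.eventually (gt_mem_nhds hδ)] with n hn
    have h1 := tsupport_mollify_subset n Φ
    refine ⟨contDiff_mollify n hΦ.continuous.locallyIntegrable, ?_, ?_⟩
    · exact HasCompactSupport.of_support_subset_isCompact
        (hc.cthickening (r := (bump n).rOut)) ((subset_tsupport _).trans h1)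
    · exact h1.trans ((Metric.cthickening_mono hn.le _).trans hδΩ)
  obtain ⟨M, hM⟩ := hc.exists_bound_of_continuous hΦ.continuous
  have hcd : ∀ i : Fin 2, Continuous fun y => fderiv ℝ Φ y (EuclideanSpace.single i 1) := fun i =>
    (hΦ.continuous_fderiv one_ne_zero).clm_apply continuous_const
  have hbd : ∀ i : Fin 2, ∃ C, ∀ x, ‖fderiv ℝ Φ x (EuclideanSpace.single i 1)‖ ≤ C := fun i =>
    (HasCompactSupport.exists_bound_of_continuous (hc.fderiv_apply (𝕜 := ℝ) _) (hcd i))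
  choose C hC using hbd
  have hpd : ∀ n i x, partialDeriv i (mollify n Φ) x =
      mollify n (fun y => fderiv ℝ Φ y (EuclideanSpace.single i 1)) x := fun n i x =>
    fderiv_mollify_of_contDiff n hΦ hc x _
  have hmc : ∀ n (g : Plane → ℝ), Continuous g → Continuous (mollify n g) := fun n g hg =>
    (contDiff_mollify n hg.locallyIntegrable).continuous
  have t1 : Filter.Tendsto (fun n => ∫ x in Ω, ∑ i, W i x * partialDeriv i (mollify n Φ) x)
      Filter.atTop (nhds (∫ x in Ω, ∑ i, W i x * partialDeriv i Φ x)) := by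
    refine tendsto_integral_of_dominated_convergence (fun x => ∑ i, ‖W i x‖ * C i) ?_ ?_ ?_ ?_
    · intro n
      refine Finset.aestronglyMeasurable_fun_sum _ fun i _ => (hW i).aestronglyMeasurable.mul ?_
      rw [funext (hpd n i)]
      exact (hmc n _ (hcd i)).aestronglyMeasurable
    · exact integrable_finsetSum _ fun i _ => (hW i).norm.mul_const _
    · refine fun n => .of_forall fun x => (norm_sum_le _ _).trans (Finset.sum_le_sum fun i _ => ?_)
      rw [norm_mul, hpd]
      gcongr
      exact abs_mollify_le n (hC i) x
    · refine .of_forall fun x => tendsto_finsetSum _ fun i _ => Filter.Tendsto.const_mul _ ?_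
      simp only [hpd]
      exact tendsto_mollify_of_continuous (hcd i) x
  have t2 : Filter.Tendsto (fun n => ∫ x in Ω, l x * mollify n Φ x)
      Filter.atTop (nhds (∫ x in Ω, l x * Φ x)) := by
    refine tendsto_integral_of_dominated_convergence (fun x => ‖l x‖ * M) ?_ (hl.norm.mul_const _)
      ?_ ?_
    · exact fun n => hl.aestronglyMeasurable.mul (hmc n _ hΦ.continuous).aestronglyMeasurable
    · refine fun n => .of_forall fun x => ?_
      rw [norm_mul]
      gcongr
      exact abs_mollify_le n hM x
    · exact .of_forall fun x => (tendsto_mollify_of_continuous hΦ.continuous x).const_mul _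
  refine tendsto_nhds_unique (t1.congr' ?_) t2
  filter_upwards [hev] with n hn using h _ hn

/-! ### Oscillation near the boundary -/

section Oscillation

variable {q : ℕ}

/-- The set of parameters `((θ, s), (τ, τ'))` of pairs of points `(τ, θ)`, `(τ', θ + s)`. -/
def box (S T T' : Set ℝ) : Set ((ℝ × ℝ) × (ℝ × ℝ)) := (Ioo (-π) π ×ˢ S) ×ˢ (T ×ˢ T')

theorem lintegral_box (S T T' : Set ℝ) {G : (ℝ × ℝ) × (ℝ × ℝ) → ℝ≥0∞} (hG : Measurable G) :
    ∫⁻ p in box S T T', G p =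
      ∫⁻ θ in Ioo (-π) π, ∫⁻ s in S, ∫⁻ τ in T, ∫⁻ τ' in T', G ((θ, s), (τ, τ')) := by
  rw [box, Measure.volume_eq_prod, ← Measure.prod_restrict, lintegral_prod _ hG.aemeasurable]
  have e : ∀ a : ℝ × ℝ, ∫⁻ b, G (a, b) ∂((volume.restrict (T ×ˢ T') : Measure (ℝ × ℝ))) =
      ∫⁻ τ in T, ∫⁻ τ' in T', G (a, (τ, τ')) := by
    intro a
    rw [Measure.volume_eq_prod, ← Measure.prod_restrict, lintegral_prod]
    exact (hG.comp measurable_prodMk_left).aemeasurable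
  rw [Measure.volume_eq_prod, ← Measure.prod_restrict, lintegral_prod]
  · simp only [e, Measure.volume_eq_prod] at *
  · exact hG.lintegral_prod_right'.aemeasurable

theorem measurable_polarPt_swap (hq : 7 ≤ q) :
    Measurable fun p : ℝ × ℝ => polarPt q p.2 p.1 :=
  ((continuous_polarPt hq).comp (by fun_prop : Continuous fun p : ℝ × ℝ => (p.2, p.1))).measurable

theorem measurable_polarPt_fst (hq : 7 ≤ q) :
    Measurable fun p : (ℝ × ℝ) × (ℝ × ℝ) => polarPt q p.2.1 p.1.1 :=
  ((continuous_polarPt hq).comp (by fun_prop :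
    Continuous fun p : (ℝ × ℝ) × (ℝ × ℝ) => (p.2.1, p.1.1))).measurable

theorem measurable_polarPt_snd (hq : 7 ≤ q) :
    Measurable fun p : (ℝ × ℝ) × (ℝ × ℝ) => polarPt q p.2.2 (p.1.1 + p.1.2) :=
  ((continuous_polarPt hq).comp (by fun_prop :
    Continuous fun p : (ℝ × ℝ) × (ℝ × ℝ) => (p.2.2, p.1.1 + p.1.2))).measurable

theorem lintegral_box_fst (hq : 7 ≤ q) (S T T' : Set ℝ) {φ : Plane → ℝ≥0∞} (hφ : Measurable φ) :
    ∫⁻ p in box S T T', φ (polarPt q p.2.1 p.1.1) =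
      volume S * volume T' * ∫⁻ θ in Ioo (-π) π, ∫⁻ τ in T, φ (polarPt q τ θ) := by
  rw [lintegral_box _ _ _ (G := fun p => φ (polarPt q p.2.1 p.1.1))
    (hφ.comp (measurable_polarPt_fst hq))]
  have hm : Measurable fun p : ℝ × ℝ => φ (polarPt q p.2 p.1) :=
    hφ.comp (measurable_polarPt_swap hq)
  have h1 : ∀ θ, Measurable fun τ => φ (polarPt q τ θ) := fun θ =>
    hm.comp (measurable_prodMk_left (x := θ))
  set g : ℝ → ℝ≥0∞ := fun θ => ∫⁻ τ in T, φ (polarPt q τ θ) with hg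
  have h2 : Measurable g := hm.lintegral_prod_right'
  have h3 : ∀ θ, ∫⁻ _s in S, ∫⁻ τ in T, ∫⁻ _τ' in T', φ (polarPt q τ θ) =
      volume S * volume T' * g θ := by
    intro θ
    simp only [lintegral_const, Measure.restrict_apply_univ]
    rw [lintegral_mul_const _ (h1 θ)]
    ring
  simp only [h3]
  rw [lintegral_const_mul _ h2]

/-- The second point has angle θ + s, and an integral over a full period in θ does not see the shift
s. -/
theorem lintegral_box_snd (hq : 7 ≤ q) (S T T' : Set ℝ) {φ : Plane → ℝ≥0∞} (hφ : Measurable φ) :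
    ∫⁻ p in box S T T', φ (polarPt q p.2.2 (p.1.1 + p.1.2)) =
      volume S * volume T * ∫⁻ θ in Ioo (-π) π, ∫⁻ τ in T', φ (polarPt q τ θ) := by
  rw [lintegral_box _ _ _ (G := fun p => φ (polarPt q p.2.2 (p.1.1 + p.1.2)))
    (hφ.comp (measurable_polarPt_snd hq))]
  have hm : Measurable fun p : ℝ × ℝ => φ (polarPt q p.2 p.1) :=
    hφ.comp (measurable_polarPt_swap hq)
  set g : ℝ → ℝ≥0∞ := fun θ => ∫⁻ τ in T', φ (polarPt q τ θ) with hg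
  have h2 : Measurable g := hm.lintegral_prod_right'
  have hgp : Function.Periodic g (2 * π) := fun θ => by
    simp only [hg, polarPt_periodic hq _ θ]
  have hgs : Measurable fun p : ℝ × ℝ => g (p.1 + p.2) :=
    h2.comp (measurable_fst.add measurable_snd)
  simp only [lintegral_const, Measure.restrict_apply_univ]
  have e : ∫⁻ θ in Ioo (-π) π, ∫⁻ s in S, g (θ + s) * volume T =
      ∫⁻ s in S, ∫⁻ θ in Ioo (-π) π, g (θ + s) * volume T :=
    lintegral_lintegral_swap (hgs.mul_const _).aemeasurable
  rw [e]
  have h3 : ∀ s, Measurable fun θ => g (θ + s) := fun s => h2.comp (measurable_add_const s)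
  simp only [lintegral_mul_const _ (h3 _), lintegral_period_shift hgp, lintegral_const,
    Measure.restrict_apply_univ]
  ring

/-- The mean oscillation of `z` at scale `h` in the boundary strip of width `h`. -/
noncomputable def osc (q : ℕ) (z : Plane → ℝ) (S T : Set ℝ) : ℝ≥0∞ :=
  ∫⁻ p in box S T T, ‖z (polarPt q p.2.1 p.1.1) - z (polarPt q p.2.2 (p.1.1 + p.1.2))‖ₑ

theorem measurable_osc_integrand (hq : 7 ≤ q) {z : Plane → ℝ} (hz : Measurable z) :
    Measurable fun p : (ℝ × ℝ) × (ℝ × ℝ) =>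
      ‖z (polarPt q p.2.1 p.1.1) - z (polarPt q p.2.2 (p.1.1 + p.1.2))‖ₑ :=
  ((hz.comp (measurable_polarPt_fst hq)).sub (hz.comp (measurable_polarPt_snd hq))).enorm

/-- Decay of the oscillation of order `κ`. -/
def OscBound (q : ℕ) (z : Plane → ℝ) (κ : ℝ) : Prop :=
  ∃ C : ℝ≥0∞, C ≠ ⊤ ∧ ∃ h₀ : ℝ, 0 < h₀ ∧ h₀ ≤ 1 / 10 ∧ ∀ h, 0 < h → h ≤ h₀ →
    osc q z (Ioo 0 (2 * h)) (Ioo 0 h) ≤ C * ENNReal.ofReal (h ^ κ)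

/-- Decay of the integral over the boundary strip of order `κ`. -/
def StripBound (q : ℕ) (z : Plane → ℝ) (κ : ℝ) : Prop :=
  ∃ C : ℝ≥0∞, C ≠ ⊤ ∧ ∃ h₀ : ℝ, 0 < h₀ ∧ h₀ ≤ 1 / 5 ∧ ∀ h, 0 < h → h ≤ h₀ →
    ∫⁻ x in strip q h, ‖z x‖ₑ ≤ C * ENNReal.ofReal (h ^ κ)

/-- Distinguish |a| ≤ M and |a| > M. With M chosen as a power of the scale this takes the place of
Hölder's inequality, and it covers p = 1 as well. -/
theorem enorm_le_add_rpow {M p : ℝ} (hM : 0 < M) (hp : 1 ≤ p) (a : ℝ) :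
    ‖a‖ₑ ≤ ENNReal.ofReal M + ENNReal.ofReal (M ^ (1 - p)) * ‖a‖ₑ ^ p := by
  rw [Real.enorm_eq_ofReal_abs, ENNReal.ofReal_rpow_of_nonneg (abs_nonneg a) (by linarith),
    ← ENNReal.ofReal_mul (by positivity), ← ENNReal.ofReal_add hM.le (by positivity)]
  refine ENNReal.ofReal_le_ofReal ?_
  rcases le_or_gt |a| M with h | h
  · have : 0 ≤ M ^ (1 - p) * |a| ^ p := by positivity
    linarith
  · have ha : 0 < |a| := hM.trans h
    have h1 : |a| = |a| ^ (1 - p) * |a| ^ p := by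
      rw [← rpow_add ha, sub_add_cancel, rpow_one]
    have h2 : |a| ^ (1 - p) ≤ M ^ (1 - p) := rpow_le_rpow_of_nonpos hM h.le (by linarith)
    have h3 : |a| ^ (1 - p) * |a| ^ p ≤ M ^ (1 - p) * |a| ^ p := by gcongr
    linarith

theorem volume_strip_le (hq : 7 ≤ q) {h : ℝ} (hh : h ≤ 1 / 5) :
    volume (strip q h) ≤ ENNReal.ofReal (4 * π * h) := by
  have h1 := lintegral_strip_le hq hh (φ := fun _ => 1) measurable_const
  simp only [lintegral_const, Measure.restrict_apply_univ, one_mul, Real.volume_Ioo] at h1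
  refine h1.trans_eq ?_
  rw [show (2 : ℝ≥0∞) = ENNReal.ofReal 2 by simp, sub_zero, mul_comm (ENNReal.ofReal h),
    ← ENNReal.ofReal_mul (by linarith [pi_pos]), ← ENNReal.ofReal_mul (by norm_num)]
  congr 1; ring

/-- The threshold M = h^(-1/p) balances the area O(h) of the strip against the L^p norm: both
contributions are of order h^(1-1/p). -/
theorem stripBound_of_memLp (hq : 7 ≤ q) {z : Plane → ℝ} {p : ℝ} (hp : 1 < p)
    (hz : MemLp z (ENNReal.ofReal p) (volume.restrict (omega q))) :
    StripBound q z (1 - 1 / p) := by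
  have hp0 : 0 < p := by linarith
  have hfin : ∫⁻ x in omega q, ‖z x‖ₑ ^ p < ⊤ := by
    have := lintegral_rpow_enorm_lt_top_of_eLpNorm_lt_top (by simpa using hp0) (by simp) hz.2
    rwa [ENNReal.toReal_ofReal hp0.le] at this
  refine ⟨ENNReal.ofReal (4 * π) + ∫⁻ x in omega q, ‖z x‖ₑ ^ p,
    (ENNReal.add_lt_top.2 ⟨ENNReal.ofReal_lt_top, hfin⟩).ne, 1 / 5, by norm_num, le_rfl,
    fun h h0 hh => ?_⟩
  have e1 : h * h ^ (-(1 / p)) = h ^ (1 - 1 / p) := by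
    rw [sub_eq_add_neg, rpow_add h0, rpow_one]
  have e2 : (h ^ (-(1 / p))) ^ (1 - p) = h ^ (1 - 1 / p) := by
    rw [← rpow_mul h0.le]
    congr 1
    field_simp
    ring
  calc ∫⁻ x in strip q h, ‖z x‖ₑ
      ≤ ∫⁻ x in strip q h, (ENNReal.ofReal (h ^ (-(1 / p))) +
          ENNReal.ofReal ((h ^ (-(1 / p))) ^ (1 - p)) * ‖z x‖ₑ ^ p) :=
        lintegral_mono fun x => enorm_le_add_rpow (by positivity) hp.le _
    _ = ENNReal.ofReal (h ^ (-(1 / p))) * volume (strip q h) +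
          ENNReal.ofReal (h ^ (1 - 1 / p)) * ∫⁻ x in strip q h, ‖z x‖ₑ ^ p := by
        rw [lintegral_add_left measurable_const, lintegral_const, Measure.restrict_apply_univ,
          lintegral_const_mul' _ _ (by simp), e2]
    _ ≤ ENNReal.ofReal (h ^ (-(1 / p))) * ENNReal.ofReal (4 * π * h) +
          ENNReal.ofReal (h ^ (1 - 1 / p)) * ∫⁻ x in omega q, ‖z x‖ₑ ^ p := by
        gcongr
        · exact volume_strip_le hq hh
        · exact strip_subset_omega hq h
    _ = _ := by
        rw [← ENNReal.ofReal_mul (by positivity), add_mul, ← ENNReal.ofReal_mul (by positivity),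
          ← e1, mul_comm (ENNReal.ofReal (h * h ^ (-(1 / p)))),
          show h ^ (-(1 / p)) * (4 * π * h) = 4 * π * (h * h ^ (-(1 / p))) by ring]

/-- Enlarging the range of s to a full period decouples the two points, so that both run over the
strip independently; each change of variables costs a factor 5. -/
theorem lintegral_box_pair_le (hq : 7 ≤ q) {h : ℝ} (h0 : 0 < h) (hh : h ≤ 1 / 10)
    {G : Plane × Plane → ℝ≥0∞} (hG : Measurable G) :
    ∫⁻ p in box (Ioo 0 (2 * h)) (Ioo 0 h) (Ioo 0 h),
      G (polarPt q p.2.1 p.1.1, polarPt q p.2.2 (p.1.1 + p.1.2)) ≤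
      25 * ∫⁻ y in omega q, ∫⁻ x in omega q, G (y, x) := by
  have hm : Measurable fun p : (ℝ × ℝ) × (ℝ × ℝ) =>
      G (polarPt q p.2.1 p.1.1, polarPt q p.2.2 (p.1.1 + p.1.2)) :=
    hG.comp ((measurable_polarPt_fst hq).prodMk (measurable_polarPt_snd hq))
  have hpi := pi_gt_three
  have hGx : ∀ y, Measurable fun x => G (y, x) := fun y => hG.comp measurable_prodMk_left
  have hin : Measurable fun y => ∫⁻ x in strip q h, G (y, x) := hG.lintegral_prod_right'
  have hinner : ∀ y θ, ∫⁻ s in Ioo (-π) π, ∫⁻ τ' in Ioo 0 h, G (y, polarPt q τ' (θ + s)) ≤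
      5 * ∫⁻ x in strip q h, G (y, x) := by
    intro y θ
    have hper : Function.Periodic (fun s => ∫⁻ τ' in Ioo 0 h, G (y, polarPt q τ' s)) (2 * π) :=
      fun s => by simp only [polarPt_periodic hq _ s]
    have := lintegral_period_shift hper θ
    simp only [add_comm _ θ] at this
    rw [this]
    exact lintegral_polarPt_le hq (by linarith) (hGx y)
  calc ∫⁻ p in box (Ioo 0 (2 * h)) (Ioo 0 h) (Ioo 0 h),
      G (polarPt q p.2.1 p.1.1, polarPt q p.2.2 (p.1.1 + p.1.2))
      ≤ ∫⁻ p in box (Ioo (-π) π) (Ioo 0 h) (Ioo 0 h),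
      G (polarPt q p.2.1 p.1.1, polarPt q p.2.2 (p.1.1 + p.1.2)) := by
        refine lintegral_mono_set ?_
        refine prod_mono (prod_mono le_rfl ?_) le_rfl
        exact Ioo_subset_Ioo (by linarith) (by linarith)
    _ = ∫⁻ θ in Ioo (-π) π, ∫⁻ s in Ioo (-π) π, ∫⁻ τ in Ioo 0 h, ∫⁻ τ' in Ioo 0 h,
          G (polarPt q τ θ, polarPt q τ' (θ + s)) := lintegral_box _ _ _ hm
    _ = ∫⁻ θ in Ioo (-π) π, ∫⁻ τ in Ioo 0 h, ∫⁻ s in Ioo (-π) π, ∫⁻ τ' in Ioo 0 h,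
          G (polarPt q τ θ, polarPt q τ' (θ + s)) := by
        refine lintegral_congr fun θ => lintegral_lintegral_swap ?_
        have : Measurable fun w : (ℝ × ℝ) × ℝ =>
            G (polarPt q w.1.2 θ, polarPt q w.2 (θ + w.1.1)) :=
          hm.comp (f := fun w : (ℝ × ℝ) × ℝ => ((θ, w.1.1), (w.1.2, w.2))) (by fun_prop)
        exact this.lintegral_prod_right'.aemeasurable
    _ ≤ ∫⁻ θ in Ioo (-π) π, ∫⁻ τ in Ioo 0 h, 5 * ∫⁻ x in strip q h, G (polarPt q τ θ, x) := by
        gcongr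
        exact hinner _ _
    _ ≤ 5 * ∫⁻ y in strip q h, 5 * ∫⁻ x in strip q h, G (y, x) :=
        lintegral_polarPt_le hq (by linarith) (hin.const_mul 5)
    _ = 25 * ∫⁻ y in strip q h, ∫⁻ x in strip q h, G (y, x) := by
        rw [lintegral_const_mul _ hin, ← mul_assoc]
        norm_num
    _ ≤ _ := by
        gcongr
        · exact strip_subset_omega hq h
        · exact strip_subset_omega hq h

/-- Hypothesis `he` says e = σ - 1/p. The parameter box has volume 4πh³, so the order 3 + e
expresses a mean oscillation of order h^e. Paired points are at distance at most h + 4·2h = 9h, so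
|z(y) - z(x)|^p is at most (9h)^(2+σp) times the integrand of the seminorm. The threshold M = h^e
then balances the two terms of `enorm_le_add_rpow`. -/
theorem oscBound_of_slobodeckij (hq : 7 ≤ q) {z : Plane → ℝ} (hz : Measurable z) {σ p e : ℝ}
    (hp : 1 ≤ p) (hσ : 0 ≤ σ) (he : 2 + σ * p = 3 + e * p)
    (hfin : slobodeckij (omega q) σ p z < ⊤) : OscBound q z (3 + e) := by
  have hp0 : 0 < p := by linarith
  set S := slobodeckij (omega q) σ p z with hS
  have hα : 0 < 2 + σ * p := by positivity
  refine ⟨ENNReal.ofReal (4 * π) + ENNReal.ofReal (9 ^ (2 + σ * p)) * (25 * S), ?_, 1 / 10,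
    by norm_num, le_rfl, fun h h0 hh => ?_⟩
  · refine (ENNReal.add_lt_top.2 ⟨ENNReal.ofReal_lt_top, ENNReal.mul_lt_top ENNReal.ofReal_lt_top
      (ENNReal.mul_lt_top (by simp) hfin)⟩).ne
  set G : Plane × Plane → ℝ≥0∞ := fun w =>
    ‖z w.1 - z w.2‖ₑ ^ p / ‖w.1 - w.2‖ₑ ^ (((2 : ℕ) : ℝ) + σ * p) with hG
  have hGm : Measurable G := by
    refine Measurable.div ?_ ?_
    · exact ((hz.comp measurable_fst).sub (hz.comp measurable_snd)).enorm.pow_const _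
    · exact (measurable_fst.sub measurable_snd).enorm.pow_const _
  have hpt : ∀ p' ∈ box (Ioo 0 (2 * h)) (Ioo 0 h) (Ioo 0 h),
      ‖z (polarPt q p'.2.1 p'.1.1) - z (polarPt q p'.2.2 (p'.1.1 + p'.1.2))‖ₑ ≤
      ENNReal.ofReal (h ^ e) + ENNReal.ofReal ((h ^ e) ^ (1 - p)) *
        (ENNReal.ofReal ((9 * h) ^ (2 + σ * p)) *
          G (polarPt q p'.2.1 p'.1.1, polarPt q p'.2.2 (p'.1.1 + p'.1.2))) := by
    rintro ⟨⟨θ, s⟩, ⟨τ, τ'⟩⟩ ⟨⟨-, hs⟩, hτ, hτ'⟩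
    simp only at hs hτ hτ' ⊢
    refine (enorm_le_add_rpow (M := h ^ e) (by positivity) hp _).trans ?_
    gcongr
    set y := polarPt q τ θ
    set x := polarPt q τ' (θ + s)
    have hd : ‖y - x‖ ≤ 9 * h := by
      refine (norm_polarPt_sub_le hq ⟨hτ'.1.le, by linarith [hτ'.2]⟩).trans ?_
      have h1 : |τ - τ'| ≤ h := abs_le.2 ⟨by linarith [hτ.1, hτ'.2], by linarith [hτ.2, hτ'.1]⟩
      have h2 : |θ - (θ + s)| ≤ 2 * h := by
        rw [sub_add_cancel_left, abs_neg, abs_of_pos hs.1]; exact hs.2.le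
      linarith
    have hd' : ‖y - x‖ₑ ^ (((2 : ℕ) : ℝ) + σ * p) ≤ ENNReal.ofReal ((9 * h) ^ (2 + σ * p)) := by
      rw [← ENNReal.ofReal_rpow_of_nonneg (by positivity) hα.le, Nat.cast_ofNat]
      refine ENNReal.rpow_le_rpow ?_ hα.le
      rw [← ofReal_norm]
      exact ENNReal.ofReal_le_ofReal hd
    rcases eq_or_ne y x with hyx | hyx
    · simp [hyx, hp0]
    · have hne : ‖y - x‖ₑ ^ (((2 : ℕ) : ℝ) + σ * p) ≠ 0 := by
        rw [Ne, ENNReal.rpow_eq_zero_iff_of_pos (by simpa using hα), enorm_eq_zero, sub_eq_zero]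
        exact hyx
      have hnt : ‖y - x‖ₑ ^ (((2 : ℕ) : ℝ) + σ * p) ≠ ⊤ :=
        (hd'.trans_lt ENNReal.ofReal_lt_top).ne
      calc ‖z y - z x‖ₑ ^ p = ‖y - x‖ₑ ^ (((2 : ℕ) : ℝ) + σ * p) * G (y, x) :=
            (ENNReal.mul_div_cancel hne hnt).symm
        _ ≤ _ := by gcongr
  have hmeas : MeasurableSet (box (Ioo 0 (2 * h)) (Ioo 0 h) (Ioo 0 h)) :=
    (measurableSet_Ioo.prod measurableSet_Ioo).prod (measurableSet_Ioo.prod measurableSet_Ioo)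
  have hvol : volume (box (Ioo 0 (2 * h)) (Ioo 0 h) (Ioo 0 h)) =
      ENNReal.ofReal (4 * π * h ^ 3) := by
    simp only [box, Measure.volume_eq_prod, Measure.prod_prod, Real.volume_Ioo]
    rw [← ENNReal.ofReal_mul (by linarith [pi_pos]), ← ENNReal.ofReal_mul (by linarith),
      ← ENNReal.ofReal_mul (by have := pi_pos; nlinarith)]
    congr 1; ring
  calc osc q z (Ioo 0 (2 * h)) (Ioo 0 h)
      ≤ ∫⁻ p' in box (Ioo 0 (2 * h)) (Ioo 0 h) (Ioo 0 h), (ENNReal.ofReal (h ^ e) +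
        ENNReal.ofReal ((h ^ e) ^ (1 - p)) * (ENNReal.ofReal ((9 * h) ^ (2 + σ * p)) *
          G (polarPt q p'.2.1 p'.1.1, polarPt q p'.2.2 (p'.1.1 + p'.1.2)))) :=
        setLIntegral_mono' hmeas hpt
    _ ≤ ENNReal.ofReal (h ^ e) * ENNReal.ofReal (4 * π * h ^ 3) +
        ENNReal.ofReal ((h ^ e) ^ (1 - p)) * (ENNReal.ofReal ((9 * h) ^ (2 + σ * p)) *
          (25 * S)) := by
        rw [lintegral_add_left measurable_const, lintegral_const, Measure.restrict_apply_univ, hvol,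
          lintegral_const_mul' _ _ (by simp), lintegral_const_mul' _ _ (by simp)]
        gcongr
        exact lintegral_box_pair_le hq h0 hh hGm
    _ = _ := by
        have e1 : h ^ e * (4 * π * h ^ 3) = 4 * π * h ^ (3 + e) := by
          rw [rpow_add h0]
          norm_cast
          ring
        have e2 : (h ^ e) ^ (1 - p) * (9 * h) ^ (2 + σ * p) =
            9 ^ (2 + σ * p) * h ^ (3 + e) := by
          rw [mul_rpow (by norm_num) h0.le, ← rpow_mul h0.le, mul_left_comm, ← rpow_add h0]
          congr 2
          rw [he]; ring
        rw [← ENNReal.ofReal_mul (by positivity), e1, ← mul_assoc (ENNReal.ofReal ((h ^ e) ^ (1 - p))),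
          ← ENNReal.ofReal_mul (by positivity), e2,
          ENNReal.ofReal_mul (p := 4 * π) (by positivity),
          ENNReal.ofReal_mul (p := 9 ^ (2 + σ * p)) (by positivity), add_mul]
        ring

end Oscillation

/-! ### Oscillation estimates from weak derivatives, and strip estimates from oscillation -/

section Oscillation

variable {q : ℕ}

/-- Oscillation bounds control the integral over thin strips. -/
theorem stripBound_of_oscBound (hq : 7 ≤ q) {z : Plane → ℝ} (hz : Measurable z)
    (hzi : IntegrableOn z (omega q)) {κ : ℝ} (hκ1 : κ ≤ 1)
    (hosc : OscBound q z (2 + κ)) : StripBound q z (κ / 2) := by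
  obtain ⟨C, hC, H₀, hH₀, hH₀', hCb⟩ := hosc
  set N := ∫⁻ x in omega q, ‖z x‖ₑ with hN
  have hNfin : N < ⊤ := hzi.2
  refine ⟨2 * (C + 10 * N), (ENNReal.mul_lt_top (by simp) (ENNReal.add_lt_top.2
    ⟨hC.lt_top, ENNReal.mul_lt_top (by simp) hNfin⟩)).ne, H₀ ^ 2, by positivity, by nlinarith,
    fun h h0 hh => ?_⟩
  -- Points of depth below h are compared with points of depth below the much larger H = √h. After
  -- division by H², the oscillation at scale H contributes a multiple of H^κ, and the integral over
  -- the wide strip a multiple of h/H = H.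
  set H := √h with hH
  have hHpos : 0 < H := Real.sqrt_pos.2 h0
  have hHH : H * H = h := Real.mul_self_sqrt h0.le
  have hHle : H ≤ H₀ := by
    rw [hH, Real.sqrt_le_left hH₀.le]; exact hh
  have hhH : h ≤ H := by nlinarith
  have hzm : Measurable fun x => ‖z x‖ₑ := hz.enorm
  set T := ∫⁻ θ in Ioo (-π) π, ∫⁻ τ in Ioo 0 h, ‖z (polarPt q τ θ)‖ₑ with hT
  have hstrip : ∫⁻ x in strip q h, ‖z x‖ₑ ≤ 2 * T := lintegral_strip_le hq (by linarith) hzm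
  have hm1 : Measurable fun p : (ℝ × ℝ) × (ℝ × ℝ) =>
      ‖z (polarPt q p.2.2 (p.1.1 + p.1.2))‖ₑ := hzm.comp (measurable_polarPt_snd hq)
  have key : ENNReal.ofReal (2 * H) * ENNReal.ofReal H * T ≤
      C * ENNReal.ofReal (H ^ (2 + κ)) + ENNReal.ofReal (2 * H) * ENNReal.ofReal h * (5 * N) := by
    have e1 := lintegral_box_fst hq (Ioo 0 (2 * H)) (Ioo 0 h) (Ioo 0 H) hzm
    have e2 := lintegral_box_snd hq (Ioo 0 (2 * H)) (Ioo 0 h) (Ioo 0 H) hzm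
    simp only [Real.volume_Ioo, sub_zero] at e1 e2
    rw [← e1]
    calc ∫⁻ p in box (Ioo 0 (2 * H)) (Ioo 0 h) (Ioo 0 H), ‖z (polarPt q p.2.1 p.1.1)‖ₑ
        ≤ ∫⁻ p in box (Ioo 0 (2 * H)) (Ioo 0 h) (Ioo 0 H),
          (‖z (polarPt q p.2.1 p.1.1) - z (polarPt q p.2.2 (p.1.1 + p.1.2))‖ₑ +
            ‖z (polarPt q p.2.2 (p.1.1 + p.1.2))‖ₑ) := by
          refine lintegral_mono fun p => ?_
          refine le_trans (le_of_eq ?_) (enorm_add_le _ _)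
          rw [sub_add_cancel]
      _ = (∫⁻ p in box (Ioo 0 (2 * H)) (Ioo 0 h) (Ioo 0 H),
          ‖z (polarPt q p.2.1 p.1.1) - z (polarPt q p.2.2 (p.1.1 + p.1.2))‖ₑ) +
          ∫⁻ p in box (Ioo 0 (2 * H)) (Ioo 0 h) (Ioo 0 H),
            ‖z (polarPt q p.2.2 (p.1.1 + p.1.2))‖ₑ := lintegral_add_right _ hm1
      _ ≤ C * ENNReal.ofReal (H ^ (2 + κ)) +
          ENNReal.ofReal (2 * H) * ENNReal.ofReal h * (5 * N) := by
          gcongr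
          · refine (lintegral_mono_set ?_).trans (hCb H hHpos hHle)
            exact prod_mono le_rfl (prod_mono (Ioo_subset_Ioo le_rfl hhH) le_rfl)
          · rw [e2]
            gcongr
            refine (lintegral_polarPt_le hq (by linarith) hzm).trans ?_
            gcongr
            exact lintegral_mono_set (strip_subset_omega hq H)
  have hpow : H ^ κ = h ^ (κ / 2) := by
    rw [hH, Real.sqrt_eq_rpow, ← rpow_mul h0.le]
    congr 1; ring
  have hHκ : H ≤ H ^ κ := by
    conv_lhs => rw [← rpow_one H]
    exact rpow_le_rpow_of_exponent_ge hHpos (by linarith) hκ1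
  have key2 : ENNReal.ofReal (2 * H) * ENNReal.ofReal H * T ≤
      ENNReal.ofReal (2 * H) * ENNReal.ofReal H *
        ((C + 10 * N) * ENNReal.ofReal (h ^ (κ / 2))) := by
    refine key.trans ?_
    have a1 : ENNReal.ofReal (H ^ (2 + κ)) ≤
        ENNReal.ofReal (2 * H) * ENNReal.ofReal H * ENNReal.ofReal (h ^ (κ / 2)) := by
      rw [← ENNReal.ofReal_mul (by positivity), ← ENNReal.ofReal_mul (by positivity)]
      refine ENNReal.ofReal_le_ofReal ?_
      rw [rpow_add hHpos, hpow, rpow_two]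
      have : 0 < h ^ (κ / 2) := by positivity
      nlinarith [mul_pos (mul_pos hHpos hHpos) this]
    have a2 : ENNReal.ofReal (2 * H) * ENNReal.ofReal h ≤
        ENNReal.ofReal (2 * H) * ENNReal.ofReal H * ENNReal.ofReal (h ^ (κ / 2)) := by
      rw [mul_assoc]
      gcongr
      rw [← ENNReal.ofReal_mul (by positivity)]
      refine ENNReal.ofReal_le_ofReal ?_
      rw [← hpow, ← hHH]
      gcongr
    calc C * ENNReal.ofReal (H ^ (2 + κ)) + ENNReal.ofReal (2 * H) * ENNReal.ofReal h * (5 * N)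
        ≤ C * (ENNReal.ofReal (2 * H) * ENNReal.ofReal H * ENNReal.ofReal (h ^ (κ / 2))) +
          (ENNReal.ofReal (2 * H) * ENNReal.ofReal H * ENNReal.ofReal (h ^ (κ / 2))) *
            (10 * N) := by
          gcongr
          norm_num
      _ = _ := by ring
  have hfac : ENNReal.ofReal (2 * H) * ENNReal.ofReal H ≠ 0 := by
    simp [hHpos]
  have hfac' : ENNReal.ofReal (2 * H) * ENNReal.ofReal H ≠ ⊤ :=
    ENNReal.mul_ne_top ENNReal.ofReal_ne_top ENNReal.ofReal_ne_top
  rw [ENNReal.mul_le_mul_iff_right hfac hfac'] at key2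
  refine hstrip.trans ?_
  rw [mul_assoc]
  gcongr

theorem hasDerivAt_polarPt_fst (τ θ : ℝ) :
    HasDerivAt (fun τ => polarPt q τ θ) (-er θ) τ := by
  have h := ((hasDerivAt_id τ).const_sub (radius q θ)).smul_const (er θ)
  simp only [neg_smul, one_smul] at h
  refine h.congr_of_eventuallyEq (.of_forall fun y => ?_)
  simp only [polarPt, id]

theorem exists_hasDerivAt_polarPt_snd (hq : 7 ≤ q) {τ : ℝ} (hτ : τ ∈ Icc 0 (2 / 5)) (θ : ℝ) :
    ∃ w : Plane, HasDerivAt (fun θ => polarPt q τ θ) w θ ∧ ‖w‖ ≤ 4 := by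
  have hd : DifferentiableAt ℝ (fun θ => polarPt q τ θ) θ := by
    have h1 := (hasDerivAt_radius hq θ).differentiableAt
    have h2 := contDiff_er.differentiable (by simp) θ
    simp only [polarPt]
    fun_prop
  refine ⟨_, hd.hasDerivAt, ?_⟩
  refine norm_deriv_le_of_lip' (by norm_num) (.of_forall fun y => ?_)
  have := norm_polarPt_sub_le hq (τ := τ) (τ' := τ) (θ := y) (θ' := θ) hτ
  rw [sub_self, abs_zero, zero_add] at this
  exact this

theorem enorm_sub_le_lintegral_deriv {φ φ' : ℝ → ℝ} (hd : ∀ t, HasDerivAt φ (φ' t) t)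
    (hc : Continuous φ') {a b : ℝ} {I : Set ℝ} (hI : uIoc a b ⊆ I) :
    ‖φ b - φ a‖ₑ ≤ ∫⁻ t in I, ‖φ' t‖ₑ := by
  rw [← intervalIntegral.integral_eq_sub_of_hasDerivAt (fun t _ => hd t) (hc.intervalIntegrable _ _)]
  rw [← enorm_norm, intervalIntegral.norm_intervalIntegral_eq, enorm_norm]
  exact (enorm_integral_le_lintegral_enorm _).trans (lintegral_mono_set hI)

/-- A Poincaré inequality. The two points are joined by a radial segment at angle θ, followed by the
curve of constant depth τ', along which the speed is at most 4. Integrating over the box, the two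
pieces contribute 2h³ and 4·2h·2h·h = 16h³ times the integral of the gradient. -/
theorem osc_le_of_contDiff (hq : 7 ≤ q) {Z : Plane → ℝ} (hZ : ContDiff ℝ 1 Z) {δ h : ℝ}
    (hδ : 0 < δ) (hh : h ≤ 1 / 10) :
    osc q Z (Ioo 0 (2 * h)) (Ioo δ h) ≤ ENNReal.ofReal (20 * h ^ 3) *
      ∫⁻ θ in Ioo (-π) π, ∫⁻ τ in Ioo δ h, ‖fderiv ℝ Z (polarPt q τ θ)‖ₑ := by
  rcases le_or_gt h δ with hle | hδh
  · rw [osc, box, Ioo_eq_empty hle.not_gt]; simp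
  have h0 : 0 < h := hδ.trans hδh
  have hDc : Continuous fun x => fderiv ℝ Z x := hZ.continuous_fderiv one_ne_zero
  set D : Plane → ℝ≥0∞ := fun x => ‖fderiv ℝ Z x‖ₑ with hD
  have hDm : Measurable D := hDc.enorm.measurable
  have hrad : ∀ θ τ τ', τ ∈ Ioo δ h → τ' ∈ Ioo δ h →
      ‖Z (polarPt q τ θ) - Z (polarPt q τ' θ)‖ₑ ≤ ∫⁻ t in Ioo δ h, D (polarPt q t θ) := by
    intro θ τ τ' hτ hτ'
    have hd : ∀ t, HasDerivAt (fun t => Z (polarPt q t θ))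
        (fderiv ℝ Z (polarPt q t θ) (-er θ)) t := fun t =>
      ((hZ.differentiable one_ne_zero _).hasFDerivAt).comp_hasDerivAt t
        (hasDerivAt_polarPt_fst t θ)
    have hc : Continuous fun t => fderiv ℝ Z (polarPt q t θ) (-er θ) :=
      (hDc.comp ((continuous_polarPt hq).comp (by fun_prop :
        Continuous fun t : ℝ => (t, θ)))).clm_apply continuous_const
    refine (enorm_sub_le_lintegral_deriv hd hc (I := Ioo δ h) ?_).trans (lintegral_mono fun t => ?_)
    · intro t ht
      rcases mem_uIoc.1 ht with ht | ht
      · exact ⟨hτ'.1.trans ht.1, ht.2.trans_lt hτ.2⟩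
      · exact ⟨hτ.1.trans ht.1, ht.2.trans_lt hτ'.2⟩
    · refine (ContinuousLinearMap.le_opENorm _ _).trans ?_
      have : ‖-er θ‖ₑ = 1 := by rw [enorm_neg, ← ofReal_norm, norm_er]; simp
      rw [this, mul_one]
  have hang : ∀ θ s τ, s ∈ Ioo 0 (2 * h) → τ ∈ Ioo δ h →
      ‖Z (polarPt q τ θ) - Z (polarPt q τ (θ + s))‖ₑ ≤
        ∫⁻ t in Ioo 0 (2 * h), 4 * D (polarPt q τ (θ + t)) := by
    intro θ s τ hs hτ
    have hτ' : τ ∈ Icc (0 : ℝ) (2 / 5) := ⟨(hδ.trans hτ.1).le, by linarith [hτ.2]⟩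
    choose w hw hw4 using fun θ => exists_hasDerivAt_polarPt_snd hq hτ' θ
    have hd : ∀ t, HasDerivAt (fun t => Z (polarPt q τ (θ + t)))
        (fderiv ℝ Z (polarPt q τ (θ + t)) (w (θ + t))) t := fun t =>
      ((hZ.differentiable one_ne_zero _).hasFDerivAt).comp_hasDerivAt t
        ((hw (θ + t)).comp_const_add θ t)
    have hcont : ContDiff ℝ 1 fun t => Z (polarPt q τ (θ + t)) := by
      refine hZ.comp ?_
      have e : (fun t => polarPt q τ (θ + t)) = fun t => (radius q (θ + t) - τ) • er (θ + t) := by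
        ext1 t; rw [polarPt]
      rw [e]
      have ha : ContDiff ℝ 1 fun t : ℝ => θ + t := contDiff_const.add contDiff_id
      exact (((contDiff_radius hq).comp ha).sub contDiff_const).smul
        ((contDiff_er.of_le (by norm_cast)).comp ha)
    have hc : Continuous fun t => fderiv ℝ Z (polarPt q τ (θ + t)) (w (θ + t)) := by
      have := hcont.continuous_deriv le_rfl
      rwa [funext fun t => (hd t).deriv] at this
    have hbd := enorm_sub_le_lintegral_deriv hd hc (a := s) (b := 0) (I := Ioo 0 (2 * h)) (by
      intro t ht
      rw [uIoc_of_ge hs.1.le] at ht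
      exact ⟨ht.1, ht.2.trans_lt hs.2⟩)
    rw [add_zero] at hbd
    refine hbd.trans (lintegral_mono fun t => ?_)
    refine (ContinuousLinearMap.le_opENorm _ _).trans ?_
    rw [mul_comm]
    gcongr
    rw [← ofReal_norm, show (4 : ℝ≥0∞) = ENNReal.ofReal 4 by simp]
    exact ENNReal.ofReal_le_ofReal (hw4 _)
  set I := ∫⁻ θ in Ioo (-π) π, ∫⁻ τ in Ioo δ h, D (polarPt q τ θ) with hI
  set V : ℝ → ℝ≥0∞ := fun θ => ∫⁻ t in Ioo δ h, D (polarPt q t θ) with hV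
  have hVm : Measurable V := (hDm.comp (measurable_polarPt_swap hq)).lintegral_prod_right'
  set A : ℝ × ℝ → ℝ≥0∞ := fun p => ∫⁻ t in Ioo 0 (2 * h), 4 * D (polarPt q p.2 (p.1 + t)) with hA
  have hDm2 : Measurable fun w : (ℝ × ℝ) × ℝ => 4 * D (polarPt q w.1.2 (w.1.1 + w.2)) :=
    (hDm.comp ((continuous_polarPt hq).comp (by fun_prop :
      Continuous fun w : (ℝ × ℝ) × ℝ => (w.1.2, w.1.1 + w.2))).measurable).const_mul 4
  have hAm : Measurable A := hDm2.lintegral_prod_right'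
  have hVbox : Measurable fun p : (ℝ × ℝ) × (ℝ × ℝ) => V p.1.1 := hVm.comp measurable_fst.fst
  have hAbox : Measurable fun p : (ℝ × ℝ) × (ℝ × ℝ) => A (p.1.1, p.2.2) :=
    hAm.comp (measurable_fst.fst.prodMk measurable_snd.snd)
  have hmeas : MeasurableSet (box (Ioo 0 (2 * h)) (Ioo δ h) (Ioo δ h)) :=
    (measurableSet_Ioo.prod measurableSet_Ioo).prod (measurableSet_Ioo.prod measurableSet_Ioo)
  have hVint : ∫⁻ p in box (Ioo 0 (2 * h)) (Ioo δ h) (Ioo δ h), V p.1.1 ≤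
      ENNReal.ofReal (2 * h ^ 3) * I := by
    rw [lintegral_box _ _ _ hVbox]
    simp only [lintegral_const, Measure.restrict_apply_univ, Real.volume_Ioo]
    rw [lintegral_mul_const _ ((hVm.mul_const _).mul_const _),
      lintegral_mul_const _ (hVm.mul_const _), lintegral_mul_const _ hVm]
    have e : ENNReal.ofReal (2 * h ^ 3) = ENNReal.ofReal h * ENNReal.ofReal h *
        ENNReal.ofReal (2 * h) := by
      rw [← ENNReal.ofReal_mul h0.le, ← ENNReal.ofReal_mul (by positivity)]
      congr 1; ring
    rw [e]
    calc _ ≤ I * ENNReal.ofReal h * ENNReal.ofReal h * ENNReal.ofReal (2 * h) := by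
          gcongr <;> linarith
      _ = _ := by ring
  have hAint : ∫⁻ p in box (Ioo 0 (2 * h)) (Ioo δ h) (Ioo δ h), A (p.1.1, p.2.2) ≤
      ENNReal.ofReal (16 * h ^ 3) * I := by
    have e1 := lintegral_box_snd hq (Ioo 0 (2 * h)) (Ioo δ h) (Ioo δ h) (hDm.const_mul 4)
    rw [lintegral_box _ _ _ (G := fun p => 4 * D (polarPt q p.2.2 (p.1.1 + p.1.2)))
      ((hDm.const_mul 4).comp (measurable_polarPt_snd hq))] at e1
    rw [lintegral_box _ _ _ hAbox]
    have hswap : ∀ θ, ∫⁻ τ in Ioo δ h, A (θ, τ) =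
        ∫⁻ s in Ioo 0 (2 * h), ∫⁻ τ in Ioo δ h, 4 * D (polarPt q τ (θ + s)) := by
      intro θ
      refine lintegral_lintegral_swap ?_
      exact (hDm2.comp (f := fun w : ℝ × ℝ => ((θ, w.1), w.2)) (by fun_prop)).aemeasurable
    have hA1 : Measurable fun θ => ∫⁻ τ in Ioo δ h, A (θ, τ) := hAm.lintegral_prod_right'
    simp only [lintegral_const, Measure.restrict_apply_univ] at e1 ⊢
    rw [lintegral_mul_const _ (hA1.mul_const _), lintegral_mul_const _ hA1]
    have e2 : ∫⁻ θ in Ioo (-π) π, ∫⁻ τ in Ioo δ h, 4 * D (polarPt q τ θ) = 4 * I := by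
      have : ∀ θ, ∫⁻ τ in Ioo δ h, 4 * D (polarPt q τ θ) = 4 * V θ := fun θ =>
        lintegral_const_mul' _ _ (by simp)
      simp only [this]
      rw [lintegral_const_mul _ hVm]
    have e3 : (∫⁻ θ in Ioo (-π) π, ∫⁻ τ in Ioo δ h, A (θ, τ)) * volume (Ioo δ h) =
        volume (Ioo 0 (2 * h)) * volume (Ioo δ h) * (4 * I) := by
      rw [← e2, ← e1, ← lintegral_mul_const _ hA1]
      refine lintegral_congr fun θ => ?_
      rw [hswap, ← lintegral_mul_const]
      exact (hDm2.comp (f := fun w : ℝ × ℝ => ((θ, w.2), w.1))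
        (by fun_prop)).lintegral_prod_right'
    rw [e3]
    simp only [Real.volume_Ioo, sub_zero]
    have e : ENNReal.ofReal (16 * h ^ 3) = ENNReal.ofReal (2 * h) * ENNReal.ofReal h *
        ENNReal.ofReal 4 * ENNReal.ofReal (2 * h) := by
      rw [← ENNReal.ofReal_mul (by positivity), ← ENNReal.ofReal_mul (by positivity),
        ← ENNReal.ofReal_mul (by positivity)]
      congr 1; ring
    rw [e, show (4 : ℝ≥0∞) = ENNReal.ofReal 4 by simp]
    calc _ ≤ ENNReal.ofReal (2 * h) * ENNReal.ofReal h * (ENNReal.ofReal 4 * I) *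
          ENNReal.ofReal (2 * h) := by
          gcongr; linarith
      _ = _ := by ring
  calc osc q Z (Ioo 0 (2 * h)) (Ioo δ h)
      ≤ ∫⁻ p in box (Ioo 0 (2 * h)) (Ioo δ h) (Ioo δ h), (V p.1.1 + A (p.1.1, p.2.2)) := by
        refine setLIntegral_mono' hmeas ?_
        rintro ⟨⟨θ, s⟩, ⟨τ, τ'⟩⟩ ⟨⟨-, hs⟩, hτ, hτ'⟩
        simp only at hs hτ hτ' ⊢
        rw [← sub_add_sub_cancel _ (Z (polarPt q τ' θ))]
        exact (enorm_add_le _ _).trans (add_le_add (hrad θ τ τ' hτ hτ') (hang θ s τ' hs hτ'))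
    _ = _ := lintegral_add_left hVbox _
    _ ≤ ENNReal.ofReal (2 * h ^ 3) * I + ENNReal.ofReal (16 * h ^ 3) * I := add_le_add hVint hAint
    _ ≤ ENNReal.ofReal (20 * h ^ 3) * I := by
        rw [← add_mul, ← ENNReal.ofReal_add (by positivity) (by positivity)]
        gcongr
        have : 0 < h ^ 3 := by positivity
        linarith

theorem measurable_depth (hq : 7 ≤ q) : Measurable (depth q) :=
  ((continuous_radius hq).measurable.comp measurable_angle).sub measurable_norm

theorem polarPt_depth_angle (x : Plane) : polarPt q (depth q x) (angle x) = x := by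
  rw [polarPt, depth, sub_sub_cancel, norm_smul_er_angle]

theorem lintegral_polarPt_indicator_null (hq : 7 ≤ q) {h : ℝ} (hh : h ≤ 1 / 5) {T : Set ℝ}
    (hT : T ⊆ Ioo 0 h) {N : Set Plane} (hN : MeasurableSet N) (hN0 : volume N = 0) :
    ∫⁻ θ in Ioo (-π) π, ∫⁻ τ in T, N.indicator (1 : Plane → ℝ≥0∞) (polarPt q τ θ) = 0 := by
  have hφ : Measurable (N.indicator (1 : Plane → ℝ≥0∞)) := measurable_one.indicator hN
  refine le_antisymm ?_ bot_le
  calc _ ≤ ∫⁻ θ in Ioo (-π) π, ∫⁻ τ in Ioo 0 h, N.indicator (1 : Plane → ℝ≥0∞) (polarPt q τ θ) := by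
        gcongr
    _ ≤ 5 * ∫⁻ x in strip q h, N.indicator 1 x := lintegral_polarPt_le hq hh hφ
    _ ≤ 5 * ∫⁻ x, N.indicator 1 x := by gcongr; exact Measure.restrict_le_self
    _ = 0 := by rw [lintegral_indicator_one hN, hN0, mul_zero]

/-- Null sets of the plane pull back to null sets of parameters, so the almost everywhere
convergence of mollifications can be used in the box. -/
theorem ae_box_fst (hq : 7 ≤ q) {h : ℝ} (hh : h ≤ 1 / 5) (S T T' : Set ℝ)
    (hT : T ⊆ Ioo 0 h) {Q : Plane → Prop} (hQ : ∀ᵐ x, Q x) :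
    ∀ᵐ p ∂(volume.restrict (box S T T')), Q (polarPt q p.2.1 p.1.1) := by
  set N := toMeasurable volume {x | ¬ Q x} with hN
  have hN0 : volume N = 0 := by rw [measure_toMeasurable]; exact hQ
  have hNm : MeasurableSet N := measurableSet_toMeasurable _ _
  have hφ : Measurable (N.indicator (1 : Plane → ℝ≥0∞)) := measurable_one.indicator hNm
  have e := lintegral_box_fst hq S T T' hφ
  have hm : Measurable fun p : (ℝ × ℝ) × (ℝ × ℝ) =>
    N.indicator (1 : Plane → ℝ≥0∞) (polarPt q p.2.1 p.1.1) := hφ.comp (measurable_polarPt_fst hq)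
  rw [lintegral_polarPt_indicator_null hq hh hT hNm hN0, mul_zero, lintegral_eq_zero_iff hm] at e
  filter_upwards [e] with p hp
  by_contra hne
  have : polarPt q p.2.1 p.1.1 ∈ N := subset_toMeasurable _ _ hne
  simp [this] at hp

theorem ae_box_snd (hq : 7 ≤ q) {h : ℝ} (hh : h ≤ 1 / 5) (S T T' : Set ℝ)
    (hT : T' ⊆ Ioo 0 h) {Q : Plane → Prop} (hQ : ∀ᵐ x, Q x) :
    ∀ᵐ p ∂(volume.restrict (box S T T')), Q (polarPt q p.2.2 (p.1.1 + p.1.2)) := by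
  set N := toMeasurable volume {x | ¬ Q x} with hN
  have hN0 : volume N = 0 := by rw [measure_toMeasurable]; exact hQ
  have hNm : MeasurableSet N := measurableSet_toMeasurable _ _
  have hφ : Measurable (N.indicator (1 : Plane → ℝ≥0∞)) := measurable_one.indicator hNm
  have e := lintegral_box_snd hq S T T' hφ
  have hm : Measurable fun p : (ℝ × ℝ) × (ℝ × ℝ) =>
    N.indicator (1 : Plane → ℝ≥0∞) (polarPt q p.2.2 (p.1.1 + p.1.2)) :=
    hφ.comp (measurable_polarPt_snd hq)
  rw [lintegral_polarPt_indicator_null hq hh hT hNm hN0, mul_zero, lintegral_eq_zero_iff hm] at e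
  filter_upwards [e] with p hp
  by_contra hne
  have : polarPt q p.2.2 (p.1.1 + p.1.2) ∈ N := subset_toMeasurable _ _ hne
  simp [this] at hp

theorem enorm_le_sum_enorm_apply (L : Plane →L[ℝ] ℝ) :
    ‖L‖ₑ ≤ ∑ i, ‖L (EuclideanSpace.single i 1)‖ₑ := by
  have h : ‖L‖ ≤ ∑ i, ‖L (EuclideanSpace.single i 1)‖ := by
    refine L.opNorm_le_bound (Finset.sum_nonneg fun i _ => norm_nonneg _) fun v => ?_
    have hv : v = ∑ i, v i • (EuclideanSpace.single i (1 : ℝ) : Plane) := by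
      ext j
      fin_cases j <;> simp [Fin.sum_univ_two]
    conv_lhs => rw [hv]
    rw [map_sum, Finset.sum_mul]
    refine (norm_sum_le _ _).trans (Finset.sum_le_sum fun i _ => ?_)
    rw [map_smul, norm_smul, mul_comm]
    gcongr
    exact PiLp.norm_apply_le v i
  rw [← ofReal_norm]
  refine (ENNReal.ofReal_le_ofReal h).trans_eq ?_
  rw [ENNReal.ofReal_sum_of_nonneg fun i _ => norm_nonneg _]
  simp only [ofReal_norm]

/-- Apply `osc_le_of_contDiff` to mollifications of `z` and pass to the limit with Fatou's lemma.
Depths above δ keep the points in a compact subset of the strip of width 2h; there the gradient of a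
sufficiently fine mollification is the mollified weak gradient. -/
theorem osc_le_of_isWeakPartial_aux (hq : 7 ≤ q) {z : Plane → ℝ}
    (hzi : IntegrableOn z (omega q)) {w : Fin 2 → Plane → ℝ} (hw : ∀ i, Measurable (w i))
    (hwi : ∀ i, IntegrableOn (w i) (omega q))
    (hzw : ∀ i, IsWeakPartial (omega q) i z (w i)) {δ h : ℝ} (hδ : 0 < δ)
    (hδh : δ < h) (hh : h ≤ 1 / 10) :
    osc q z (Ioo 0 (2 * h)) (Ioo δ h) ≤
      ENNReal.ofReal (20 * h ^ 3) * (5 * ∑ i, ∫⁻ x in strip q (2 * h), ‖w i x‖ₑ) := by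
  have hΩm := (isOpen_omega hq).measurableSet
  have h0 : 0 < h := hδ.trans hδh
  set Z : ℕ → Plane → ℝ := fun n => mollify n ((omega q).indicator z) with hZ
  have hloc : LocallyIntegrable ((omega q).indicator z) :=
    (hzi.integrable_indicator hΩm).locallyIntegrable
  have hZ1 : ∀ n, ContDiff ℝ 1 (Z n) := fun n => (contDiff_mollify n hloc).of_le (by norm_cast)
  have hTsub : Ioo δ h ⊆ Ioo 0 (1 / 5) := Ioo_subset_Ioo hδ.le (by linarith)
  set S := Ioo 0 (2 * h)
  set T := Ioo δ h
  have hlim := ae_tendsto_mollify hloc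
  have hmeas : MeasurableSet (box S T T) :=
    (measurableSet_Ioo.prod measurableSet_Ioo).prod (measurableSet_Ioo.prod measurableSet_Ioo)
  have hPΩ : ∀ τ ∈ T, ∀ θ, polarPt q τ θ ∈ omega q := fun τ hτ θ =>
    strip_subset_omega hq _ (polarPt_mem_strip hq (h := 1 / 5) (by norm_num) (hTsub hτ) θ)
  have hfatou : osc q z S T ≤ Filter.liminf (fun n => osc q (Z n) S T) Filter.atTop := by
    refine le_trans (le_of_eq ?_) (lintegral_liminf_le fun n =>
      measurable_osc_integrand hq (hZ1 n).continuous.measurable)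
    refine lintegral_congr_ae ?_
    filter_upwards [ae_box_fst hq le_rfl S T T hTsub hlim, ae_box_snd hq le_rfl S T T hTsub hlim,
      ae_restrict_mem hmeas] with p hp1 hp2 hp
    obtain ⟨-, hτ, hτ'⟩ := hp
    rw [indicator_of_mem (hPΩ _ hτ _)] at hp1
    rw [indicator_of_mem (hPΩ _ hτ' _)] at hp2
    exact ((hp1.sub hp2).enorm.liminf_eq).symm
  set K := (fun p : ℝ × ℝ => polarPt q p.1 p.2) '' (Icc δ h ×ˢ Icc (-π) π) with hK
  have hKc : IsCompact K := (isCompact_Icc.prod isCompact_Icc).image (continuous_polarPt hq)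
  have hKs : K ⊆ strip q (2 * h) := by
    rintro _ ⟨⟨τ, θ⟩, ⟨hτ, -⟩, rfl⟩
    exact polarPt_mem_strip hq (by linarith) ⟨hδ.trans_le hτ.1, by linarith [hτ.2]⟩ θ
  obtain ⟨ε, hε, hεK⟩ := hKc.exists_cthickening_subset_open (isOpen_strip hq (by linarith)) hKs
  set A : Set Plane := {x | δ < depth q x} ∩ strip q h with hA
  have hAm : MeasurableSet A :=
    (measurable_depth hq measurableSet_Ioi).inter (isOpen_strip hq (by linarith)).measurableSet
  have hAK : A ⊆ K := by
    rintro x ⟨hx1, hx2⟩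
    exact ⟨(depth q x, angle x), ⟨⟨le_of_lt hx1, hx2.2.le⟩, Ioc_subset_Icc_self (angle_mem x)⟩,
      polarPt_depth_angle x⟩
  refine hfatou.trans (Filter.liminf_le_of_frequently_le' (Filter.Eventually.frequently ?_))
  filter_upwards [tendsto_rOut.eventually (gt_mem_nhds hε)] with n hn
  have hball : ∀ x ∈ A, Metric.closedBall x (bump n).rOut ⊆ strip q (2 * h) := fun x hx =>
    ((Metric.closedBall_subset_cthickening (hAK hx) _).trans
      (Metric.cthickening_mono hn.le _)).trans hεK
  refine (osc_le_of_contDiff hq (hZ1 n) hδ hh).trans ?_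
  gcongr
  have hDm : Measurable fun x => ‖fderiv ℝ (Z n) x‖ₑ :=
    ((hZ1 n).continuous_fderiv one_ne_zero).enorm.measurable
  calc ∫⁻ θ in Ioo (-π) π, ∫⁻ τ in T, ‖fderiv ℝ (Z n) (polarPt q τ θ)‖ₑ
      ≤ ∫⁻ θ in Ioo (-π) π, ∫⁻ τ in Ioo 0 h,
          A.indicator (fun x => ‖fderiv ℝ (Z n) x‖ₑ) (polarPt q τ θ) := by
        refine lintegral_mono fun θ => ?_
        refine le_trans (le_of_eq (setLIntegral_congr_fun measurableSet_Ioo fun τ hτ => ?_))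
          (lintegral_mono_set (Ioo_subset_Ioo hδ.le le_rfl))
        have hτF : τ < radius q θ := by linarith [hτ.2, (radius_bounds hq θ).1]
        have : polarPt q τ θ ∈ A := by
          refine ⟨?_, polarPt_mem_strip hq (by linarith) ⟨hδ.trans hτ.1, hτ.2⟩ θ⟩
          rw [mem_ofPred_eq, depth_polarPt hq hτF]
          exact hτ.1
        beta_reduce
        rw [indicator_of_mem this]
    _ ≤ 5 * ∫⁻ x in strip q h, A.indicator (fun x => ‖fderiv ℝ (Z n) x‖ₑ) x :=
        lintegral_polarPt_le hq (by linarith) (hDm.indicator hAm)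
    _ ≤ 5 * ∫⁻ x in A, ‖fderiv ℝ (Z n) x‖ₑ := by
        rw [← lintegral_indicator hAm]
        gcongr
        exact Measure.restrict_le_self
    _ ≤ 5 * ∫⁻ x in A, ∑ i, ‖mollify n ((omega q).indicator (w i)) x‖ₑ := by
        gcongr 5 * ?_
        refine setLIntegral_mono' hAm fun x hx => ?_
        refine (enorm_le_sum_enorm_apply _).trans (le_of_eq (Finset.sum_congr rfl fun i _ => ?_))
        rw [fderiv_mollify_of_isWeakPartial hΩm (hzw i) hzi n
          ((hball x hx).trans (strip_subset_omega hq _))]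
    _ = 5 * ∑ i, ∫⁻ x in A, ‖mollify n ((omega q).indicator (w i)) x‖ₑ := by
        rw [lintegral_finsetSum']
        intro i _
        exact (contDiff_mollify n ((hwi i).integrable_indicator hΩm).locallyIntegrable).continuous.enorm.measurable.aemeasurable
    _ ≤ 5 * ∑ i, ∫⁻ x in strip q (2 * h), ‖w i x‖ₑ := by
        refine mul_le_mul_right (Finset.sum_le_sum fun i _ => ?_) _
        have := lintegral_mollify_le n ((hw i).indicator hΩm) (p := 1) le_rfl hAm
          (isOpen_strip hq (by linarith)).measurableSet hball
        simp only [ENNReal.rpow_one] at this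
        refine this.trans (lintegral_mono fun x => ?_)
        exact enorm_indicator_le_enorm_self _ _

/-- The estimate for depths above δ has a constant independent of δ, and the boxes increase to the
full one as δ decreases to 0. -/
theorem osc_le_of_isWeakPartial (hq : 7 ≤ q) {z : Plane → ℝ}
    (hzi : IntegrableOn z (omega q)) {w : Fin 2 → Plane → ℝ} (hw : ∀ i, Measurable (w i))
    (hwi : ∀ i, IntegrableOn (w i) (omega q))
    (hzw : ∀ i, IsWeakPartial (omega q) i z (w i)) {h : ℝ} (h0 : 0 < h) (hh : h ≤ 1 / 10) :
    osc q z (Ioo 0 (2 * h)) (Ioo 0 h) ≤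
      ENNReal.ofReal (20 * h ^ 3) * (5 * ∑ i, ∫⁻ x in strip q (2 * h), ‖w i x‖ₑ) := by
  set δ : ℕ → ℝ := fun n => h / (n + 2) with hδ
  have hδ0 : ∀ n, 0 < δ n := fun n => by positivity
  have hδh : ∀ n, δ n < h := fun n => div_lt_self h0 (by linarith [(Nat.cast_nonneg n : (0 : ℝ) ≤ n)])
  have hanti : Antitone δ := fun m n hmn => by
    simp only [hδ]
    gcongr
  have hmono : Monotone fun n => box (Ioo 0 (2 * h)) (Ioo (δ n) h) (Ioo (δ n) h) := fun m n hmn =>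
    prod_mono le_rfl (prod_mono (Ioo_subset_Ioo (hanti hmn) le_rfl)
      (Ioo_subset_Ioo (hanti hmn) le_rfl))
  have hU : box (Ioo 0 (2 * h)) (Ioo 0 h) (Ioo 0 h) =
      ⋃ n, box (Ioo 0 (2 * h)) (Ioo (δ n) h) (Ioo (δ n) h) := by
    refine Subset.antisymm ?_ (iUnion_subset fun n => ?_)
    · rintro ⟨p, ⟨τ, τ'⟩⟩ ⟨hp, hτ, hτ'⟩
      have hlim : Filter.Tendsto δ Filter.atTop (nhds 0) :=
        tendsto_const_nhds.div_atTop
          (Filter.tendsto_atTop_add_const_right _ _ tendsto_natCast_atTop_atTop)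
      obtain ⟨n, hn1, hn2⟩ := ((hlim.eventually (gt_mem_nhds hτ.1)).and
        (hlim.eventually (gt_mem_nhds hτ'.1))).exists
      exact mem_iUnion.2 ⟨n, hp, ⟨hn1, hτ.2⟩, ⟨hn2, hτ'.2⟩⟩
    · exact prod_mono le_rfl (prod_mono (Ioo_subset_Ioo (hδ0 n).le le_rfl)
        (Ioo_subset_Ioo (hδ0 n).le le_rfl))
  rw [osc, hU, setLIntegral_iUnion_of_directed _ hmono.directed_le]
  exact iSup_le fun n => osc_le_of_isWeakPartial_aux hq hzi hw hwi hzw (hδ0 n) (hδh n) hh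

theorem oscBound_of_isWeakPartial (hq : 7 ≤ q) {z : Plane → ℝ}
    (hzi : IntegrableOn z (omega q)) {w : Fin 2 → Plane → ℝ} (hw : ∀ i, Measurable (w i))
    (hwi : ∀ i, IntegrableOn (w i) (omega q))
    (hzw : ∀ i, IsWeakPartial (omega q) i z (w i)) {κ : ℝ}
    (hstrip : ∀ i, StripBound q (w i) κ) : OscBound q z (3 + κ) := by
  choose C hC h₁ hh₁ hh₁' hb using hstrip
  refine ⟨ENNReal.ofReal 20 * (5 * ((∑ i, C i) * ENNReal.ofReal (2 ^ κ))), ?_,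
    min (h₁ 0) (h₁ 1) / 2, ?_, ?_, fun h h0 hh => ?_⟩
  · refine ENNReal.mul_ne_top ENNReal.ofReal_ne_top (ENNReal.mul_ne_top (by simp)
      (ENNReal.mul_ne_top ?_ ENNReal.ofReal_ne_top))
    exact ENNReal.sum_ne_top.2 fun i _ => hC i
  · have := lt_min (hh₁ 0) (hh₁ 1); linarith
  · have := min_le_left (h₁ 0) (h₁ 1); have := hh₁' 0; linarith
  · have hhi : ∀ i, 2 * h ≤ h₁ i := fun i => by
      have h2 : 2 * h ≤ min (h₁ 0) (h₁ 1) := by linarith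
      fin_cases i
      · exact h2.trans (min_le_left _ _)
      · exact h2.trans (min_le_right _ _)
    refine (osc_le_of_isWeakPartial hq hzi hw hwi hzw h0
      (by have := hhi 0; have := hh₁' 0; linarith)).trans ?_
    calc ENNReal.ofReal (20 * h ^ 3) * (5 * ∑ i, ∫⁻ x in strip q (2 * h), ‖w i x‖ₑ)
        ≤ ENNReal.ofReal (20 * h ^ 3) * (5 * ∑ i, C i * ENNReal.ofReal ((2 * h) ^ κ)) := by
          gcongr with i
          exact hb i (2 * h) (by linarith) (hhi i)
      _ = _ := by
          rw [← Finset.sum_mul, mul_rpow (by norm_num) h0.le, rpow_add h0,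
            ENNReal.ofReal_mul (p := 20) (by norm_num),
            ENNReal.ofReal_mul (p := (2 : ℝ) ^ κ) (by positivity),
            ENNReal.ofReal_mul (p := h ^ (3 : ℝ)) (by positivity)]
          norm_cast
          ring

end Oscillation

/-! ### From Sobolev-Slobodeckij regularity to oscillation bounds -/

section Regularity

theorem slobodeckij_congr {d : ℕ} {𝕜 : Type*} [RCLike 𝕜] {Ω : Set (EuclideanSpace ℝ (Fin d))}
    {σ p : ℝ} {u u' : EuclideanSpace ℝ (Fin d) → 𝕜} (h : u =ᵐ[volume.restrict Ω] u') :
    slobodeckij Ω σ p u = slobodeckij Ω σ p u' := by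
  refine lintegral_congr_ae ?_
  filter_upwards [h] with y hy
  refine lintegral_congr_ae ?_
  filter_upwards [h] with x hx
  rw [hy, hx]

theorem LocallyIntegrableOn.congr_ae_restrict {Ω : Set Plane} {u u' : Plane → ℝ}
    (hu : LocallyIntegrableOn u Ω) (h : u =ᵐ[volume.restrict Ω] u') : LocallyIntegrableOn u' Ω := by
  intro x hx
  obtain ⟨s, hs, hi⟩ := hu x hx
  refine ⟨s ∩ Ω, Filter.inter_mem hs self_mem_nhdsWithin, ?_⟩
  exact (hi.mono_set inter_subset_left).congr
    (ae_mono (Measure.restrict_mono inter_subset_right le_rfl) h)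

theorem IsWeakPartial.congr_ae {Ω : Set Plane} {i : Fin 2} {u u' w w' : Plane → ℝ}
    (h : IsWeakPartial Ω i u w) (hu : u =ᵐ[volume.restrict Ω] u')
    (hw : w =ᵐ[volume.restrict Ω] w') : IsWeakPartial Ω i u' w' where
  locInt_fun := LocallyIntegrableOn.congr_ae_restrict h.locInt_fun hu
  locInt_deriv := LocallyIntegrableOn.congr_ae_restrict h.locInt_deriv hw
  integral_eq := by
    intro φ hφ
    have h1 : ∫ x in Ω, partialDeriv i φ x • u' x = ∫ x in Ω, partialDeriv i φ x • u x :=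
      integral_congr_ae (by filter_upwards [hu] with x hx; rw [hx])
    have h2 : ∫ x in Ω, φ x • w' x = ∫ x in Ω, φ x • w x :=
      integral_congr_ae (by filter_upwards [hw] with x hx; rw [hx])
    rw [h1, h2, h.integral_eq φ hφ]

theorem MemWAux.congr_ae {Ω : Set Plane} {σ p : ℝ} {m : ℕ} {u u' : Plane → ℝ}
    (h : MemWAux Ω σ p m u) (hu : u =ᵐ[volume.restrict Ω] u') : MemWAux Ω σ p m u' := by
  induction m with
  | zero => exact ⟨h.1.ae_eq hu, fun hσ => by rw [← slobodeckij_congr hu]; exact h.2 hσ⟩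
  | succ m ih =>
    refine ⟨ih h.1, fun i => ?_⟩
    obtain ⟨w, hw, hw'⟩ := h.2 i
    exact ⟨w, hw.congr_ae hu Filter.EventuallyEq.rfl, hw'⟩

theorem MemWAux.memLp {Ω : Set Plane} {σ p : ℝ} {m : ℕ} {u : Plane → ℝ}
    (h : MemWAux Ω σ p m u) : MemLp u (ENNReal.ofReal p) (volume.restrict Ω) := by
  induction m with
  | zero => exact h.1
  | succ m ih => exact ih h.1

/-- The weak partial derivatives of a Sobolev function have measurable representatives. -/
theorem MemWAux.exists_measurable_partial {Ω : Set Plane} {σ p : ℝ} {m : ℕ} {u : Plane → ℝ}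
    (h : MemWAux Ω σ p (m + 1) u) (i : Fin 2) :
    ∃ w : Plane → ℝ, Measurable w ∧ IsWeakPartial Ω i u w ∧ MemWAux Ω σ p m w := by
  obtain ⟨w, hw, hw'⟩ := h.2 i
  have hm := hw'.memLp.aestronglyMeasurable.aemeasurable
  exact ⟨hm.mk w, hm.measurable_mk, hw.congr_ae .rfl hm.ae_eq_mk, hw'.congr_ae hm.ae_eq_mk⟩

variable {q : ℕ}

theorem volume_omega_lt_top (hq : 7 ≤ q) : volume (omega q) < ⊤ :=
  (measure_mono (omega_subset_ball hq)).trans_lt measure_ball_lt_top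

theorem MemLp.integrableOn_omega (hq : 7 ≤ q) {p : ℝ} (hp : 1 ≤ p) {u : Plane → ℝ}
    (h : MemLp u (ENNReal.ofReal p) (volume.restrict (omega q))) : IntegrableOn u (omega q) := by
  have : Fact (volume (omega q) < ⊤) := ⟨volume_omega_lt_top hq⟩
  exact h.integrable (by simpa using hp)

/-- The cases follow the integer part of s = 1 + 1/p + ε. If it is 1, the gradient has fractional
order 1/p + ε and η = ε. If it is at least 2 and p > 1, the second derivatives lie in L^p, and their
strip integrals decay like h^(1-1/p). For p = 1 plain integrability of the second derivatives gives
no decay, but then s = 2 + ε, and the remaining smoothness of the second derivatives yields it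
through `stripBound_of_oscBound`. -/
theorem oscBound_of_memW (hq : 7 ≤ q) {v : Plane → ℝ} {p ε : ℝ} (hp : 1 ≤ p) (hε : 0 < ε)
    (h : MemW (omega q) (1 + 1 / p + ε) p v) (i : Fin 2) :
    ∃ w : Plane → ℝ, Measurable w ∧ IsWeakPartial (omega q) i v w ∧
      ∃ η : ℝ, 0 < η ∧ OscBound q w (3 + η) := by
  have hp0 : 0 < p := by linarith
  have hs0 : 0 ≤ 1 + 1 / p + ε := by positivity
  rw [MemW] at h
  set s := 1 + 1 / p + ε with hs
  have hfl : (⌊s⌋₊ : ℝ) + Int.fract s = s := by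
    rw [natCast_floor_eq_intCast_floor hs0]
    exact Int.floor_add_fract s
  set σ := Int.fract s with hσ
  have hσ0 : 0 ≤ σ := Int.fract_nonneg s
  have hσ1 : σ < 1 := Int.fract_lt_one s
  have hfl1 : 1 ≤ ⌊s⌋₊ := Nat.le_floor (by
    have : 0 ≤ 1 / p := by positivity
    push_cast; linarith)
  obtain ⟨m, hm⟩ := Nat.exists_eq_add_of_le' hfl1
  rw [hm] at h hfl
  push_cast at hfl
  obtain ⟨w, hwm, hwp, hw⟩ := h.exists_measurable_partial i
  refine ⟨w, hwm, hwp, ?_⟩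
  have hwi := MemLp.integrableOn_omega hq hp hw.memLp
  rcases m with _ | m
  · have hσe : σ = 1 / p + ε := by push_cast at hfl; linarith
    have hσp : 0 < σ := by rw [hσe]; positivity
    refine ⟨ε, hε, oscBound_of_slobodeckij hq hwm hp hσ0 ?_ (hw.2 hσp)⟩
    rw [hσe]
    field_simp
    ring
  · choose z hzm hzp hz using fun j => hw.exists_measurable_partial j
    have hzi := fun j => MemLp.integrableOn_omega hq hp (hz j).memLp
    rcases hp.eq_or_lt with rfl | hp1
    -- Here s = 2 + ε: in the first case the second derivatives have fractional order σ = ε only, in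
    -- the second one there are integrable third derivatives.
    · rcases m with _ | m
      · have hσe : σ = ε := by rw [hs] at hfl; push_cast at hfl; norm_num at hfl; linarith
        have hσp : 0 < σ := by rw [hσe]; exact hε
        refine ⟨σ / 2, by positivity, oscBound_of_isWeakPartial hq hwi hzm hzi hzp fun j => ?_⟩
        refine stripBound_of_oscBound hq (hzm j) (hzi j) hσ1.le ?_
        have := oscBound_of_slobodeckij hq (hzm j) (e := σ - 1) le_rfl hσ0 (by ring) ((hz j).2 hσp)
        rwa [show 3 + (σ - 1) = 2 + σ by ring] at this
      · refine ⟨1 / 2, by norm_num, oscBound_of_isWeakPartial hq hwi hzm hzi hzp fun j => ?_⟩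
        refine stripBound_of_oscBound hq (hzm j) (hzi j) le_rfl ?_
        choose y hym hyp hy using fun k => (hz j).exists_measurable_partial k
        have hyi := fun k => MemLp.integrableOn_omega hq le_rfl (hy k).memLp
        -- For the third derivatives no decay is needed: order 3 + 0 for the second derivatives is
        -- order 2 + κ with κ = 1.
        have := oscBound_of_isWeakPartial hq (hzi j) hym hyi hyp (κ := 0) fun k => ?_
        · rwa [show (3 : ℝ) + 0 = 2 + 1 by norm_num] at this
        · refine ⟨∫⁻ x in omega q, ‖y k x‖ₑ, (hyi k).2.ne, 1 / 5, by norm_num, le_rfl,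
            fun h _ _ => ?_⟩
          rw [rpow_zero, ENNReal.ofReal_one, mul_one]
          exact lintegral_mono_set (strip_subset_omega hq h)
    · refine ⟨1 - 1 / p, ?_, oscBound_of_isWeakPartial hq hwi hzm hzi hzp fun j =>
        stripBound_of_memLp hq hp1 (hz j).memLp⟩
      rw [sub_pos, div_lt_one hp0]
      exact hp1

end Regularity

/-! ### Boundary averages and fluxes -/

/-- A smooth cutoff function, vanishing on `(-∞, 1/4]` and equal to one on `[1/2, ∞)`. -/
noncomputable def cut (u : ℝ) : ℝ := Real.smoothTransition (4 * u - 1)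

/-- The derivative of the cutoff function. -/
noncomputable def kap (u : ℝ) : ℝ := deriv cut u

theorem contDiff_cut : ContDiff ℝ ∞ cut := by
  unfold cut
  exact Real.smoothTransition.contDiff.comp (by fun_prop)

theorem hasDerivAt_cut (u : ℝ) : HasDerivAt cut (kap u) u :=
  (contDiff_cut.differentiable (by simp) u).hasDerivAt

theorem continuous_kap : Continuous kap := contDiff_cut.continuous_deriv (by norm_cast)

theorem cut_of_le {u : ℝ} (h : u ≤ 1 / 4) : cut u = 0 :=
  Real.smoothTransition.zero_of_nonpos (by linarith)

theorem cut_of_ge {u : ℝ} (h : 1 / 2 ≤ u) : cut u = 1 :=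
  Real.smoothTransition.one_of_one_le (by linarith)

theorem cut_mem (u : ℝ) : 0 ≤ cut u ∧ cut u ≤ 1 :=
  ⟨Real.smoothTransition.nonneg _, Real.smoothTransition.le_one _⟩

theorem kap_of_lt {u : ℝ} (h : u < 1 / 4) : kap u = 0 := by
  refine (hasDerivAt_cut u).unique ((hasDerivAt_const u (0 : ℝ)).congr_of_eventuallyEq ?_)
  filter_upwards [gt_mem_nhds h] with v hv using cut_of_le hv.le

theorem kap_of_gt {u : ℝ} (h : 1 / 2 < u) : kap u = 0 := by
  refine (hasDerivAt_cut u).unique ((hasDerivAt_const u (1 : ℝ)).congr_of_eventuallyEq ?_)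
  filter_upwards [lt_mem_nhds h] with v hv using cut_of_ge hv.le

theorem exists_kap_bound : ∃ C : ℝ, 0 < C ∧ ∀ u, |kap u| ≤ C := by
  have hs : HasCompactSupport kap := by
    refine HasCompactSupport.intro (isCompact_Icc (a := (1 / 4 : ℝ)) (b := 1 / 2)) fun u hu => ?_
    rw [mem_Icc, not_and_or, not_le, not_le] at hu
    rcases hu with hu | hu
    · exact kap_of_lt hu
    · exact kap_of_gt hu
  obtain ⟨C, hC⟩ := hs.exists_bound_of_continuous continuous_kap
  exact ⟨max C 1, by positivity, fun u => (hC u).trans (le_max_left _ _)⟩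

/-- A bound for the derivative of the cutoff function. -/
noncomputable def kapBound : ℝ := exists_kap_bound.choose

theorem kapBound_pos : 0 < kapBound := exists_kap_bound.choose_spec.1

theorem abs_kap_le (u : ℝ) : |kap u| ≤ kapBound := exists_kap_bound.choose_spec.2 u

/-- The averaging kernel at scale `h`. -/
noncomputable def avgKernel (h τ : ℝ) : ℝ := kap (τ / h) / h

theorem continuous_avgKernel (h : ℝ) : Continuous (avgKernel h) := by
  unfold avgKernel
  exact (continuous_kap.comp (by fun_prop)).div_const h

theorem abs_avgKernel_le {h : ℝ} (h0 : 0 < h) (τ : ℝ) : |avgKernel h τ| ≤ kapBound / h := by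
  rw [avgKernel, abs_div, abs_of_pos h0]
  gcongr
  exact abs_kap_le _

theorem avgKernel_eq_zero {h : ℝ} (h0 : 0 < h) {τ : ℝ} (hτ : τ ∉ Ioo 0 h) : avgKernel h τ = 0 := by
  have : kap (τ / h) = 0 := by
    rw [mem_Ioo, not_and_or, not_lt, not_lt] at hτ
    rcases hτ with hτ | hτ
    · exact kap_of_lt ((div_nonpos_of_nonpos_of_nonneg hτ h0.le).trans_lt (by norm_num))
    · exact kap_of_gt (lt_of_lt_of_le (by norm_num) ((one_le_div h0).2 hτ))
  rw [avgKernel, this, zero_div]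

/-- The kernel is the derivative of τ ↦ `cut (τ / h)`. For the same reason it appears in the
gradient of the cutoff `chi q h`, which links radial averages to integrals over the domain. -/
theorem integral_avgKernel {h : ℝ} (h0 : 0 < h) : ∫ τ in Ioo 0 h, avgKernel h τ = 1 := by
  have hd : ∀ τ, HasDerivAt (fun τ => cut (τ / h)) (avgKernel h τ) τ := fun τ => by
    have := (hasDerivAt_cut (τ / h)).comp τ ((hasDerivAt_id τ).div_const h)
    simpa [avgKernel, div_eq_mul_inv] using! this
  rw [← integral_Ioc_eq_integral_Ioo, ← intervalIntegral.integral_of_le h0.le,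
    intervalIntegral.integral_eq_sub_of_hasDerivAt (fun τ _ => hd τ)
      ((continuous_avgKernel h).intervalIntegrable _ _), div_self h0.ne', zero_div,
    cut_of_ge (by norm_num), cut_of_le (by norm_num), sub_zero]

theorem abs_avgKernel_mul_le {h : ℝ} (h0 : 0 < h) {τ : ℝ} (hτ : τ ∈ Ioo 0 h) :
    |avgKernel h τ| * τ ≤ kapBound := by
  have h1 := abs_avgKernel_le h0 τ
  have hC := kapBound_pos
  calc |avgKernel h τ| * τ ≤ kapBound / h * h := by
        have := hτ.1
        have := hτ.2.le
        gcongr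
    _ = kapBound := by field_simp

section Averages

variable {q : ℕ}

/-- The average of `w` at scale `h` along the ray with angle `θ`. -/
noncomputable def bAvg (q : ℕ) (h : ℝ) (w : Plane → ℝ) (θ : ℝ) : ℝ :=
  ∫ τ in Ioo 0 h, avgKernel h τ * w (polarPt q τ θ)

theorem bAvg_eq {h h' : ℝ} (h0 : 0 < h) (hh : h ≤ h') (w : Plane → ℝ) (θ : ℝ) :
    bAvg q h w θ = ∫ τ in Ioo 0 h', avgKernel h τ * w (polarPt q τ θ) := by
  rw [bAvg]
  refine (setIntegral_eq_of_subset_of_forall_sdiff_eq_zero measurableSet_Ioo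
    (Ioo_subset_Ioo le_rfl hh) fun τ hτ => ?_).symm
  rw [avgKernel_eq_zero h0 hτ.2, zero_mul]

theorem bAvg_periodic (hq : 7 ≤ q) (h : ℝ) (w : Plane → ℝ) :
    Function.Periodic (bAvg q h w) (2 * π) := fun θ => by
  simp only [bAvg, polarPt_periodic hq _ θ]

theorem measurable_bAvg (hq : 7 ≤ q) (h : ℝ) {w : Plane → ℝ} (hw : Measurable w) :
    Measurable (bAvg q h w) := by
  have hm : Measurable fun p : ℝ × ℝ => avgKernel h p.2 * w (polarPt q p.2 p.1) :=
    ((continuous_avgKernel h).measurable.comp measurable_snd).mul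
      (hw.comp (measurable_polarPt_swap hq))
  exact (hm.stronglyMeasurable.integral_prod_right' (ν := volume.restrict (Ioo 0 h))).measurable

/-- Both kernels have mass one, so the difference of the averages is a double average of
differences. -/
theorem enorm_avg_sub_le {k k' u u' : ℝ → ℝ} {h M M' : ℝ} (hM' : 0 ≤ M') (hk : Continuous k)
    (hk' : Continuous k') (hkM : ∀ τ, |k τ| ≤ M) (hkM' : ∀ τ, |k' τ| ≤ M')
    (h1 : ∫ τ in Ioo 0 h, k τ = 1) (h1' : ∫ τ in Ioo 0 h, k' τ = 1)
    (hu : IntegrableOn u (Ioo 0 h)) (hu' : IntegrableOn u' (Ioo 0 h)) :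
    ‖(∫ τ in Ioo 0 h, k' τ * u τ) - ∫ τ in Ioo 0 h, k τ * u' τ‖ₑ ≤
      ENNReal.ofReal (M' * M) * ∫⁻ τ in Ioo 0 h, ∫⁻ τ' in Ioo 0 h, ‖u τ - u' τ'‖ₑ := by
  have hmul : ∀ {k u : ℝ → ℝ} {M : ℝ}, Continuous k → (∀ τ, |k τ| ≤ M) → IntegrableOn u (Ioo 0 h) →
      IntegrableOn (fun τ => k τ * u τ) (Ioo 0 h) := fun hk hM hu =>
    hu.bdd_mul hk.aestronglyMeasurable (.of_forall hM)
  have hki : ∀ {k : ℝ → ℝ}, Continuous k → IntegrableOn k (Ioo 0 h) := fun hk =>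
    (hk.integrableOn_Icc).mono_set Ioo_subset_Icc_self
  set B := ∫ τ in Ioo 0 h, k τ * u' τ with hB
  have e1 : (∫ τ in Ioo 0 h, k' τ * u τ) - B = ∫ τ in Ioo 0 h, k' τ * (u τ - B) := by
    simp only [mul_sub]
    rw [integral_sub (hmul hk' hkM' hu) ((hki hk').mul_const B), integral_mul_const, h1', one_mul]
  have e2 : ∀ τ, ‖u τ - B‖ₑ ≤ ENNReal.ofReal M * ∫⁻ τ' in Ioo 0 h, ‖u τ - u' τ'‖ₑ := by
    intro τ
    have : u τ - B = ∫ τ' in Ioo 0 h, k τ' * (u τ - u' τ') := by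
      simp only [mul_sub]
      rw [integral_sub ((hki hk).mul_const _) (hmul hk hkM hu'), integral_mul_const, h1, one_mul]
    rw [this, ← lintegral_const_mul' _ _ (by simp)]
    refine (enorm_integral_le_lintegral_enorm _).trans (lintegral_mono fun τ' => ?_)
    rw [enorm_mul]
    gcongr
    rw [Real.enorm_eq_ofReal_abs]
    exact ENNReal.ofReal_le_ofReal (hkM τ')
  rw [e1, ENNReal.ofReal_mul hM', mul_assoc, ← lintegral_const_mul' (ENNReal.ofReal M) _ (by simp),
    ← lintegral_const_mul' _ _ (by simp)]
  refine (enorm_integral_le_lintegral_enorm _).trans (lintegral_mono fun τ => ?_)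
  rw [enorm_mul]
  gcongr
  · rw [Real.enorm_eq_ofReal_abs]
    exact ENNReal.ofReal_le_ofReal (hkM' τ)
  · exact e2 τ

theorem lintegral_polarPt_lt_top (hq : 7 ≤ q) {h : ℝ} (hh : h ≤ 1 / 5) {w : Plane → ℝ}
    (hw : Measurable w) (hwi : IntegrableOn w (omega q)) :
    ∫⁻ θ in Ioo (-π) π, ∫⁻ τ in Ioo 0 h, ‖w (polarPt q τ θ)‖ₑ < ⊤ :=
  (lintegral_polarPt_le hq hh hw.enorm).trans_lt (ENNReal.mul_lt_top (by simp)
    ((lintegral_mono_set (strip_subset_omega hq h)).trans_lt hwi.2))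

theorem lintegral_enorm_bAvg_le (hq : 7 ≤ q) {h : ℝ} (h0 : 0 < h) (hh : h ≤ 1 / 5) {w : Plane → ℝ}
    (hw : Measurable w) :
    ∫⁻ θ in Ioo (-π) π, ‖bAvg q h w θ‖ₑ ≤
      ENNReal.ofReal (5 * kapBound / h) * ∫⁻ x in strip q h, ‖w x‖ₑ := by
  have hC := kapBound_pos
  calc ∫⁻ θ in Ioo (-π) π, ‖bAvg q h w θ‖ₑ
      ≤ ∫⁻ θ in Ioo (-π) π, ENNReal.ofReal (kapBound / h) *
          ∫⁻ τ in Ioo 0 h, ‖w (polarPt q τ θ)‖ₑ := by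
        refine lintegral_mono fun θ => ?_
        rw [← lintegral_const_mul' _ _ (by simp)]
        refine (enorm_integral_le_lintegral_enorm _).trans (lintegral_mono fun τ => ?_)
        rw [enorm_mul]
        gcongr
        rw [Real.enorm_eq_ofReal_abs]
        exact ENNReal.ofReal_le_ofReal (abs_avgKernel_le h0 τ)
    _ = ENNReal.ofReal (kapBound / h) * ∫⁻ θ in Ioo (-π) π,
          ∫⁻ τ in Ioo 0 h, ‖w (polarPt q τ θ)‖ₑ := lintegral_const_mul' _ _ (by simp)
    _ ≤ ENNReal.ofReal (kapBound / h) * (5 * ∫⁻ x in strip q h, ‖w x‖ₑ) := by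
        gcongr
        exact lintegral_polarPt_le hq hh hw.enorm
    _ = _ := by
        rw [← mul_assoc, show (5 : ℝ≥0∞) = ENNReal.ofReal 5 by simp,
          ← ENNReal.ofReal_mul (by positivity)]
        congr 2; ring

theorem ae_integrableOn_polarPt (hq : 7 ≤ q) {h : ℝ} (hh : h ≤ 1 / 5) {w : Plane → ℝ}
    (hw : Measurable w) (hwi : IntegrableOn w (omega q)) :
    ∀ᵐ θ ∂(volume.restrict (Ioo (-π) π)),
      IntegrableOn (fun τ => w (polarPt q τ θ)) (Ioo 0 h) := by
  have hm : Measurable fun p : ℝ × ℝ => ‖w (polarPt q p.2 p.1)‖ₑ :=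
    hw.enorm.comp (measurable_polarPt_swap hq)
  have h1 := ae_lt_top (hm.lintegral_prod_right' (ν := volume.restrict (Ioo 0 h)))
    (lintegral_polarPt_lt_top hq hh hw hwi).ne
  filter_upwards [h1] with θ hθ
  exact ⟨(hw.comp ((measurable_polarPt_swap hq).comp
    (measurable_prodMk_left (x := θ)))).aestronglyMeasurable, hθ⟩

theorem ae_integrableOn_polarPt_shift (hq : 7 ≤ q) {h : ℝ} (hh : h ≤ 1 / 5) {w : Plane → ℝ}
    (hw : Measurable w) (hwi : IntegrableOn w (omega q)) (s : ℝ) :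
    ∀ᵐ θ ∂(volume.restrict (Ioo (-π) π)),
      IntegrableOn (fun τ => w (polarPt q τ (θ + s))) (Ioo 0 h) := by
  have hm : Measurable fun p : ℝ × ℝ => ‖w (polarPt q p.2 p.1)‖ₑ :=
    hw.enorm.comp (measurable_polarPt_swap hq)
  have hm' : Measurable fun θ => ∫⁻ τ in Ioo 0 h, ‖w (polarPt q τ θ)‖ₑ :=
    hm.lintegral_prod_right'
  have hper : Function.Periodic (fun θ => ∫⁻ τ in Ioo 0 h, ‖w (polarPt q τ θ)‖ₑ) (2 * π) :=
    fun θ => by simp only [polarPt_periodic hq _ θ]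
  have hfin := (lintegral_polarPt_lt_top hq hh hw hwi).ne
  rw [← lintegral_period_shift hper s] at hfin
  have h1 := ae_lt_top (hm'.comp (measurable_add_const s)) hfin
  filter_upwards [h1] with θ hθ
  exact ⟨(hw.comp ((measurable_polarPt_swap hq).comp
    (measurable_prodMk_left (x := θ + s)))).aestronglyMeasurable, hθ⟩

/-- By `enorm_avg_sub_le` on almost every pair of rays. The kernels are bounded by `kapBound / h`
and, as h' ≥ h/2, by `2 * kapBound / h`; their product is the constant. -/
theorem lintegral_bAvg_sub_le (hq : 7 ≤ q) {h h' : ℝ} (h0 : 0 < h) (hh : h ≤ 1 / 10)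
    (hh' : h' ≤ h) (hh2 : h / 2 ≤ h') {w : Plane → ℝ}
    (hw : Measurable w) (hwi : IntegrableOn w (omega q)) :
    ∫⁻ θ in Ioo (-π) π, ∫⁻ s in Ioo 0 (2 * h), ‖bAvg q h' w θ - bAvg q h w (θ + s)‖ₑ ≤
      ENNReal.ofReal (2 * kapBound ^ 2 / h ^ 2) * osc q w (Ioo 0 (2 * h)) (Ioo 0 h) := by
  have hC := kapBound_pos
  have h0' : 0 < h' := by linarith
  have hB := measurable_bAvg hq h hw
  have hB' := measurable_bAvg hq h' hw
  have hm : Measurable fun p : ℝ × ℝ => ‖bAvg q h' w p.1 - bAvg q h w (p.1 + p.2)‖ₑ :=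
    ((hB'.comp measurable_fst).sub (hB.comp (measurable_fst.add measurable_snd))).enorm
  set G : (ℝ × ℝ) × (ℝ × ℝ) → ℝ≥0∞ := fun p =>
    ‖w (polarPt q p.2.1 p.1.1) - w (polarPt q p.2.2 (p.1.1 + p.1.2))‖ₑ with hG
  have hGm : Measurable G := measurable_osc_integrand hq hw
  have hg1 : Measurable fun p : (ℝ × ℝ) × ℝ => ∫⁻ τ' in Ioo 0 h, G (p.1, (p.2, τ')) := by
    have : Measurable fun w : ((ℝ × ℝ) × ℝ) × ℝ => G (w.1.1, (w.1.2, w.2)) :=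
      hGm.comp (by fun_prop)
    exact this.lintegral_prod_right'
  have hg : Measurable fun p : ℝ × ℝ => ∫⁻ τ in Ioo 0 h, ∫⁻ τ' in Ioo 0 h, G (p, (τ, τ')) :=
    hg1.lintegral_prod_right'
  have hosc : osc q w (Ioo 0 (2 * h)) (Ioo 0 h) = ∫⁻ s in Ioo 0 (2 * h), ∫⁻ θ in Ioo (-π) π,
      ∫⁻ τ in Ioo 0 h, ∫⁻ τ' in Ioo 0 h, G ((θ, s), (τ, τ')) := by
    rw [osc, lintegral_box _ _ _ hGm]
    exact lintegral_lintegral_swap hg.aemeasurable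
  have hswap : ∫⁻ θ in Ioo (-π) π, ∫⁻ s in Ioo 0 (2 * h), ‖bAvg q h' w θ - bAvg q h w (θ + s)‖ₑ =
      ∫⁻ s in Ioo 0 (2 * h), ∫⁻ θ in Ioo (-π) π, ‖bAvg q h' w θ - bAvg q h w (θ + s)‖ₑ :=
    lintegral_lintegral_swap hm.aemeasurable
  rw [hosc, hswap, ← lintegral_const_mul' _ _ (by simp)]
  refine lintegral_mono fun s => ?_
  rw [← lintegral_const_mul' _ _ (by simp)]
  refine lintegral_mono_ae ?_
  filter_upwards [ae_integrableOn_polarPt hq (by linarith : h ≤ 1 / 5) hw hwi,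
    ae_integrableOn_polarPt_shift hq (by linarith : h ≤ 1 / 5) hw hwi s] with θ h1 h2
  rw [bAvg_eq h0' hh', bAvg_eq h0 le_rfl]
  have hk1 : ∫ τ in Ioo 0 h, avgKernel h' τ = 1 := by
    rw [← integral_avgKernel h0']
    refine setIntegral_eq_of_subset_of_forall_sdiff_eq_zero measurableSet_Ioo
      (Ioo_subset_Ioo le_rfl hh') fun τ hτ => avgKernel_eq_zero h0' hτ.2
  refine (enorm_avg_sub_le (M := kapBound / h) (M' := 2 * kapBound / h) (by positivity)
    (continuous_avgKernel h)
    (continuous_avgKernel h') (abs_avgKernel_le h0) (fun τ => ?_) (integral_avgKernel h0) hk1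
    h1 h2).trans (le_of_eq ?_)
  · refine (abs_avgKernel_le h0' τ).trans ?_
    rw [div_le_div_iff₀ h0' h0]
    nlinarith
  · congr 2
    field_simp

/-- The averages converge as the scale tends to zero, with a rate. -/
theorem lintegral_bAvg_half_sub_le (hq : 7 ≤ q) {h : ℝ} (h0 : 0 < h) (hh : h ≤ 1 / 10)
    {w : Plane → ℝ} (hw : Measurable w) (hwi : IntegrableOn w (omega q)) :
    ∫⁻ θ in Ioo (-π) π, ‖bAvg q h w θ - bAvg q (h / 2) w θ‖ₑ ≤
      ENNReal.ofReal (2 * kapBound ^ 2 / h ^ 3) * osc q w (Ioo 0 (2 * h)) (Ioo 0 h) := by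
  have hC := kapBound_pos
  set O := osc q w (Ioo 0 (2 * h)) (Ioo 0 h)
  have t1 := lintegral_bAvg_sub_le hq h0 hh le_rfl (by linarith) hw hwi
  have t2 := lintegral_bAvg_sub_le hq h0 hh (h' := h / 2) (by linarith) le_rfl hw hwi
  have hB := measurable_bAvg hq h hw
  have hB' := measurable_bAvg hq (h / 2) hw
  have hm : Measurable fun p : ℝ × ℝ => ‖bAvg q h w p.1 - bAvg q h w (p.1 + p.2)‖ₑ :=
    ((hB.comp measurable_fst).sub (hB.comp (measurable_fst.add measurable_snd))).enorm
  have hI : Measurable fun θ => ∫⁻ s in Ioo 0 (2 * h), ‖bAvg q h w θ - bAvg q h w (θ + s)‖ₑ :=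
    hm.lintegral_prod_right'
  -- The oscillation only compares rays at angles θ and θ + s. So both averages at θ are compared
  -- with the one at θ + s, and s is integrated over an interval of length 2h.
  have key : ENNReal.ofReal (2 * h) * ∫⁻ θ in Ioo (-π) π, ‖bAvg q h w θ - bAvg q (h / 2) w θ‖ₑ ≤
      ENNReal.ofReal (2 * h) * (ENNReal.ofReal (2 * kapBound ^ 2 / h ^ 3) * O) := by
    calc _ = ∫⁻ θ in Ioo (-π) π, ∫⁻ _s in Ioo 0 (2 * h), ‖bAvg q h w θ - bAvg q (h / 2) w θ‖ₑ := by
          rw [← lintegral_const_mul' _ _ ENNReal.ofReal_ne_top]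
          refine lintegral_congr fun θ => ?_
          rw [lintegral_const, Measure.restrict_apply_univ, Real.volume_Ioo, sub_zero, mul_comm]
      _ ≤ ∫⁻ θ in Ioo (-π) π, ((∫⁻ s in Ioo 0 (2 * h), ‖bAvg q h w θ - bAvg q h w (θ + s)‖ₑ) +
          ∫⁻ s in Ioo 0 (2 * h), ‖bAvg q (h / 2) w θ - bAvg q h w (θ + s)‖ₑ) := by
          refine lintegral_mono fun θ => ?_
          have hmθ : Measurable fun s => ‖bAvg q h w θ - bAvg q h w (θ + s)‖ₑ :=
            hm.comp (measurable_prodMk_left (x := θ))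
          rw [← lintegral_add_left hmθ]
          refine lintegral_mono fun s => ?_
          have e : bAvg q h w θ - bAvg q (h / 2) w θ = (bAvg q h w θ - bAvg q h w (θ + s)) -
            (bAvg q (h / 2) w θ - bAvg q h w (θ + s)) := by ring
          rw [e]
          exact enorm_sub_le
      _ ≤ ENNReal.ofReal (2 * kapBound ^ 2 / h ^ 2) * O +
          ENNReal.ofReal (2 * kapBound ^ 2 / h ^ 2) * O := by
          rw [lintegral_add_left hI]
          exact add_le_add t1 t2
      _ = _ := by
          rw [← add_mul, ← ENNReal.ofReal_add (by positivity) (by positivity), ← mul_assoc,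
            ← ENNReal.ofReal_mul (by positivity)]
          congr 2
          field_simp
          ring
  rwa [ENNReal.mul_le_mul_iff_right (by simp [h0]) ENNReal.ofReal_ne_top] at key

end Averages

/-! ### Cutoff functions and the flux through the boundary -/

section Flux

variable {q : ℕ}

/-- The measure `dθ dτ` on the parameter domain of the boundary strip of width `h`. -/
noncomputable def stripMeasure (h : ℝ) : Measure (ℝ × ℝ) :=
  (volume.restrict (Ioo (-π) π)).prod (volume.restrict (Ioo 0 h))

theorem map_stripMeasure (hq : 7 ≤ q) {h : ℝ} (hh : h ≤ 2 / 5) :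
    ((stripMeasure h).withDensity fun p => ENNReal.ofReal (radius q p.1 - p.2)).map
      (fun p => polarPt q p.2 p.1) = volume.restrict (strip q h) := by
  have hF := (continuous_radius hq).measurable
  have hρ : Measurable fun p : ℝ × ℝ => ENNReal.ofReal (radius q p.1 - p.2) :=
    ENNReal.measurable_ofReal.comp ((hF.comp measurable_fst).sub measurable_snd)
  have hP := measurable_polarPt_swap hq
  refine Measure.ext fun s hs => ?_
  rw [Measure.map_apply hP hs, withDensity_apply _ (hP hs), ← lintegral_indicator (hP hs),
    stripMeasure, lintegral_prod _ (hρ.indicator (hP hs)).aemeasurable, ← lintegral_indicator_one hs,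
    lintegral_strip hq hh (measurable_one.indicator hs)]
  refine lintegral_congr fun θ => lintegral_congr fun τ => ?_
  by_cases h1 : polarPt q τ θ ∈ s
  · rw [indicator_of_mem (by exact h1), indicator_of_mem h1]; simp
  · rw [indicator_of_notMem (by exact h1), indicator_of_notMem h1]; simp

theorem ae_stripMeasure_mem (h : ℝ) :
    ∀ᵐ p ∂stripMeasure h, p.1 ∈ Ioo (-π) π ∧ p.2 ∈ Ioo 0 h := by
  rw [stripMeasure, Measure.prod_restrict]
  filter_upwards [ae_restrict_mem (measurableSet_Ioo.prod measurableSet_Ioo)] with p hp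
  exact hp

theorem lintegral_stripMeasure_le (hq : 7 ≤ q) {h : ℝ} (hh : h ≤ 1 / 5) {φ : Plane → ℝ≥0∞}
    (hφ : Measurable φ) :
    ∫⁻ p, φ (polarPt q p.2 p.1) ∂stripMeasure h ≤ 5 * ∫⁻ x in strip q h, φ x := by
  have hm : Measurable fun p : ℝ × ℝ => φ (polarPt q p.2 p.1) := hφ.comp (measurable_polarPt_swap hq)
  rw [stripMeasure, lintegral_prod _ hm.aemeasurable]
  exact lintegral_polarPt_le hq hh hφ

theorem integrable_polarPt (hq : 7 ≤ q) {h : ℝ} (hh : h ≤ 1 / 5) {w : Plane → ℝ}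
    (hw : Measurable w) (hwi : IntegrableOn w (strip q h)) :
    Integrable (fun p : ℝ × ℝ => w (polarPt q p.2 p.1)) (stripMeasure h) :=
  ⟨(hw.comp (measurable_polarPt_swap hq)).aestronglyMeasurable,
    (lintegral_stripMeasure_le hq hh hw.enorm).trans_lt (ENNReal.mul_lt_top (by simp) hwi.2)⟩

theorem integral_strip (hq : 7 ≤ q) {h : ℝ} (hh : h ≤ 2 / 5) {w : Plane → ℝ} (hw : Measurable w) :
    ∫ x in strip q h, w x = ∫ p, (radius q p.1 - p.2) * w (polarPt q p.2 p.1) ∂stripMeasure h := by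
  have hF := (continuous_radius hq).measurable
  have hρ : Measurable fun p : ℝ × ℝ => (radius q p.1 - p.2).toNNReal :=
    ((hF.comp measurable_fst).sub measurable_snd).real_toNNReal
  rw [← map_stripMeasure hq hh, integral_map (measurable_polarPt_swap hq).aemeasurable
    hw.aestronglyMeasurable]
  have := integral_withDensity_eq_integral_smul (μ := stripMeasure h) hρ
    (fun p : ℝ × ℝ => w (polarPt q p.2 p.1))
  refine this.trans (integral_congr_ae ?_)
  filter_upwards [ae_stripMeasure_mem h] with p hp
  have h1 := (radius_bounds hq p.1).1
  rw [NNReal.smul_def, Real.coe_toNNReal _ (by linarith [hp.2.2]), smul_eq_mul]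

/-- The cutoff function near the boundary, at scale `h`. -/
noncomputable def chi (q : ℕ) (h : ℝ) (x : Plane) : ℝ := cut (depth q x / h)

theorem chi_eventually_eq_one (hq : 7 ≤ q) {h : ℝ} (h0 : 0 < h) (hh : h ≤ 1 / 5) :
    ∀ᶠ x in nhds (0 : Plane), chi q h x = 1 := by
  filter_upwards [Metric.ball_mem_nhds (0 : Plane) (ε := 1 / 5) (by norm_num)] with x hx
  rw [mem_ball_zero_iff] at hx
  refine cut_of_ge ?_
  rw [le_div_iff₀ h0, depth]
  linarith [(radius_bounds hq (angle x)).1]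

/-- No more than C¹ can be expected, since F is only C¹. Identities known for smooth test functions
are therefore extended by `integral_eq_of_contDiff_one` before the cutoff is inserted. -/
theorem contDiff_chi (hq : 7 ≤ q) {h : ℝ} (h0 : 0 < h) (hh : h ≤ 1 / 5) :
    ContDiff ℝ 1 (chi q h) := by
  rw [contDiff_iff_contDiffAt]
  intro x
  rcases eq_or_ne x 0 with rfl | hx
  · exact contDiffAt_const.congr_of_eventuallyEq (chi_eventually_eq_one hq h0 hh)
  · exact (contDiff_cut.of_le (by norm_cast)).contDiffAt.comp x
      ((contDiffAt_depth hq hx).div_const h)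

theorem fderiv_chi_zero (hq : 7 ≤ q) {h : ℝ} (h0 : 0 < h) (hh : h ≤ 1 / 5) :
    fderiv ℝ (chi q h) 0 = 0 := by
  have : chi q h =ᶠ[nhds 0] fun _ => 1 := chi_eventually_eq_one hq h0 hh
  rw [this.fderiv_eq, fderiv_const_apply]

theorem fderiv_chi (hq : 7 ≤ q) (h : ℝ) {x : Plane} (hx : x ≠ 0) :
    fderiv ℝ (chi q h) x = avgKernel h (depth q x) • dDepth q x := by
  have h1 := (hasDerivAt_cut (depth q x / h)).comp_hasFDerivAt x
    ((hasFDerivAt_depth hq hx).mul_const h⁻¹)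
  rw [smul_smul, ← div_eq_mul_inv] at h1
  exact h1.fderiv

theorem chi_eq_zero {h : ℝ} (h0 : 0 < h) {x : Plane} (hx : depth q x ≤ h / 4) :
    chi q h x = 0 := by
  refine cut_of_le ?_
  rw [div_le_iff₀ h0]
  linarith

theorem chi_mem (h : ℝ) (x : Plane) : 0 ≤ chi q h x ∧ chi q h x ≤ 1 := cut_mem _

theorem chi_eq_one {h : ℝ} (h0 : 0 < h) {x : Plane} (hx : h ≤ depth q x) :
    chi q h x = 1 := by
  refine cut_of_ge ?_
  rw [le_div_iff₀ h0]
  linarith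

theorem tsupport_chi_subset (hq : 7 ≤ q) {h : ℝ} (h0 : 0 < h) (hh : h ≤ 1 / 5) :
    tsupport (chi q h) ⊆ omega q := by
  intro x hx
  by_contra hxo
  rw [mem_omega_iff hq, not_lt] at hxo
  have hx0 : x ≠ 0 := ne_zero_of_depth_lt hq (by linarith)
  have hc := (contDiffAt_depth hq hx0).continuousAt
  refine notMem_tsupport_iff_eventuallyEq.2 ?_ hx
  filter_upwards [hc.eventually (gt_mem_nhds (show depth q x < h / 4 by linarith))] with y hy
  exact chi_eq_zero h0 hy.le

theorem hasCompactSupport_chi (hq : 7 ≤ q) {h : ℝ} (h0 : 0 < h) (hh : h ≤ 1 / 5) :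
    HasCompactSupport (chi q h) :=
  (isCompact_closedBall (0 : Plane) (8 / 5)).of_isClosed_subset (isClosed_tsupport _)
    ((tsupport_chi_subset hq h0 hh).trans ((omega_subset_ball hq).trans Metric.ball_subset_closedBall))

theorem fderiv_chi_eq_zero (hq : 7 ≤ q) {h : ℝ} (h0 : 0 < h) (hh : h ≤ 1 / 5) {x : Plane}
    (hx : x ∉ strip q h) : fderiv ℝ (chi q h) x = 0 := by
  rcases eq_or_ne x 0 with rfl | hx0
  · exact fderiv_chi_zero hq h0 hh
  · rw [fderiv_chi hq h hx0, avgKernel_eq_zero h0 (by exact hx), zero_smul]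

/-- The outward flux through the boundary of the averages of the field `X`. -/
noncomputable def flux (q : ℕ) (h : ℝ) (X : Fin 2 → Plane → ℝ) (θ : ℝ) : ℝ :=
  (radius q θ * cos θ + sepFun q θ * sin θ) * bAvg q h (X 0) θ +
    (radius q θ * sin θ - sepFun q θ * cos θ) * bAvg q h (X 1) θ

theorem abs_normal_le (hq : 7 ≤ q) (θ : ℝ) :
    |radius q θ * cos θ + sepFun q θ * sin θ| ≤ 2 ∧
      |radius q θ * sin θ - sepFun q θ * cos θ| ≤ 2 := by
  have h1 := radius_bounds hq θ
  have h2 := abs_sepFun_le hq θ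
  have hF : |radius q θ| ≤ 8 / 5 := abs_le.2 ⟨by linarith, h1.2⟩
  have hc := abs_cos_le_one θ
  have hs := abs_sin_le_one θ
  have m : ∀ {a b A : ℝ}, |a| ≤ A → |b| ≤ 1 → |a * b| ≤ A := fun ha hb => by
    rw [abs_mul]
    exact (mul_le_of_le_one_right (abs_nonneg _) hb).trans ha
  constructor
  · exact (abs_add_le _ _).trans (by linarith [m hF hc, m h2 hs])
  · exact (abs_sub _ _).trans (by linarith [m hF hs, m h2 hc])

theorem continuous_normal (hq : 7 ≤ q) :
    Continuous (fun θ => radius q θ * cos θ + sepFun q θ * sin θ) ∧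
      Continuous (fun θ => radius q θ * sin θ - sepFun q θ * cos θ) := by
  have h1 := continuous_radius hq
  have h2 := continuous_sepFun hq
  exact ⟨by fun_prop, by fun_prop⟩

theorem integrable_mul_bAvg (hq : 7 ≤ q) {h : ℝ} (h0 : 0 < h) (hh : h ≤ 1 / 5) {w : Plane → ℝ}
    (hw : Measurable w) (hwi : IntegrableOn w (strip q h)) {m : ℝ → ℝ} (hm : Continuous m) {M : ℝ}
    (hmM : ∀ θ, |m θ| ≤ M) :
    Integrable (fun p : ℝ × ℝ => m p.1 * (avgKernel h p.2 * w (polarPt q p.2 p.1)))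
      (stripMeasure h) ∧
    IntegrableOn (fun θ => m θ * bAvg q h w θ) (Ioo (-π) π) ∧
    ∫ θ in Ioo (-π) π, m θ * bAvg q h w θ =
      ∫ p, m p.1 * (avgKernel h p.2 * w (polarPt q p.2 p.1)) ∂stripMeasure h := by
  have hi := integrable_polarPt hq hh hw hwi
  have hk := continuous_avgKernel h
  have h1 : Integrable (fun p : ℝ × ℝ => m p.1 * (avgKernel h p.2 * w (polarPt q p.2 p.1)))
      (stripMeasure h) :=
    (hi.bdd_mul (c := kapBound / h) (by fun_prop : Continuous fun p : ℝ × ℝ =>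
      avgKernel h p.2).aestronglyMeasurable (.of_forall fun p => abs_avgKernel_le h0 _)).bdd_mul
      (c := M) (by fun_prop : Continuous fun p : ℝ × ℝ => m p.1).aestronglyMeasurable
      (.of_forall fun p => hmM _)
  have e : ∀ θ, ∫ τ in Ioo 0 h, m θ * (avgKernel h τ * w (polarPt q τ θ)) = m θ * bAvg q h w θ :=
    fun θ => by rw [integral_const_mul, bAvg]
  refine ⟨h1, ?_, ?_⟩
  · have := h1.integral_prod_left
    simp only [e] at this
    exact this
  · rw [stripMeasure, integral_prod _ h1]
    simp only [e]

theorem integrableOn_mul_flux (hq : 7 ≤ q) {h : ℝ} (h0 : 0 < h) (hh : h ≤ 1 / 5)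
    {X : Fin 2 → Plane → ℝ} (hX : ∀ i, Measurable (X i))
    (hXi : ∀ i, IntegrableOn (X i) (strip q h)) {m : ℝ → ℝ} (hm : Continuous m) {M : ℝ}
    (hmM : ∀ θ, |m θ| ≤ M) :
    IntegrableOn (fun θ => m θ * flux q h X θ) (Ioo (-π) π) ∧
    Integrable (fun p : ℝ × ℝ => m p.1 * (avgKernel h p.2 *
      ((radius q p.1 * cos p.1 + sepFun q p.1 * sin p.1) * X 0 (polarPt q p.2 p.1) +
        (radius q p.1 * sin p.1 - sepFun q p.1 * cos p.1) * X 1 (polarPt q p.2 p.1))))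
      (stripMeasure h) ∧
    ∫ θ in Ioo (-π) π, m θ * flux q h X θ =
      ∫ p, m p.1 * (avgKernel h p.2 *
      ((radius q p.1 * cos p.1 + sepFun q p.1 * sin p.1) * X 0 (polarPt q p.2 p.1) +
        (radius q p.1 * sin p.1 - sepFun q p.1 * cos p.1) * X 1 (polarPt q p.2 p.1)))
        ∂stripMeasure h := by
  have hM : 0 ≤ M := (abs_nonneg _).trans (hmM 0)
  have hb : ∀ {n : ℝ → ℝ}, (∀ θ, |n θ| ≤ 2) → ∀ θ, |m θ * n θ| ≤ M * 2 := fun hn θ => by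
    rw [abs_mul]
    exact mul_le_mul (hmM θ) (hn θ) (abs_nonneg _) hM
  have m0 : Continuous fun θ => m θ * (radius q θ * cos θ + sepFun q θ * sin θ) :=
    hm.mul (continuous_normal hq).1
  have m1 : Continuous fun θ => m θ * (radius q θ * sin θ - sepFun q θ * cos θ) :=
    hm.mul (continuous_normal hq).2
  obtain ⟨a1, a2, a3⟩ := integrable_mul_bAvg hq h0 hh (hX 0) (hXi 0) m0
    (hb fun θ => (abs_normal_le hq θ).1)
  obtain ⟨b1, b2, b3⟩ := integrable_mul_bAvg hq h0 hh (hX 1) (hXi 1) m1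
    (hb fun θ => (abs_normal_le hq θ).2)
  refine ⟨(a2.add b2).congr (.of_forall fun θ => ?_), (a1.add b1).congr (.of_forall fun p => ?_), ?_⟩
  · simp only [flux, Pi.add_apply]; ring
  · simp only [Pi.add_apply]; ring
  · calc _ = ∫ θ in Ioo (-π) π, (m θ * (radius q θ * cos θ + sepFun q θ * sin θ) *
          bAvg q h (X 0) θ + m θ * (radius q θ * sin θ - sepFun q θ * cos θ) *
          bAvg q h (X 1) θ) := by
          congr 1; ext θ; simp only [flux]; ring
      _ = _ := by
          rw [integral_add a2 b2, a3, b3, ← integral_add a1 b1]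
          congr 1; ext p; ring

/-- The gradient of `chi q h` is `avgKernel h` times the gradient of the depth, and multiplication
by the polar density F - τ turns the latter into τ e_r - n, with n = F e_r - f e_θ. So the integral
over the domain is minus the flux weighted by the boundary values `ψ` of `g`, up to errors with a
factor τ, which compensates the size 1/h of the kernel. -/
theorem enorm_integral_partialDeriv_chi_add_le (hq : 7 ≤ q) {h : ℝ} (h0 : 0 < h) (hh : h ≤ 1 / 5)
    {X : Fin 2 → Plane → ℝ} (hX : ∀ i, Measurable (X i)) (hXi : ∀ i, IntegrableOn (X i) (omega q))
    {g : Plane → ℝ} (hg : Measurable g) {ψ : ℝ → ℝ} (hψ : Continuous ψ) {L M : ℝ} (hL : 0 ≤ L)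
    (hM : ∀ θ, |ψ θ| ≤ M)
    (hgψ : ∀ θ ∈ Ioo (-π) π, ∀ τ ∈ Ioo 0 h, |g (polarPt q τ θ) - ψ θ| ≤ L * τ) :
    ‖(∫ x in omega q, g x * ∑ i, X i x * partialDeriv i (chi q h) x) +
      ∫ θ in Ioo (-π) π, ψ θ * flux q h X θ‖ₑ ≤
      ENNReal.ofReal (5 * (kapBound * (3 * L + M))) * ∑ i, ∫⁻ x in strip q h, ‖X i x‖ₑ := by
  have hC := kapBound_pos
  have hM0 : 0 ≤ M := (abs_nonneg _).trans (hM 0)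
  have hXs : ∀ i, IntegrableOn (X i) (strip q h) := fun i =>
    (hXi i).mono_set (strip_subset_omega hq h)
  obtain ⟨-, f2, f3⟩ := integrableOn_mul_flux hq h0 hh hX hXs hψ hM
  set n : ℝ × ℝ → ℝ := fun p =>
    (radius q p.1 * cos p.1 + sepFun q p.1 * sin p.1) * X 0 (polarPt q p.2 p.1) +
        (radius q p.1 * sin p.1 - sepFun q p.1 * cos p.1) * X 1 (polarPt q p.2 p.1) with hn
  set t : ℝ × ℝ → ℝ := fun p =>
    cos p.1 * X 0 (polarPt q p.2 p.1) + sin p.1 * X 1 (polarPt q p.2 p.1) with ht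
  have hχ := contDiff_chi hq h0 hh
  have hχm : ∀ i, Measurable fun x => partialDeriv i (chi q h) x := fun i =>
    ((hχ.continuous_fderiv one_ne_zero).clm_apply continuous_const).measurable
  have hΦ : Measurable fun x => g x * ∑ i, X i x * partialDeriv i (chi q h) x :=
    hg.mul (Finset.measurable_fun_sum _ fun i _ => (hX i).mul (hχm i))
  have e1 : ∫ x in omega q, g x * ∑ i, X i x * partialDeriv i (chi q h) x =
      ∫ x in strip q h, g x * ∑ i, X i x * partialDeriv i (chi q h) x := by
    refine setIntegral_eq_of_subset_of_forall_sdiff_eq_zero (isOpen_omega hq).measurableSet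
      (strip_subset_omega hq h) fun x hx => ?_
    simp [partialDeriv, fderiv_chi_eq_zero hq h0 hh hx.2]
  have pt : ∀ p : ℝ × ℝ, p.2 ∈ Ioo 0 h → (radius q p.1 - p.2) * (g (polarPt q p.2 p.1) *
      ∑ i, X i (polarPt q p.2 p.1) * partialDeriv i (chi q h) (polarPt q p.2 p.1)) =
      g (polarPt q p.2 p.1) * (avgKernel h p.2 * (p.2 * t p - n p)) := by
    intro p hp
    have hr : 0 < radius q p.1 - p.2 := by linarith [(radius_bounds hq p.1).1, hp.2]
    have hd : depth q (polarPt q p.2 p.1) = p.2 := depth_polarPt hq (by linarith)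
    have hne : polarPt q p.2 p.1 ≠ 0 := ne_zero_of_depth_lt hq (by linarith [hp.2])
    simp only [partialDeriv, fderiv_chi hq h hne, hd, Fin.sum_univ_two, smul_apply, smul_eq_mul]
    have d0 : ∀ w, dDepth q (polarPt q p.2 p.1) w = sepFun q p.1 / (radius q p.1 - p.2) *
        (w 1 * cos p.1 - w 0 * sin p.1) - (w 0 * cos p.1 + w 1 * sin p.1) := fun w => by
      rw [polarPt]; exact dDepth_smul_er hr p.1 w
    rw [d0, d0]
    simp only [hn, ht, PiLp.single_apply]
    simp
    field_simp
    ring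
  rw [e1, integral_strip hq (by linarith) hΦ, f3]
  have e2 : ∫ p, (radius q p.1 - p.2) * (g (polarPt q p.2 p.1) *
      ∑ i, X i (polarPt q p.2 p.1) * partialDeriv i (chi q h) (polarPt q p.2 p.1)) ∂stripMeasure h =
      ∫ p, g (polarPt q p.2 p.1) * (avgKernel h p.2 * (p.2 * t p - n p)) ∂stripMeasure h := by
    refine integral_congr_ae ?_
    filter_upwards [ae_stripMeasure_mem h] with p hp using pt p hp.2
  have bd : ∀ p : ℝ × ℝ, p.1 ∈ Ioo (-π) π → p.2 ∈ Ioo 0 h →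
      |g (polarPt q p.2 p.1) * (avgKernel h p.2 * (p.2 * t p - n p)) +
        ψ p.1 * (avgKernel h p.2 * n p)| ≤ kapBound * (3 * L + M) *
          (|X 0 (polarPt q p.2 p.1)| + |X 1 (polarPt q p.2 p.1)|) := by
    intro p hp1 hp2
    have k1 := abs_avgKernel_mul_le h0 hp2
    have k2 := hgψ p.1 hp1 p.2 hp2
    have k3 := hM p.1
    set A := |X 0 (polarPt q p.2 p.1)| + |X 1 (polarPt q p.2 p.1)| with hA
    have hA0 : 0 ≤ A := by positivity
    have n1 : |n p| ≤ 2 * A := by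
      refine (abs_add_le _ _).trans ?_
      rw [abs_mul, abs_mul, hA, mul_add]
      gcongr
      · exact (abs_normal_le hq p.1).1
      · exact (abs_normal_le hq p.1).2
    have t1 : |t p| ≤ A := by
      refine (abs_add_le _ _).trans ?_
      rw [abs_mul, abs_mul, hA]
      have := abs_cos_le_one p.1
      have := abs_sin_le_one p.1
      nlinarith [abs_nonneg (X 0 (polarPt q p.2 p.1)), abs_nonneg (X 1 (polarPt q p.2 p.1))]
    have g1 : |g (polarPt q p.2 p.1)| ≤ L + M := by
      have : |g (polarPt q p.2 p.1)| ≤ |g (polarPt q p.2 p.1) - ψ p.1| + |ψ p.1| := by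
        simpa using abs_add_le (g (polarPt q p.2 p.1) - ψ p.1) (ψ p.1)
      nlinarith [hp2.1, hp2.2]
    have e : g (polarPt q p.2 p.1) * (avgKernel h p.2 * (p.2 * t p - n p)) +
        ψ p.1 * (avgKernel h p.2 * n p) = avgKernel h p.2 *
          (g (polarPt q p.2 p.1) * (p.2 * t p) - (g (polarPt q p.2 p.1) - ψ p.1) * n p) := by ring
    rw [e, abs_mul]
    calc |avgKernel h p.2| * |g (polarPt q p.2 p.1) * (p.2 * t p) -
          (g (polarPt q p.2 p.1) - ψ p.1) * n p|
        ≤ |avgKernel h p.2| * ((L + M) * (p.2 * A) + L * p.2 * (2 * A)) := by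
          gcongr
          refine (abs_sub _ _).trans ?_
          rw [abs_mul, abs_mul, abs_mul, abs_of_pos hp2.1]
          have := hp2.1.le
          gcongr
      _ = |avgKernel h p.2| * p.2 * (3 * L + M) * A := by ring
      _ ≤ _ := by gcongr
  -- Integrability is not an extra assumption: the integrand is the sum bounded in `bd` minus the
  -- integrable flux term.
  by_cases hint : Integrable (fun p : ℝ × ℝ =>
      g (polarPt q p.2 p.1) * (avgKernel h p.2 * (p.2 * t p - n p))) (stripMeasure h)
  swap
  · exfalso
    refine hint ?_
    have hP := measurable_polarPt_swap hq
    have hm0 : ∀ i, Measurable fun p : ℝ × ℝ => X i (polarPt q p.2 p.1) := fun i => (hX i).comp hP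
    have hmg : Measurable fun p : ℝ × ℝ => g (polarPt q p.2 p.1) := hg.comp hP
    have hF := (continuous_radius hq).measurable
    have hf := (continuous_sepFun hq).measurable
    have hk := (continuous_avgKernel h).measurable
    have hmt : Measurable t := by
      have := hm0 0; have := hm0 1
      fun_prop
    have hmn : Measurable n := by
      have := hm0 0; have := hm0 1
      fun_prop
    have hS : Integrable (fun p : ℝ × ℝ => kapBound * (3 * L + M) *
          (|X 0 (polarPt q p.2 p.1)| + |X 1 (polarPt q p.2 p.1)|)) (stripMeasure h) :=
      ((integrable_polarPt hq hh (hX 0) (hXs 0)).abs.add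
        (integrable_polarPt hq hh (hX 1) (hXs 1)).abs).const_mul _
    have hsum : Integrable (fun p : ℝ × ℝ =>
        g (polarPt q p.2 p.1) * (avgKernel h p.2 * (p.2 * t p - n p)) +
        ψ p.1 * (avgKernel h p.2 * n p)) (stripMeasure h) := by
      refine hS.mono' ?_ ?_
      · have := hψ.measurable
        exact Measurable.aestronglyMeasurable (by fun_prop)
      · filter_upwards [ae_stripMeasure_mem h] with p hp using bd p hp.1 hp.2
    refine (hsum.sub f2).congr (.of_forall fun p => ?_)
    simp only [Pi.sub_apply, hn]
    ring
  rw [e2, ← integral_add hint f2]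
  refine (enorm_integral_le_lintegral_enorm _).trans ?_
  have hmi : ∀ i, Measurable fun x => ‖X i x‖ₑ := fun i => (hX i).enorm
  calc _ ≤ ∫⁻ p, ENNReal.ofReal (kapBound * (3 * L + M)) *
        ∑ i, ‖X i (polarPt q p.2 p.1)‖ₑ ∂stripMeasure h := by
        refine lintegral_mono_ae ?_
        filter_upwards [ae_stripMeasure_mem h] with p hp
        rw [Fin.sum_univ_two, Real.enorm_eq_ofReal_abs, Real.enorm_eq_ofReal_abs,
          Real.enorm_eq_ofReal_abs, ← ENNReal.ofReal_add (abs_nonneg _) (abs_nonneg _),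
          ← ENNReal.ofReal_mul (by positivity)]
        exact ENNReal.ofReal_le_ofReal (bd p hp.1 hp.2)
    _ ≤ ENNReal.ofReal (kapBound * (3 * L + M)) *
        (5 * ∫⁻ x in strip q h, ∑ i, ‖X i x‖ₑ) := by
        rw [lintegral_const_mul' _ _ ENNReal.ofReal_ne_top]
        gcongr
        exact lintegral_stripMeasure_le hq hh (φ := fun x => ∑ i, ‖X i x‖ₑ)
          (Finset.measurable_fun_sum _ fun i _ => hmi i)
    _ = _ := by
        rw [lintegral_finsetSum' _ fun i _ => (hmi i).aemeasurable, ← mul_assoc, mul_comm _ (5 : ℝ≥0∞),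
          ENNReal.ofReal_mul (by norm_num : (0 : ℝ) ≤ 5), ENNReal.ofReal_ofNat]

end Flux

/-! ### Fields without normal component -/

section Core

variable {q : ℕ}

/-- A vector field `X` on `omega q` with small oscillation near the boundary which satisfies
`-div X = l` in `omega q` and `n · X = 0` on the boundary, in the weak sense. -/
structure FluxField (q : ℕ) (X : Fin 2 → Plane → ℝ) (l : Plane → ℝ) : Prop where
  meas : ∀ i, Measurable (X i)
  integrable : ∀ i, IntegrableOn (X i) (omega q)
  source : IntegrableOn l (omega q)
  stripBound : ∀ i, StripBound q (X i) (1 / 2)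
  oscBound : ∀ i, ∃ η : ℝ, 0 < η ∧ OscBound q (X i) (3 + η)
  -- Since Ψ need not vanish on the boundary, this identity contains the boundary condition n·X = 0.
  eq : ∀ Ψ : Plane → ℝ, ContDiff ℝ 1 Ψ →
    ∫ x in omega q, ∑ i, X i x * partialDeriv i Ψ x = ∫ x in omega q, l x * Ψ x

/-- Uniform constants in the bounds for a flux field. -/
theorem FluxField.exists_bounds {X : Fin 2 → Plane → ℝ} {l : Plane → ℝ} (hX : FluxField q X l) :
    ∃ C η h₀ : ℝ, 0 ≤ C ∧ 0 < η ∧ 0 < h₀ ∧ h₀ ≤ 1 / 10 ∧ ∀ h, 0 < h → h ≤ h₀ →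
      (∑ i, osc q (X i) (Ioo 0 (2 * h)) (Ioo 0 h) ≤ ENNReal.ofReal (C * h ^ (3 + η))) ∧
      (∑ i, ∫⁻ x in strip q h, ‖X i x‖ₑ ≤ ENNReal.ofReal (C * h ^ (1 / 2 : ℝ))) := by
  choose η hη C hC h₀ hh hh' hO using hX.oscBound
  choose C' hC' h₀' hk hk' hS using hX.stripBound
  refine ⟨∑ i, ((C i).toReal + (C' i).toReal), min (η 0) (η 1),
    min (min (h₀ 0) (h₀ 1)) (min (h₀' 0) (h₀' 1)), by positivity, lt_min (hη 0) (hη 1),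
    lt_min (lt_min (hh 0) (hh 1)) (lt_min (hk 0) (hk 1)),
    (min_le_left _ _).trans ((min_le_left _ _).trans (hh' 0)), fun h h0 hle => ?_⟩
  have hle1 : ∀ i, h ≤ h₀ i := by
    intro i
    have := hle.trans (min_le_left _ _)
    fin_cases i
    · exact this.trans (min_le_left _ _)
    · exact this.trans (min_le_right _ _)
  have hle2 : ∀ i, h ≤ h₀' i := by
    intro i
    have := hle.trans (min_le_right _ _)
    fin_cases i
    · exact this.trans (min_le_left _ _)
    · exact this.trans (min_le_right _ _)
  have hη' : ∀ i, min (η 0) (η 1) ≤ η i := by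
    intro i
    fin_cases i
    · exact min_le_left _ _
    · exact min_le_right _ _
  have h1 : h ≤ 1 := by linarith [hle1 0, hh' 0]
  -- The family `D'` merely enlarges the constant, so that both estimates share the same one.
  have key : ∀ (D D' : Fin 2 → ℝ≥0∞) (a : Fin 2 → ℝ≥0∞) (t : ℝ), 0 ≤ t → (∀ i, D i ≠ ⊤) →
      (∀ i, a i ≤ D i * ENNReal.ofReal t) → ∑ i, a i ≤
        ENNReal.ofReal ((∑ i, ((D i).toReal + (D' i).toReal)) * t) := by
    intro D D' a t ht hD ha
    rw [Finset.sum_mul, ENNReal.ofReal_sum_of_nonneg (fun i _ => by positivity)]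
    refine Finset.sum_le_sum fun i _ => (ha i).trans ?_
    rw [ENNReal.ofReal_mul (by positivity)]
    gcongr
    rw [ENNReal.ofReal_add (by positivity) (by positivity), ENNReal.ofReal_toReal (hD i)]
    exact le_self_add
  constructor
  · refine key C C' _ _ (by positivity) hC fun i => (hO i h h0 (hle1 i)).trans ?_
    gcongr 1
    exact ENNReal.ofReal_le_ofReal (rpow_le_rpow_of_exponent_ge h0 h1 (by linarith [hη' i]))
  · have := key C' C _ (h ^ (1 / 2 : ℝ)) (by positivity) hC' fun i => hS i h h0 (hle2 i)
    simpa only [add_comm] using this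

theorem tendsto_rpow_zero {u : ℕ → ℝ} (hu : Filter.Tendsto u Filter.atTop (nhds 0)) {a : ℝ}
    (ha : 0 < a) (C : ℝ) :
    Filter.Tendsto (fun j => ENNReal.ofReal (C * u j ^ a)) Filter.atTop (nhds 0) := by
  have h1 := (hu.rpow_const (Or.inr ha.le)).const_mul C
  rw [zero_rpow ha.ne', mul_zero] at h1
  simpa using ENNReal.tendsto_ofReal h1

theorem tendsto_chi (hq : 7 ≤ q) {u : ℕ → ℝ} (hu : Filter.Tendsto u Filter.atTop (nhds 0))
    (hu0 : ∀ j, 0 < u j) {x : Plane} (hx : x ∈ omega q) :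
    Filter.Tendsto (fun j => chi q (u j) x) Filter.atTop (nhds 1) := by
  rw [mem_omega_iff hq] at hx
  refine tendsto_const_nhds.congr' ?_
  filter_upwards [hu.eventually (gt_mem_nhds hx)] with j hj
  exact (chi_eq_one (hu0 j) hj.le).symm

/-- Test the equation with ψ(θ)(1 - χ), where χ is the cutoff at scale `u j`. The terms without
derivatives of χ vanish in the limit by dominated convergence, because χ → 1 in the domain. What
remains is the integral of ψ X·∇χ, which is minus the flux weighted by ψ up to a vanishing error.
The factor 1 - χ removes the singularity of the angle at the origin, and the support of ψ its jump
on the negative half axis. -/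
theorem FluxField.tendsto_integral_flux (hq : 7 ≤ q) {X : Fin 2 → Plane → ℝ} {l : Plane → ℝ}
    (hX : FluxField q X l) {ψ : ℝ → ℝ} (hψ : ContDiff ℝ 1 ψ) {a : ℝ} (ha0 : 0 < a) (ha : a < π)
    (hs : ∀ θ, ψ θ ≠ 0 → |θ| ≤ a) {u : ℕ → ℝ} (hu : Filter.Tendsto u Filter.atTop (nhds 0))
    (hu0 : ∀ j, 0 < u j) (hu1 : ∀ j, u j ≤ 1 / 10) :
    Filter.Tendsto (fun j => ∫ θ in Ioo (-π) π, ψ θ * flux q (u j) X θ) Filter.atTop (nhds 0) := by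
  have hψd : ∀ θ, HasDerivAt ψ (deriv ψ θ) θ := fun θ =>
    (hψ.differentiable one_ne_zero θ).hasDerivAt
  have hψ'c : Continuous (deriv ψ) := hψ.continuous_deriv le_rfl
  have hcs : HasCompactSupport ψ := by
    refine HasCompactSupport.intro (isCompact_Icc (a := -a) (b := a)) fun θ hθ => ?_
    by_contra hne
    exact hθ (abs_le.1 (hs θ hne))
  obtain ⟨M, hM⟩ := hcs.exists_bound_of_continuous hψ.continuous
  obtain ⟨M', hM'⟩ := hcs.deriv.exists_bound_of_continuous hψ'c
  have hM0 : 0 ≤ M := (norm_nonneg _).trans (hM 0)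
  have hM0' : 0 ≤ M' := (norm_nonneg _).trans (hM' 0)
  set g : Plane → ℝ := fun x => ψ (angle x) with hg
  have hgm : Measurable g := hψ.continuous.measurable.comp measurable_angle
  have hgd : ∀ x : Plane, x ≠ 0 → ContDiffAt ℝ 1 g x ∧
      HasFDerivAt g (deriv ψ (angle x) • dAngle x) x := fun x hx =>
    hasFDerivAt_comp_angle_of_support hψd hψ'c ha ha0 hs hx
  set s : Plane → ℝ := fun x =>
    ∑ i, X i x * (deriv ψ (angle x) * dAngle x (EuclideanSpace.single i 1)) - l x * g x with hs_def
  have near : ∀ j, ∀ x : Plane, ‖x‖ < 1 / 5 → chi q (u j) x = 1 := fun j x hx => by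
    refine chi_eq_one (hu0 j) ?_
    rw [depth]
    linarith [(radius_bounds hq (angle x)).1, hu1 j]
  have hu5 : ∀ j, u j ≤ 1 / 5 := fun j => by linarith [hu1 j]
  have identity : ∀ j, ∫ x in omega q, g x * ∑ i, X i x * partialDeriv i (chi q (u j)) x =
      ∫ x in omega q, (1 - chi q (u j) x) * s x := by
    intro j
    have hχ := contDiff_chi hq (hu0 j) (hu5 j)
    have hΨc : ContDiff ℝ 1 fun x => g x * (1 - chi q (u j) x) := by
      rw [contDiff_iff_contDiffAt]
      intro x
      rcases eq_or_ne x 0 with rfl | hx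
      · refine (contDiffAt_const (c := (0 : ℝ))).congr_of_eventuallyEq ?_
        filter_upwards [Metric.ball_mem_nhds (0 : Plane) (ε := 1 / 5) (by norm_num)] with x hx
        rw [mem_ball_zero_iff] at hx
        rw [near j x hx, sub_self, mul_zero]
      · exact (hgd x hx).1.mul (contDiffAt_const.sub hχ.contDiffAt)
    have hΨd : ∀ i x, partialDeriv i (fun x => g x * (1 - chi q (u j) x)) x =
        (1 - chi q (u j) x) * (deriv ψ (angle x) * dAngle x (EuclideanSpace.single i 1)) -
          g x * partialDeriv i (chi q (u j)) x := by
      intro i x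
      rcases eq_or_ne x 0 with rfl | hx
      · have e : (fun x => g x * (1 - chi q (u j) x)) =ᶠ[nhds 0] fun _ => 0 := by
          filter_upwards [Metric.ball_mem_nhds (0 : Plane) (ε := 1 / 5) (by norm_num)] with x hx
          rw [mem_ball_zero_iff] at hx
          rw [near j x hx, sub_self, mul_zero]
        rw [partialDeriv, e.fderiv_eq, fderiv_const_apply, near j 0 (by simp), partialDeriv,
          fderiv_chi_zero hq (hu0 j) (hu5 j)]
        simp
      · have : HasFDerivAt (fun x => g x * (1 - chi q (u j) x)) _ x := (hgd x hx).2.mul ((hasFDerivAt_const (1 : ℝ) x).sub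
          (hχ.differentiable one_ne_zero x).hasFDerivAt)
        rw [partialDeriv, this.fderiv, partialDeriv]
        simp
        ring
    have h1 := hX.eq _ hΨc
    have hXχ : ∀ i, IntegrableOn (fun x => X i x * partialDeriv i (chi q (u j)) x) (omega q) := by
      intro i
      have hc : Continuous (partialDeriv i (chi q (u j))) :=
        (hχ.continuous_fderiv one_ne_zero).clm_apply continuous_const
      have hcs : HasCompactSupport (partialDeriv i (chi q (u j))) :=
        (hasCompactSupport_chi hq (hu0 j) (hu5 j)).fderiv_apply (𝕜 := ℝ) _
      obtain ⟨B, hB⟩ := hcs.exists_bound_of_continuous hc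
      exact (hX.integrable i).mul_bdd hc.aestronglyMeasurable (.of_forall hB)
    have i1 : IntegrableOn (fun x => g x * ∑ i, X i x * partialDeriv i (chi q (u j)) x)
        (omega q) := by
      refine (integrable_finsetSum _ fun i _ => hXχ i).bdd_mul (c := M) hgm.aestronglyMeasurable
        (.of_forall fun x => hM _)
    have hχm : ∀ i, Measurable fun x => partialDeriv i (chi q (u j)) x := fun i =>
      ((hχ.continuous_fderiv one_ne_zero).clm_apply continuous_const).measurable
    have hΨm : ∀ i, Continuous fun x => partialDeriv i (fun x => g x * (1 - chi q (u j) x)) x :=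
      fun i => (hΨc.continuous_fderiv one_ne_zero).clm_apply continuous_const
    have hΨcs : ∀ i, ∃ B, ∀ x ∈ omega q,
        ‖partialDeriv i (fun x => g x * (1 - chi q (u j) x)) x‖ ≤ B := by
      intro i
      obtain ⟨B, hB⟩ := (isCompact_closedBall (0 : Plane) (8 / 5)).exists_bound_of_continuousOn
        (hΨm i).continuousOn
      exact ⟨B, fun x hx => hB x (Metric.ball_subset_closedBall (omega_subset_ball hq hx))⟩
    have i2 : ∀ i, IntegrableOn (fun x => X i x *
        partialDeriv i (fun x => g x * (1 - chi q (u j) x)) x) (omega q) := by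
      intro i
      obtain ⟨B, hB⟩ := hΨcs i
      refine (hX.integrable i).mul_bdd (c := B) (hΨm i).aestronglyMeasurable ?_
      filter_upwards [ae_restrict_mem (isOpen_omega hq).measurableSet] with x hx using hB x hx
    have i3 : IntegrableOn (fun x => l x * (g x * (1 - chi q (u j) x))) (omega q) := by
      refine hX.source.mul_bdd (c := M) hΨc.continuous.aestronglyMeasurable (.of_forall fun x => ?_)
      rw [norm_mul]
      have := chi_mem (q := q) (u j) x
      have h2 : ‖1 - chi q (u j) x‖ ≤ 1 := by
        rw [Real.norm_eq_abs, abs_le]; constructor <;> linarith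
      exact (mul_le_of_le_one_right (norm_nonneg _) h2).trans (hM _)
    have e : ∀ x, g x * ∑ i, X i x * partialDeriv i (chi q (u j)) x = (1 - chi q (u j) x) * s x -
        ((∑ i, X i x * partialDeriv i (fun x => g x * (1 - chi q (u j) x)) x) -
          l x * (g x * (1 - chi q (u j) x))) := by
      intro x
      simp only [hΨd, hs_def, Fin.sum_univ_two]
      ring
    have e' : ∀ x, (1 - chi q (u j) x) * s x = g x * ∑ i, X i x * partialDeriv i (chi q (u j)) x +
        ((∑ i, X i x * partialDeriv i (fun x => g x * (1 - chi q (u j) x)) x) -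
          l x * (g x * (1 - chi q (u j) x))) := fun x => by rw [e x]; ring
    simp_rw [e']
    have i4 := (integrable_finsetSum Finset.univ fun i _ => i2 i)
    have i5 : ∫ x in omega q, ((∑ i, X i x * partialDeriv i (fun x => g x * (1 - chi q (u j) x)) x) -
        l x * (g x * (1 - chi q (u j) x))) = 0 := by rw [integral_sub i4 i3, h1, sub_self]
    exact (add_zero _).symm.trans ((congrArg _ i5.symm).trans (integral_add i1 (i4.sub i3)).symm)
  have hbound : ∀ j x, ‖(1 - chi q (u j) x) * s x‖ ≤ 5 * M' * ∑ i, |X i x| + M * |l x| := by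
    intro j x
    have hB0 : 0 ≤ 5 * M' * ∑ i, |X i x| + M * |l x| := by positivity
    -- The differential of the angle is of size 1/‖x‖, hence at most 5 wherever 1 - χ can be
    -- nonzero.
    rcases lt_or_ge ‖x‖ (1 / 5) with hx | hx
    · rw [near j x hx, sub_self, zero_mul, norm_zero]; exact hB0
    · have := chi_mem (q := q) (u j) x
      have h2 : ‖1 - chi q (u j) x‖ ≤ 1 := by
        rw [Real.norm_eq_abs, abs_le]; constructor <;> linarith
      rw [norm_mul]
      refine (mul_le_of_le_one_left (norm_nonneg _) h2).trans ?_
      rw [hs_def]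
      refine (norm_sub_le _ _).trans (add_le_add ?_ ?_)
      · refine (norm_sum_le _ _).trans ?_
        rw [Finset.mul_sum]
        refine Finset.sum_le_sum fun i _ => ?_
        rw [norm_mul, norm_mul, mul_comm, Real.norm_eq_abs (X i x)]
        refine mul_le_mul_of_nonneg_right ?_ (abs_nonneg _)
        have d1 := norm_dAngle_le x (EuclideanSpace.single i 1)
        have d2 : ‖x‖⁻¹ ≤ 5 := by
          rw [inv_le_comm₀ (by linarith) (by norm_num)]; linarith
        rw [Real.norm_eq_abs (dAngle _ _)]
        have d3 : ‖(EuclideanSpace.single i 1 : Plane)‖ = 1 := by simp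
        rw [d3, mul_one] at d1
        rw [mul_comm 5]
        exact mul_le_mul (hM' _) (d1.trans d2) (abs_nonneg _) hM0'
      · rw [norm_mul, mul_comm]
        exact mul_le_mul_of_nonneg_right (hM _) (norm_nonneg _)
  have lim1 : Filter.Tendsto (fun j => ∫ x in omega q, (1 - chi q (u j) x) * s x) Filter.atTop
      (nhds 0) := by
    have hbi : IntegrableOn (fun x => 5 * M' * ∑ i, |X i x| + M * |l x|) (omega q) :=
      ((integrable_finsetSum _ fun i _ => (hX.integrable i).abs).const_mul _).add
        (hX.source.abs.const_mul _)
    have hsm : AEStronglyMeasurable s (volume.restrict (omega q)) := by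
      refine AEStronglyMeasurable.sub ?_ (hX.source.1.mul hgm.aestronglyMeasurable)
      refine Finset.aestronglyMeasurable_fun_sum _ fun i _ => ?_
      refine (hX.integrable i).1.mul (Measurable.aestronglyMeasurable ?_)
      refine (hψ'c.measurable.comp measurable_angle).mul ?_
      simp only [dAngle_apply]
      have := toComplex.continuous.measurable
      fun_prop
    have := tendsto_integral_of_dominated_convergence
      (F := fun j x => (1 - chi q (u j) x) * s x) (f := fun _ => (0 : ℝ))
      (μ := volume.restrict (omega q)) _ (fun j => ?_) hbi
      (fun j => .of_forall fun x => hbound j x) ?_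
    · simpa using this
    · exact (continuous_const.sub (contDiff_chi hq (hu0 j) (hu5 j)).continuous).aestronglyMeasurable.mul
        hsm
    · filter_upwards [ae_restrict_mem (isOpen_omega hq).measurableSet] with x hx
      have := ((tendsto_chi hq hu hu0 hx).const_sub 1).mul_const (s x)
      simpa using this
  obtain ⟨C, η, h₀, hC, hη, hh0, hh1, hB⟩ := hX.exists_bounds
  have lim2 : Filter.Tendsto (fun j => (∫ x in omega q, g x * ∑ i, X i x *
      partialDeriv i (chi q (u j)) x) + ∫ θ in Ioo (-π) π, ψ θ * flux q (u j) X θ) Filter.atTop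
      (nhds 0) := by
    rw [tendsto_zero_iff_enorm_tendsto_zero]
    have t1 : Filter.Tendsto (fun j => ENNReal.ofReal (5 * (kapBound * (3 * 0 + M))) *
        ENNReal.ofReal (C * u j ^ (1 / 2 : ℝ))) Filter.atTop (nhds 0) := by
      have := ENNReal.Tendsto.const_mul (a := ENNReal.ofReal (5 * (kapBound * (3 * 0 + M))))
        (tendsto_rpow_zero hu (a := 1 / 2) (by norm_num) C) (Or.inr ENNReal.ofReal_ne_top)
      simpa using this
    refine tendsto_of_tendsto_of_tendsto_of_le_of_le' tendsto_const_nhds t1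
      (.of_forall fun j => zero_le) ?_
    filter_upwards [hu.eventually (gt_mem_nhds hh0)] with j hj
    refine (enorm_integral_partialDeriv_chi_add_le hq (hu0 j) (hu5 j) hX.meas hX.integrable hgm
      hψ.continuous le_rfl hM fun θ hθ τ hτ => ?_).trans ?_
    · have hr : 0 < radius q θ - τ := by linarith [(radius_bounds hq θ).1, hτ.2, hu1 j]
      simp only [hg]
      rw [polarPt, angle_smul_er hr (Ioo_subset_Ioc_self hθ), sub_self, abs_zero, zero_mul]
    · gcongr
      exact (hB _ (hu0 j) hj.le).2
  simp_rw [identity] at lim2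
  simpa using lim2.sub lim1

end Core

/-! ### Rate of decay of the flux, and comparison of neighbouring normals -/

section Decay

variable {q : ℕ}

theorem flux_periodic (hq : 7 ≤ q) (h : ℝ) (X : Fin 2 → Plane → ℝ) :
    Function.Periodic (flux q h X) (2 * π) := fun θ => by
  simp only [flux, radius_periodic hq θ, sepFun_periodic θ, cos_add_two_pi, sin_add_two_pi,
    bAvg_periodic hq h _ θ]

theorem measurable_flux (hq : 7 ≤ q) (h : ℝ) {X : Fin 2 → Plane → ℝ} (hX : ∀ i, Measurable (X i)) :
    Measurable (flux q h X) :=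
  ((continuous_normal hq).1.measurable.mul (measurable_bAvg hq h (hX 0))).add
    ((continuous_normal hq).2.measurable.mul (measurable_bAvg hq h (hX 1)))

/-- Passing from h to h/2 changes the averaged flux by O(h^η) in L¹. Along h·2^(-j) this gives a
Cauchy sequence; its limit vanishes since it vanishes against test functions, by
`FluxField.tendsto_integral_flux`. Summing the geometric series gives the rate. -/
theorem FluxField.lintegral_flux_le (hq : 7 ≤ q) {X : Fin 2 → Plane → ℝ} {l : Plane → ℝ}
    (hX : FluxField q X l) :
    ∃ C η h₀ : ℝ, 0 ≤ C ∧ 0 < η ∧ 0 < h₀ ∧ h₀ ≤ 1 / 10 ∧ ∀ h, 0 < h → h ≤ h₀ →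
      ∫⁻ θ in Ioo (-π) π, ‖flux q h X θ‖ₑ ≤ ENNReal.ofReal (C * h ^ η) := by
  obtain ⟨C, η, h₀, hC, hη, hh0, hh1, hB⟩ := hX.exists_bounds
  have hk := kapBound_pos
  have hr1 : (1 / 2 : ℝ) ^ η < 1 := rpow_lt_one (by norm_num) (by norm_num) hη
  -- A factor 2 bounds the components of the normal, 2·`kapBound`²·C comes from halving the scale,
  -- and the ratio of the geometric series is 2^(-η).
  refine ⟨4 * kapBound ^ 2 * C / (1 - (1 / 2 : ℝ) ^ η), η, h₀,
    div_nonneg (by positivity) (by linarith), hη, hh0, hh1, fun h h0 hle => ?_⟩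
  set u : ℕ → ℝ := fun j => h * (1 / 2) ^ j with hu
  have hu0 : ∀ j, 0 < u j := fun j => by positivity
  have huh : ∀ j, u j ≤ h := fun j =>
    mul_le_of_le_one_right h0.le (pow_le_one₀ (by norm_num) (by norm_num))
  have hu1 : ∀ j, u j ≤ 1 / 10 := fun j => (huh j).trans (hle.trans hh1)
  have hulim : Filter.Tendsto u Filter.atTop (nhds 0) := by
    have := (tendsto_pow_atTop_nhds_zero_of_lt_one (r := (1 / 2 : ℝ)) (by norm_num)
      (by norm_num)).const_mul h
    rwa [mul_zero] at this
  have hXs : ∀ j i, IntegrableOn (X i) (strip q (u j)) := fun j i =>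
    (hX.integrable i).mono_set (strip_subset_omega hq _)
  have hint : ∀ j, Integrable (flux q (u j) X) (volume.restrict (Ioo (-π) π)) := fun j => by
    have := (integrableOn_mul_flux hq (hu0 j) (by linarith [hu1 j]) hX.meas (hXs j)
      (m := fun _ => 1) continuous_const (M := 1) (by simp)).1
    simp only [one_mul] at this
    exact this
  have step : ∀ j, ∫⁻ θ in Ioo (-π) π, ‖flux q (u j) X θ - flux q (u (j + 1)) X θ‖ₑ ≤
      ENNReal.ofReal (4 * kapBound ^ 2 * C * h ^ η) * ENNReal.ofReal ((1 / 2 : ℝ) ^ η) ^ j := by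
    intro j
    have hhalf : u (j + 1) = u j / 2 := by simp only [hu, pow_succ]; ring
    have hm : ∀ i, Measurable fun θ => ‖bAvg q (u j) (X i) θ - bAvg q (u j / 2) (X i) θ‖ₑ :=
      fun i => ((measurable_bAvg hq _ (hX.meas i)).sub (measurable_bAvg hq _ (hX.meas i))).enorm
    calc _ ≤ ∫⁻ θ in Ioo (-π) π, ENNReal.ofReal 2 *
          ∑ i, ‖bAvg q (u j) (X i) θ - bAvg q (u j / 2) (X i) θ‖ₑ := by
          refine lintegral_mono fun θ => ?_
          rw [Fin.sum_univ_two, Real.enorm_eq_ofReal_abs, Real.enorm_eq_ofReal_abs,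
            Real.enorm_eq_ofReal_abs, ← ENNReal.ofReal_add (abs_nonneg _) (abs_nonneg _),
            ← ENNReal.ofReal_mul (by norm_num), hhalf]
          refine ENNReal.ofReal_le_ofReal ?_
          have e : flux q (u j) X θ - flux q (u j / 2) X θ =
            (radius q θ * cos θ + sepFun q θ * sin θ) *
              (bAvg q (u j) (X 0) θ - bAvg q (u j / 2) (X 0) θ) +
            (radius q θ * sin θ - sepFun q θ * cos θ) *
              (bAvg q (u j) (X 1) θ - bAvg q (u j / 2) (X 1) θ) := by
            simp only [flux]; ring
          rw [e]
          refine (abs_add_le _ _).trans ?_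
          rw [abs_mul, abs_mul, mul_add]
          gcongr
          · exact (abs_normal_le hq θ).1
          · exact (abs_normal_le hq θ).2
      _ = ENNReal.ofReal 2 * ∑ i, ∫⁻ θ in Ioo (-π) π,
          ‖bAvg q (u j) (X i) θ - bAvg q (u j / 2) (X i) θ‖ₑ := by
          rw [lintegral_const_mul' _ _ ENNReal.ofReal_ne_top,
            lintegral_finsetSum' _ fun i _ => (hm i).aemeasurable]
      _ ≤ ENNReal.ofReal 2 * (ENNReal.ofReal (2 * kapBound ^ 2 / u j ^ 3) *
          ENNReal.ofReal (C * u j ^ (3 + η))) := by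
          gcongr
          refine (Finset.sum_le_sum fun i _ => lintegral_bAvg_half_sub_le hq (hu0 j) (hu1 j)
            (hX.meas i) (hX.integrable i)).trans ?_
          rw [← Finset.mul_sum]
          gcongr
          exact (hB _ (hu0 j) ((huh j).trans hle)).1
      _ = _ := by
          have h3 := hu0 j
          rw [← ENNReal.ofReal_mul (by positivity), ← ENNReal.ofReal_mul (by positivity),
            ← ENNReal.ofReal_pow (by positivity), ← ENNReal.ofReal_mul (by positivity)]
          congr 1
          have e1 : u j ^ (3 + η) = u j ^ 3 * u j ^ η := by
            rw [rpow_add h3]; norm_cast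
          have e2 : u j ^ η = h ^ η * ((1 / 2 : ℝ) ^ η) ^ j := by
            rw [hu, mul_rpow h0.le (by positivity), ← rpow_natCast, ← rpow_mul (by norm_num),
              ← rpow_natCast, ← rpow_mul (by norm_num), mul_comm η]
          rw [e1, e2]
          field_simp
          ring
  set N : ℕ → (ℝ →₁[volume.restrict (Ioo (-π) π)] ℝ) := fun j => (hint j).toL1 _ with hN
  have hdist : ∀ j, edist (N j) (N (j + 1)) ≤
      ENNReal.ofReal (4 * kapBound ^ 2 * C * h ^ η) * ENNReal.ofReal ((1 / 2 : ℝ) ^ η) ^ j := by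
    intro j
    rw [hN, Integrable.edist_toL1_toL1]
    refine le_trans (lintegral_mono fun θ => ?_) (step j)
    rw [edist_eq_enorm_sub]
  have hrE : ENNReal.ofReal ((1 / 2 : ℝ) ^ η) < 1 := by
    rwa [← ENNReal.ofReal_one, ENNReal.ofReal_lt_ofReal_iff one_pos]
  obtain ⟨Z, hZ⟩ := cauchySeq_tendsto_of_complete
    (cauchySeq_of_edist_le_geometric _ _ hrE ENNReal.ofReal_ne_top hdist)
  have hZi := L1.integrable_coeFn Z
  have hZlim : Filter.Tendsto (fun j => ∫⁻ θ in Ioo (-π) π, ‖flux q (u j) X θ - Z θ‖ₑ)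
      Filter.atTop (nhds 0) := by
    have h1 := tendsto_iff_edist_tendsto_0.1 hZ
    refine h1.congr fun j => ?_
    have e : edist (N j) Z = edist (N j) (hZi.toL1 _) := by rw [Integrable.toL1_coeFn]
    rw [e, hN, Integrable.edist_toL1_toL1]
    simp only [edist_eq_enorm_sub]
  -- Testing on the open interval suffices, as the endpoints ±π are negligible for an L¹ limit.
  have hZ0 : Z = 0 := by
    have hae : ∀ᵐ θ ∂(volume : Measure ℝ), θ ∈ Ioo (-π) π → Z θ = 0 := by
      refine isOpen_Ioo.ae_eq_zero_of_integral_contDiff_smul_eq_zero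
        (IntegrableOn.locallyIntegrableOn hZi) fun ψ hψ hψc hψs => ?_
      have e1 : ∫ θ, ψ θ • Z θ = ∫ θ in Ioo (-π) π, ψ θ * Z θ := by
        refine (setIntegral_eq_integral_of_forall_compl_eq_zero fun θ hθ => ?_).symm
        rw [image_eq_zero_of_notMem_tsupport fun hh => hθ (hψs hh), zero_smul]
      rw [e1]
      obtain ⟨a, ha0, haπ, has⟩ : ∃ a, 0 < a ∧ a < π ∧ ∀ θ, ψ θ ≠ 0 → |θ| ≤ a := by
        rcases (tsupport ψ).eq_empty_or_nonempty with he | hne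
        · refine ⟨1, one_pos, by linarith [pi_gt_three], fun θ hθ => ?_⟩
          have : θ ∈ tsupport ψ := subset_tsupport _ hθ
          rw [he] at this
          exact this.elim
        · obtain ⟨z, hz, hmax⟩ := hψc.isCompact.exists_isMaxOn hne continuous_abs.continuousOn
          have hzπ : |z| < π := abs_lt.2 (hψs hz)
          refine ⟨max |z| 1, by positivity, max_lt hzπ (by linarith [pi_gt_three]), fun θ hθ => ?_⟩
          exact (hmax (subset_tsupport _ hθ)).trans (le_max_left _ _)
      have l1 := hX.tendsto_integral_flux hq (hψ.of_le (by norm_cast)) ha0 haπ has hulim hu0 hu1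
      obtain ⟨M, hM⟩ := hψc.exists_bound_of_continuous hψ.continuous
      have l2 : Filter.Tendsto (fun j => ∫ θ in Ioo (-π) π, ψ θ * flux q (u j) X θ) Filter.atTop
          (nhds (∫ θ in Ioo (-π) π, ψ θ * Z θ)) := by
        refine tendsto_integral_of_L1 _ (hZi.bdd_mul hψ.continuous.aestronglyMeasurable
          (.of_forall hM)).1 (.of_forall fun j => (hint j).bdd_mul
            hψ.continuous.aestronglyMeasurable (.of_forall hM)) ?_
        have l3 := ENNReal.Tendsto.const_mul (a := ENNReal.ofReal M) hZlim
          (Or.inr ENNReal.ofReal_ne_top)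
        rw [mul_zero] at l3
        refine tendsto_of_tendsto_of_tendsto_of_le_of_le tendsto_const_nhds l3
          (fun j => zero_le) fun j => ?_
        rw [← lintegral_const_mul' _ _ ENNReal.ofReal_ne_top]
        refine lintegral_mono fun θ => ?_
        rw [← mul_sub, enorm_mul]
        gcongr
        rw [Real.enorm_eq_ofReal_abs]
        exact ENNReal.ofReal_le_ofReal (hM θ)
      exact tendsto_nhds_unique l2 l1
    rw [Lp.eq_zero_iff_ae_eq_zero]
    exact (ae_restrict_iff' measurableSet_Ioo).2 hae
  have final := edist_le_of_edist_le_geometric_of_tendsto₀ _ _ hdist hZ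
  have e0 : edist (N 0) Z = ∫⁻ θ in Ioo (-π) π, ‖flux q h X θ‖ₑ := by
    rw [hZ0, edist_zero_right, hN, Integrable.enorm_toL1]
    simp [hu]
  rw [e0] at final
  refine final.trans (le_of_eq ?_)
  rw [← ENNReal.ofReal_one, ← ENNReal.ofReal_sub _ (by positivity),
    ← ENNReal.ofReal_div_of_pos (by linarith)]
  congr 1
  ring

/-- The tangential component of the averages of the field `X`. -/
noncomputable def tang (q : ℕ) (h : ℝ) (X : Fin 2 → Plane → ℝ) (θ : ℝ) : ℝ :=
  -sin θ * bAvg q h (X 0) θ + cos θ * bAvg q h (X 1) θ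

theorem measurable_tang (hq : 7 ≤ q) (h : ℝ) {X : Fin 2 → Plane → ℝ} (hX : ∀ i, Measurable (X i)) :
    Measurable (tang q h X) := by
  have h0 := measurable_bAvg hq h (hX 0)
  have h1 := measurable_bAvg hq h (hX 1)
  unfold tang
  fun_prop

/-- For n = F e_r - f e_θ one has n(θ+s) - n(θ) = -(f(θ+s) - f(θ)) e_θ(θ) + O(s), because F, e_r and
e_θ are Lipschitz. Pairing with the averages at θ, and replacing these by the averages at θ + s in
the product with n(θ+s), leaves only the two fluxes, the increments of the averages and the O(s)
term. -/
theorem abs_sepFun_sub_mul_tang_le (hq : 7 ≤ q) (h : ℝ) (X : Fin 2 → Plane → ℝ) (θ : ℝ) {s : ℝ}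
    (hs : 0 ≤ s) :
    |sepFun q (θ + s) - sepFun q θ| * |tang q h X θ| ≤ |flux q h X (θ + s)| + |flux q h X θ| +
      2 * ∑ i, |bAvg q h (X i) θ - bAvg q h (X i) (θ + s)| +
      2 * s * ∑ i, |bAvg q h (X i) θ| := by
  set b0 := bAvg q h (X 0) θ
  set b1 := bAvg q h (X 1) θ
  set c0 := bAvg q h (X 0) (θ + s)
  set c1 := bAvg q h (X 1) (θ + s)
  have hn := abs_normal_le hq (θ + s)
  set n0 := radius q (θ + s) * cos (θ + s) + sepFun q (θ + s) * sin (θ + s)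
  set n1 := radius q (θ + s) * sin (θ + s) - sepFun q (θ + s) * cos (θ + s)
  have hsin := abs_sin_sub_sin_le (θ + s) θ
  have hcos : |cos (θ + s) - cos θ| ≤ s := by
    have := abs_sin_sub_sin_le (π / 2 - (θ + s)) (π / 2 - θ)
    rw [sin_pi_div_two_sub, sin_pi_div_two_sub,
      show π / 2 - (θ + s) - (π / 2 - θ) = -s by ring, abs_neg, abs_of_nonneg hs] at this
    exact this
  rw [add_sub_cancel_left, abs_of_nonneg hs] at hsin
  have hL := lipschitz_radius hq (θ + s) θ
  rw [add_sub_cancel_left, abs_of_nonneg hs] at hL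
  have hF := radius_bounds hq θ
  have hFa : |radius q θ| ≤ 8 / 5 := abs_le.2 ⟨by linarith, hF.2⟩
  have hf := abs_sepFun_le hq (θ + s)
  have m : ∀ {a b A B : ℝ}, |a| ≤ A → |b| ≤ B → |a * b| ≤ A * B := fun {a b A B} ha hb => by
    rw [abs_mul]
    exact mul_le_mul ha hb (abs_nonneg _) ((abs_nonneg _).trans ha)
  have r0 : |(radius q (θ + s) - radius q θ) * cos (θ + s) +
      radius q θ * (cos (θ + s) - cos θ) + sepFun q (θ + s) * (sin (θ + s) - sin θ)| ≤ 2 * s := by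
    refine (abs_add_three _ _ _).trans ?_
    linarith [m hL (abs_cos_le_one (θ + s)), m hFa hcos, m hf hsin]
  have r1 : |(radius q (θ + s) - radius q θ) * sin (θ + s) +
      radius q θ * (sin (θ + s) - sin θ) - sepFun q (θ + s) * (cos (θ + s) - cos θ)| ≤ 2 * s := by
    refine (abs_sub _ _).trans ((add_le_add_left (abs_add_le _ _) _).trans ?_)
    linarith [m hL (abs_sin_le_one (θ + s)), m hFa hsin, m hf hcos]
  rw [Fin.sum_univ_two, Fin.sum_univ_two, ← abs_mul]
  have e : (sepFun q (θ + s) - sepFun q θ) * tang q h X θ =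
      -(flux q h X (θ + s) - flux q h X θ + (n0 * (b0 - c0) + n1 * (b1 - c1)) -
      (((radius q (θ + s) - radius q θ) * cos (θ + s) +
      radius q θ * (cos (θ + s) - cos θ) + sepFun q (θ + s) * (sin (θ + s) - sin θ)) * b0 +
      ((radius q (θ + s) - radius q θ) * sin (θ + s) +
      radius q θ * (sin (θ + s) - sin θ) - sepFun q (θ + s) * (cos (θ + s) - cos θ)) * b1)) := by
    simp only [tang, flux, n0, n1, b0, b1, c0, c1]
    ring
  rw [e, abs_neg]
  refine (abs_sub _ _).trans ?_
  refine (add_le_add ((abs_add_le _ _).trans (add_le_add (abs_sub _ _) (abs_add_le _ _)))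
    (abs_add_le _ _)).trans ?_
  linarith [m hn.1 (le_refl |b0 - c0|), m hn.2 (le_refl |b1 - c1|), m r0 (le_refl |b0|),
    m r1 (le_refl |b1|)]

/-- As F ≥ 2/5, the normal is uniformly transversal to e_θ: the radial component of the averages
equals (flux + f·tang)/F. -/
theorem sum_abs_bAvg_le (hq : 7 ≤ q) (h : ℝ) (X : Fin 2 → Plane → ℝ) (θ : ℝ) :
    ∑ i, |bAvg q h (X i) θ| ≤ 6 * |flux q h X θ| + 3 * |tang q h X θ| := by
  set b0 := bAvg q h (X 0) θ with hb0
  set b1 := bAvg q h (X 1) θ with hb1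
  set β := tang q h X θ with hβ
  set ρ := cos θ * b0 + sin θ * b1 with hρ
  have hF := radius_bounds hq θ
  have hf := abs_sepFun_le hq θ
  have hc := abs_cos_le_one θ
  have hs := abs_sin_le_one θ
  have e1 : radius q θ * ρ = flux q h X θ + sepFun q θ * β := by
    simp only [hρ, hβ, tang, flux, hb0, hb1]; ring
  have h1 : 2 / 5 * |ρ| ≤ |flux q h X θ| + 1 / 6 * |β| := by
    calc 2 / 5 * |ρ| ≤ radius q θ * |ρ| := by gcongr; exact hF.1
      _ = |radius q θ * ρ| := by rw [abs_mul, abs_of_pos (show 0 < radius q θ by linarith)]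
      _ ≤ |flux q h X θ| + |sepFun q θ * β| := by rw [e1]; exact abs_add_le _ _
      _ ≤ _ := by rw [abs_mul]; gcongr
  have cs := sin_sq_add_cos_sq θ
  have e2 : b0 = cos θ * ρ - sin θ * β := by
    simp only [hρ, hβ, tang, ← hb0, ← hb1]; linear_combination (-b0) * cs
  have e3 : b1 = sin θ * ρ + cos θ * β := by
    simp only [hρ, hβ, tang, ← hb0, ← hb1]; linear_combination (-b1) * cs
  have b : ∀ {a c : ℝ}, |a| ≤ 1 → |a * c| ≤ |c| := fun ha => by
    rw [abs_mul]; exact mul_le_of_le_one_left (abs_nonneg _) ha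
  have h2 : |b0| ≤ |ρ| + |β| := by
    rw [e2]
    exact (abs_sub _ _).trans (add_le_add (b hc) (b hs))
  have h3 : |b1| ≤ |ρ| + |β| := by
    rw [e3]
    exact (abs_add_le _ _).trans (add_le_add (b hs) (b hc))
  rw [Fin.sum_univ_two]
  linarith [abs_nonneg β, abs_nonneg (flux q h X θ)]

end Decay

/-! ### Vanishing of all boundary averages along the scales of the series -/

section TangentialDecay

variable {q : ℕ}

/-- Integrate `abs_sepFun_sub_mul_tang_le` over θ and over s in (h, 2h), with h = `scale q k`. On
the left the increments of f contribute at least 2γ q^(-(k+1)) h for every θ. Dividing by this costs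
the factor q^(k+1), while the flux, oscillation and O(s) terms retain positive powers of h. -/
theorem FluxField.lintegral_tang_le (hq : LargeBase q) {X : Fin 2 → Plane → ℝ} {l : Plane → ℝ}
    (hX : FluxField q X l) :
    ∃ C₁ η₁ C₂ η₂ C₃ h₀ : ℝ, 0 < η₁ ∧ 0 < η₂ ∧ 0 < h₀ ∧
      ∀ k : ℕ, scale q k ≤ h₀ → ∫⁻ θ in Ioo (-π) π, ‖tang q (scale q k) X θ‖ₑ ≤
        ENNReal.ofReal (C₁ * ((q : ℝ) ^ (k + 1) * scale q k ^ η₁) +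
          C₂ * ((q : ℝ) ^ (k + 1) * scale q k ^ η₂) +
          C₃ * ((q : ℝ) ^ (k + 1) * scale q k ^ (1 / 2 : ℝ))) := by
  have hq7 := hq.1
  have hγ := gamma_pos
  have hkap := kapBound_pos
  obtain ⟨C, η, h₀, hC, hη, hh0, hh1, hN⟩ := hX.lintegral_flux_le hq7
  obtain ⟨C', η', h₀', hC', hη', hh0', hh1', hB⟩ := hX.exists_bounds
  -- In order: the two flux terms, the oscillation term and the O(s) term, each divided by 2γ.
  refine ⟨C / gamma, η, 2 * kapBound ^ 2 * C' / gamma, η', 10 * kapBound * C' / gamma, min h₀ h₀',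
    hη, hη', lt_min hh0 hh0', fun k hk => ?_⟩
  set h := scale q k with hh
  have h0 : 0 < h := scale_pos q k
  have hle : h ≤ h₀ := hk.trans (min_le_left _ _)
  have hle' : h ≤ h₀' := hk.trans (min_le_right _ _)
  have hq0 : (0 : ℝ) < (q : ℝ) ^ (k + 1) := by
    have : (0 : ℝ) < q := by exact_mod_cast (by omega : 0 < q)
    positivity
  set A := ∫⁻ θ in Ioo (-π) π, ‖tang q h X θ‖ₑ with hA
  have hf := continuous_sepFun hq7
  have hNm := measurable_flux hq7 h hX.meas
  have hTm := measurable_tang hq7 h hX.meas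
  have hbm : ∀ i, Measurable (bAvg q h (X i)) := fun i => measurable_bAvg hq7 h (hX.meas i)
  set μ : Measure (ℝ × ℝ) := (volume.restrict (Ioo (-π) π)).prod (volume.restrict (Ioo h (2 * h)))
    with hμ
  have hvol : volume.restrict (Ioo h (2 * h)) univ = ENNReal.ofReal h := by
    rw [Measure.restrict_apply_univ, Real.volume_Ioo]; congr 1; ring
  have first : ∀ {g : ℝ → ℝ≥0∞}, Measurable g → ∫⁻ p, g p.1 ∂μ =
      ENNReal.ofReal h * ∫⁻ θ in Ioo (-π) π, g θ := by
    intro g hg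
    have hg' : Measurable fun p : ℝ × ℝ => g p.1 := hg.comp measurable_fst
    rw [hμ, lintegral_prod _ hg'.aemeasurable,
      ← lintegral_const_mul' _ _ ENNReal.ofReal_ne_top]
    refine lintegral_congr fun θ => ?_
    simp only []
    rw [lintegral_const, hvol, mul_comm]
  have lower : ENNReal.ofReal (2 * gamma * ((q : ℝ) ^ (k + 1))⁻¹ * h) * A ≤
      ∫⁻ p, ‖sepFun q (p.1 + p.2) - sepFun q p.1‖ₑ * ‖tang q h X p.1‖ₑ ∂μ := by
    rw [hA, ← lintegral_const_mul' _ _ ENNReal.ofReal_ne_top, hμ, lintegral_prod]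
    · refine lintegral_mono fun θ => ?_
      simp only []
      rw [lintegral_mul_const' _ _ enorm_ne_top]
      gcongr
      have i1 : IntegrableOn (fun s => sepFun q (θ + s) - sepFun q θ) (Ioo h (2 * h)) :=
        ((by fun_prop : Continuous fun s => sepFun q (θ + s) - sepFun q θ).integrableOn_Icc).mono_set
          Ioo_subset_Icc_self
      rw [← ofReal_integral_norm_eq_lintegral_enorm i1]
      refine ENNReal.ofReal_le_ofReal ((integral_abs_sepFun_sub_ge hq k θ).trans (le_of_eq ?_))
      rw [intervalIntegral.integral_of_le (by linarith), integral_Ioc_eq_integral_Ioo]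
      rfl
    · have := hf.measurable
      exact Measurable.aemeasurable (by fun_prop)
  have t1 : ∫⁻ p, ‖flux q h X (p.1 + p.2)‖ₑ ∂μ ≤ ENNReal.ofReal h * ENNReal.ofReal (C * h ^ η) := by
    have hm : Measurable fun p : ℝ × ℝ => ‖flux q h X (p.1 + p.2)‖ₑ :=
      (hNm.comp (measurable_fst.add measurable_snd)).enorm
    rw [hμ, lintegral_prod_symm _ hm.aemeasurable]
    have hper : Function.Periodic (fun θ => ‖flux q h X θ‖ₑ) (2 * π) := fun θ => by
      simp only [flux_periodic hq7 h X θ]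
    calc _ = ∫⁻ _s in Ioo h (2 * h), ∫⁻ θ in Ioo (-π) π, ‖flux q h X θ‖ₑ :=
          lintegral_congr fun s => lintegral_period_shift hper s
      _ ≤ _ := by
          rw [lintegral_const, hvol, mul_comm]
          gcongr
          exact hN h h0 hle
  have t2 : ∫⁻ p, ‖flux q h X p.1‖ₑ ∂μ ≤ ENNReal.ofReal h * ENNReal.ofReal (C * h ^ η) := by
    rw [first hNm.enorm]
    gcongr
    exact hN h h0 hle
  have hbd : ∀ i, Measurable fun p : ℝ × ℝ =>
      ‖bAvg q h (X i) p.1 - bAvg q h (X i) (p.1 + p.2)‖ₑ := fun i =>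
    (((hbm i).comp measurable_fst).sub ((hbm i).comp (measurable_fst.add measurable_snd))).enorm
  have t3 : ∫⁻ p, ∑ i, ‖bAvg q h (X i) p.1 - bAvg q h (X i) (p.1 + p.2)‖ₑ ∂μ ≤
      ENNReal.ofReal (2 * kapBound ^ 2 / h ^ 2) * ENNReal.ofReal (C' * h ^ (3 + η')) := by
    rw [lintegral_finsetSum' _ fun i _ => (hbd i).aemeasurable]
    have : ∀ i, ∫⁻ p, ‖bAvg q h (X i) p.1 - bAvg q h (X i) (p.1 + p.2)‖ₑ ∂μ ≤
        ENNReal.ofReal (2 * kapBound ^ 2 / h ^ 2) * osc q (X i) (Ioo 0 (2 * h)) (Ioo 0 h) := by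
      intro i
      rw [hμ, lintegral_prod _ (hbd i).aemeasurable]
      refine le_trans (lintegral_mono fun θ => lintegral_mono_set (Ioo_subset_Ioo_left h0.le)) ?_
      exact lintegral_bAvg_sub_le hq7 h0 (by linarith) le_rfl (by linarith) (hX.meas i)
        (hX.integrable i)
    refine (Finset.sum_le_sum fun i _ => this i).trans ?_
    rw [← Finset.mul_sum]
    gcongr
    exact (hB h h0 hle').1
  have hbs : Measurable fun θ => ∑ i, ‖bAvg q h (X i) θ‖ₑ :=
    Finset.measurable_fun_sum _ fun i _ => (hbm i).enorm
  have t4 : ∫⁻ p, ∑ i, ‖bAvg q h (X i) p.1‖ₑ ∂μ ≤ ENNReal.ofReal h *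
      (ENNReal.ofReal (5 * kapBound / h) * ENNReal.ofReal (C' * h ^ (1 / 2 : ℝ))) := by
    rw [first hbs, lintegral_finsetSum' _ fun i _ => (hbm i).enorm.aemeasurable]
    gcongr
    refine (Finset.sum_le_sum fun i _ => lintegral_enorm_bAvg_le hq7 h0 (by linarith)
      (hX.meas i)).trans ?_
    rw [← Finset.mul_sum]
    gcongr
    exact (hB h h0 hle').2
  have upper : ∫⁻ p, ‖sepFun q (p.1 + p.2) - sepFun q p.1‖ₑ * ‖tang q h X p.1‖ₑ ∂μ ≤
      ∫⁻ p, (‖flux q h X (p.1 + p.2)‖ₑ + ‖flux q h X p.1‖ₑ +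
        ENNReal.ofReal 2 * ∑ i, ‖bAvg q h (X i) p.1 - bAvg q h (X i) (p.1 + p.2)‖ₑ +
        ENNReal.ofReal (4 * h) * ∑ i, ‖bAvg q h (X i) p.1‖ₑ) ∂μ := by
    refine lintegral_mono_ae ?_
    have hmem : ∀ᵐ p ∂μ, p.2 ∈ Ioo h (2 * h) := by
      rw [hμ, Measure.prod_restrict]
      filter_upwards [ae_restrict_mem (measurableSet_Ioo.prod measurableSet_Ioo)] with p hp
      exact hp.2
    filter_upwards [hmem] with p hp
    have hs0 : 0 ≤ p.2 := h0.le.trans hp.1.le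
    have key := abs_sepFun_sub_mul_tang_le hq7 h X p.1 hs0
    simp only [Real.enorm_eq_ofReal_abs]
    rw [← ENNReal.ofReal_mul (abs_nonneg _), ← ENNReal.ofReal_sum_of_nonneg fun i _ => abs_nonneg _,
      ← ENNReal.ofReal_sum_of_nonneg fun i _ => abs_nonneg _,
      ← ENNReal.ofReal_mul (by norm_num), ← ENNReal.ofReal_mul (by positivity),
      ← ENNReal.ofReal_add (abs_nonneg _) (abs_nonneg _),
      ← ENNReal.ofReal_add (by positivity) (by positivity),
      ← ENNReal.ofReal_add (by positivity) (by positivity)]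
    refine ENNReal.ofReal_le_ofReal (key.trans ?_)
    have : 2 * p.2 ≤ 4 * h := by linarith [hp.2]
    gcongr
  have m1 : Measurable fun p : ℝ × ℝ => ‖flux q h X (p.1 + p.2)‖ₑ + ‖flux q h X p.1‖ₑ :=
    (hNm.comp (measurable_fst.add measurable_snd)).enorm.add (hNm.comp measurable_fst).enorm
  have m2 : Measurable fun p : ℝ × ℝ => ENNReal.ofReal 2 *
      ∑ i, ‖bAvg q h (X i) p.1 - bAvg q h (X i) (p.1 + p.2)‖ₑ :=
    (Finset.measurable_fun_sum _ fun i _ => hbd i).const_mul _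
  have m0 : Measurable fun p : ℝ × ℝ => ‖flux q h X (p.1 + p.2)‖ₑ :=
    (hNm.comp (measurable_fst.add measurable_snd)).enorm
  have m3 : Measurable fun p : ℝ × ℝ => ‖flux q h X (p.1 + p.2)‖ₑ + ‖flux q h X p.1‖ₑ +
      ENNReal.ofReal 2 * ∑ i, ‖bAvg q h (X i) p.1 - bAvg q h (X i) (p.1 + p.2)‖ₑ := m1.add m2
  rw [lintegral_add_left m3, lintegral_add_left m1, lintegral_add_left m0,
    lintegral_const_mul' _ _ ENNReal.ofReal_ne_top,
    lintegral_const_mul' _ _ ENNReal.ofReal_ne_top] at upper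
  have all := (lower.trans upper).trans (add_le_add (add_le_add (add_le_add t1 t2)
    (mul_le_mul_right t3 _)) (mul_le_mul_right t4 _))
  have e1 : h ^ (3 + η') = h ^ 3 * h ^ η' := by
    rw [rpow_add h0]; norm_cast
  rw [← ENNReal.ofReal_mul h0.le, ← ENNReal.ofReal_mul (by positivity),
    ← ENNReal.ofReal_mul (by positivity), ← ENNReal.ofReal_mul (by positivity),
    ← ENNReal.ofReal_mul (by positivity), ← ENNReal.ofReal_mul (by positivity),
    ← ENNReal.ofReal_add (by positivity) (by positivity),
    ← ENNReal.ofReal_add (by positivity) (by positivity),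
    ← ENNReal.ofReal_add (by positivity) (by positivity)] at all
  have hc : 0 < 2 * gamma * ((q : ℝ) ^ (k + 1))⁻¹ * h := by positivity
  rw [← ENNReal.mul_le_mul_iff_right (a := ENNReal.ofReal (2 * gamma * ((q : ℝ) ^ (k + 1))⁻¹ * h))
    (by simpa using hc) ENNReal.ofReal_ne_top, ← ENNReal.ofReal_mul hc.le]
  refine all.trans (le_of_eq ?_)
  congr 1
  rw [e1]
  field_simp
  ring

/-- Here the growth q^(k+1) meets powers of the scale: by `tendsto_pow_mul_scale_rpow` the powers
win. Together with the decay of the flux this controls both components. -/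
theorem FluxField.tendsto_lintegral_bAvg (hq : LargeBase q) {X : Fin 2 → Plane → ℝ} {l : Plane → ℝ}
    (hX : FluxField q X l) :
    Filter.Tendsto (fun k => ∑ i, ∫⁻ θ in Ioo (-π) π, ‖bAvg q (scale q k) (X i) θ‖ₑ) Filter.atTop
      (nhds 0) := by
  obtain ⟨C, η, h₀, hC, hη, hh0, hh1, hN⟩ := hX.lintegral_flux_le hq.1
  obtain ⟨C₁, η₁, C₂, η₂, C₃, h₁, hη₁, hη₂, hh2, hT⟩ := hX.lintegral_tang_le hq
  have lim := tendsto_scale hq.1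
  have l1 := (tendsto_rpow_zero lim hη C)
  have l2 : Filter.Tendsto (fun k => ENNReal.ofReal (C₁ * ((q : ℝ) ^ (k + 1) * scale q k ^ η₁) +
          C₂ * ((q : ℝ) ^ (k + 1) * scale q k ^ η₂) +
          C₃ * ((q : ℝ) ^ (k + 1) * scale q k ^ (1 / 2 : ℝ)))) Filter.atTop (nhds 0) := by
    have := (((tendsto_pow_mul_scale_rpow hq.1 hη₁).const_mul C₁).add
      ((tendsto_pow_mul_scale_rpow hq.1 hη₂).const_mul C₂)).add
      ((tendsto_pow_mul_scale_rpow hq.1 (η := 1 / 2) (by norm_num)).const_mul C₃)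
    simpa using ENNReal.tendsto_ofReal this
  have l3 := (ENNReal.Tendsto.const_mul (a := ENNReal.ofReal 6) l1
    (Or.inr ENNReal.ofReal_ne_top)).add
    (ENNReal.Tendsto.const_mul (a := ENNReal.ofReal 3) l2 (Or.inr ENNReal.ofReal_ne_top))
  rw [mul_zero, mul_zero, add_zero] at l3
  refine tendsto_of_tendsto_of_tendsto_of_le_of_le' tendsto_const_nhds l3
    (.of_forall fun k => zero_le) ?_
  filter_upwards [lim.eventually (ge_mem_nhds hh0), lim.eventually (ge_mem_nhds hh2)] with k hk hk'
  have hbm : ∀ i, Measurable fun θ => ‖bAvg q (scale q k) (X i) θ‖ₑ := fun i =>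
    (measurable_bAvg hq.1 _ (hX.meas i)).enorm
  have hNm := (measurable_flux hq.1 (scale q k) hX.meas).enorm
  rw [← lintegral_finsetSum' _ fun i _ => (hbm i).aemeasurable]
  calc _ ≤ ∫⁻ θ in Ioo (-π) π, (ENNReal.ofReal 6 * ‖flux q (scale q k) X θ‖ₑ +
        ENNReal.ofReal 3 * ‖tang q (scale q k) X θ‖ₑ) := by
        refine lintegral_mono fun θ => ?_
        simp only [Real.enorm_eq_ofReal_abs]
        rw [← ENNReal.ofReal_sum_of_nonneg fun i _ => abs_nonneg _,
          ← ENNReal.ofReal_mul (by norm_num), ← ENNReal.ofReal_mul (by norm_num),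
          ← ENNReal.ofReal_add (by positivity) (by positivity)]
        exact ENNReal.ofReal_le_ofReal (sum_abs_bAvg_le hq.1 _ X θ)
    _ = ENNReal.ofReal 6 * (∫⁻ θ in Ioo (-π) π, ‖flux q (scale q k) X θ‖ₑ) +
        ENNReal.ofReal 3 * ∫⁻ θ in Ioo (-π) π, ‖tang q (scale q k) X θ‖ₑ := by
        rw [lintegral_add_left (hNm.const_mul _), lintegral_const_mul' _ _ ENNReal.ofReal_ne_top,
          lintegral_const_mul' _ _ ENNReal.ofReal_ne_top]
    _ ≤ _ := by
        gcongr
        · exact hN _ (scale_pos q k) hk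
        · exact hT k hk'

/-- The field `X`, rotated by a right angle. -/
def rot (X : Fin 2 → Plane → ℝ) : Fin 2 → Plane → ℝ := ![fun x => -X 1 x, X 0]

/-- The flux of the rotated field through the boundary vanishes in the limit of small scales. -/
theorem FluxField.tendsto_rot (hq : LargeBase q) {X : Fin 2 → Plane → ℝ} {l : Plane → ℝ}
    (hX : FluxField q X l) {g : Plane → ℝ} (hg : ContDiff ℝ 1 g) :
    Filter.Tendsto (fun k => ∫ x in omega q, g x * ∑ i, rot X i x *
      partialDeriv i (chi q (scale q k)) x) Filter.atTop (nhds 0) := by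
  have hq7 := hq.1
  have hYm : ∀ i, Measurable (rot X i) := by
    intro i
    fin_cases i
    · exact (hX.meas 1).neg
    · exact hX.meas 0
  have hYi : ∀ i, IntegrableOn (rot X i) (omega q) := by
    intro i
    fin_cases i
    · exact (hX.integrable 1).neg
    · exact hX.integrable 0
  obtain ⟨K, hK⟩ := hg.contDiffOn.exists_lipschitzOnWith one_ne_zero
    (convex_closedBall (0 : Plane) 2) (isCompact_closedBall (0 : Plane) 2)
  have hball : ∀ τ θ : ℝ, τ ∈ Icc 0 (2 / 5) → polarPt q τ θ ∈ Metric.closedBall (0 : Plane) 2 := by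
    intro τ θ hτ
    have := radius_bounds hq7 θ
    rw [mem_closedBall_zero_iff, polarPt, norm_smul, norm_er, mul_one, Real.norm_eq_abs, abs_le]
    constructor <;> linarith [hτ.1, hτ.2]
  obtain ⟨M, hM⟩ := (isCompact_closedBall (0 : Plane) 2).exists_bound_of_continuousOn
    hg.continuous.continuousOn
  -- The weight is frozen at its boundary values along each ray; the Lipschitz constant `K` accounts
  -- for an error of at most Kτ.
  set ψ : ℝ → ℝ := fun θ => g (polarPt q 0 θ) with hψ
  have hψc : Continuous ψ := hg.continuous.comp
    ((continuous_polarPt hq7).comp (by fun_prop : Continuous fun θ : ℝ => ((0 : ℝ), θ)))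
  have hψM : ∀ θ, |ψ θ| ≤ M := fun θ => hM _ (hball 0 θ ⟨le_rfl, by norm_num⟩)
  have hM0 : 0 ≤ M := (abs_nonneg _).trans (hψM 0)
  obtain ⟨C, η, h₀, hC, hη, hh0, hh1, hB⟩ := hX.exists_bounds
  have lim := tendsto_scale hq.1
  have l1 := ENNReal.Tendsto.const_mul (a := ENNReal.ofReal (5 * (kapBound * (3 * K + M))))
    (tendsto_rpow_zero lim (a := 1 / 2) (by norm_num) C) (Or.inr ENNReal.ofReal_ne_top)
  have l2 := ENNReal.Tendsto.const_mul (a := ENNReal.ofReal (M * 2))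
    (hX.tendsto_lintegral_bAvg hq) (Or.inr ENNReal.ofReal_ne_top)
  have l3 := l1.add l2
  rw [mul_zero, mul_zero, add_zero] at l3
  rw [tendsto_zero_iff_enorm_tendsto_zero]
  refine tendsto_of_tendsto_of_tendsto_of_le_of_le' tendsto_const_nhds l3
    (.of_forall fun k => zero_le) ?_
  filter_upwards [lim.eventually (ge_mem_nhds hh0)] with k hk
  have h0 := scale_pos q k
  have hk1 : scale q k ≤ 1 / 10 := hk.trans hh1
  have main := enorm_integral_partialDeriv_chi_add_le hq7 h0 (by linarith) hYm hYi
    hg.continuous.measurable hψc K.coe_nonneg hψM fun θ hθ τ hτ => by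
      have hτ' : τ ∈ Icc (0 : ℝ) (2 / 5) := ⟨hτ.1.le, by linarith [hτ.2]⟩
      have h00 : (0 : ℝ) ∈ Icc (0 : ℝ) (2 / 5) := ⟨le_rfl, by norm_num⟩
      have d1 := hK.dist_le_mul _ (hball τ θ hτ') _ (hball 0 θ h00)
      rw [Real.dist_eq, dist_eq_norm] at d1
      refine d1.trans ?_
      gcongr
      have d2 := norm_polarPt_sub_le hq7 (τ := τ) (τ' := 0) (θ := θ) (θ' := θ) h00
      rwa [sub_zero, sub_self, abs_zero, mul_zero, add_zero, abs_of_pos hτ.1] at d2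
  have hstrip : ∑ i, ∫⁻ x in strip q (scale q k), ‖rot X i x‖ₑ =
      ∑ i, ∫⁻ x in strip q (scale q k), ‖X i x‖ₑ := by
    rw [Fin.sum_univ_two, Fin.sum_univ_two]
    simp only [rot, Matrix.cons_val_zero, Matrix.cons_val_one, enorm_neg]
    rw [add_comm]
  have hneg : ∀ θ, bAvg q (scale q k) (rot X 0) θ = -bAvg q (scale q k) (X 1) θ := fun θ => by
    simp only [bAvg, rot, Matrix.cons_val_zero, mul_neg, integral_neg]
  have hone : ∀ θ, bAvg q (scale q k) (rot X 1) θ = bAvg q (scale q k) (X 0) θ := fun θ => rfl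
  have hflux : ‖∫ θ in Ioo (-π) π, ψ θ * flux q (scale q k) (rot X) θ‖ₑ ≤ ENNReal.ofReal (M * 2) *
      ∑ i, ∫⁻ θ in Ioo (-π) π, ‖bAvg q (scale q k) (X i) θ‖ₑ := by
    refine (enorm_integral_le_lintegral_enorm _).trans ?_
    rw [← lintegral_finsetSum' _ fun i _ =>
      (measurable_bAvg hq7 _ (hX.meas i)).enorm.aemeasurable,
      ← lintegral_const_mul' _ _ ENNReal.ofReal_ne_top]
    refine lintegral_mono fun θ => ?_
    simp only [Real.enorm_eq_ofReal_abs]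
    rw [← ENNReal.ofReal_sum_of_nonneg fun i _ => abs_nonneg _, ← ENNReal.ofReal_mul (by positivity)]
    refine ENNReal.ofReal_le_ofReal ?_
    rw [abs_mul, mul_assoc]
    refine mul_le_mul (hψM θ) ?_ (abs_nonneg _) hM0
    rw [flux, hneg, hone, Fin.sum_univ_two]
    refine (abs_add_le _ _).trans ?_
    rw [abs_mul, abs_mul, abs_neg]
    have n0 := mul_le_mul_of_nonneg_right (abs_normal_le hq7 θ).1
      (abs_nonneg (bAvg q (scale q k) (X 1) θ))
    have n1 := mul_le_mul_of_nonneg_right (abs_normal_le hq7 θ).2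
      (abs_nonneg (bAvg q (scale q k) (X 0) θ))
    linarith
  rw [hstrip] at main
  set I := ∫ x in omega q, g x * ∑ i, rot X i x * partialDeriv i (chi q (scale q k)) x
  set J := ∫ θ in Ioo (-π) π, ψ θ * flux q (scale q k) (rot X) θ
  calc ‖I‖ₑ = ‖(I + J) - J‖ₑ := by rw [add_sub_cancel_right]
    _ ≤ ‖I + J‖ₑ + ‖J‖ₑ := enorm_sub_le
    _ ≤ _ := by
        refine add_le_add (main.trans ?_) hflux
        gcongr
        exact (hB _ h0 hk).2

end TangentialDecay

/-! ### Test functions, weak derivatives and change of scalars -/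

section SobolevTools

variable {d : ℕ}

theorem LocallyIntegrableOn.integrableOn_smul {𝕜 : Type*} [RCLike 𝕜]
    {Ω : Set (EuclideanSpace ℝ (Fin d))} {u : EuclideanSpace ℝ (Fin d) → 𝕜}
    (hu : LocallyIntegrableOn u Ω) {φ : EuclideanSpace ℝ (Fin d) → ℝ} (hφ : Continuous φ)
    (hc : HasCompactSupport φ) (hs : tsupport φ ⊆ Ω) : IntegrableOn (fun x => φ x • u x) Ω := by
  obtain ⟨M, hM⟩ := hc.exists_bound_of_continuous hφ
  have h1 : IntegrableOn (fun x => φ x • u x) (tsupport φ) :=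
    (hu.integrableOn_compact_subset hs hc).bdd_smul M hφ.aestronglyMeasurable (.of_forall hM)
  have h2 : Integrable (fun x => φ x • u x) :=
    (integrableOn_iff_integrable_of_support_subset fun x hx => by
      by_contra hne
      exact hx (by simp only [image_eq_zero_of_notMem_tsupport hne, zero_smul])).1 h1
  exact h2.integrableOn

theorem IsTest.partialDeriv {Ω : Set (EuclideanSpace ℝ (Fin d))}
    {φ : EuclideanSpace ℝ (Fin d) → ℝ} (h : IsTest Ω φ) (i : Fin d) :
    IsTest Ω (partialDeriv i φ) where
  smooth := (h.smooth.fderiv_right (by simp)).clm_apply contDiff_const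
  compact := h.compact.fderiv_apply (𝕜 := ℝ) _
  supp := (tsupport_fderiv_apply_subset ℝ _).trans h.supp

theorem continuous_partialDeriv {φ : EuclideanSpace ℝ (Fin d) → ℝ} (h : ContDiff ℝ 1 φ)
    (i : Fin d) : Continuous (partialDeriv i φ) :=
  (h.continuous_fderiv one_ne_zero).clm_apply continuous_const

theorem partialDeriv_comm {φ : EuclideanSpace ℝ (Fin d) → ℝ} (h : ContDiff ℝ ∞ φ) (i j : Fin d)
    (x : EuclideanSpace ℝ (Fin d)) :
    partialDeriv i (partialDeriv j φ) x = partialDeriv j (partialDeriv i φ) x := by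
  have hd : DifferentiableAt ℝ (fderiv ℝ φ) x :=
    (h.fderiv_right (m := 1) (by norm_cast)).differentiable one_ne_zero x
  have e : ∀ i j : Fin d, partialDeriv i (partialDeriv j φ) x =
      fderiv ℝ (fderiv ℝ φ) x (EuclideanSpace.single i 1) (EuclideanSpace.single j 1) := by
    intro i j
    have := hd.hasFDerivAt.clm_apply (hasFDerivAt_const (EuclideanSpace.single j (1 : ℝ)) x)
    have h2 : HasFDerivAt (partialDeriv j φ) _ x := this
    rw [partialDeriv, h2.fderiv]
    simp
  rw [e, e]
  exact ((contDiff_infty.1 h 2).contDiffAt.isSymmSndFDerivAt (by simp)) _ _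

theorem partialDeriv_eq_zero_of_notMem {φ : EuclideanSpace ℝ (Fin d) → ℝ} (i : Fin d)
    {x : EuclideanSpace ℝ (Fin d)} (hx : x ∉ tsupport φ) : partialDeriv i φ x = 0 :=
  image_eq_zero_of_notMem_tsupport fun h => hx (tsupport_fderiv_apply_subset ℝ _ h)

/-- Integration by parts. -/
theorem integral_partialDeriv_mul {Ω : Set (EuclideanSpace ℝ (Fin d))}
    {φ u : EuclideanSpace ℝ (Fin d) → ℝ} (hφ : ContDiff ℝ 1 φ) (hc : HasCompactSupport φ)
    (hs : tsupport φ ⊆ Ω) (hu : ContDiff ℝ 1 u) (i : Fin d) :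
    ∫ x in Ω, partialDeriv i φ x * u x = -∫ x in Ω, φ x * partialDeriv i u x := by
  have hφ' := continuous_partialDeriv hφ i
  have hu' := continuous_partialDeriv hu i
  rw [setIntegral_eq_integral_of_forall_compl_eq_zero fun x hx => by
      rw [partialDeriv_eq_zero_of_notMem i fun h => hx (hs h), zero_mul],
    setIntegral_eq_integral_of_forall_compl_eq_zero fun x hx => by
      rw [image_eq_zero_of_notMem_tsupport fun h => hx (hs h), zero_mul], eq_neg_iff_add_eq_zero,
    add_comm, ← eq_neg_iff_add_eq_zero]
  refine integral_mul_fderiv_eq_neg_fderiv_mul_of_integrable ?_ ?_ ?_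
    (fun x _ => hφ.differentiable one_ne_zero x) (fun x _ => hu.differentiable one_ne_zero x)
  · exact (hφ'.mul hu.continuous).integrable_of_hasCompactSupport
      ((hc.fderiv_apply (𝕜 := ℝ) _).mul_right)
  · exact (hφ.continuous.mul hu').integrable_of_hasCompactSupport hc.mul_right
  · exact (hφ.continuous.mul hu.continuous).integrable_of_hasCompactSupport hc.mul_right

theorem isWeakPartial_of_contDiff {Ω : Set (EuclideanSpace ℝ (Fin d))}
    {u : EuclideanSpace ℝ (Fin d) → ℝ} (hu : ContDiff ℝ 1 u) (i : Fin d) :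
    IsWeakPartial Ω i u (partialDeriv i u) where
  locInt_fun := hu.continuous.locallyIntegrable.locallyIntegrableOn _
  locInt_deriv := (continuous_partialDeriv hu i).locallyIntegrable.locallyIntegrableOn _
  integral_eq φ hφ :=
    integral_partialDeriv_mul (hφ.smooth.of_le (by norm_cast)) hφ.compact hφ.supp hu i

theorem IsWeakPartial.ae_eq {𝕜 : Type*} [RCLike 𝕜] {Ω : Set (EuclideanSpace ℝ (Fin d))}
    (hΩ : IsOpen Ω) {i : Fin d} {u w w' : EuclideanSpace ℝ (Fin d) → 𝕜}
    (h : IsWeakPartial Ω i u w) (h' : IsWeakPartial Ω i u w') :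
    w =ᵐ[volume.restrict Ω] w' := by
  have h1 : ∀ᵐ x ∂(volume : Measure (EuclideanSpace ℝ (Fin d))), x ∈ Ω → w x - w' x = 0 := by
    refine hΩ.ae_eq_zero_of_integral_contDiff_smul_eq_zero
      (h.locInt_deriv.sub h'.locInt_deriv) fun φ hφ hc hs => ?_
    have hi := LocallyIntegrableOn.integrableOn_smul h.locInt_deriv hφ.continuous hc hs
    have hi' := LocallyIntegrableOn.integrableOn_smul h'.locInt_deriv hφ.continuous hc hs
    rw [← setIntegral_eq_integral_of_forall_compl_eq_zero (s := Ω) fun x hx => by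
      rw [image_eq_zero_of_notMem_tsupport fun hh => hx (hs hh), zero_smul]]
    have e1 := h.integral_eq φ ⟨hφ, hc, hs⟩
    have e2 := h'.integral_eq φ ⟨hφ, hc, hs⟩
    simp only [smul_sub]
    rw [integral_sub hi hi', sub_eq_zero]
    exact neg_injective (e1.symm.trans e2)
  filter_upwards [(ae_restrict_iff' hΩ.measurableSet).2 h1] with x hx using sub_eq_zero.1 hx

/-! ### Change of the field of scalars -/

section Comp

variable {𝕜 𝕜' : Type*} [RCLike 𝕜] [RCLike 𝕜'] {Ω : Set (EuclideanSpace ℝ (Fin d))}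

theorem partialDeriv_comp (L : 𝕜 →L[ℝ] 𝕜') {φ : EuclideanSpace ℝ (Fin d) → 𝕜}
    (hφ : Differentiable ℝ φ) (i : Fin d) :
    partialDeriv i (fun x => L (φ x)) = fun x => L (partialDeriv i φ x) := by
  ext x
  have h : HasFDerivAt (fun x => L (φ x)) (L.comp (fderiv ℝ φ x)) x :=
    L.hasFDerivAt.comp x (hφ x).hasFDerivAt
  rw [partialDeriv, h.fderiv]
  rfl

theorem IsTest.comp (L : 𝕜 →L[ℝ] 𝕜') {φ : EuclideanSpace ℝ (Fin d) → 𝕜} (h : IsTest Ω φ) :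
    IsTest Ω fun x => L (φ x) where
  smooth := L.contDiff.comp h.smooth
  compact := h.compact.comp_left (map_zero L)
  supp := (tsupport_comp_subset (map_zero L) φ).trans h.supp

theorem IsWeakPartial.comp (L : 𝕜 →L[ℝ] 𝕜') {i : Fin d} {u w : EuclideanSpace ℝ (Fin d) → 𝕜}
    (h : IsWeakPartial Ω i u w) : IsWeakPartial Ω i (fun x => L (u x)) (fun x => L (w x)) where
  locInt_fun x hx := by
    obtain ⟨s, hs, hi⟩ := h.locInt_fun x hx
    exact ⟨s, hs, L.integrable_comp hi⟩
  locInt_deriv x hx := by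
    obtain ⟨s, hs, hi⟩ := h.locInt_deriv x hx
    exact ⟨s, hs, L.integrable_comp hi⟩
  integral_eq φ hφ := by
    have h1 := LocallyIntegrableOn.integrableOn_smul h.locInt_fun
      (hφ.partialDeriv i).smooth.continuous (hφ.partialDeriv i).compact (hφ.partialDeriv i).supp
    have h2 := LocallyIntegrableOn.integrableOn_smul h.locInt_deriv hφ.smooth.continuous hφ.compact
      hφ.supp
    simp only [← map_smul]
    rw [L.integral_comp_comm h1, L.integral_comp_comm h2, h.integral_eq φ hφ, map_neg]

theorem HasH1Grad.comp (L : 𝕜 →L[ℝ] 𝕜') {v : EuclideanSpace ℝ (Fin d) → 𝕜}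
    {G : Fin d → EuclideanSpace ℝ (Fin d) → 𝕜} (h : HasH1Grad Ω v G) :
    HasH1Grad Ω (fun x => L (v x)) (fun i x => L (G i x)) where
  memLp_fun := L.comp_memLp' h.memLp_fun
  memLp_grad i := L.comp_memLp' (h.memLp_grad i)
  weak i := (h.weak i).comp L

theorem HasH10Grad.comp (L : 𝕜 →L[ℝ] 𝕜') (hL : ∀ z, ‖L z‖ ≤ ‖z‖)
    {v : EuclideanSpace ℝ (Fin d) → 𝕜} {G : Fin d → EuclideanSpace ℝ (Fin d) → 𝕜}
    (h : HasH10Grad Ω v G) : HasH10Grad Ω (fun x => L (v x)) (fun i x => L (G i x)) where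
  toHasH1Grad := h.toHasH1Grad.comp L
  approx δ hδ := by
    obtain ⟨φ, hφ, h1, h2⟩ := h.approx δ hδ
    refine ⟨fun x => L (φ x), hφ.comp L, (eLpNorm_mono fun x => ?_).trans_lt h1,
      fun i => (eLpNorm_mono fun x => ?_).trans_lt (h2 i)⟩
    · simp only [Pi.sub_apply, ← map_sub]
      exact hL _
    · rw [partialDeriv_comp L (hφ.smooth.differentiable (by simp))]
      simp only [Pi.sub_apply, ← map_sub]
      exact hL _

theorem MemWAux.comp (L : 𝕜 →L[ℝ] 𝕜') (hL : ∀ z, ‖L z‖ ≤ ‖z‖) {σ p : ℝ} (hp : 0 ≤ p) {m : ℕ}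
    {u : EuclideanSpace ℝ (Fin d) → 𝕜} (h : MemWAux Ω σ p m u) :
    MemWAux Ω σ p m fun x => L (u x) := by
  induction m generalizing u with
  | zero =>
    refine ⟨L.comp_memLp' h.1, fun hσ => lt_of_le_of_lt ?_ (h.2 hσ)⟩
    refine lintegral_mono fun y => lintegral_mono fun x => ?_
    gcongr
    rw [← map_sub, enorm_le_iff_norm_le]
    exact hL _
  | succ m ih =>
    refine ⟨ih h.1, fun i => ?_⟩
    obtain ⟨w, hw, hw'⟩ := h.2 i
    exact ⟨_, hw.comp L, ih hw'⟩

theorem MemLp.integrable_mul_two {α : Type*} [MeasurableSpace α] {μ : Measure α} {f g : α → 𝕜}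
    (hf : MemLp f 2 μ) (hg : MemLp g 2 μ) : Integrable (fun x => f x * g x) μ :=
  hf.integrable_mul hg

theorem IsTest.memLp {φ : EuclideanSpace ℝ (Fin d) → 𝕜} (h : IsTest Ω φ) :
    MemLp φ 2 (volume.restrict Ω) :=
  (h.smooth.continuous.memLp_of_hasCompactSupport h.compact).restrict _

theorem IsTest.memLp_partialDeriv {φ : EuclideanSpace ℝ (Fin d) → 𝕜} (h : IsTest Ω φ) (i : Fin d) :
    MemLp (LimitReg.partialDeriv i φ) 2 (volume.restrict Ω) := by
  refine (Continuous.memLp_of_hasCompactSupport ?_ (h.compact.fderiv_apply (𝕜 := ℝ) _)).restrict _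
  exact (h.smooth.continuous_fderiv (by simp)).clm_apply continuous_const

theorem map_mul_ofReal (L : 𝕜 →L[ℝ] ℝ) (z : 𝕜) (r : ℝ) : L (z * (r : 𝕜)) = L z * r := by
  rw [mul_comm, ← RCLike.real_smul_eq_coe_mul, map_smul, smul_eq_mul, mul_comm]

theorem map_ofReal_mul (L : 𝕜 →L[ℝ] ℝ) (r : ℝ) (z : 𝕜) : L ((r : 𝕜) * z) = r * L z := by
  rw [← RCLike.real_smul_eq_coe_mul, map_smul, smul_eq_mul]

theorem map_integral_sum_mul_ofReal (L : 𝕜 →L[ℝ] ℝ) {G : Fin d → EuclideanSpace ℝ (Fin d) → 𝕜}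
    {Φ : Fin d → EuclideanSpace ℝ (Fin d) → ℝ} (hG : ∀ i, MemLp (G i) 2 (volume.restrict Ω))
    (hΦ : ∀ i, MemLp (Φ i) 2 (volume.restrict Ω)) :
    L (∫ x in Ω, ∑ i, G i x * (Φ i x : 𝕜)) = ∫ x in Ω, ∑ i, L (G i x) * Φ i x := by
  rw [← L.integral_comp_comm (integrable_finsetSum _ fun i _ =>
    MemLp.integrable_mul_two (hG i) (hΦ i).ofReal)]
  simp only [map_sum, map_mul_ofReal]

theorem map_integral_mul_ofReal (L : 𝕜 →L[ℝ] ℝ) {g : EuclideanSpace ℝ (Fin d) → 𝕜}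
    {φ : EuclideanSpace ℝ (Fin d) → ℝ} (hg : MemLp g 2 (volume.restrict Ω))
    (hφ : MemLp φ 2 (volume.restrict Ω)) :
    L (∫ x in Ω, g x * (φ x : 𝕜)) = ∫ x in Ω, L (g x) * φ x := by
  rw [← L.integral_comp_comm (MemLp.integrable_mul_two hg hφ.ofReal)]
  simp only [map_mul_ofReal]

theorem map_integral_sum_ofReal_mul (L : 𝕜 →L[ℝ] ℝ) {G : Fin d → EuclideanSpace ℝ (Fin d) → ℝ}
    {Φ : Fin d → EuclideanSpace ℝ (Fin d) → 𝕜} (hG : ∀ i, MemLp (G i) 2 (volume.restrict Ω))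
    (hΦ : ∀ i, MemLp (Φ i) 2 (volume.restrict Ω)) :
    L (∫ x in Ω, ∑ i, (G i x : 𝕜) * Φ i x) = ∫ x in Ω, ∑ i, G i x * L (Φ i x) := by
  rw [← L.integral_comp_comm (integrable_finsetSum _ fun i _ =>
    MemLp.integrable_mul_two (hG i).ofReal (hΦ i))]
  simp only [map_sum, map_ofReal_mul]

theorem map_integral_ofReal_mul (L : 𝕜 →L[ℝ] ℝ) {g : EuclideanSpace ℝ (Fin d) → ℝ}
    {φ : EuclideanSpace ℝ (Fin d) → 𝕜} (hg : MemLp g 2 (volume.restrict Ω))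
    (hφ : MemLp φ 2 (volume.restrict Ω)) :
    L (∫ x in Ω, (g x : 𝕜) * φ x) = ∫ x in Ω, g x * L (φ x) := by
  rw [← L.integral_comp_comm (MemLp.integrable_mul_two hg.ofReal hφ)]
  simp only [map_ofReal_mul]

/-- `L` is only real-linear, in practice the real or imaginary part. Testing with real-valued
functions lets it pass through the products. -/
theorem IsDirichletSol.comp (L : 𝕜 →L[ℝ] ℝ) (hL : ∀ z, ‖L z‖ ≤ ‖z‖)
    {g v : EuclideanSpace ℝ (Fin d) → 𝕜} (hg : MemLp g 2 (volume.restrict Ω))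
    (h : IsDirichletSol Ω g v) : IsDirichletSol Ω (fun x => L (g x)) (fun x => L (v x)) := by
  obtain ⟨G, hG, heq⟩ := h
  refine ⟨_, hG.comp L hL, fun φ hφ => ?_⟩
  have e := congrArg L (heq _ (hφ.comp (RCLike.ofRealCLM : ℝ →L[ℝ] 𝕜)))
  simp only [partialDeriv_comp (RCLike.ofRealCLM : ℝ →L[ℝ] 𝕜)
    (hφ.smooth.differentiable (by simp)), map_neg] at e
  simp only [RCLike.ofRealCLM_apply] at e
  rwa [map_integral_sum_mul_ofReal L hG.memLp_grad hφ.memLp_partialDeriv,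
    map_integral_mul_ofReal L hg hφ.memLp] at e

theorem IsNeumannSol.comp (L : 𝕜 →L[ℝ] ℝ) {g v : EuclideanSpace ℝ (Fin d) → 𝕜}
    (hg : MemLp g 2 (volume.restrict Ω)) (h : IsNeumannSol Ω g v) :
    IsNeumannSol Ω (fun x => L (g x)) (fun x => L (v x)) := by
  obtain ⟨G, hG, heq⟩ := h
  refine ⟨_, hG.comp L, fun φ Φ hφ => ?_⟩
  have e := congrArg L (heq _ _ (hφ.comp (RCLike.ofRealCLM : ℝ →L[ℝ] 𝕜)))
  simp only [RCLike.ofRealCLM_apply, map_neg] at e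
  rwa [map_integral_sum_mul_ofReal L hG.memLp_grad hφ.memLp_grad,
    map_integral_mul_ofReal L hg hφ.memLp_fun] at e

theorem ext_re_im {z w : 𝕜} (h : ∀ L : 𝕜 →L[ℝ] ℝ, (∀ z, ‖L z‖ ≤ ‖z‖) → L z = L w) : z = w :=
  RCLike.ext (h RCLike.reCLM fun _ => RCLike.norm_re_le_norm _)
    (h RCLike.imCLM fun _ => RCLike.norm_im_le_norm _)

/-- A general test function enters linearly, and its real and imaginary parts are real test
functions. -/
theorem IsDirichletSol.ofReal (𝕜 : Type*) [RCLike 𝕜] {g v : EuclideanSpace ℝ (Fin d) → ℝ}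
    (hg : MemLp g 2 (volume.restrict Ω)) (h : IsDirichletSol Ω g v) :
    IsDirichletSol Ω (fun x => (g x : 𝕜)) (fun x => (v x : 𝕜)) := by
  obtain ⟨G, hG, heq⟩ := h
  refine ⟨_, hG.comp (RCLike.ofRealCLM : ℝ →L[ℝ] 𝕜) (fun z => by simp), fun φ hφ => ?_⟩
  refine ext_re_im fun L hL => ?_
  have e := heq _ (hφ.comp L)
  simp only [partialDeriv_comp L (hφ.smooth.differentiable (by simp))] at e
  simp only [RCLike.ofRealCLM_apply, map_neg]
  rwa [map_integral_sum_ofReal_mul L hG.memLp_grad hφ.memLp_partialDeriv,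
    map_integral_ofReal_mul L hg hφ.memLp]

theorem IsNeumannSol.ofReal (𝕜 : Type*) [RCLike 𝕜] {g v : EuclideanSpace ℝ (Fin d) → ℝ}
    (hg : MemLp g 2 (volume.restrict Ω)) (h : IsNeumannSol Ω g v) :
    IsNeumannSol Ω (fun x => (g x : 𝕜)) (fun x => (v x : 𝕜)) := by
  obtain ⟨G, hG, heq⟩ := h
  refine ⟨_, hG.comp (RCLike.ofRealCLM : ℝ →L[ℝ] 𝕜), fun φ Φ hφ => ?_⟩
  refine ext_re_im fun L hL => ?_
  have e := heq _ _ (hφ.comp L)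
  simp only [RCLike.ofRealCLM_apply, map_neg]
  rwa [map_integral_sum_ofReal_mul L hG.memLp_grad hφ.memLp_grad,
    map_integral_ofReal_mul L hg hφ.memLp_fun]

end Comp

end SobolevTools

/-! ### Irregularity of the solutions -/

section Nonexistence

variable {q : ℕ}

/-- The strip exponent 1/2 = 1 - 1/2 comes from the square integrability of the gradient in H¹, so
it is available for every p, including p = 1. -/
theorem exists_regular_grad (hq : 7 ≤ q) {v : Plane → ℝ} {G : Fin 2 → Plane → ℝ}
    (hv : HasH1Grad (omega q) v G) {p ε : ℝ} (hp : 1 ≤ p) (hε : 0 < ε)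
    (h : MemW (omega q) (1 + 1 / p + ε) p v) :
    ∃ w : Fin 2 → Plane → ℝ, (∀ i, Measurable (w i)) ∧
      (∀ i, G i =ᵐ[volume.restrict (omega q)] w i) ∧
      (∀ i, MemLp (w i) 2 (volume.restrict (omega q))) ∧
      (∀ i, IntegrableOn (w i) (omega q)) ∧ (∀ i, StripBound q (w i) (1 / 2)) ∧
      (∀ i, ∃ η : ℝ, 0 < η ∧ OscBound q (w i) (3 + η)) := by
  choose w hwm hw hosc using fun i => oscBound_of_memW hq hp hε h i
  have hae : ∀ i, G i =ᵐ[volume.restrict (omega q)] w i := fun i =>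
    (hv.weak i).ae_eq (isOpen_omega hq) (hw i)
  have h2 : ∀ i, MemLp (w i) 2 (volume.restrict (omega q)) := fun i =>
    (memLp_congr_ae (hae i)).1 (hv.memLp_grad i)
  have h2' : ∀ i, MemLp (w i) (ENNReal.ofReal 2) (volume.restrict (omega q)) := fun i => by
    rw [ENNReal.ofReal_ofNat]; exact h2 i
  refine ⟨w, hwm, hae, h2, fun i => MemLp.integrableOn_omega hq one_le_two (h2' i), fun i => ?_, hosc⟩
  have := stripBound_of_memLp hq (p := 2) one_lt_two (h2' i)
  norm_num at this ⊢
  exact this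

theorem rot_apply (X : Fin 2 → Plane → ℝ) (x : Plane) :
    rot X 0 x = -X 1 x ∧ rot X 1 x = X 0 x := ⟨rfl, rfl⟩

theorem forall_rot {X : Fin 2 → Plane → ℝ} {P : (Plane → ℝ) → Prop} (hP : ∀ i, P (X i))
    (hn : ∀ f, P f → P fun x => -f x) (i : Fin 2) : P (rot X i) := by
  fin_cases i
  · exact hn _ (hP 1)
  · exact hP 0

theorem stripBound_neg {w : Plane → ℝ} {κ : ℝ} (h : StripBound q w κ) :
    StripBound q (fun x => -w x) κ := by
  simpa only [StripBound, enorm_neg] using h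

theorem oscBound_neg {w : Plane → ℝ} {κ : ℝ} (h : OscBound q w κ) :
    OscBound q (fun x => -w x) κ := by
  have : osc q (fun x => -w x) = osc q w := by
    ext S T
    simp only [osc, neg_sub_neg]
    refine lintegral_congr fun p => ?_
    rw [← enorm_neg, neg_sub]
  simpa only [OscBound, this] using h

theorem integrableOn_mul_of_continuous (hq : 7 ≤ q) {w : Plane → ℝ} (hw : IntegrableOn w (omega q))
    {g : Plane → ℝ} (hg : Continuous g) : IntegrableOn (fun x => w x * g x) (omega q) := by
  obtain ⟨B, hB⟩ := (isCompact_closedBall (0 : Plane) (8 / 5)).exists_bound_of_continuousOn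
    hg.continuousOn
  refine hw.mul_bdd (c := B) hg.aestronglyMeasurable ?_
  filter_upwards [ae_restrict_mem (isOpen_omega hq).measurableSet] with x hx
  exact hB x (Metric.ball_subset_closedBall (omega_subset_ball hq hx))

theorem memLp_omega_of_continuous (hq : 7 ≤ q) {𝕜 : Type*} [RCLike 𝕜] {g : Plane → 𝕜}
    (hg : Continuous g) : MemLp g 2 (volume.restrict (omega q)) := by
  obtain ⟨B, hB⟩ := (isCompact_closedBall (0 : Plane) (8 / 5)).exists_bound_of_continuousOn
    hg.continuousOn
  have : Fact (volume (omega q) < ⊤) := ⟨volume_omega_lt_top hq⟩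
  refine MemLp.of_bound hg.aestronglyMeasurable B ?_
  filter_upwards [ae_restrict_mem (isOpen_omega hq).measurableSet] with x hx
  exact hB x (Metric.ball_subset_closedBall (omega_subset_ball hq hx))

theorem hasH1Grad_of_contDiff (hq : 7 ≤ q) {u : Plane → ℝ} (hu : ContDiff ℝ 1 u) :
    HasH1Grad (omega q) u fun i => partialDeriv i u where
  memLp_fun := memLp_omega_of_continuous hq hu.continuous
  memLp_grad i := memLp_omega_of_continuous hq (continuous_partialDeriv hu i)
  weak i := isWeakPartial_of_contDiff hu i

theorem integral_neg_add {α : Type*} [MeasurableSpace α] {μ : Measure α} {f g : α → ℝ}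
    (hf : Integrable f μ) (hg : Integrable g μ) :
    ∫ x, (-f x + g x) ∂μ = -∫ x, f x ∂μ + ∫ x, g x ∂μ := by
  rw [← integral_neg]
  exact integral_add hf.neg hg

/-- The rotated gradient of a test function is orthogonal to all gradients. -/
theorem integral_rot_partialDeriv_test (hq : 7 ≤ q) {φ : Plane → ℝ} (hφ : IsTest (omega q) φ)
    {Ψ : Plane → ℝ} (hΨ : ContDiff ℝ 1 Ψ) :
    ∫ x in omega q, ∑ i, rot (fun i => partialDeriv i φ) i x * partialDeriv i Ψ x = 0 := by
  have hi : ∀ i j, IntegrableOn (fun x => partialDeriv i φ x * partialDeriv j Ψ x) (omega q) :=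
    fun i j => MemLp.integrable_mul_two (hφ.memLp_partialDeriv i)
      (memLp_omega_of_continuous hq (continuous_partialDeriv hΨ j))
  -- The derivatives are moved onto φ, since Ψ is only C¹; the mixed second derivatives of φ then
  -- cancel.
  have ibp : ∀ i j : Fin 2, ∫ x in omega q, partialDeriv i φ x * partialDeriv j Ψ x =
      -∫ x in omega q, partialDeriv j (partialDeriv i φ) x * Ψ x := by
    intro i j
    have h := hφ.partialDeriv i
    rw [integral_partialDeriv_mul (h.smooth.of_le (by norm_cast)) h.compact h.supp hΨ, neg_neg]
  simp only [Fin.sum_univ_two, rot_apply, neg_mul]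
  rw [integral_neg_add (hi 1 0) (hi 0 1), ibp, ibp, neg_neg, ← sub_eq_add_neg,
    sub_eq_zero]
  simp only [partialDeriv_comm hφ.smooth 0 1]

/-- The rotated gradient of an `H¹₀` function is orthogonal to all gradients. -/
theorem integral_rot_grad_eq_zero (hq : 7 ≤ q) {v : Plane → ℝ} {G : Fin 2 → Plane → ℝ}
    (hv : HasH10Grad (omega q) v G) {Ψ : Plane → ℝ} (hΨ : ContDiff ℝ 1 Ψ) :
    ∫ x in omega q, ∑ i, rot G i x * partialDeriv i Ψ x = 0 := by
  have hΨ2 : ∀ i, MemLp (partialDeriv i Ψ) 2 (volume.restrict (omega q)) := fun i =>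
    memLp_omega_of_continuous hq (continuous_partialDeriv hΨ i)
  have hB : ∀ i, eLpNorm (partialDeriv i Ψ) 2 (volume.restrict (omega q)) ≠ ⊤ := fun i =>
    (hΨ2 i).2.ne
  rw [← enorm_eq_zero, ← nonpos_iff_eq_zero]
  refine ENNReal.le_of_forall_pos_le_add fun ε hε _ => ?_
  -- By Hölder's inequality, approximating the gradient up to ε/B costs at most ε in the integral;
  -- the summand 1 keeps B away from 0.
  set B := eLpNorm (partialDeriv 0 Ψ) 2 (volume.restrict (omega q)) +
    eLpNorm (partialDeriv 1 Ψ) 2 (volume.restrict (omega q)) + 1 with hBdef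
  have hB0 : B ≠ 0 := by simp [hBdef]
  have hBt : B ≠ ⊤ := by simp [hBdef, hB]
  have hε0 : (ε : ℝ≥0∞) ≠ 0 := by exact_mod_cast hε.ne'
  obtain ⟨φ, hφ, -, hφG⟩ := hv.approx (ε / B) (ENNReal.div_pos hε0 hBt)
  have hd : ∀ i, MemLp (fun x => G i x - partialDeriv i φ x) 2 (volume.restrict (omega q)) :=
    fun i => (hv.memLp_grad i).sub (hφ.memLp_partialDeriv i)
  have i1 : ∀ i j, IntegrableOn (fun x => G i x * partialDeriv j Ψ x) (omega q) := fun i j =>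
    MemLp.integrable_mul_two (hv.memLp_grad i) (hΨ2 j)
  have i2 : ∀ i j, IntegrableOn (fun x => partialDeriv i φ x * partialDeriv j Ψ x) (omega q) :=
    fun i j => MemLp.integrable_mul_two (hφ.memLp_partialDeriv i) (hΨ2 j)
  have e : ∫ x in omega q, ∑ i, rot G i x * partialDeriv i Ψ x =
      ∫ x in omega q, (-((G 1 x - partialDeriv 1 φ x) * partialDeriv 0 Ψ x) +
        (G 0 x - partialDeriv 0 φ x) * partialDeriv 1 Ψ x) := by
    have h0 := integral_rot_partialDeriv_test hq hφ hΨ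
    simp only [Fin.sum_univ_two, rot_apply, neg_mul] at h0 ⊢
    rw [integral_neg_add (i2 1 0) (i2 0 1)] at h0
    have d : ∀ i j, IntegrableOn (fun x => G i x * partialDeriv j Ψ x -
        partialDeriv i φ x * partialDeriv j Ψ x) (omega q) := fun i j => (i1 i j).sub (i2 i j)
    simp only [sub_mul]
    rw [integral_neg_add (i1 1 0) (i1 0 1),
      integral_neg_add (d 1 0) (d 0 1), integral_sub (i1 1 0) (i2 1 0),
      integral_sub (i1 0 1) (i2 0 1)]
    linarith
  have holder : ∀ i j, ∫⁻ x in omega q, ‖(G i x - partialDeriv i φ x) * partialDeriv j Ψ x‖ₑ ≤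
      ε / B * eLpNorm (partialDeriv j Ψ) 2 (volume.restrict (omega q)) := by
    intro i j
    have := eLpNorm_smul_le_mul_eLpNorm (p := 2) (q := 2) (r := 1) (hΨ2 j).1 (hd i).1
    rw [eLpNorm_one_eq_lintegral_enorm] at this
    refine this.trans ?_
    gcongr
    exact (hφG i).le
  rw [e, zero_add]
  calc _ ≤ ∫⁻ x in omega q, ‖-((G 1 x - partialDeriv 1 φ x) * partialDeriv 0 Ψ x) +
        (G 0 x - partialDeriv 0 φ x) * partialDeriv 1 Ψ x‖ₑ := enorm_integral_le_lintegral_enorm _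
    _ ≤ ∫⁻ x in omega q, (‖(G 1 x - partialDeriv 1 φ x) * partialDeriv 0 Ψ x‖ₑ +
        ‖(G 0 x - partialDeriv 0 φ x) * partialDeriv 1 Ψ x‖ₑ) :=
        lintegral_mono fun x => (enorm_add_le _ _).trans (by rw [enorm_neg])
    _ = (∫⁻ x in omega q, ‖(G 1 x - partialDeriv 1 φ x) * partialDeriv 0 Ψ x‖ₑ) +
        ∫⁻ x in omega q, ‖(G 0 x - partialDeriv 0 φ x) * partialDeriv 1 Ψ x‖ₑ :=
        lintegral_add_left' ((hd 1).1.mul (hΨ2 0).1).enorm _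
    _ ≤ ε / B * eLpNorm (partialDeriv 0 Ψ) 2 (volume.restrict (omega q)) +
        ε / B * eLpNorm (partialDeriv 1 Ψ) 2 (volume.restrict (omega q)) :=
        add_le_add (holder 1 0) (holder 0 1)
    _ ≤ ε / B * B := by
        rw [← mul_add]
        gcongr
        exact le_self_add
    _ = ε := ENNReal.div_mul_cancel hB0 hBt

theorem integral_sum_congr_ae {Ω : Set Plane} {G w H : Fin 2 → Plane → ℝ}
    (h : ∀ i, G i =ᵐ[volume.restrict Ω] w i) :
    ∫ x in Ω, ∑ i, G i x * H i x = ∫ x in Ω, ∑ i, w i x * H i x := by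
  refine integral_congr_ae ?_
  filter_upwards [h 0, h 1] with x h0 h1
  rw [Fin.sum_univ_two, Fin.sum_univ_two, h0, h1]

/-- The rotated gradient is a `FluxField` with source 0, its normal component being a tangential
derivative of v, which vanishes. Rotating twice gives -∇v, so `FluxField.tendsto_rot` with weight 1
shows that the integral of -∇v·∇χ tends to 0. By the equation this integral is that of χ, which
tends to the area of the domain. -/
theorem not_memW_of_isDirichletSol (hq : LargeBase q) {v : Plane → ℝ}
    (hv : IsDirichletSol (omega q) (fun _ => 1) v) {p ε : ℝ} (hp : 1 ≤ p) (hε : 0 < ε) :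
    ¬MemW (omega q) (1 + 1 / p + ε) p v := by
  intro hW
  have hq7 := hq.1
  obtain ⟨G, hG, heq⟩ := hv
  obtain ⟨w, hwm, hae, hw2, hwi, hws, hwo⟩ := exists_regular_grad hq7 hG.toHasH1Grad hp hε hW
  have hrae : ∀ i, rot G i =ᵐ[volume.restrict (omega q)] rot w i := by
    intro i
    fin_cases i
    · exact (hae 1).neg
    · exact hae 0
  have hX : FluxField q (rot w) (fun _ => 0) :=
    { meas := forall_rot (P := Measurable) hwm fun f hf => hf.neg
      integrable := forall_rot (P := fun f => IntegrableOn f (omega q) volume) hwi fun f hf => hf.neg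
      source := integrableOn_zero
      stripBound := forall_rot (P := fun f => StripBound q f (1 / 2)) hws fun f hf => stripBound_neg hf
      oscBound := forall_rot (P := fun f => ∃ η : ℝ, 0 < η ∧ OscBound q f (3 + η)) hwo
        fun f ⟨η, hη, hf⟩ => ⟨η, hη, oscBound_neg hf⟩
      eq := fun Ψ hΨ => by
        rw [← integral_sum_congr_ae hrae, integral_rot_grad_eq_zero hq7 hG hΨ]
        simp }
  have lim := hX.tendsto_rot hq (g := fun _ => 1) contDiff_const
  have hsc := tendsto_scale hq7
  have ev : ∀ᶠ k in Filter.atTop, ∫ x in omega q, 1 * ∑ i, rot (rot w) i x *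
      partialDeriv i (chi q (scale q k)) x = ∫ x in omega q, chi q (scale q k) x := by
    filter_upwards [hsc.eventually (ge_mem_nhds (show (0 : ℝ) < 1 / 5 by norm_num))] with k hk
    have h0 := scale_pos q k
    have hl : IntegrableOn (fun _ : Plane => (-1 : ℝ)) (omega q) :=
      integrableOn_const (volume_omega_lt_top hq7).ne
    have key := integral_eq_of_contDiff_one (isOpen_omega hq7) (W := w) (l := fun _ => -1) hwi hl
      (fun φ hφ => by
        rw [← integral_sum_congr_ae hae, heq φ hφ, ← integral_neg]
        simp only [one_mul, neg_mul]) (contDiff_chi hq7 h0 hk) (hasCompactSupport_chi hq7 h0 hk)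
      (tsupport_chi_subset hq7 h0 hk)
    simp only [neg_mul, one_mul, integral_neg] at key
    rw [← neg_inj, ← key, ← integral_neg]
    congr 1
    ext x
    simp only [Fin.sum_univ_two, rot_apply]
    ring
  have lim2 : Filter.Tendsto (fun k => ∫ x in omega q, chi q (scale q k) x) Filter.atTop
      (nhds (∫ _x in omega q, (1 : ℝ))) := by
    have := tendsto_integral_filter_of_dominated_convergence (μ := volume.restrict (omega q))
      (F := fun k x => chi q (scale q k) x) (f := fun _ => (1 : ℝ)) (l := Filter.atTop)
      (fun _ => 1) ?_ ?_ (integrableOn_const (volume_omega_lt_top hq7).ne) ?_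
    · exact this
    · filter_upwards [hsc.eventually (ge_mem_nhds (show (0 : ℝ) < 1 / 5 by norm_num))] with k hk
      exact (contDiff_chi hq7 (scale_pos q k) hk).continuous.aestronglyMeasurable
    · refine .of_forall fun k => .of_forall fun x => ?_
      have := chi_mem (q := q) (scale q k) x
      rw [Real.norm_eq_abs, abs_of_nonneg this.1]
      exact this.2
    · filter_upwards [ae_restrict_mem (isOpen_omega hq7).measurableSet] with x hx
      exact tendsto_chi hq7 hsc (scale_pos q) hx
  have h0 := tendsto_nhds_unique (lim.congr' ev) lim2
  have hpos : 0 < volume.real (omega q) :=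
    ENNReal.toReal_pos ((isOpen_omega hq7).measure_pos _ ⟨0, zero_mem_omega hq7⟩).ne'
      (volume_omega_lt_top hq7).ne
  rw [setIntegral_const, smul_eq_mul, mul_one] at h0
  exact hpos.ne h0

theorem contDiff_quadPoly (α β : ℝ) : ContDiff ℝ ∞ (quadPoly α β) := by
  have h : ∀ i : Fin 2, ContDiff ℝ ∞ fun x : Plane => x i := fun i => contDiff_euclidean.1 contDiff_id i
  exact (((h 0).mul (h 1)).const_smul α).add ((((h 0).pow 2).sub ((h 1).pow 2)).const_smul β)

theorem partialDeriv_quadPoly (α β : ℝ) (x : Plane) :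
    partialDeriv 0 (quadPoly α β) x = α * x 1 + 2 * β * x 0 ∧
      partialDeriv 1 (quadPoly α β) x = α * x 0 - 2 * β * x 1 := by
  have h : ∀ i : Fin 2, HasFDerivAt (fun x : Plane => x i) (EuclideanSpace.proj i : Plane →L[ℝ] ℝ) x :=
    fun i => (EuclideanSpace.proj i : Plane →L[ℝ] ℝ).hasFDerivAt
  have hd : HasFDerivAt (quadPoly α β) _ x :=
    (((h 0).mul (h 1)).const_mul α).add ((((h 0).pow 2).sub ((h 1).pow 2)).const_mul β)
  rw [partialDeriv, partialDeriv, hd.fderiv]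
  constructor <;> simp <;> ring

/-- The gradient is a `FluxField` with source -g, where g is `quadPoly α β`. Its rotation is
divergence free, so testing with kχ turns `FluxField.tendsto_rot` for the weight k into the
vanishing of ∫ rot ∇v·∇k. By the choice of k and the equation tested with g itself, this integral is
-∫ g². -/
theorem not_memW_of_isNeumannSol (hq : LargeBase q) {α β : ℝ} (hαβ : α ≠ 0 ∨ β ≠ 0) {v : Plane → ℝ}
    (hv : IsNeumannSol (omega q) (quadPoly α β) v) {p ε : ℝ} (hp : 1 ≤ p) (hε : 0 < ε) :
    ¬MemW (omega q) (1 + 1 / p + ε) p v := by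
  intro hW
  have hq7 := hq.1
  obtain ⟨G, hG, heq⟩ := hv
  obtain ⟨w, hwm, hae, hw2, hwi, hws, hwo⟩ := exists_regular_grad hq7 hG hp hε hW
  have hg1 : ContDiff ℝ 1 (quadPoly α β) := (contDiff_quadPoly α β).of_le (by norm_cast)
  have hX : FluxField q w (fun x => -quadPoly α β x) :=
    { meas := hwm
      integrable := hwi
      source := by
        have := integrableOn_mul_of_continuous hq7
          (integrableOn_const (C := (-1 : ℝ)) (volume_omega_lt_top hq7).ne) hg1.continuous
        simpa using this
      stripBound := hws
      oscBound := hwo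
      eq := fun Ψ hΨ => by
        rw [← integral_sum_congr_ae hae, heq Ψ _ (hasH1Grad_of_contDiff hq7 hΨ), ← integral_neg]
        simp only [neg_mul] }
  -- This is the harmonic conjugate of g: ∂₁k = ∂₀g and ∂₀k = -∂₁g, so that rot ∇v·∇k = ∇v·∇g.
  set k := quadPoly (2 * β) (-α / 2) with hk
  have hk1 : ContDiff ℝ 1 k := (contDiff_quadPoly _ _).of_le (by norm_cast)
  have lim := hX.tendsto_rot hq hk1
  have hsc := tendsto_scale hq7
  have hri : ∀ i, IntegrableOn (rot w i) (omega q) :=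
    forall_rot (P := fun f => IntegrableOn f (omega q) volume) hwi fun f hf => hf.neg
  set s : Plane → ℝ := fun x => ∑ i, rot w i x * partialDeriv i k x with hs
  have hsi : IntegrableOn s (omega q) := integrable_finsetSum _ fun i _ =>
    integrableOn_mul_of_continuous hq7 (hri i) (continuous_partialDeriv hk1 i)
  have ev : ∀ᶠ j in Filter.atTop, ∫ x in omega q, k x * ∑ i, rot w i x *
      partialDeriv i (chi q (scale q j)) x = -∫ x in omega q, chi q (scale q j) x * s x := by
    filter_upwards [hsc.eventually (ge_mem_nhds (show (0 : ℝ) < 1 / 5 by norm_num))] with j hj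
    have h0 := scale_pos q j
    have hχ := contDiff_chi hq7 h0 hj
    have key := integral_eq_of_contDiff_one (isOpen_omega hq7) (W := rot w) (l := fun _ => 0) hri
      integrableOn_zero (fun φ hφ => by
        -- The weak gradient is curl free: its two components are tested with ∂₁φ and ∂₀φ, and the
        -- mixed derivatives agree.
        have hw : ∀ i, IsWeakPartial (omega q) i v (w i) := fun i =>
          (hG.weak i).congr_ae .rfl (hae i)
        have hi : ∀ i j, IntegrableOn (fun x => partialDeriv j φ x * w i x) (omega q) := fun i j =>
          MemLp.integrable_mul_two (hφ.memLp_partialDeriv j) (hw2 i)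
        have e1 := (hw 1).integral_eq _ (hφ.partialDeriv 0)
        have e0 := (hw 0).integral_eq _ (hφ.partialDeriv 1)
        simp only [smul_eq_mul] at e0 e1
        simp only [partialDeriv_comm hφ.smooth 1 0] at e1
        simp only [zero_mul, integral_zero, Fin.sum_univ_two, rot_apply, neg_mul]
        simp only [mul_comm (w _ _)]
        rw [integral_neg_add (hi 1 0) (hi 0 1), ← e1, e0]
        ring)
      (Φ := fun x => k x * chi q (scale q j) x) (hk1.mul hχ)
      (hasCompactSupport_chi hq7 h0 hj).mul_left
      ((tsupport_mul_subset_right).trans (tsupport_chi_subset hq7 h0 hj))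
    have hder : ∀ i x, partialDeriv i (fun x => k x * chi q (scale q j) x) x =
        k x * partialDeriv i (chi q (scale q j)) x + chi q (scale q j) x * partialDeriv i k x := by
      intro i x
      have : HasFDerivAt (fun x => k x * chi q (scale q j) x) _ x :=
        (hk1.differentiable one_ne_zero x).hasFDerivAt.mul
          (hχ.differentiable one_ne_zero x).hasFDerivAt
      rw [partialDeriv, this.fderiv]
      simp [partialDeriv]
    have i1 : IntegrableOn (fun x => k x * ∑ i, rot w i x *
        partialDeriv i (chi q (scale q j)) x) (omega q) := by
      have := integrableOn_mul_of_continuous hq7 (integrable_finsetSum Finset.univ fun i _ =>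
        integrableOn_mul_of_continuous hq7 (hri i) (continuous_partialDeriv hχ i)) hk1.continuous
      simpa only [mul_comm] using this
    have i2 : IntegrableOn (fun x => chi q (scale q j) x * s x) (omega q) := by
      have := integrableOn_mul_of_continuous hq7 hsi hχ.continuous
      simpa only [mul_comm] using this
    rw [eq_neg_iff_add_eq_zero, ← integral_add i1 i2]
    simp only [zero_mul, integral_zero, hder] at key
    rw [← key]
    congr 1
    ext x
    simp only [hs, Fin.sum_univ_two]
    ring
  have lim2 : Filter.Tendsto (fun j => -∫ x in omega q, chi q (scale q j) x * s x) Filter.atTop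
      (nhds (-∫ x in omega q, s x)) := by
    refine (tendsto_integral_filter_of_dominated_convergence (fun x => ‖s x‖) ?_ ?_ hsi.norm ?_).neg
    · filter_upwards [hsc.eventually (ge_mem_nhds (show (0 : ℝ) < 1 / 5 by norm_num))] with j hj
      exact (contDiff_chi hq7 (scale_pos q j) hj).continuous.aestronglyMeasurable.mul hsi.1
    · refine .of_forall fun j => .of_forall fun x => ?_
      have := chi_mem (q := q) (scale q j) x
      rw [norm_mul, Real.norm_eq_abs, abs_of_nonneg this.1]
      exact mul_le_of_le_one_left (norm_nonneg _) this.2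
    · filter_upwards [ae_restrict_mem (isOpen_omega hq7).measurableSet] with x hx
      simpa using (tendsto_chi hq7 hsc (scale_pos q) hx).mul_const (s x)
  have h0 := tendsto_nhds_unique (lim.congr' ev) lim2
  have hsg : ∫ x in omega q, s x = -∫ x in omega q, quadPoly α β x * quadPoly α β x := by
    rw [← heq _ _ (hasH1Grad_of_contDiff hq7 hg1), integral_sum_congr_ae hae]
    congr 1
    ext x
    simp only [hs, Fin.sum_univ_two, rot_apply, hk, partialDeriv_quadPoly]
    ring
  rw [hsg, neg_neg] at h0
  have hnn : 0 ≤ᵐ[volume.restrict (omega q)] fun x => quadPoly α β x * quadPoly α β x :=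
    .of_forall fun x => mul_self_nonneg _
  have hci : IntegrableOn (fun x => quadPoly α β x * quadPoly α β x) (omega q) := by
    have := integrableOn_mul_of_continuous hq7
      (integrableOn_const (C := (1 : ℝ)) (volume_omega_lt_top hq7).ne)
      (hg1.continuous.mul hg1.continuous)
    simpa using this
  have hz := (setIntegral_eq_zero_iff_of_nonneg_ae hnn hci).1 h0.symm
  have hzero : EqOn (fun x => quadPoly α β x * quadPoly α β x) 0 (omega q) :=
    Measure.eqOn_open_of_ae_eq hz (isOpen_omega hq7)
      (hg1.continuous.mul hg1.continuous).continuousOn continuousOn_const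
  have pt : ∀ a b : ℝ, a ^ 2 + b ^ 2 < 4 / 25 → quadPoly α β !₂[a, b] = 0 := by
    intro a b hab
    have hm : (!₂[a, b] : Plane) ∈ omega q := by
      refine ball_subset_omega hq7 ?_
      rw [mem_ball_zero_iff, EuclideanSpace.norm_eq, Real.sqrt_lt' (by norm_num)]
      simp [Fin.sum_univ_two]
      linarith
    simpa using hzero hm
  -- The values of g at these two points are β/25 and α/25.
  have p1 := pt (1 / 5) 0 (by norm_num)
  have p2 := pt (1 / 5) (1 / 5) (by norm_num)
  simp [quadPoly] at p1 p2
  rcases hαβ with h | h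
  · exact h p2
  · exact h p1

end Nonexistence

/-! ### Weak formulations in Hilbert space -/

section Hilbert

/-- The Lax-Milgram theorem for a sum of squares, on a closed subspace. -/
theorem exists_weak_solution {H K ι : Type*} [NormedAddCommGroup H] [InnerProductSpace ℝ H]
    [CompleteSpace H] [NormedAddCommGroup K] [InnerProductSpace ℝ K] [Fintype ι]
    (V : Submodule ℝ H) (hV : IsClosed (V : Set H)) (A : ι → H →L[ℝ] K) {c : ℝ} (hc : 0 < c)
    (h : ∀ v ∈ V, c * ‖v‖ ^ 2 ≤ ∑ i, ‖A i v‖ ^ 2) (ℓ : H →L[ℝ] ℝ) :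
    ∃ u ∈ V, ∀ w ∈ V, ∑ i, inner ℝ (A i u) (A i w) = ℓ w := by
  have : CompleteSpace V := hV.completeSpace_coe
  set B : V →L[ℝ] V →L[ℝ] ℝ :=
    ∑ i, (innerSL ℝ).bilinearComp ((A i).comp V.subtypeL) ((A i).comp V.subtypeL) with hB
  have hBv : ∀ v w : V, B v w = ∑ i, inner ℝ (A i v) (A i w) := by
    intro v w
    simp [hB]
  have hco : IsCoercive B := by
    refine ⟨c, hc, fun v => ?_⟩
    rw [hBv]
    simp only [real_inner_self_eq_norm_sq]
    have := h v v.2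
    rw [mul_assoc, ← sq]
    exact this
  set f : V := (InnerProductSpace.toDual ℝ V).symm (ℓ.comp V.subtypeL) with hf
  refine ⟨hco.continuousLinearEquivOfBilin.symm f, Subtype.property _, fun w hw => ?_⟩
  have h1 := hco.continuousLinearEquivOfBilin_apply (hco.continuousLinearEquivOfBilin.symm f) ⟨w, hw⟩
  rw [ContinuousLinearEquiv.apply_symm_apply, hBv] at h1
  rw [← h1, hf, InnerProductSpace.toDual_symm_apply]
  rfl

variable (Ω : Set Plane)

/-- The space of square integrable functions on `Ω`. -/
abbrev L2 : Type := Lp ℝ 2 (volume.restrict Ω)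

/-- Triples of square integrable functions, thought of as a function with its gradient. -/
abbrev Jet : Type := PiLp 2 fun _ : Option (Fin 2) => L2 Ω

variable {Ω}

/-- The components of a jet. -/
noncomputable def Jet.proj (o : Option (Fin 2)) : Jet Ω →L[ℝ] L2 Ω :=
  PiLp.proj 2 (fun _ : Option (Fin 2) => L2 Ω) o

/-- The jet of a function `v` with gradient `G`. -/
noncomputable def Jet.mk {v : Plane → ℝ} {G : Fin 2 → Plane → ℝ}
    (hv : MemLp v 2 (volume.restrict Ω)) (hG : ∀ i, MemLp (G i) 2 (volume.restrict Ω)) : Jet Ω :=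
  WithLp.toLp 2 fun o => o.elim (hv.toLp v) fun i => (hG i).toLp (G i)

theorem Jet.proj_mk_none {v : Plane → ℝ} {G : Fin 2 → Plane → ℝ}
    (hv : MemLp v 2 (volume.restrict Ω)) (hG : ∀ i, MemLp (G i) 2 (volume.restrict Ω)) :
    Jet.proj none (Jet.mk hv hG) = hv.toLp v := rfl

theorem Jet.proj_mk_some {v : Plane → ℝ} {G : Fin 2 → Plane → ℝ}
    (hv : MemLp v 2 (volume.restrict Ω)) (hG : ∀ i, MemLp (G i) 2 (volume.restrict Ω)) (i : Fin 2) :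
    Jet.proj (some i) (Jet.mk hv hG) = (hG i).toLp (G i) := rfl

theorem Jet.ext {x y : Jet Ω} (h : ∀ o, Jet.proj o x = Jet.proj o y) : x = y :=
  PiLp.ext h

theorem Jet.norm_sq (x : Jet Ω) : ‖x‖ ^ 2 = ‖Jet.proj none x‖ ^ 2 + ∑ i, ‖Jet.proj (some i) x‖ ^ 2 := by
  rw [PiLp.norm_sq_eq_of_L2, Fintype.sum_option]
  rfl

theorem inner_toLp {f : Plane → ℝ} (hf : MemLp f 2 (volume.restrict Ω)) (x : L2 Ω) :
    inner ℝ (hf.toLp f) x = ∫ a in Ω, f a * x a := by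
  rw [L2.inner_def]
  refine integral_congr_ae ?_
  filter_upwards [hf.coeFn_toLp] with a ha
  rw [ha]
  simp [mul_comm]

/-- The closed subspace of all jets `(v, G)` with `v ∈ H¹(Ω)` and gradient `G`. -/
def h1Space (Ω : Set Plane) : Submodule ℝ (Jet Ω) where
  carrier := {x | ∀ φ : Plane → ℝ, IsTest Ω φ → ∀ i,
    (∫ a in Ω, partialDeriv i φ a * Jet.proj none x a) +
      ∫ a in Ω, φ a * Jet.proj (some i) x a = 0}
  zero_mem' φ hφ i := by
    rw [map_zero, map_zero, ← inner_toLp (hφ.memLp_partialDeriv i), ← inner_toLp hφ.memLp]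
    simp
  add_mem' {x y} hx hy φ hφ i := by
    have h1 := hx φ hφ i
    have h2 := hy φ hφ i
    rw [← inner_toLp (hφ.memLp_partialDeriv i), ← inner_toLp hφ.memLp] at h1 h2 ⊢
    rw [map_add, map_add, inner_add_right, inner_add_right]
    linarith
  smul_mem' c x hx φ hφ i := by
    have h1 := hx φ hφ i
    rw [← inner_toLp (hφ.memLp_partialDeriv i), ← inner_toLp hφ.memLp] at h1 ⊢
    rw [map_smul, map_smul, inner_smul_right, inner_smul_right, ← mul_add, h1, mul_zero]

theorem mem_h1Space {x : Jet Ω} : x ∈ h1Space Ω ↔ ∀ φ : Plane → ℝ, IsTest Ω φ → ∀ i,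
    (∫ a in Ω, partialDeriv i φ a * Jet.proj none x a) +
      ∫ a in Ω, φ a * Jet.proj (some i) x a = 0 := Iff.rfl

/-- Each condition is an equation between L² pairings with fixed functions, hence continuous in the
jet. -/
theorem isClosed_h1Space : IsClosed (h1Space Ω : Set (Jet Ω)) := by
  have : (h1Space Ω : Set (Jet Ω)) = ⋂ (φ : Plane → ℝ) (hφ : IsTest Ω φ) (i : Fin 2),
      {x | inner ℝ ((hφ.memLp_partialDeriv i).toLp _) (Jet.proj none x) +
        inner ℝ (hφ.memLp.toLp _) (Jet.proj (some i) x) = 0} := by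
    ext x
    simp only [SetLike.mem_coe, mem_h1Space, mem_iInter, mem_ofPred_eq, inner_toLp]
  rw [this]
  refine isClosed_iInter fun φ => isClosed_iInter fun hφ => isClosed_iInter fun i =>
    isClosed_eq ?_ continuous_const
  exact ((innerSL ℝ _).continuous.comp (Jet.proj none).continuous).add
    ((innerSL ℝ _).continuous.comp (Jet.proj (some i)).continuous)

theorem mk_mem_h1Space {v : Plane → ℝ} {G : Fin 2 → Plane → ℝ} (h : HasH1Grad Ω v G) :
    Jet.mk h.memLp_fun h.memLp_grad ∈ h1Space Ω := by
  intro φ hφ i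
  have e := (h.weak i).integral_eq φ hφ
  simp only [smul_eq_mul] at e
  have e1 : ∫ a in Ω, partialDeriv i φ a * Jet.proj none (Jet.mk h.memLp_fun h.memLp_grad) a =
      ∫ a in Ω, partialDeriv i φ a * v a := by
    refine integral_congr_ae ?_
    filter_upwards [h.memLp_fun.coeFn_toLp] with a ha
    rw [Jet.proj_mk_none, ha]
  have e2 : ∫ a in Ω, φ a * Jet.proj (some i) (Jet.mk h.memLp_fun h.memLp_grad) a =
      ∫ a in Ω, φ a * G i a := by
    refine integral_congr_ae ?_
    filter_upwards [(h.memLp_grad i).coeFn_toLp] with a ha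
    rw [Jet.proj_mk_some, ha]
  rw [e1, e2, e, neg_add_cancel]

theorem hasH1Grad_of_mem (hΩ : volume Ω < ⊤) {x : Jet Ω} (hx : x ∈ h1Space Ω) :
    HasH1Grad Ω (Jet.proj none x) (fun i => Jet.proj (some i) x) where
  memLp_fun := Lp.memLp _
  memLp_grad i := Lp.memLp _
  weak i := by
    have : Fact (volume Ω < ⊤) := ⟨hΩ⟩
    refine ⟨IntegrableOn.locallyIntegrableOn ((Lp.memLp _).integrable one_le_two),
      IntegrableOn.locallyIntegrableOn ((Lp.memLp _).integrable one_le_two), fun φ hφ => ?_⟩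
    simp only [smul_eq_mul]
    linarith [hx φ hφ i]

/-- The jets of test functions. -/
def testSpace (Ω : Set Plane) : Submodule ℝ (Jet Ω) where
  carrier := {x | ∃ (φ : Plane → ℝ) (hφ : IsTest Ω φ), x = Jet.mk hφ.memLp hφ.memLp_partialDeriv}
  zero_mem' := by
    have h0 : IsTest Ω (fun _ : Plane => (0 : ℝ)) :=
      ⟨contDiff_const, HasCompactSupport.zero, by simp [tsupport]⟩
    refine ⟨_, h0, Jet.ext fun o => ?_⟩
    have hp : ∀ i, partialDeriv i (fun _ : Plane => (0 : ℝ)) = 0 := fun i => by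
      ext x; simp [partialDeriv]
    cases o with
    | none => rw [Jet.proj_mk_none, map_zero]; exact (MemLp.toLp_zero h0.memLp).symm
    | some i =>
      rw [Jet.proj_mk_some, map_zero]
      simp only [hp]
      exact (MemLp.toLp_zero _).symm
  add_mem' := by
    rintro x y ⟨φ, hφ, rfl⟩ ⟨ψ, hψ, rfl⟩
    have h : IsTest Ω (φ + ψ) := ⟨hφ.smooth.add hψ.smooth, hφ.compact.add hψ.compact,
      (tsupport_add _ _).trans (union_subset hφ.supp hψ.supp)⟩
    refine ⟨_, h, Jet.ext fun o => ?_⟩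
    have hp : ∀ i, partialDeriv i (φ + ψ) = partialDeriv i φ + partialDeriv i ψ := fun i => by
      ext x
      have := ((hφ.smooth.differentiable (by simp) x).hasFDerivAt.add
        (hψ.smooth.differentiable (by simp) x).hasFDerivAt)
      rw [partialDeriv, this.fderiv]
      rfl
    cases o with
    | none => rw [map_add]; simp only [Jet.proj_mk_none]; exact (MemLp.toLp_add _ _).symm
    | some i =>
      rw [map_add]
      simp only [Jet.proj_mk_some, hp]
      exact (MemLp.toLp_add _ _).symm
  smul_mem' := by
    rintro c x ⟨φ, hφ, rfl⟩
    have h : IsTest Ω (c • φ) := ⟨hφ.smooth.const_smul c, hφ.compact.smul_left (f := fun _ => c),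
      (tsupport_smul_subset_right (fun _ => c) φ).trans hφ.supp⟩
    refine ⟨_, h, Jet.ext fun o => ?_⟩
    have hp : ∀ i, partialDeriv i (c • φ) = c • partialDeriv i φ := fun i => by
      ext x
      have := (hφ.smooth.differentiable (by simp) x).hasFDerivAt.const_smul c
      rw [partialDeriv, this.fderiv]
      rfl
    cases o with
    | none => rw [map_smul]; simp only [Jet.proj_mk_none]; exact (MemLp.toLp_const_smul c _).symm
    | some i =>
      rw [map_smul]
      simp only [Jet.proj_mk_some, hp]
      exact (MemLp.toLp_const_smul c _).symm

theorem IsTest.hasH1Grad {φ : Plane → ℝ} (hφ : IsTest Ω φ) :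
    HasH1Grad Ω φ fun i => LimitReg.partialDeriv i φ where
  memLp_fun := hφ.memLp
  memLp_grad := hφ.memLp_partialDeriv
  weak i := isWeakPartial_of_contDiff (hφ.smooth.of_le (by norm_cast)) i

theorem testSpace_le : testSpace Ω ≤ h1Space Ω := by
  rintro x ⟨φ, hφ, rfl⟩
  exact mk_mem_h1Space hφ.hasH1Grad

theorem norm_proj_le (o : Option (Fin 2)) (x : Jet Ω) : ‖Jet.proj o x‖ ≤ ‖x‖ :=
  PiLp.norm_apply_le x o

theorem hasH10Grad_of_mem (hΩ : volume Ω < ⊤) {x : Jet Ω}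
    (hx : x ∈ (testSpace Ω).topologicalClosure) :
    HasH10Grad Ω (Jet.proj none x) (fun i => Jet.proj (some i) x) where
  toHasH1Grad := hasH1Grad_of_mem hΩ
    ((testSpace Ω).topologicalClosure_minimal testSpace_le isClosed_h1Space hx)
  approx δ hδ := by
    have hx' : x ∈ closure (testSpace Ω : Set (Jet Ω)) := hx
    obtain ⟨y, ⟨φ, hφ, rfl⟩, hy⟩ := EMetric.mem_closure_iff.1 hx' δ hδ
    have key : ∀ o, edist (Jet.proj o x) (Jet.proj o (Jet.mk hφ.memLp hφ.memLp_partialDeriv)) < δ :=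
      fun o => by
        refine lt_of_le_of_lt ?_ hy
        rw [edist_eq_enorm_sub, edist_eq_enorm_sub, ← map_sub, enorm_le_iff_norm_le]
        exact norm_proj_le o _
    refine ⟨φ, hφ, ?_, fun i => ?_⟩
    · have := key none
      rw [Lp.edist_def, Jet.proj_mk_none] at this
      refine lt_of_le_of_lt (le_of_eq (eLpNorm_congr_ae ?_)) this
      exact (ae_eq_refl _).sub hφ.memLp.coeFn_toLp.symm
    · have := key (some i)
      rw [Lp.edist_def, Jet.proj_mk_some] at this
      refine lt_of_le_of_lt (le_of_eq (eLpNorm_congr_ae ?_)) this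
      exact (ae_eq_refl _).sub (hφ.memLp_partialDeriv i).coeFn_toLp.symm

theorem mk_mem_closure {v : Plane → ℝ} {G : Fin 2 → Plane → ℝ} (h : HasH10Grad Ω v G) :
    Jet.mk h.memLp_fun h.memLp_grad ∈ (testSpace Ω).topologicalClosure := by
  change _ ∈ closure (testSpace Ω : Set (Jet Ω))
  rw [Metric.mem_closure_iff]
  intro ε hε
  obtain ⟨φ, hφ, h1, h2⟩ := h.approx (ENNReal.ofReal (ε / 2)) (by simpa using hε)
  refine ⟨_, ⟨φ, hφ, rfl⟩, ?_⟩
  set x := Jet.mk h.memLp_fun h.memLp_grad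
  set y := Jet.mk hφ.memLp hφ.memLp_partialDeriv
  -- There are three components, and 3(ε/2)² < ε².
  have key : ∀ o, ‖Jet.proj o (x - y)‖ < ε / 2 := by
    intro o
    rw [map_sub, ← dist_eq_norm, ← ENNReal.ofReal_lt_ofReal_iff (half_pos hε), ← edist_dist,
      Lp.edist_def]
    cases o with
    | none =>
      refine lt_of_le_of_lt (le_of_eq (eLpNorm_congr_ae ?_)) h1
      exact h.memLp_fun.coeFn_toLp.sub hφ.memLp.coeFn_toLp
    | some i =>
      refine lt_of_le_of_lt (le_of_eq (eLpNorm_congr_ae ?_)) (h2 i)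
      exact (h.memLp_grad i).coeFn_toLp.sub (hφ.memLp_partialDeriv i).coeFn_toLp
  rw [dist_eq_norm]
  refine lt_of_pow_lt_pow_left₀ 2 hε.le ?_
  rw [Jet.norm_sq, Fin.sum_univ_two]
  have b : ∀ o, ‖Jet.proj o (x - y)‖ ^ 2 < ε ^ 2 / 4 := fun o => by
    have := key o
    nlinarith [norm_nonneg (Jet.proj o (x - y))]
  nlinarith [b none, b (some 0), b (some 1)]

end Hilbert

/-! ### The Dirichlet problem -/

section DirichletExistence

variable {Ω : Set Plane}

theorem eLpNorm_partialDeriv_one (hΩ : MeasurableSet Ω) {φ : Plane → ℝ} (hφ : IsTest Ω φ) :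
    eLpNorm (fderiv ℝ φ) 1 volume ≤
      ∑ i, eLpNorm (partialDeriv i φ) 1 (volume.restrict Ω) := by
  simp only [eLpNorm_one_eq_lintegral_enorm]
  have hc : ∀ i, Continuous (partialDeriv i φ) := fun i =>
    continuous_partialDeriv (hφ.smooth.of_le (by norm_cast)) i
  rw [← lintegral_finsetSum _ fun i _ => (hc i).enorm.measurable]
  calc ∫⁻ x, ‖fderiv ℝ φ x‖ₑ ≤ ∫⁻ x, Ω.indicator (fun x => ∑ i, ‖partialDeriv i φ x‖ₑ) x := by
        refine lintegral_mono fun x => ?_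
        by_cases hx : x ∈ Ω
        · rw [indicator_of_mem hx]
          exact enorm_le_sum_enorm_apply _
        · have : x ∉ tsupport (fderiv ℝ φ) := fun h => hx (hφ.supp (tsupport_fderiv_subset ℝ h))
          have e : fderiv ℝ φ x = 0 := image_eq_zero_of_notMem_tsupport this
          refine (enorm_le_sum_enorm_apply _).trans (le_of_eq_of_le ?_ zero_le)
          refine Finset.sum_eq_zero fun i _ => ?_
          rw [e, zero_apply, enorm_zero]
    _ = _ := lintegral_indicator hΩ _

theorem norm_toLp_eq {f : Plane → ℝ} (hf : MemLp f 2 (volume.restrict Ω)) :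
    ‖hf.toLp f‖ₑ = eLpNorm f 2 (volume.restrict Ω) := by
  rw [Lp.enorm_def]
  exact eLpNorm_congr_ae hf.coeFn_toLp

/-- Poincaré's inequality for test functions: in dimension two the Gagliardo-Nirenberg-Sobolev
inequality bounds the L² norm of φ by the L¹ norm of its gradient, and boundedness of `Ω` passes
from L¹ to L². -/
theorem norm_toLp_le_sum (hΩ : MeasurableSet Ω) (hb : Bornology.IsBounded Ω) :
    ∃ C : ℝ, 0 ≤ C ∧ ∀ x ∈ testSpace Ω,
      ‖Jet.proj none x‖ ≤ C * ∑ i, ‖Jet.proj (some i) x‖ := by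
  have hfin : volume Ω < ⊤ := hb.measure_lt_top
  set K : ℝ≥0∞ := eLpNormLESNormFDerivOfLeConst ℝ (volume : Measure Plane) Ω 1 2 *
    volume Ω ^ (1 / 2 : ℝ) with hK
  have hK' : K ≠ ⊤ := ENNReal.mul_ne_top ENNReal.coe_ne_top
    (ENNReal.rpow_ne_top_of_nonneg (by norm_num) hfin.ne)
  refine ⟨K.toReal, ENNReal.toReal_nonneg, ?_⟩
  rintro x ⟨φ, hφ, rfl⟩
  have h1 := eLpNorm_le_eLpNorm_fderiv_of_le (F := ℝ) (volume : Measure Plane)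
    (u := φ) (s := Ω) (hφ.smooth.of_le (by norm_cast)) ((subset_tsupport _).trans hφ.supp)
    (p := 1) (q := 2) le_rfl (by simp) (by norm_num) hb
  have h2 : ∀ i, eLpNorm (partialDeriv i φ) 1 (volume.restrict Ω) ≤
      eLpNorm (partialDeriv i φ) 2 (volume.restrict Ω) * volume Ω ^ (1 / 2 : ℝ) := fun i => by
    have := eLpNorm_le_eLpNorm_mul_rpow_measure_univ (μ := volume.restrict Ω) (p := 1) (q := 2)
      one_le_two (hφ.memLp_partialDeriv i).1
    rw [Measure.restrict_apply_univ] at this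
    convert this using 3
    norm_num
  have h3 : eLpNorm φ 2 (volume.restrict Ω) ≤
      K * ∑ i, eLpNorm (partialDeriv i φ) 2 (volume.restrict Ω) := by
    calc eLpNorm φ 2 (volume.restrict Ω) ≤ eLpNorm φ 2 volume := eLpNorm_restrict_le _ _ _ _
      _ ≤ _ := h1
      _ ≤ eLpNormLESNormFDerivOfLeConst ℝ (volume : Measure Plane) Ω 1 2 *
          ∑ i, (eLpNorm (partialDeriv i φ) 2 (volume.restrict Ω) * volume Ω ^ (1 / 2 : ℝ)) := by
        gcongr
        exact (eLpNorm_partialDeriv_one hΩ hφ).trans (Finset.sum_le_sum fun i _ => h2 i)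
      _ = _ := by rw [← Finset.sum_mul, hK]; ring
  simp only [Jet.proj_mk_none, Jet.proj_mk_some]
  rw [← norm_toLp_eq hφ.memLp] at h3
  simp only [← norm_toLp_eq (hφ.memLp_partialDeriv _)] at h3
  have h4 := ENNReal.toReal_mono (ENNReal.mul_ne_top hK'
    (ENNReal.sum_ne_top.2 fun i _ => enorm_ne_top)) h3
  rwa [ENNReal.toReal_mul, ENNReal.toReal_sum fun i _ => enorm_ne_top, toReal_enorm] at h4

theorem norm_proj_none_le_sum (hΩ : MeasurableSet Ω) (hb : Bornology.IsBounded Ω) :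
    ∃ C : ℝ, 0 ≤ C ∧ ∀ x ∈ (testSpace Ω).topologicalClosure,
      ‖Jet.proj none x‖ ≤ C * ∑ i, ‖Jet.proj (some i) x‖ := by
  obtain ⟨C, hC, h⟩ := norm_toLp_le_sum hΩ hb
  refine ⟨C, hC, fun x hx => ?_⟩
  have hcl : IsClosed {x : Jet Ω | ‖Jet.proj none x‖ ≤ C * ∑ i, ‖Jet.proj (some i) x‖} :=
    isClosed_le (Jet.proj none).continuous.norm
      (continuous_const.mul (continuous_finsetSum _ fun i _ => (Jet.proj (some i)).continuous.norm))
  exact closure_minimal (fun y hy => h y hy) hcl hx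

/-- The constant comes from C²(a + b)² ≤ 2C²(a² + b²). -/
theorem coercive_of_norm_le {C : ℝ} {x : Jet Ω}
    (h : ‖Jet.proj none x‖ ≤ C * ∑ i, ‖Jet.proj (some i) x‖) :
    (2 * C ^ 2 + 1)⁻¹ * ‖x‖ ^ 2 ≤ ∑ i, ‖Jet.proj (some i) x‖ ^ 2 := by
  rw [inv_mul_le_iff₀ (by positivity), Jet.norm_sq]
  rw [Fin.sum_univ_two] at h ⊢
  set a := ‖Jet.proj (some 0) x‖
  set b := ‖Jet.proj (some 1) x‖
  have h1 : ‖Jet.proj none x‖ ^ 2 ≤ (C * (a + b)) ^ 2 :=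
    pow_le_pow_left₀ (norm_nonneg _) h 2
  nlinarith [mul_nonneg (sq_nonneg C) (sq_nonneg (a - b))]

theorem integral_sum_mul_eq_sum_inner {G H : Fin 2 → Plane → ℝ}
    (hG : ∀ i, MemLp (G i) 2 (volume.restrict Ω)) (hH : ∀ i, MemLp (H i) 2 (volume.restrict Ω)) :
    ∫ a in Ω, ∑ i, G i a * H i a = ∑ i, inner ℝ ((hG i).toLp (G i)) ((hH i).toLp (H i)) := by
  rw [integral_finsetSum _ fun i _ => MemLp.integrable_mul_two (hG i) (hH i)]
  refine Finset.sum_congr rfl fun i _ => ?_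
  rw [inner_toLp]
  refine integral_congr_ae ?_
  filter_upwards [(hH i).coeFn_toLp] with a ha
  rw [ha]

theorem integral_mul_eq_inner {g φ : Plane → ℝ}
    (hg : MemLp g 2 (volume.restrict Ω)) (hφ : MemLp φ 2 (volume.restrict Ω)) :
    ∫ a in Ω, g a * φ a = inner ℝ (hg.toLp g) (hφ.toLp φ) := by
  rw [inner_toLp]
  refine integral_congr_ae ?_
  filter_upwards [hφ.coeFn_toLp] with a ha
  rw [ha]

theorem toLp_proj (o : Option (Fin 2)) (x : Jet Ω) :
    (Lp.memLp (Jet.proj o x)).toLp (Jet.proj o x) = Jet.proj o x :=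
  Lp.toLp_coeFn _ _

/-- Existence for the Dirichlet problem. -/
theorem exists_isDirichletSol (hΩ : MeasurableSet Ω) (hb : Bornology.IsBounded Ω) {g : Plane → ℝ}
    (hg : MemLp g 2 (volume.restrict Ω)) : ∃ v, IsDirichletSol Ω g v := by
  obtain ⟨C, -, h⟩ := norm_proj_none_le_sum hΩ hb
  obtain ⟨u, hu, hsol⟩ := exists_weak_solution (testSpace Ω).topologicalClosure
    (testSpace Ω).isClosed_topologicalClosure (fun i => Jet.proj (some i))
    (c := (2 * C ^ 2 + 1)⁻¹) (by positivity) (fun x hx => coercive_of_norm_le (h x hx))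
    (-((innerSL ℝ (hg.toLp g)).comp (Jet.proj none)))
  refine ⟨_, _, hasH10Grad_of_mem hb.measure_lt_top hu, fun φ hφ => ?_⟩
  have e := hsol _ ((testSpace Ω).le_topologicalClosure ⟨φ, hφ, rfl⟩)
  rw [integral_sum_mul_eq_sum_inner (fun i => Lp.memLp _) hφ.memLp_partialDeriv,
    integral_mul_eq_inner hg hφ.memLp]
  simp only [toLp_proj]
  exact e

/-- Uniqueness for the Dirichlet problem. -/
theorem IsDirichletSol.ae_eq (hΩ : MeasurableSet Ω) (hb : Bornology.IsBounded Ω) {g v w : Plane → ℝ}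
    (hv : IsDirichletSol Ω g v) (hw : IsDirichletSol Ω g w) : v =ᵐ[volume.restrict Ω] w := by
  obtain ⟨C, -, h⟩ := norm_proj_none_le_sum hΩ hb
  obtain ⟨G, hG, eG⟩ := hv
  obtain ⟨H, hH, eH⟩ := hw
  set x := Jet.mk hG.memLp_fun hG.memLp_grad with hx
  set y := Jet.mk hH.memLp_fun hH.memLp_grad with hy
  have hxy : x - y ∈ (testSpace Ω).topologicalClosure :=
    sub_mem (mk_mem_closure hG) (mk_mem_closure hH)
  have h0 : ∀ s ∈ testSpace Ω, ∑ i, inner ℝ (Jet.proj (some i) (x - y)) (Jet.proj (some i) s) = 0 := by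
    rintro s ⟨φ, hφ, rfl⟩
    have e := (eG φ hφ).trans (eH φ hφ).symm
    rw [integral_sum_mul_eq_sum_inner hG.memLp_grad hφ.memLp_partialDeriv,
      integral_sum_mul_eq_sum_inner hH.memLp_grad hφ.memLp_partialDeriv] at e
    simp only [map_sub, inner_sub_left, Finset.sum_sub_distrib]
    exact sub_eq_zero.2 e
  have h1 : ∀ s ∈ (testSpace Ω).topologicalClosure,
      ∑ i, inner ℝ (Jet.proj (some i) (x - y)) (Jet.proj (some i) s) = 0 := by
    intro s hs
    have hcl : IsClosed {s : Jet Ω |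
        ∑ i, inner ℝ (Jet.proj (some i) (x - y)) (Jet.proj (some i) s) = 0} :=
      isClosed_eq (continuous_finsetSum _ fun i _ =>
        (innerSL ℝ _).continuous.comp (Jet.proj (some i)).continuous) continuous_const
    exact closure_minimal (fun z hz => h0 z hz) hcl hs
  -- The difference of the solutions is tested with itself, so its gradient vanishes.
  have h2 := h1 _ hxy
  simp only [real_inner_self_eq_norm_sq] at h2
  have h3 := coercive_of_norm_le (h _ hxy)
  rw [h2] at h3
  have h4 : x - y = 0 := by
    have : 0 < (2 * C ^ 2 + 1)⁻¹ := by positivity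
    have : ‖x - y‖ ^ 2 ≤ 0 := nonpos_of_mul_nonpos_right h3 this
    exact norm_eq_zero.1 (pow_eq_zero_iff two_ne_zero |>.1 (le_antisymm this (sq_nonneg _)))
  have h5 : Jet.proj none x = Jet.proj none y := by rw [sub_eq_zero.1 h4]
  exact (MemLp.toLp_eq_toLp_iff hG.memLp_fun hH.memLp_fun).1 h5

end DirichletExistence

/-! ### The Poincaré inequality on star-shaped domains -/

section Poincare

theorem lintegral_comp_affine {g : Plane → ℝ≥0∞} (hg : Measurable g) {t : ℝ} (ht : t ≠ 0) (b : Plane) :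
    ∫⁻ x, g (t • x + b) = ENNReal.ofReal (t ^ 2)⁻¹ * ∫⁻ z, g z := by
  have h1 : ∫⁻ x : Plane, g (t • x + b) = ∫⁻ z, g (z + b) ∂(Measure.map (t • ·) volume) := by
    have m : Measurable fun z : Plane => g (z + b) := hg.comp (measurable_add_const b)
    rw [lintegral_map m (measurable_const_smul t)]
  rw [h1, Measure.map_addHaar_smul _ ht, lintegral_smul_measure, lintegral_add_right_eq_self]
  simp

theorem setLIntegral_comp_affine_le {g : Plane → ℝ≥0∞} (hg : Measurable g) {t : ℝ} (ht : t ≠ 0)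
    (b : Plane) {D E : Set Plane} (hD : MeasurableSet D) (hE : MeasurableSet E)
    (h : ∀ x ∈ E, t • x + b ∈ D) :
    ∫⁻ x in E, g (t • x + b) ≤ ENNReal.ofReal (t ^ 2)⁻¹ * ∫⁻ z in D, g z := by
  rw [← lintegral_indicator hD, ← lintegral_comp_affine (hg.indicator hD) ht b,
    ← lintegral_indicator hE]
  refine lintegral_mono fun x => ?_
  by_cases hx : x ∈ E
  · rw [indicator_of_mem hx, indicator_of_mem (h x hx)]
  · rw [indicator_of_notMem hx]
    exact zero_le

/-- The fundamental theorem of calculus on the segment from a to x, then Jensen's inequality on the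
unit interval, the derivative being extended by zero outside (s, 1]. -/
theorem enorm_sub_rpow_two_le_lintegral {u : Plane → ℝ} (hu : ContDiff ℝ 1 u) {a x : Plane}
    {s R : ℝ} (hs : 0 ≤ s) (hs1 : s ≤ 1) (hR : ‖x - a‖ ≤ R) :
    ‖u x - u (a + s • (x - a))‖ₑ ^ (2 : ℝ) ≤ ENNReal.ofReal R ^ (2 : ℝ) *
      ∫⁻ t in Ioc s 1, ‖fderiv ℝ u (a + t • (x - a))‖ₑ ^ (2 : ℝ) := by
  have hpath : ∀ t : ℝ, HasDerivAt (fun t : ℝ => a + t • (x - a)) (x - a) t := fun t => by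
    simpa using ((hasDerivAt_id t).smul_const (x - a)).const_add a
  have hd : ∀ t : ℝ, HasDerivAt (fun t : ℝ => u (a + t • (x - a)))
      (fderiv ℝ u (a + t • (x - a)) (x - a)) t := fun t =>
    ((hu.differentiable (by norm_num) _).hasFDerivAt).comp_hasDerivAt t (hpath t)
  have hcd : Continuous fun t : ℝ => fderiv ℝ u (a + t • (x - a)) :=
    (hu.continuous_fderiv (by norm_num)).comp (by fun_prop)
  have h1 := enorm_sub_le_lintegral_deriv (a := s) (b := 1) (I := Ioc s 1) hd
    (hcd.clm_apply continuous_const) (by rw [uIoc_of_le hs1])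
  simp only [one_smul, add_sub_cancel] at h1
  have hprob : IsProbabilityMeasure (volume.restrict (Ioc (0 : ℝ) 1)) := ⟨by simp⟩
  set F : ℝ → ℝ := (Ioc s 1).indicator fun t => fderiv ℝ u (a + t • (x - a)) (x - a) with hF
  have hFm : Measurable F := ((hcd.clm_apply continuous_const).measurable).indicator measurableSet_Ioc
  have hsub : Ioc s 1 ⊆ Ioc (0 : ℝ) 1 := Ioc_subset_Ioc_left hs
  have h2 : ∫⁻ t in Ioc s 1, ‖fderiv ℝ u (a + t • (x - a)) (x - a)‖ₑ = ∫⁻ t in Ioc (0 : ℝ) 1, ‖F t‖ₑ := by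
    simp only [hF, enorm_indicator_eq_indicator_enorm]
    rw [setLIntegral_indicator measurableSet_Ioc, inter_eq_left.2 hsub]
  have h3 : ∫⁻ t in Ioc (0 : ℝ) 1, ‖F t‖ₑ ^ (2 : ℝ) =
      ∫⁻ t in Ioc s 1, ‖fderiv ℝ u (a + t • (x - a)) (x - a)‖ₑ ^ (2 : ℝ) := by
    rw [← inter_eq_left.2 hsub, ← setLIntegral_indicator measurableSet_Ioc]
    refine lintegral_congr fun t => ?_
    by_cases ht : t ∈ Ioc s 1
    · simp only [hF, indicator_of_mem ht]
    · simp [hF, indicator_of_notMem ht]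
  calc ‖u x - u (a + s • (x - a))‖ₑ ^ (2 : ℝ) ≤ (∫⁻ t in Ioc (0 : ℝ) 1, ‖F t‖ₑ) ^ (2 : ℝ) := by
        rw [← h2]
        exact ENNReal.rpow_le_rpow h1 (by norm_num)
    _ ≤ ∫⁻ t in Ioc (0 : ℝ) 1, ‖F t‖ₑ ^ (2 : ℝ) :=
        lintegral_rpow_le_of_isProbabilityMeasure one_le_two hFm
    _ ≤ ∫⁻ t in Ioc s 1, ENNReal.ofReal R ^ (2 : ℝ) *
          ‖fderiv ℝ u (a + t • (x - a))‖ₑ ^ (2 : ℝ) := by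
        rw [h3]
        refine lintegral_mono fun t => ?_
        rw [← ENNReal.mul_rpow_of_nonneg _ _ (by norm_num), mul_comm]
        refine ENNReal.rpow_le_rpow ((ContinuousLinearMap.le_opENorm _ _).trans ?_) (by norm_num)
        gcongr
        rw [← ofReal_norm]
        exact ENNReal.ofReal_le_ofReal hR
    _ = _ := lintegral_const_mul _ (hcd.enorm.measurable.pow_const _)

/-- The energy integral of `u` over `D`. -/
noncomputable def energy (u : Plane → ℝ) (D : Set Plane) : ℝ≥0∞ :=
  ∫⁻ z in D, ‖fderiv ℝ u z‖ₑ ^ (2 : ℝ)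

/-- Integrate the estimate along rays over x and substitute z = a + t(x - a). The Jacobian factor
t^(-2) is bounded by s^(-2), which is why the contraction stops at a ratio s > 0. -/
theorem lintegral_sub_dilate_le {u : Plane → ℝ} (hu : ContDiff ℝ 1 u) {a : Plane} {s R : ℝ}
    {D E : Set Plane} (hD : MeasurableSet D) (hE : MeasurableSet E) (hs : 0 < s) (hs1 : s ≤ 1)
    (hR : ∀ x ∈ E, ‖x - a‖ ≤ R) (hseg : ∀ x ∈ E, ∀ t ∈ Ioc s 1, a + t • (x - a) ∈ D) :
    ∫⁻ x in E, ‖u x - u (a + s • (x - a))‖ₑ ^ (2 : ℝ) ≤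
      ENNReal.ofReal R ^ (2 : ℝ) * ENNReal.ofReal (s ^ 2)⁻¹ * energy u D := by
  have hdu : Continuous (fderiv ℝ u) := hu.continuous_fderiv (by norm_num)
  have hg : Measurable fun z => ‖fderiv ℝ u z‖ₑ ^ (2 : ℝ) := hdu.enorm.measurable.pow_const _
  have hm : Measurable fun z : Plane × ℝ => ‖fderiv ℝ u (a + z.2 • (z.1 - a))‖ₑ ^ (2 : ℝ) :=
    (hdu.comp (by fun_prop)).enorm.measurable.pow_const _
  calc ∫⁻ x in E, ‖u x - u (a + s • (x - a))‖ₑ ^ (2 : ℝ)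
      ≤ ∫⁻ x in E, ENNReal.ofReal R ^ (2 : ℝ) *
          ∫⁻ t in Ioc s 1, ‖fderiv ℝ u (a + t • (x - a))‖ₑ ^ (2 : ℝ) :=
        setLIntegral_mono' hE fun x hx => enorm_sub_rpow_two_le_lintegral hu hs.le hs1 (hR x hx)
    _ = ENNReal.ofReal R ^ (2 : ℝ) *
          ∫⁻ t in Ioc s 1, ∫⁻ x in E, ‖fderiv ℝ u (a + t • (x - a))‖ₑ ^ (2 : ℝ) := by
        rw [lintegral_const_mul _ hm.lintegral_prod_right', lintegral_lintegral_swap hm.aemeasurable]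
    _ ≤ ENNReal.ofReal R ^ (2 : ℝ) *
          ∫⁻ t in Ioc s 1, ENNReal.ofReal (s ^ 2)⁻¹ * energy u D := by
        gcongr ENNReal.ofReal R ^ (2 : ℝ) * ?_
        refine setLIntegral_mono' measurableSet_Ioc fun t ht => ?_
        have ht0 : 0 < t := hs.trans ht.1
        have e : ∀ x : Plane, a + t • (x - a) = t • x + (a - t • a) := fun x => by
          rw [smul_sub]; abel
        have h1 := setLIntegral_comp_affine_le hg ht0.ne' (a - t • a) hD hE
          (fun x hx => e x ▸ hseg x hx t ht)
        simp only [e]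
        refine h1.trans ?_
        refine mul_le_mul' (ENNReal.ofReal_le_ofReal ?_) le_rfl
        gcongr
        exact ht.1.le
    _ ≤ _ := by
        have hv : volume (Ioc s 1) ≤ 1 := by
          rw [Real.volume_Ioc]
          exact ENNReal.ofReal_le_one.2 (by linarith)
        rw [setLIntegral_const, mul_assoc, mul_assoc]
        refine mul_le_mul' le_rfl (mul_le_mul' le_rfl ?_)
        exact (mul_le_mul' le_rfl hv).trans (mul_one _).le

theorem enorm_add_rpow_two_le (a b : ℝ) :
    ‖a + b‖ₑ ^ (2 : ℝ) ≤ 2 * (‖a‖ₑ ^ (2 : ℝ) + ‖b‖ₑ ^ (2 : ℝ)) := by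
  refine (ENNReal.rpow_le_rpow (enorm_add_le a b) (by norm_num)).trans ?_
  have := ENNReal.rpow_add_le_mul_rpow_add_rpow ‖a‖ₑ ‖b‖ₑ (p := 2) one_le_two
  norm_num at this ⊢
  exact this

/-- Both points are compared with their midpoint, so the contraction ratio never falls below 1/2. -/
theorem lintegral_ball_sub_le {u : Plane → ℝ} (hu : ContDiff ℝ 1 u) {ρ : ℝ} :
    ∫⁻ y in Metric.ball (0 : Plane) ρ, ∫⁻ x in Metric.ball (0 : Plane) ρ, ‖u x - u y‖ₑ ^ (2 : ℝ) ≤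
      4 * (ENNReal.ofReal (2 * ρ) ^ (2 : ℝ) * ENNReal.ofReal ((1 / 2 : ℝ) ^ 2)⁻¹ *
        energy u (Metric.ball 0 ρ)) * volume (Metric.ball (0 : Plane) ρ) := by
  set B := Metric.ball (0 : Plane) ρ with hB
  set K := ENNReal.ofReal (2 * ρ) ^ (2 : ℝ) * ENNReal.ofReal ((1 / 2 : ℝ) ^ 2)⁻¹ * energy u B with hK
  have huc := hu.continuous
  have hone : ∀ y ∈ B, ∫⁻ x in B, ‖u x - u (y + (1 / 2 : ℝ) • (x - y))‖ₑ ^ (2 : ℝ) ≤ K := by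
    intro y hy
    refine lintegral_sub_dilate_le hu measurableSet_ball measurableSet_ball (by norm_num)
      (by norm_num) (fun x hx => ?_) fun x hx t ht => ?_
    · rw [hB, mem_ball_zero_iff] at hx hy
      linarith [norm_sub_le x y]
    · have := (convex_ball (0 : Plane) ρ) hy hx (a := 1 - t) (b := t) (by linarith [ht.2])
        (by linarith [ht.1]) (by ring)
      convert this using 1
      rw [smul_sub, sub_smul, one_smul]; abel
  set M : Plane → Plane → ℝ≥0∞ := fun y x => ‖u x - u (y + (1 / 2 : ℝ) • (x - y))‖ₑ ^ (2 : ℝ) with hM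
  have hMm : Measurable fun z : Plane × Plane => M z.1 z.2 := by
    have : Continuous fun z : Plane × Plane => u z.2 - u (z.1 + (1 / 2 : ℝ) • (z.2 - z.1)) := by
      fun_prop
    exact this.enorm.measurable.pow_const _
  have hMm' : Measurable fun z : Plane × Plane => M z.2 z.1 := hMm.comp measurable_swap
  have hpt : ∀ y x, ‖u x - u y‖ₑ ^ (2 : ℝ) ≤ 2 * (M y x + M x y) := by
    intro y x
    have e : x + (1 / 2 : ℝ) • (y - x) = y + (1 / 2 : ℝ) • (x - y) := by module
    have := enorm_add_rpow_two_le (u x - u (y + (1 / 2 : ℝ) • (x - y)))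
      (u (y + (1 / 2 : ℝ) • (x - y)) - u y)
    rw [sub_add_sub_cancel] at this
    refine this.trans (le_of_eq ?_)
    simp only [hM, e]
    rw [enorm_sub_rev (u y)]
  calc ∫⁻ y in B, ∫⁻ x in B, ‖u x - u y‖ₑ ^ (2 : ℝ)
      ≤ ∫⁻ y in B, ∫⁻ x in B, 2 * (M y x + M x y) :=
        lintegral_mono fun y => lintegral_mono fun x => hpt y x
    _ = 2 * ((∫⁻ y in B, ∫⁻ x in B, M y x) + ∫⁻ y in B, ∫⁻ x in B, M x y) := by
        have n1 : Measurable fun y => ∫⁻ x in B, M y x := hMm.lintegral_prod_right'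
        rw [← lintegral_add_left n1, ← lintegral_const_mul' _ _ ENNReal.ofNat_ne_top]
        refine lintegral_congr fun y => ?_
        have m1 : Measurable (M y) := hMm.comp measurable_prodMk_left
        rw [lintegral_const_mul' _ _ ENNReal.ofNat_ne_top, lintegral_add_left m1]
    _ = 2 * ((∫⁻ y in B, ∫⁻ x in B, M y x) + ∫⁻ y in B, ∫⁻ x in B, M y x) := by
        rw [lintegral_lintegral_swap (f := fun y x => M x y) hMm'.aemeasurable]
    _ ≤ 2 * ((∫⁻ _ in B, K) + ∫⁻ _ in B, K) := by
        have h := setLIntegral_mono' (μ := volume) measurableSet_ball hone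
        exact mul_le_mul' le_rfl (add_le_add h h)
    _ = _ := by
        rw [setLIntegral_const]; ring

/-- Contracting by the factor 1/8 along rays takes `D` into the ball of radius 2/8 = 1/4, where
`lintegral_ball_sub_le` applies. The constant depends on the radii 1/4 and 2 only, hence is uniform
over the dilates used to exhaust the domain. -/
theorem exists_lintegral_sub_le :
    ∃ K : ℝ≥0∞, K ≠ ⊤ ∧ ∀ (u : Plane → ℝ) (D : Set Plane), ContDiff ℝ 1 u → MeasurableSet D →
      (∀ x ∈ D, ∀ t : ℝ, 0 ≤ t → t ≤ 1 → t • x ∈ D) → Metric.ball 0 (1 / 4) ⊆ D →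
      D ⊆ Metric.ball 0 2 →
      ∫⁻ y in D, ∫⁻ x in D, ‖u x - u y‖ₑ ^ (2 : ℝ) ≤ K * energy u D := by
  set V := volume (Metric.ball (0 : Plane) 2) with hV
  have hVt : V ≠ ⊤ := measure_ball_lt_top.ne
  set A : ℝ≥0∞ := ENNReal.ofReal 2 ^ (2 : ℝ) * ENNReal.ofReal ((1 / 8 : ℝ) ^ 2)⁻¹ with hA
  set L : ℝ≥0∞ := 4 * (ENNReal.ofReal (2 * (1 / 4)) ^ (2 : ℝ) * ENNReal.ofReal ((1 / 2 : ℝ) ^ 2)⁻¹)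
    with hL
  set c : ℝ≥0∞ := ENNReal.ofReal ((1 / 8 : ℝ) ^ 2)⁻¹ with hc
  refine ⟨4 * (A * V + A * V + c * c * L * V), ?_, fun u D hu hD hstar hB hD2 => ?_⟩
  · finiteness
  set B := Metric.ball (0 : Plane) (1 / 4) with hBd
  have huc := hu.continuous
  have hDV : volume D ≤ V := measure_mono hD2
  set P : Plane → ℝ≥0∞ := fun x => ‖u x - u ((1 / 8 : ℝ) • x)‖ₑ ^ (2 : ℝ) with hP
  have hPm : Measurable P := by
    have : Continuous fun x : Plane => u x - u ((1 / 8 : ℝ) • x) := by fun_prop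
    exact this.enorm.measurable.pow_const _
  have hPle : ∫⁻ x in D, P x ≤ A * energy u D := by
    have := lintegral_sub_dilate_le hu (a := 0) (s := 1 / 8) (R := 2) hD hD (by norm_num)
      (by norm_num) (fun x hx => by
        rw [sub_zero]; exact (mem_ball_zero_iff.1 (hD2 hx)).le)
      (fun x hx t ht => by
        rw [sub_zero, zero_add]; exact hstar x hx t (by linarith [ht.1]) ht.2)
    simpa only [sub_zero, zero_add] using this
  set N : Plane → Plane → ℝ≥0∞ := fun y x => ‖u x - u y‖ₑ ^ (2 : ℝ) with hN
  have hNm : Measurable fun z : Plane × Plane => N z.1 z.2 := by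
    have : Continuous fun z : Plane × Plane => u z.2 - u z.1 := by fun_prop
    exact this.enorm.measurable.pow_const _
  have hscale : ∀ x ∈ D, (1 / 8 : ℝ) • x + 0 ∈ B := fun x hx => by
    have := mem_ball_zero_iff.1 (hD2 hx)
    rw [add_zero, hBd, mem_ball_zero_iff, norm_smul]
    norm_num
    linarith
  have hNle : ∫⁻ y in D, ∫⁻ x in D, N ((1 / 8 : ℝ) • y) ((1 / 8 : ℝ) • x) ≤
      c * (c * (L * energy u D * V)) := by
    have hball : ∫⁻ y in B, ∫⁻ x in B, N y x ≤ L * energy u D * V := by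
      refine lintegral_ball_sub_le hu |>.trans ?_
      have e1 : energy u B ≤ energy u D := lintegral_mono_set hB
      have e2 : volume B ≤ V := measure_mono (Metric.ball_subset_ball (by norm_num))
      refine (mul_le_mul' (mul_le_mul' le_rfl (mul_le_mul' le_rfl e1)) e2).trans (le_of_eq ?_)
      rw [hL]; ring
    have h8 : (1 / 8 : ℝ) ≠ 0 := by norm_num
    have hin : ∀ y, ∫⁻ x in D, N y ((1 / 8 : ℝ) • x) ≤ c * ∫⁻ x in B, N y x := fun y => by
      have m1 : Measurable (N y) := hNm.comp measurable_prodMk_left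
      have := setLIntegral_comp_affine_le m1 h8 0 (measurableSet_ball (x := (0 : Plane)) (ε := 1 / 4)) hD hscale
      simpa only [add_zero] using this
    have hout : ∫⁻ y in D, ∫⁻ x in B, N ((1 / 8 : ℝ) • y) x ≤
        c * ∫⁻ y in B, ∫⁻ x in B, N y x := by
      have := setLIntegral_comp_affine_le (hNm.lintegral_prod_right' (ν := volume.restrict B)) h8 0
        (measurableSet_ball (x := (0 : Plane)) (ε := 1 / 4)) hD hscale
      simpa only [add_zero] using this
    calc ∫⁻ y in D, ∫⁻ x in D, N ((1 / 8 : ℝ) • y) ((1 / 8 : ℝ) • x)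
        ≤ ∫⁻ y in D, c * ∫⁻ x in B, N ((1 / 8 : ℝ) • y) x := lintegral_mono fun y => hin _
      _ = c * ∫⁻ y in D, ∫⁻ x in B, N ((1 / 8 : ℝ) • y) x := by
          refine lintegral_const_mul _ ?_
          have := (hNm.lintegral_prod_right' (ν := volume.restrict B)).comp
            (measurable_const_smul (α := Plane) (1 / 8 : ℝ))
          exact this
      _ ≤ _ := by gcongr; exact hout.trans (by gcongr)
  have hpt : ∀ y x, N y x ≤ 4 * ((P x + P y) + N ((1 / 8 : ℝ) • y) ((1 / 8 : ℝ) • x)) := by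
    intro y x
    have h1 := enorm_add_rpow_two_le (u x - u ((1 / 8 : ℝ) • x)) (u ((1 / 8 : ℝ) • x) - u y)
    have h2 := enorm_add_rpow_two_le (u ((1 / 8 : ℝ) • x) - u ((1 / 8 : ℝ) • y))
      (u ((1 / 8 : ℝ) • y) - u y)
    rw [sub_add_sub_cancel] at h1 h2
    rw [enorm_sub_rev (u ((1 / 8 : ℝ) • y)) (u y)] at h2
    change N y x ≤ 2 * (P x + _) at h1
    change _ ≤ 2 * (N ((1 / 8 : ℝ) • y) ((1 / 8 : ℝ) • x) + P y) at h2
    calc N y x ≤ 2 * (P x + 2 * (N ((1 / 8 : ℝ) • y) ((1 / 8 : ℝ) • x) + P y)) :=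
          h1.trans (by gcongr)
      _ ≤ 2 * (2 * P x + 2 * (N ((1 / 8 : ℝ) • y) ((1 / 8 : ℝ) • x) + P y)) := by
          gcongr
          exact le_mul_of_one_le_left' one_le_two
      _ = _ := by ring
  have hN8 : Measurable fun z : Plane × Plane => N ((1 / 8 : ℝ) • z.1) ((1 / 8 : ℝ) • z.2) := by
    have : Continuous fun z : Plane × Plane => u ((1 / 8 : ℝ) • z.2) - u ((1 / 8 : ℝ) • z.1) := by
      fun_prop
    exact this.enorm.measurable.pow_const _
  change ∫⁻ y in D, ∫⁻ x in D, N y x ≤ _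
  clear_value N P A L c V
  have hin : ∀ y, ∫⁻ x in D, N y x ≤ 4 * ((∫⁻ x in D, P x) + P y * volume D +
      ∫⁻ x in D, N ((1 / 8 : ℝ) • y) ((1 / 8 : ℝ) • x)) := by
    intro y
    have m2 : Measurable fun x => N ((1 / 8 : ℝ) • y) ((1 / 8 : ℝ) • x) :=
      hN8.comp measurable_prodMk_left
    have n1 : Measurable fun x => P x + P y := hPm.add measurable_const
    rw [← setLIntegral_const, ← lintegral_add_left hPm,
      ← lintegral_add_left n1, ← lintegral_const_mul' _ _ ENNReal.ofNat_ne_top]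
    exact lintegral_mono fun x => hpt y x
  have m3 : Measurable fun y => ∫⁻ x in D, N ((1 / 8 : ℝ) • y) ((1 / 8 : ℝ) • x) :=
    hN8.lintegral_prod_right'
  calc ∫⁻ y in D, ∫⁻ x in D, N y x
      ≤ ∫⁻ y in D, 4 * ((∫⁻ x in D, P x) + P y * volume D +
          ∫⁻ x in D, N ((1 / 8 : ℝ) • y) ((1 / 8 : ℝ) • x)) := lintegral_mono hin
    _ = 4 * ((∫⁻ x in D, P x) * volume D + (∫⁻ x in D, P x) * volume D +
          ∫⁻ y in D, ∫⁻ x in D, N ((1 / 8 : ℝ) • y) ((1 / 8 : ℝ) • x)) := by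
        have n1 : Measurable fun y => (∫⁻ x in D, P x) + P y * volume D :=
          measurable_const.add (hPm.mul_const _)
        rw [lintegral_const_mul' _ _ ENNReal.ofNat_ne_top, lintegral_add_left n1,
          lintegral_add_left measurable_const, setLIntegral_const, lintegral_mul_const _ hPm]
    _ ≤ 4 * (A * energy u D * V + A * energy u D * V + c * (c * (L * energy u D * V))) := by
        gcongr
    _ = _ := by ring

end Poincare

/-! ### The Poincaré inequality for functions in H¹ of the domain -/

section PoincareWirtinger

variable {q : ℕ}

theorem depth_nonneg_of_mem_closure (hq : 7 ≤ q) {x : Plane} (hx : x ∈ closure (omega q)) :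
    0 ≤ depth q x := by
  rcases eq_or_ne x 0 with rfl | h0
  · exact ((mem_omega_iff hq _).1 (zero_mem_omega hq)).le
  · have hc := (contDiffAt_depth hq h0).continuousAt
    have : ∃ᶠ y in nhds x, depth q y ∈ Ici (0 : ℝ) :=
      (mem_closure_iff_frequently.1 hx).mono fun y hy => ((mem_omega_iff hq y).1 hy).le
    exact isClosed_Ici.mem_of_frequently_of_tendsto this hc

/-- Strict star-shapedness, by which proper dilates of the closure are compact subsets of the domain
and leave room for mollification. -/
theorem smul_mem_omega_of_mem_closure (hq : 7 ≤ q) {x : Plane} (hx : x ∈ closure (omega q)) {t : ℝ}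
    (ht0 : 0 < t) (ht1 : t < 1) : t • x ∈ omega q := by
  have hd := depth_nonneg_of_mem_closure hq hx
  rcases eq_or_ne x 0 with rfl | h0
  · rw [smul_zero]; exact zero_mem_omega hq
  have hpos : 0 < ‖x‖ := norm_pos_iff.2 h0
  have e : t • x = (t * ‖x‖) • er (angle x) := by rw [mul_smul, norm_smul_er_angle]
  rw [mem_omega_iff hq, e, depth_smul_er hq (by positivity)]
  rw [depth] at hd
  nlinarith

/-- The dilates of `ω` exhausting it. -/
def dilate (q : ℕ) (t : ℝ) : Set Plane := (fun x => t • x) '' omega q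

theorem isOpen_dilate (hq : 7 ≤ q) {t : ℝ} (ht : t ≠ 0) : IsOpen (dilate q t) :=
  isOpenMap_smul₀ ht _ (isOpen_omega hq)

theorem dilate_subset (hq : 7 ≤ q) {t : ℝ} (ht0 : 0 ≤ t) (ht1 : t ≤ 1) : dilate q t ⊆ omega q := by
  rintro _ ⟨x, hx, rfl⟩
  exact smul_mem_omega hq hx ht0 ht1

theorem smul_mem_dilate (hq : 7 ≤ q) {t : ℝ} {x : Plane} (hx : x ∈ dilate q t) {s : ℝ}
    (hs0 : 0 ≤ s) (hs1 : s ≤ 1) : s • x ∈ dilate q t := by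
  obtain ⟨y, hy, rfl⟩ := hx
  exact ⟨s • y, smul_mem_omega hq hy hs0 hs1, smul_comm _ _ _⟩

theorem mem_dilate_iff {t : ℝ} (ht : t ≠ 0) {x : Plane} : x ∈ dilate q t ↔ t⁻¹ • x ∈ omega q := by
  refine ⟨?_, fun h => ⟨_, h, smul_inv_smul₀ ht x⟩⟩
  rintro ⟨y, hy, rfl⟩
  simpa only [inv_smul_smul₀ ht] using hy

/-- The domain contains the ball of radius 2/5, and (2/3)(2/5) = 4/15 > 1/4. -/
theorem ball_subset_dilate (hq : 7 ≤ q) {t : ℝ} (ht : 2 / 3 ≤ t) :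
    Metric.ball (0 : Plane) (1 / 4) ⊆ dilate q t := by
  intro x hx
  have ht0 : 0 < t := by linarith
  rw [mem_dilate_iff ht0.ne']
  refine ball_subset_omega hq ?_
  rw [mem_ball_zero_iff] at hx ⊢
  rw [norm_smul, norm_inv, Real.norm_of_nonneg ht0.le, inv_mul_lt_iff₀ ht0]
  linarith

/-- An auxiliary sequence increasing to `1`. -/
noncomputable def ratio (n : ℕ) : ℝ := 1 - 1 / ((n : ℝ) + 3)

theorem ratio_lt_one (n : ℕ) : ratio n < 1 := by
  have : (0 : ℝ) < 1 / ((n : ℝ) + 3) := by positivity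
  rw [ratio]; linarith

theorem le_ratio (n : ℕ) : 2 / 3 ≤ ratio n := by
  have : 1 / ((n : ℝ) + 3) ≤ 1 / 3 := by
    gcongr
    linarith [(Nat.cast_nonneg n : (0 : ℝ) ≤ n)]
  rw [ratio]; linarith

theorem ratio_pos (n : ℕ) : 0 < ratio n := by linarith [le_ratio n]

theorem tendsto_ratio : Filter.Tendsto ratio Filter.atTop (nhds 1) := by
  have : Filter.Tendsto (fun n : ℕ => 1 / ((n : ℝ) + 3)) Filter.atTop (nhds 0) :=
    tendsto_const_nhds.div_atTop
      (Filter.tendsto_atTop_add_const_right _ _ tendsto_natCast_atTop_atTop)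
  have h := (tendsto_const_nhds (x := (1 : ℝ))).sub this
  rwa [sub_zero] at h

theorem eventually_mem_dilate (hq : 7 ≤ q) {x : Plane} (hx : x ∈ omega q) :
    ∀ᶠ n in Filter.atTop, x ∈ dilate q (ratio n) := by
  have h : Filter.Tendsto (fun n => (ratio n)⁻¹ • x) Filter.atTop (nhds x) := by
    simpa using (tendsto_ratio.inv₀ one_ne_zero).smul_const x
  filter_upwards [h.eventually ((isOpen_omega hq).mem_nhds hx)] with n hn
  exact (mem_dilate_iff (ratio_pos n).ne').2 hn

theorem exists_closedBall_subset_omega (hq : 7 ≤ q) (n : ℕ) :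
    ∃ N, n ≤ N ∧ ∀ x ∈ dilate q (ratio n), Metric.closedBall x (bump N).rOut ⊆ omega q := by
  have hcpt : IsCompact (closure (omega q)) :=
    (Metric.isBounded_ball.subset (omega_subset_ball hq)).isCompact_closure
  have hcpt' : IsCompact ((fun x : Plane => ratio n • x) '' closure (omega q)) :=
    hcpt.image (continuous_const_smul _)
  have hsub : (fun x : Plane => ratio n • x) '' closure (omega q) ⊆ omega q := by
    rintro _ ⟨x, hx, rfl⟩
    exact smul_mem_omega_of_mem_closure hq hx (ratio_pos n) (ratio_lt_one n)
  obtain ⟨δ, hδ, h⟩ := hcpt'.exists_cthickening_subset_open (isOpen_omega hq) hsub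
  obtain ⟨N, hN1, hN2⟩ := ((tendsto_rOut.eventually (gt_mem_nhds hδ)).and
    (Filter.eventually_ge_atTop n)).exists
  refine ⟨N, hN2, fun x hx => ?_⟩
  refine (Metric.closedBall_subset_closedBall hN1.le).trans
    ((Metric.closedBall_subset_cthickening ?_ δ).trans h)
  obtain ⟨y, hy, rfl⟩ := hx
  exact ⟨y, subset_closure hy, rfl⟩

theorem energy_mollify_le (hq : 7 ≤ q) {v : Plane → ℝ} {w : Fin 2 → Plane → ℝ}
    (hv : IntegrableOn v (omega q)) (hw : ∀ i, Measurable (w i))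
    (hwi : ∀ i, IntegrableOn (w i) (omega q)) (h : ∀ i, IsWeakPartial (omega q) i v (w i)) {D : Set Plane} (hD : MeasurableSet D) {N : ℕ}
    (hN : ∀ x ∈ D, Metric.closedBall x (bump N).rOut ⊆ omega q) :
    energy (mollify N ((omega q).indicator v)) D ≤
      2 * ∑ i, ∫⁻ x in omega q, ‖w i x‖ₑ ^ (2 : ℝ) := by
  have hΩ := (isOpen_omega hq).measurableSet
  set W : Fin 2 → Plane → ℝ := fun i => (omega q).indicator (w i) with hW
  have hWm : ∀ i, Measurable (W i) := fun i => (hw i).indicator hΩ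
  have hpt : ∀ x ∈ D, ‖fderiv ℝ (mollify N ((omega q).indicator v)) x‖ₑ ^ (2 : ℝ) ≤
      2 * (‖mollify N (W 0) x‖ₑ ^ (2 : ℝ) + ‖mollify N (W 1) x‖ₑ ^ (2 : ℝ)) := by
    intro x hx
    have h1 := enorm_le_sum_enorm_apply (fderiv ℝ (mollify N ((omega q).indicator v)) x)
    simp only [fderiv_mollify_of_isWeakPartial hΩ (h _) hv N (hN x hx), Fin.sum_univ_two] at h1
    refine (ENNReal.rpow_le_rpow h1 (by norm_num)).trans ?_
    have := ENNReal.rpow_add_le_mul_rpow_add_rpow ‖mollify N (W 0) x‖ₑ ‖mollify N (W 1) x‖ₑ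
      (p := 2) one_le_two
    norm_num at this ⊢
    exact this
  have hle : ∀ i, ∫⁻ x in D, ‖mollify N (W i) x‖ₑ ^ (2 : ℝ) ≤
      ∫⁻ x in omega q, ‖w i x‖ₑ ^ (2 : ℝ) := fun i => by
    refine (lintegral_mollify_le N (hWm i) one_le_two hD hΩ hN).trans (le_of_eq ?_)
    refine setLIntegral_congr_fun hΩ fun x hx => ?_
    simp only [hW, indicator_of_mem hx]
  have hm : ∀ i, AEMeasurable (fun x => ‖mollify N (W i) x‖ₑ ^ (2 : ℝ)) (volume.restrict D) := fun i => by
    have hi : LocallyIntegrable (W i) := ((integrable_indicator_iff hΩ).2 (hwi i)).locallyIntegrable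
    exact ((contDiff_mollify N hi).continuous.enorm.measurable.pow_const _).aemeasurable
  calc energy (mollify N ((omega q).indicator v)) D
      ≤ ∫⁻ x in D, 2 * (‖mollify N (W 0) x‖ₑ ^ (2 : ℝ) + ‖mollify N (W 1) x‖ₑ ^ (2 : ℝ)) :=
        setLIntegral_mono' hD hpt
    _ = 2 * ((∫⁻ x in D, ‖mollify N (W 0) x‖ₑ ^ (2 : ℝ)) +
          ∫⁻ x in D, ‖mollify N (W 1) x‖ₑ ^ (2 : ℝ)) := by
        rw [lintegral_const_mul' _ _ ENNReal.ofNat_ne_top, lintegral_add_left' (hm 0)]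
    _ ≤ _ := by
        rw [Fin.sum_univ_two]
        exact mul_le_mul' le_rfl (add_le_add (hle 0) (hle 1))

/-- Fatou's lemma in each variable, after truncating the integrands to the exhausting sets. -/
theorem lintegral_sub_le_of_tendsto {Ω : Set Plane} (hΩ : MeasurableSet Ω) {D : ℕ → Set Plane}
    (hDm : ∀ n, MeasurableSet (D n)) (hDΩ : ∀ n, D n ⊆ Ω)
    (hev : ∀ x ∈ Ω, ∀ᶠ n in Filter.atTop, x ∈ D n) {u : ℕ → Plane → ℝ}
    (hu : ∀ n, Continuous (u n)) {v : Plane → ℝ}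
    (hlim : ∀ᵐ x ∂volume.restrict Ω, Filter.Tendsto (fun n => u n x) Filter.atTop (nhds (v x)))
    {C : ℝ≥0∞} (hbd : ∀ n, ∫⁻ y in D n, ∫⁻ x in D n, ‖u n x - u n y‖ₑ ^ (2 : ℝ) ≤ C) :
    ∫⁻ y in Ω, ∫⁻ x in Ω, ‖v x - v y‖ₑ ^ (2 : ℝ) ≤ C := by
  set f : ℕ → Plane → Plane → ℝ≥0∞ := fun n y x =>
    (D n).indicator (fun y => (D n).indicator (fun x => ‖u n x - u n y‖ₑ ^ (2 : ℝ)) x) y with hf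
  have hpair : ∀ n, Measurable fun z : Plane × Plane => ‖u n z.2 - u n z.1‖ₑ ^ (2 : ℝ) := fun n => by
    have : Continuous fun z : Plane × Plane => u n z.2 - u n z.1 :=
      ((hu n).comp continuous_snd).sub ((hu n).comp continuous_fst)
    exact this.enorm.measurable.pow_const _
  have hfx : ∀ n y, Measurable (f n y) := by
    intro n y
    by_cases hy : y ∈ D n
    · have m1 : Measurable fun x => ‖u n x - u n y‖ₑ ^ (2 : ℝ) := (hpair n).comp measurable_prodMk_left
      have e : f n y = (D n).indicator fun x => ‖u n x - u n y‖ₑ ^ (2 : ℝ) := by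
        ext x; simp only [hf, indicator_of_mem hy]
      rw [e]
      exact m1.indicator (hDm n)
    · have e : f n y = fun _ => 0 := by
        ext x; simp only [hf, indicator_of_notMem hy]
      rw [e]
      exact measurable_const
  have hfint : ∀ n y, ∫⁻ x in Ω, f n y x =
      (D n).indicator (fun y => ∫⁻ x in D n, ‖u n x - u n y‖ₑ ^ (2 : ℝ)) y := by
    intro n y
    by_cases hy : y ∈ D n
    · simp only [hf, indicator_of_mem hy]
      rw [setLIntegral_indicator (hDm n), inter_eq_left.2 (hDΩ n)]
    · simp only [hf, indicator_of_notMem hy, lintegral_zero]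
  have hfy : ∀ n, Measurable fun y => ∫⁻ x in Ω, f n y x := by
    intro n
    simp only [hfint]
    have m1 : Measurable fun y => ∫⁻ x in D n, ‖u n x - u n y‖ₑ ^ (2 : ℝ) :=
      (hpair n).lintegral_prod_right'
    exact m1.indicator (hDm n)
  have hfbd : ∀ n, ∫⁻ y in Ω, ∫⁻ x in Ω, f n y x ≤ C := by
    intro n
    simp only [hfint]
    rw [setLIntegral_indicator (hDm n), inter_eq_left.2 (hDΩ n)]
    exact hbd n
  calc ∫⁻ y in Ω, ∫⁻ x in Ω, ‖v x - v y‖ₑ ^ (2 : ℝ)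
      ≤ ∫⁻ y in Ω, Filter.liminf (fun n => ∫⁻ x in Ω, f n y x) Filter.atTop := by
        refine lintegral_mono_ae ?_
        filter_upwards [hlim, ae_restrict_mem hΩ] with y hy hyΩ
        refine le_trans (le_of_eq ?_) (lintegral_liminf_le (hfx · y))
        refine lintegral_congr_ae ?_
        filter_upwards [hlim, ae_restrict_mem hΩ] with x hx hxΩ
        symm
        refine Filter.Tendsto.liminf_eq ?_
        have h1 : Filter.Tendsto (fun n => ‖u n x - u n y‖ₑ ^ (2 : ℝ)) Filter.atTop
            (nhds (‖v x - v y‖ₑ ^ (2 : ℝ))) :=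
          ((ENNReal.continuous_rpow_const.tendsto _).comp
            ((continuous_enorm.tendsto _).comp (hx.sub hy)))
        refine h1.congr' ?_
        filter_upwards [hev x hxΩ, hev y hyΩ] with n hnx hny
        have a1 : x ∈ D n := hnx
        have a2 : y ∈ D n := hny
        simp only [hf, indicator_of_mem a1, indicator_of_mem a2]
    _ ≤ Filter.liminf (fun n => ∫⁻ y in Ω, ∫⁻ x in Ω, f n y x) Filter.atTop :=
        lintegral_liminf_le hfy
    _ ≤ Filter.liminf (fun _ : ℕ => C) Filter.atTop :=
        Filter.liminf_le_liminf (.of_forall hfbd)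
    _ = _ := Filter.liminf_const _

/-- The smooth inequality is applied to mollifications on the dilates, which are again star-shaped,
and these exhaust the domain. -/
theorem exists_lintegral_sub_le_of_isWeakPartial (hq : 7 ≤ q) :
    ∃ K : ℝ≥0∞, K ≠ ⊤ ∧ ∀ (v : Plane → ℝ) (w : Fin 2 → Plane → ℝ), IntegrableOn v (omega q) →
      (∀ i, Measurable (w i)) → (∀ i, IntegrableOn (w i) (omega q)) →
      (∀ i, IsWeakPartial (omega q) i v (w i)) →
      ∫⁻ y in omega q, ∫⁻ x in omega q, ‖v x - v y‖ₑ ^ (2 : ℝ) ≤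
        K * ∑ i, ∫⁻ x in omega q, ‖w i x‖ₑ ^ (2 : ℝ) := by
  obtain ⟨K, hK, hmain⟩ := exists_lintegral_sub_le
  refine ⟨K * 2, by finiteness, fun v w hv hw hwi h => ?_⟩
  have hΩ := (isOpen_omega hq).measurableSet
  choose N hnN hN using exists_closedBall_subset_omega hq
  have hvi : LocallyIntegrable ((omega q).indicator v) :=
    ((integrable_indicator_iff hΩ).2 hv).locallyIntegrable
  set u : ℕ → Plane → ℝ := fun n => mollify (N n) ((omega q).indicator v) with hu
  have hud : ∀ n, ContDiff ℝ 1 (u n) := fun n => (contDiff_mollify _ hvi).of_le (by norm_cast)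
  set D : ℕ → Set Plane := fun n => dilate q (ratio n) with hD
  have hDm : ∀ n, MeasurableSet (D n) := fun n => (isOpen_dilate hq (ratio_pos n).ne').measurableSet
  have hDΩ : ∀ n, D n ⊆ omega q := fun n => dilate_subset hq (ratio_pos n).le (ratio_lt_one n).le
  set E := ∑ i, ∫⁻ x in omega q, ‖w i x‖ₑ ^ (2 : ℝ) with hE
  have hbd : ∀ n, ∫⁻ y in D n, ∫⁻ x in D n, ‖u n x - u n y‖ₑ ^ (2 : ℝ) ≤ K * 2 * E := by
    intro n
    refine (hmain (u n) (D n) (hud n) (hDm n) (fun x hx t h0 h1 => smul_mem_dilate hq hx h0 h1)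
      (ball_subset_dilate hq (le_ratio n)) ((hDΩ n).trans ((omega_subset_ball hq).trans
        (Metric.ball_subset_ball (by norm_num))))).trans ?_
    rw [mul_assoc]
    exact mul_le_mul' le_rfl (energy_mollify_le hq hv hw hwi h (hDm n) (hN n))
  have hlim : ∀ᵐ x ∂volume.restrict (omega q),
      Filter.Tendsto (fun n => u n x) Filter.atTop (nhds (v x)) := by
    filter_upwards [ae_restrict_of_ae (ae_tendsto_mollify hvi), ae_restrict_mem hΩ] with x hx hxΩ
    rw [indicator_of_mem hxΩ] at hx
    exact hx.comp (Filter.tendsto_atTop_mono hnN Filter.tendsto_id)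
  exact lintegral_sub_le_of_tendsto hΩ hDm hDΩ (fun x hx => eventually_mem_dilate hq hx)
    (fun n => (hud n).continuous) hlim hbd

theorem enorm_rpow_two_eq_lintegral {Ω : Set Plane} (x : L2 Ω) :
    ‖x‖ₑ ^ (2 : ℝ) = ∫⁻ a in Ω, ‖x a‖ₑ ^ (2 : ℝ) := by
  rw [Lp.enorm_def]
  exact eLpNorm_nnreal_pow_eq_lintegral (p := 2) (by norm_num)

/-- Expand the square: the mixed term vanishes because the mean is zero, and the integral of v² is
dropped. -/
theorem ofReal_measure_mul_sq_le {Ω : Set Plane} (hΩ : volume Ω < ⊤) {v : Plane → ℝ}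
    (hv : MemLp v 2 (volume.restrict Ω)) (h0 : ∫ x in Ω, v x = 0) (y : Plane) :
    volume Ω * ‖v y‖ₑ ^ (2 : ℝ) ≤ ∫⁻ x in Ω, ‖v x - v y‖ₑ ^ (2 : ℝ) := by
  have : IsFiniteMeasure (volume.restrict Ω) := ⟨by simpa using hΩ⟩
  have hsub : MemLp (fun x => v x - v y) 2 (volume.restrict Ω) := hv.sub (memLp_const _)
  have e : ∀ r : ℝ, ‖r‖ₑ ^ (2 : ℝ) = ENNReal.ofReal (r ^ 2) := fun r => by
    rw [← ofReal_norm, ENNReal.ofReal_rpow_of_nonneg (norm_nonneg _) (by norm_num)]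
    norm_num
  simp only [e]
  rw [← ofReal_integral_eq_lintegral_ofReal hsub.integrable_sq (.of_forall fun x => sq_nonneg _),
    ← ENNReal.ofReal_toReal hΩ.ne, ← ENNReal.ofReal_mul ENNReal.toReal_nonneg]
  refine ENNReal.ofReal_le_ofReal ?_
  have h1 : ∫ x in Ω, (v x - v y) ^ 2 = (∫ x in Ω, v x ^ 2) + (volume Ω).toReal * v y ^ 2 := by
    have e1 : ∀ x, (v x - v y) ^ 2 = v x ^ 2 + ((-2 * v y) * v x + v y ^ 2) := fun x => by ring
    have hi := hv.integrable one_le_two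
    have i2 : Integrable (fun x => (-2 * v y) * v x + v y ^ 2) (volume.restrict Ω) :=
      (hi.const_mul _).add (integrable_const _)
    simp only [e1]
    rw [integral_add hv.integrable_sq i2, integral_add (hi.const_mul _) (integrable_const _), integral_const_mul, h0, setIntegral_const]
    simp [Measure.real]
  rw [h1]
  have : 0 ≤ ∫ x in Ω, v x ^ 2 := integral_nonneg fun x => sq_nonneg _
  linarith

/-- Integrating `ofReal_measure_mul_sq_le` over y turns the double integral of differences into the
usual Poincaré-Wirtinger inequality. -/
theorem exists_norm_proj_none_le (hq : 7 ≤ q) :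
    ∃ C : ℝ, ∀ x ∈ h1Space (omega q), ∫ a in omega q, Jet.proj none x a = 0 →
      ‖Jet.proj none x‖ ≤ C * ∑ i, ‖Jet.proj (some i) x‖ := by
  obtain ⟨K, hK, hmain⟩ := exists_lintegral_sub_le_of_isWeakPartial hq
  have hfin := volume_omega_lt_top hq
  have hpos : 0 < volume (omega q) := (isOpen_omega hq).measure_pos _ ⟨0, zero_mem_omega hq⟩
  set c : ℝ≥0∞ := (volume (omega q))⁻¹ * K with hc
  have hc' : c ≠ ⊤ := ENNReal.mul_ne_top (ENNReal.inv_ne_top.2 hpos.ne') hK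
  refine ⟨√c.toReal, fun x hx h0 => ?_⟩
  have hH := hasH1Grad_of_mem hfin hx
  have : Fact (volume (omega q) < ⊤) := ⟨hfin⟩
  have h1 := hmain _ _ (hH.memLp_fun.integrable one_le_two)
    (fun i => (Lp.stronglyMeasurable (Jet.proj (some i) x)).measurable)
    (fun i => (hH.memLp_grad i).integrable one_le_two) hH.weak
  have h2 : volume (omega q) * ‖Jet.proj none x‖ₑ ^ (2 : ℝ) ≤
      K * ∑ i, ‖Jet.proj (some i) x‖ₑ ^ (2 : ℝ) := by
    simp only [enorm_rpow_two_eq_lintegral]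
    rw [← lintegral_const_mul' _ _ hfin.ne]
    exact (lintegral_mono fun y => ofReal_measure_mul_sq_le hfin hH.memLp_fun h0 y).trans h1
  have h3 : ‖Jet.proj none x‖ₑ ^ (2 : ℝ) ≤ c * ∑ i, ‖Jet.proj (some i) x‖ₑ ^ (2 : ℝ) := by
    rw [hc, mul_assoc, ← ENNReal.div_eq_inv_mul, ENNReal.le_div_iff_mul_le (.inl hpos.ne')
      (.inl hfin.ne), mul_comm]
    exact h2
  have h4 : ‖Jet.proj none x‖ ^ 2 ≤ c.toReal * ∑ i, ‖Jet.proj (some i) x‖ ^ 2 := by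
    have := ENNReal.toReal_mono (ENNReal.mul_ne_top hc' (ENNReal.sum_ne_top.2 fun i _ => by finiteness)) h3
    rw [ENNReal.toReal_mul, ENNReal.toReal_sum fun i _ => by finiteness] at this
    simpa [← ENNReal.toReal_rpow] using this
  refine le_of_sq_le_sq ?_ ?_
  · rw [mul_pow, Real.sq_sqrt ENNReal.toReal_nonneg]
    refine h4.trans (mul_le_mul_of_nonneg_left ?_ ENNReal.toReal_nonneg)
    rw [Fin.sum_univ_two, Fin.sum_univ_two]
    nlinarith [mul_nonneg (norm_nonneg (Jet.proj (some 0) x)) (norm_nonneg (Jet.proj (some 1) x))]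
  · positivity

end PoincareWirtinger

/-! ### The Neumann problem -/

section NeumannExistence

variable {q : ℕ}

theorem hasH1Grad_const (hq : 7 ≤ q) (c : ℝ) :
    HasH1Grad (omega q) (fun _ => c) fun _ _ => 0 := by
  have h := hasH1Grad_of_contDiff hq (u := fun _ : Plane => c) contDiff_const
  have e : ∀ i, partialDeriv i (fun _ : Plane => c) = fun _ => 0 := fun i => by
    ext x; simp [partialDeriv]
  simpa only [e] using h

/-- Existence for the Neumann problem, for right hand sides with vanishing mean. -/
theorem exists_isNeumannSol (hq : 7 ≤ q) {g : Plane → ℝ}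
    (hg : MemLp g 2 (volume.restrict (omega q))) (h0 : ∫ x in omega q, g x = 0) :
    ∃ v, IsNeumannSol (omega q) g v := by
  obtain ⟨C, hC⟩ := exists_norm_proj_none_le hq
  have hfin := volume_omega_lt_top hq
  have hpos : 0 < volume (omega q) := (isOpen_omega hq).measure_pos _ ⟨0, zero_mem_omega hq⟩
  have : IsFiniteMeasure (volume.restrict (omega q)) := ⟨by simpa using hfin⟩
  have hone : MemLp (fun _ : Plane => (1 : ℝ)) 2 (volume.restrict (omega q)) := memLp_const _
  have hmean : ∀ x : L2 (omega q), inner ℝ (hone.toLp _) x = ∫ a in omega q, x a := fun x => by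
    rw [inner_toLp]; simp
  set T : Jet (omega q) →L[ℝ] ℝ := (innerSL ℝ (hone.toLp _)).comp (Jet.proj none) with hT
  have hTx : ∀ x, T x = ∫ a in omega q, Jet.proj none x a := fun x => hmean _
  set V : Submodule ℝ (Jet (omega q)) := h1Space (omega q) ⊓ T.ker with hV
  have hVc : IsClosed (V : Set (Jet (omega q))) := isClosed_h1Space.inter T.isClosed_ker
  have hVm : ∀ x ∈ V, ∫ a in omega q, Jet.proj none x a = 0 := fun x hx => by
    rw [← hTx]; exact hx.2
  obtain ⟨u, hu, hsol⟩ := exists_weak_solution V hVc (fun i => Jet.proj (some i))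
    (c := (2 * C ^ 2 + 1)⁻¹) (by positivity)
    (fun x hx => coercive_of_norm_le (hC x hx.1 (hVm x hx)))
    (-((innerSL ℝ (hg.toLp g)).comp (Jet.proj none)))
  refine ⟨_, _, hasH1Grad_of_mem hfin hu.1, fun φ Φ hφ => ?_⟩
  -- Subtracting its mean makes φ admissible for the space of mean zero. This affects neither side
  -- of the equation, since constants have zero gradient and g has mean zero.
  set m := (volume (omega q)).toReal⁻¹ * ∫ a in omega q, φ a with hm
  set y := Jet.mk hφ.memLp_fun hφ.memLp_grad with hy
  set k := Jet.mk (hasH1Grad_const hq m).memLp_fun (hasH1Grad_const hq m).memLp_grad with hk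
  have hk0 : ∀ i, Jet.proj (some i) k = 0 := fun i =>
    MemLp.toLp_zero ((hasH1Grad_const hq m).memLp_grad i)
  have hmem : y - k ∈ V := by
    refine ⟨sub_mem (mk_mem_h1Space hφ) (mk_mem_h1Space (hasH1Grad_const hq m)), ?_⟩
    change T (y - k) = 0
    rw [map_sub, hTx, hTx, hy, hk, Jet.proj_mk_none, Jet.proj_mk_none, integral_congr_ae hφ.memLp_fun.coeFn_toLp,
      integral_congr_ae (hasH1Grad_const hq m).memLp_fun.coeFn_toLp, setIntegral_const, hm,
      Measure.real, smul_eq_mul, mul_inv_cancel_left₀ (ENNReal.toReal_pos hpos.ne' hfin.ne).ne',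
      sub_self]
  have e := hsol _ hmem
  have hk' : ∀ i, Jet.proj (some i) (y - k) = Jet.proj (some i) y := fun i => by
    rw [map_sub, hk0, sub_zero]
  simp only [hk'] at e
  rw [integral_sum_mul_eq_sum_inner (fun i => Lp.memLp _) hφ.memLp_grad,
    integral_mul_eq_inner hg hφ.memLp_fun]
  simp only [toLp_proj]
  have e2 : inner ℝ (hg.toLp g) (Jet.proj none k) = 0 := by
    rw [hk, Jet.proj_mk_none, ← integral_mul_eq_inner hg, integral_mul_const, h0, zero_mul]
  refine Eq.trans e ?_
  change -(inner ℝ (hg.toLp g) (Jet.proj none (y - k))) = _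
  rw [map_sub, inner_sub_right, e2, sub_zero]
  rfl

/-- A linear functional of the two parameters has a nontrivial kernel; mean zero is the solvability
condition of the Neumann problem. -/
theorem exists_integral_quadPoly_eq_zero (hq : 7 ≤ q) :
    ∃ α β : ℝ, (α ≠ 0 ∨ β ≠ 0) ∧ ∫ x in omega q, quadPoly α β x = 0 := by
  have hfin := volume_omega_lt_top hq
  have : IsFiniteMeasure (volume.restrict (omega q)) := ⟨by simpa using hfin⟩
  have hint : ∀ g : Plane → ℝ, Continuous g → Integrable g (volume.restrict (omega q)) :=
    fun g hg => (memLp_omega_of_continuous hq hg).integrable one_le_two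
  set a := ∫ x in omega q, x 0 * x 1 with ha
  set b := ∫ x in omega q, (x 0 ^ 2 - x 1 ^ 2) with hb
  have key : ∀ α β : ℝ, ∫ x in omega q, quadPoly α β x = α * a + β * b := fun α β => by
    simp only [quadPoly]
    rw [integral_add (hint _ (by fun_prop)) (hint _ (by fun_prop)), integral_const_mul,
      integral_const_mul]
  by_cases h : a = 0 ∧ b = 0
  · exact ⟨1, 0, .inl one_ne_zero, by rw [key, h.1, h.2]; simp⟩
  · refine ⟨b, -a, ?_, by rw [key]; ring⟩
    by_contra! hc
    exact h ⟨by simpa using hc.2, hc.1⟩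

end NeumannExistence

end LimitReg

/-! ### The theorem for real or complex scalars -/

theorem corollary1 (q : ℕ) (hq : LimitReg.LargeBase q) (𝕜 : Type*) [RCLike 𝕜] :
    LimitReg.IsBoundedC1Domain (LimitReg.omega q) ∧
    -- Dirichlet problem, with right hand side `g = 1`
    ((∃ v : EuclideanSpace ℝ (Fin 2) → 𝕜,
        LimitReg.IsDirichletSol (LimitReg.omega q) (fun _ => (1 : 𝕜)) v) ∧
      (∀ v w : EuclideanSpace ℝ (Fin 2) → 𝕜,
        LimitReg.IsDirichletSol (LimitReg.omega q) (fun _ => (1 : 𝕜)) v →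
        LimitReg.IsDirichletSol (LimitReg.omega q) (fun _ => (1 : 𝕜)) w →
        v =ᵐ[volume.restrict (LimitReg.omega q)] w) ∧
      (∀ v : EuclideanSpace ℝ (Fin 2) → 𝕜,
        LimitReg.IsDirichletSol (LimitReg.omega q) (fun _ => (1 : 𝕜)) v →
        ∀ p ε : ℝ, 1 ≤ p → 0 < ε → ¬ LimitReg.MemW (LimitReg.omega q) (1 + 1 / p + ε) p v)) ∧
    -- Neumann problem, with `g` a harmonic quadratic polynomial
    (∃ α β : ℝ, (α ≠ 0 ∨ β ≠ 0) ∧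
      (∃ v : EuclideanSpace ℝ (Fin 2) → 𝕜,
        LimitReg.IsNeumannSol (LimitReg.omega q)
          (fun x => ((LimitReg.quadPoly α β x : ℝ) : 𝕜)) v) ∧
      (∀ v : EuclideanSpace ℝ (Fin 2) → 𝕜,
        LimitReg.IsNeumannSol (LimitReg.omega q)
          (fun x => ((LimitReg.quadPoly α β x : ℝ) : 𝕜)) v →
        ∀ p ε : ℝ, 1 ≤ p → 0 < ε → ¬ LimitReg.MemW (LimitReg.omega q) (1 + 1 / p + ε) p v)) := by
  have h7 := hq.1
  have hΩ := (LimitReg.isOpen_omega h7).measurableSet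
  have hdom := LimitReg.isBoundedC1Domain_omega h7
  have hre : ∀ z : 𝕜, ‖(RCLike.reCLM : 𝕜 →L[ℝ] ℝ) z‖ ≤ ‖z‖ := fun z => RCLike.norm_re_le_norm z
  have h1 : MemLp (fun _ => (1 : ℝ)) 2 (volume.restrict (LimitReg.omega q)) :=
    LimitReg.memLp_omega_of_continuous h7 continuous_const
  have h1' : MemLp (fun _ => (1 : 𝕜)) 2 (volume.restrict (LimitReg.omega q)) :=
    LimitReg.memLp_omega_of_continuous h7 continuous_const
  refine ⟨hdom, ⟨?_, ?_, ?_⟩, ?_⟩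
  · obtain ⟨v, hv⟩ := LimitReg.exists_isDirichletSol hΩ hdom.isBounded h1
    have := hv.ofReal 𝕜 h1
    simp only [RCLike.ofReal_one] at this
    exact ⟨_, this⟩
  · intro v w hv hw
    have key : ∀ L : 𝕜 →L[ℝ] ℝ, (∀ z, ‖L z‖ ≤ ‖z‖) →
        ∀ᵐ x ∂volume.restrict (LimitReg.omega q), L (v x) = L (w x) := fun L hL =>
      (hv.comp L hL h1').ae_eq hΩ hdom.isBounded (hw.comp L hL h1')
    filter_upwards [key RCLike.reCLM hre,
      key RCLike.imCLM fun z => RCLike.norm_im_le_norm z] with x hx hx'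
    exact RCLike.ext hx hx'
  · intro v hv p ε hp hε hmem
    -- The real part solves the real problem and inherits the supposed regularity.
    have h := hv.comp RCLike.reCLM hre h1'
    simp only [RCLike.reCLM_apply, RCLike.one_re] at h
    exact LimitReg.not_memW_of_isDirichletSol hq h hp hε
      (LimitReg.MemWAux.comp RCLike.reCLM hre (by linarith) hmem)
  · obtain ⟨α, β, hαβ, hint⟩ := LimitReg.exists_integral_quadPoly_eq_zero h7
    have hc := (LimitReg.contDiff_quadPoly α β).continuous
    have hg := LimitReg.memLp_omega_of_continuous h7 hc
    refine ⟨α, β, hαβ, ?_, ?_⟩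
    · obtain ⟨v, hv⟩ := LimitReg.exists_isNeumannSol h7 hg hint
      exact ⟨_, hv.ofReal 𝕜 hg⟩
    · intro v hv p ε hp hε hmem
      have h := hv.comp RCLike.reCLM (LimitReg.memLp_omega_of_continuous h7 (by fun_prop))
      simp only [RCLike.reCLM_apply, RCLike.ofReal_re] at h
      exact LimitReg.not_memW_of_isNeumannSol hq hαβ h hp hε
        (LimitReg.MemWAux.comp RCLike.reCLM hre (by linarith) hmem)
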